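/- **Second variation formula for the p-area.** Conventions: $\alpha\wedge\beta(X,Y)=\alpha(X)\beta(Y)-\alpha(Y)\beta(X)$ and $d\beta(X,Y)=X\beta(Y)-Y\beta(X)-\beta([X,Y])$; everything is $C^\infty$. Let $(M,J,\Theta)$ be an oriented 3-dimensional pseudohermitian manifold: $\Theta$ is a global contact form with contact bundle $\xi=\ker\Theta$, and $J:\xi\to\xi$ satisfies $J^2=-1$ and $d\Theta(v,Jv)>0$ for $0\ne v\in\xi$. Let $T$ be the Reeb field ($\Theta(T)=1$, $d\Theta(T,\cdot)=0$) and $G=\frac12 d\Theta(\cdot,J\cdot)$ the Levi metric on $\xi$. For a local section $e_1$ of $\xi$ with $G(e_1,e_1)=1$ put $e_2=Je_1$, let $(e^1,e^2,\Theta)$ be the coframe dual to $(e_1,e_2,T)$, and $\theta^1=e^1+ie^2$. The real 1-form $\omega$ and the torsion $A^1{}_{\bar 1}=\overline{A_{11}}$ are determined by $$d\theta^1=\theta^1\wedge i\omega+A^1{}_{\bar 1}\,\Theta\wedge\theta^{\bar 1},$$ the pseudohermitian connection by $\nabla e_1=\omega\otimes e_2$, $\nabla e_2=-\omega\otimes e_1$,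 $\nabla T=0$, and the Tanaka–Webster curvature by $W=-\frac12 d\omega(e_1,e_2)$. Let $\Sigma$ be an immersed surface in $M$, possibly with boundary, with singular set $S_\Sigma=\{p\in\Sigma: T_p\Sigma=\xi_p\}$. Let $e_1$ be a characteristic field, i.e. a unit vector field in $\xi\cap T\Sigma$ on $\Sigma\setminus S_\Sigma$, let $e_2=Je_1$, and let $\alpha$ be the function on $\Sigma\setminus S_\Sigma$ such that $\alpha e_2+T$ is tangent to $\Sigma$. Suppose that $\Sigma$ is p-minimal: $H=0$ on $\Sigma\setminus S_\Sigma$, where $\nabla_{e_1}e_1=He_2$. The p-area of a surface is the integral over it of the 2-form $\Theta\wedge e^1$ formed with its own characteristic field; the surface is oriented so that this form is positive off the singular set, and the form is $0$ on the singular set. Let $f,g$ be smooth functions on $\Sigma$ with compact support disjoint from $S_\Sigma\cup\partial\Sigma$. Let $(\Phi_t)_{|t|<\varepsilon}$ be a smooth variation, $\Phi:(-\varepsilon,\varepsilon)\times\Sigma\to M$, such that $\Phi_0$ is the given immersion, $\Phi_t=\Phi_0$ for all $t$ outside a compact set $K\subset\Sigma\setminus(S_\Sigma\cup\partial\Sigma)$,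 and $\frac{\partial}{\partial t}\big|_{t=0}\Phi_t=fe_2+gT$ (for example, $\Phi_t=\varphi_t\circ\Phi_0$ for the flow $\varphi_t$ of a vector field on $M$ that extends $fe_2+gT$ and satisfies the support condition). Then for every compact $L\subset\Sigma$ containing $K$ the p-area of $\Phi_t(L)$ (that is, of the map $\Phi_t|_L$) is finite for $|t|<\varepsilon$ and is differentiable near $t=0$ and twice differentiable at $t=0$, and the integrand on the right below is integrable, with $$\frac{d^2}{dt^2}\Big|_{t=0}\text{p-Area}(\Phi_t(L))=\int_\Sigma\Big\{\big(e_1(f-\alpha g)\big)^2+(f-\alpha g)^2\big[-2W+2\,\mathrm{Im}\,A_{11}-4e_1(\alpha)-4\alpha^2\big]\Big\}\,\Theta\wedge e^1,$$ where $A_{11}$ is taken with respect to the frame $Z_1=\frac12(e_1-ie_2)$, and the integrand is $0$ where $f$ and $g$ vanish identically nearby (in particular on $S_\Sigma\cup\partial\Sigma$). -/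

import Mathlib

open Set Filter Topology MeasureTheory Bundle
open scoped Manifold ContDiff

noncomputable section

/-! ### Exterior derivative of a 1-form on a 3-manifold -/

section Forms

variable {M : Type*} [TopologicalSpace M] [ChartedSpace (EuclideanSpace ℝ (Fin 3)) M]

/-- The 1-form `β` on `M` read in the preferred chart at `p`: the pull-back of `β` under the inverse
of this chart, a 1-form on (an open subset of) `ℝ³`. -/
def oneFormInChart (β : (q : M) → TangentSpace (𝓡 3) q →L[ℝ] ℝ) (p : M) :
    EuclideanSpace ℝ (Fin 3) → EuclideanSpace ℝ (Fin 3) →L[ℝ] ℝ := fun u =>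
  (β ((extChartAt (𝓡 3) p).symm u)).comp
    (mfderiv 𝓘(ℝ, EuclideanSpace ℝ (Fin 3)) (𝓡 3) (extChartAt (𝓡 3) p).symm u)

/-- The exterior derivative `dβ` of a 1-form `β` at `p`, as a bilinear form on `T_p M`, with the
normalization `dβ(X, Y) = X(β(Y)) - Y(β(X)) - β([X, Y])`. It is computed in the chart at `p`, where
`dβ(v, w) = (∂_v β)(w) - (∂_w β)(v)`. -/
def extDerivOneForm (β : (q : M) → TangentSpace (𝓡 3) q →L[ℝ] ℝ) (p : M) :
    TangentSpace (𝓡 3) p →L[ℝ] TangentSpace (𝓡 3) p →L[ℝ] ℝ :=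
  let D : EuclideanSpace ℝ (Fin 3) →L[ℝ] EuclideanSpace ℝ (Fin 3) →L[ℝ] ℝ :=
    fderiv ℝ (oneFormInChart β p) (extChartAt (𝓡 3) p p)
  let c : EuclideanSpace ℝ (Fin 3) →L[ℝ] EuclideanSpace ℝ (Fin 3) :=
    mfderiv (𝓡 3) 𝓘(ℝ, EuclideanSpace ℝ (Fin 3)) (extChartAt (𝓡 3) p) p
  let B : EuclideanSpace ℝ (Fin 3) →L[ℝ] EuclideanSpace ℝ (Fin 3) →L[ℝ] ℝ :=
    (D - D.flip).bilinearComp c c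
  B

end Forms

/-! ### Pseudohermitian structures -/

/-- An oriented pseudohermitian structure `(J, Θ)` on a 3-manifold `M`: a global contact form `Θ`,
with contact bundle `ξ = ker Θ`, and a smooth endomorphism `J` of `ξ` with `J² = -1` on `ξ`, such
that `dΘ(v, J v) > 0` for `0 ≠ v ∈ ξ`; this positivity contains the contact condition
`dΘ|_ξ ≠ 0`. The endomorphism `J` is recorded through a smooth extension to `TM`; only its
restriction to `ξ` is ever used. -/
structure PseudohermitianStructure (M : Type*) [TopologicalSpace M]
    [ChartedSpace (EuclideanSpace ℝ (Fin 3)) M] [IsManifold (𝓡 3) ∞ M] where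
  /-- the contact form -/
  Θ : (p : M) → TangentSpace (𝓡 3) p →L[ℝ] ℝ
  /-- the CR structure -/
  J : (p : M) → TangentSpace (𝓡 3) p →L[ℝ] TangentSpace (𝓡 3) p
  smooth_Θ : ContMDiff (𝓡 3) ((𝓡 3).prod 𝓘(ℝ, EuclideanSpace ℝ (Fin 3) →L[ℝ] ℝ)) ∞
    (fun p : M => TotalSpace.mk' (EuclideanSpace ℝ (Fin 3) →L[ℝ] ℝ)
      (E := fun p : M => TangentSpace (𝓡 3) p →L[ℝ] Bundle.Trivial M ℝ p) p (Θ p))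
  smooth_J : ContMDiff (𝓡 3)
    ((𝓡 3).prod 𝓘(ℝ, EuclideanSpace ℝ (Fin 3) →L[ℝ] EuclideanSpace ℝ (Fin 3))) ∞
    (fun p : M => TotalSpace.mk' (EuclideanSpace ℝ (Fin 3) →L[ℝ] EuclideanSpace ℝ (Fin 3))
      (E := fun p : M => TangentSpace (𝓡 3) p →L[ℝ] TangentSpace (𝓡 3) p) p (J p))
  Θ_ne_zero : ∀ p, Θ p ≠ 0
  J_mem : ∀ p v, Θ p v = 0 → Θ p (J p v) = 0
  J_sq : ∀ p v, Θ p v = 0 → J p (J p v) = -v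
  pos : ∀ p v, Θ p v = 0 → v ≠ 0 → 0 < extDerivOneForm Θ p v (J p v)

namespace PseudohermitianStructure

variable {M : Type*} [TopologicalSpace M] [ChartedSpace (EuclideanSpace ℝ (Fin 3)) M]
  [IsManifold (𝓡 3) ∞ M] (P : PseudohermitianStructure M)

/-- The Reeb vector field `T`: the unique vector field with `Θ(T) = 1` and `dΘ(T, ·) = 0`. -/
def reeb (p : M) : TangentSpace (𝓡 3) p :=
  Classical.epsilon fun T : TangentSpace (𝓡 3) p =>
    P.Θ p T = 1 ∧ ∀ w, extDerivOneForm P.Θ p T w = 0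

/-- The Levi metric `G(v, w) = ½ dΘ(v, J w)` (to be evaluated on `v, w ∈ ξ`). -/
def levi (p : M) (v w : TangentSpace (𝓡 3) p) : ℝ :=
  1 / 2 * extDerivOneForm P.Θ p v (P.J p w)

/-- For `x ∈ ξ_p`, the 1-form `v ↦ G(v - Θ(v) T, x)` on `T_p M`. If `e₁, e₂` is a `G`-orthonormal
basis of `ξ_p`, then `P.dualForm p e₁`, `P.dualForm p e₂` and `Θ` form the basis `e¹, e², Θ` dual to
`e₁, e₂, T`. -/
def dualForm (p : M) (x : TangentSpace (𝓡 3) p) : TangentSpace (𝓡 3) p →L[ℝ] ℝ :=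
  let B : EuclideanSpace ℝ (Fin 3) →L[ℝ] EuclideanSpace ℝ (Fin 3) →L[ℝ] ℝ := extDerivOneForm P.Θ p
  let b : TangentSpace (𝓡 3) p →L[ℝ] ℝ := (1 / 2 : ℝ) • B.flip (P.J p x)
  b.comp (ContinuousLinearMap.id ℝ (TangentSpace (𝓡 3) p) - (P.Θ p).smulRight (P.reeb p))

/-- `e₁` is a smooth section of `ξ` of unit length for the Levi metric over the open set `U`. With
`e₂ = J e₁` it gives the unitary frame `Z₁ = ½ (e₁ - i e₂)` over `U`. -/
structure IsUnitaryFrameOn (U : Set M) (e₁ : (q : M) → TangentSpace (𝓡 3) q) : Prop where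
  isOpen : IsOpen U
  smooth : ContMDiffOn (𝓡 3) (𝓡 3).tangent ∞ (fun q => (⟨q, e₁ q⟩ : TangentBundle (𝓡 3) M)) U
  horizontal : ∀ q ∈ U, P.Θ q (e₁ q) = 0
  unit : ∀ q ∈ U, P.levi q (e₁ q) (e₁ q) = 1

/-- The complex coframe `θ¹ = e¹ + i e²` of the frame `e₁`, `e₂ = J e₁`. -/
def theta (e₁ : (q : M) → TangentSpace (𝓡 3) q) (q : M) (v : TangentSpace (𝓡 3) q) : ℂ :=
  (P.dualForm q (e₁ q) v : ℝ) + Complex.I * (P.dualForm q (P.J q (e₁ q)) v : ℝ)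

/-- The exterior derivative `dθ¹ = de¹ + i de²`. -/
def dTheta (e₁ : (q : M) → TangentSpace (𝓡 3) q) (q : M) (v w : TangentSpace (𝓡 3) q) : ℂ :=
  extDerivOneForm (fun r => P.dualForm r (e₁ r)) q v w +
    Complex.I * extDerivOneForm (fun r => P.dualForm r (P.J r (e₁ r))) q v w

/-- The structure equation that determines the pseudohermitian connection and its torsion over `U`:
`dθ¹ = θ¹ ∧ ω₁¹ + A Θ ∧ θ^{\bar 1}`, with `ω₁¹ = i η` for a real 1-form `η` and with
`A = A^1_{\bar 1}`. The connection is then given by `∇e₁ = η ⊗ e₂`, `∇e₂ = -η ⊗ e₁`, `∇T = 0`. -/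
def IsConnectionForm (U : Set M) (e₁ : (q : M) → TangentSpace (𝓡 3) q)
    (η : (q : M) → TangentSpace (𝓡 3) q →L[ℝ] ℝ) (A : M → ℂ) : Prop :=
  ∀ q ∈ U, ∀ v w : TangentSpace (𝓡 3) q,
    P.dTheta e₁ q v w =
      (P.theta e₁ q v * (Complex.I * η q w) - P.theta e₁ q w * (Complex.I * η q v)) +
      A q * (P.Θ q v * starRingEnd ℂ (P.theta e₁ q w) - P.Θ q w * starRingEnd ℂ (P.theta e₁ q v))

/-- The torsion coefficient `A₁₁` at `p` relative to a frame whose first vector at `p` is the unit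
vector `x ∈ ξ_p`: the complex conjugate of `A^1_{\bar 1}`. It depends on the frame only through
`x`. -/
def torsion (p : M) (x : TangentSpace (𝓡 3) p) : ℂ :=
  Classical.epsilon fun a : ℂ => ∃ U e₁ η A, p ∈ U ∧ P.IsUnitaryFrameOn U e₁ ∧
    P.IsConnectionForm U e₁ η A ∧ e₁ p = x ∧ a = starRingEnd ℂ (A p)

/-- The Tanaka-Webster curvature `W` at `p`, given by `dω₁¹ = W θ¹ ∧ θ^{\bar 1}` modulo `Θ`, that is
`dη(e₁, e₂) = -2 W`, for one (equivalently, every) unitary frame near `p`. -/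
def websterCurvature (p : M) : ℝ :=
  Classical.epsilon fun W : ℝ => ∃ U e₁ η A, p ∈ U ∧ P.IsUnitaryFrameOn U e₁ ∧
    P.IsConnectionForm U e₁ η A ∧ extDerivOneForm η p (e₁ p) (P.J p (e₁ p)) = -2 * W

/-- The p-area density of the plane spanned by `v, w ∈ T_p M`: the absolute value of
`(Θ ∧ e¹)(v, w)`, where `e₁` is a unit vector in the intersection of `ξ_p` with this plane, which
contains `Θ(v) w - Θ(w) v`. If `v, w` both lie in `ξ_p`, the density is zero. -/
def areaDensity (p : M) (v w : TangentSpace (𝓡 3) p) : ℝ :=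
  let x : TangentSpace (𝓡 3) p := P.Θ p v • w - P.Θ p w • v
  let e₁ : TangentSpace (𝓡 3) p := (√(P.levi p x x))⁻¹ • x
  |P.Θ p v * P.dualForm p e₁ w - P.Θ p w * P.dualForm p e₁ v|

end PseudohermitianStructure

/-! ### Surfaces in a pseudohermitian 3-manifold -/

section Surfaces

variable {M : Type*} [TopologicalSpace M] [ChartedSpace (EuclideanSpace ℝ (Fin 3)) M]
  [IsManifold (𝓡 3) ∞ M]
  {H : Type*} [TopologicalSpace H] (I : ModelWithCorners ℝ (EuclideanSpace ℝ (Fin 2)) H)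
  {N : Type*} [TopologicalSpace N] [ChartedSpace H N]

/-- The tangent vector `∂(X ∘ φ⁻¹)/∂uᵢ` at the point `u`, where `φ` is the chart of the surface `N`
at `x`. -/
def chartPartial (X : N → M) (x : N) (u : EuclideanSpace ℝ (Fin 2)) (i : Fin 2) :
    TangentSpace (𝓡 3) (X ((extChartAt I x).symm u)) :=
  mfderivWithin 𝓘(ℝ, EuclideanSpace ℝ (Fin 2)) (𝓡 3) (X ∘ (extChartAt I x).symm) (range I) u
    (EuclideanSpace.single i (1 : ℝ) : EuclideanSpace ℝ (Fin 2))

/-- The singular set: the points where `ξ` coincides with the tangent plane of the (immersed)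
surface. -/
def singularSet (P : PseudohermitianStructure M) (ι : N → M) : Set N :=
  {p | ∀ v : TangentSpace I p, P.Θ (ι p) (mfderiv I (𝓡 3) ι p v) = 0}

/-- The Legendrian normal `e₂ = J e₁`. -/
def legendrianNormal (P : PseudohermitianStructure M) (ι : N → M)
    (e₁ : (p : N) → TangentSpace I p) (p : N) : TangentSpace (𝓡 3) (ι p) :=
  P.J (ι p) (mfderiv I (𝓡 3) ι p (e₁ p))

/-- The p-mean curvature `H`, `∇_{e₁} e₁ = H e₂`. For a unitary frame of `M` near `ι p` that extends
`e₁`, with connection form `η`, one has `∇_{e₁} e₁ = η(e₁) e₂`, so that `H = η(e₁)`. -/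
def pMeanCurvature (P : PseudohermitianStructure M) (ι : N → M)
    (e₁ : (p : N) → TangentSpace I p) (p : N) : ℝ :=
  Classical.epsilon fun h : ℝ => ∃ U E₁ η A, ι p ∈ U ∧ P.IsUnitaryFrameOn U E₁ ∧
    P.IsConnectionForm U E₁ η A ∧ (∀ᶠ q in 𝓝 p, E₁ (ι q) = mfderiv I (𝓡 3) ι q (e₁ q)) ∧
    h = η (ι p) (mfderiv I (𝓡 3) ι p (e₁ p))

/-- The surface is p-minimal: `H = 0` on its nonsingular part. (Boundary points need not be
included, since `H` is continuous.) -/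
def IsPMinimal (P : PseudohermitianStructure M) (ι : N → M)
    (e₁ : (p : N) → TangentSpace I p) : Prop :=
  ∀ p, p ∉ singularSet I P ι → p ∉ I.boundary N → pMeanCurvature I P ι e₁ p = 0

/-- The function `α` on the nonsingular part such that `α e₂ + T` is tangent to the surface. -/
def alphaFun (P : PseudohermitianStructure M) (ι : N → M)
    (e₁ : (p : N) → TangentSpace I p) (p : N) : ℝ :=
  Classical.epsilon fun a : ℝ => ∃ v : TangentSpace I p,
    mfderiv I (𝓡 3) ι p v = a • legendrianNormal I P ι e₁ p + P.reeb (ι p)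

/-- The derivative `e₁(u)` of a function `u` on the surface. -/
def charDeriv (e₁ : (p : N) → TangentSpace I p) (u : N → ℝ) (p : N) : ℝ :=
  mfderiv I 𝓘(ℝ, ℝ) u p (e₁ p)

/-- The integrand of the second variation formula. -/
def secondVariationIntegrand (P : PseudohermitianStructure M) (ι : N → M)
    (e₁ : (p : N) → TangentSpace I p) (f g : N → ℝ) (p : N) : ℝ :=
  let α := alphaFun I P ι e₁
  (charDeriv I e₁ (fun q => f q - α q * g q) p) ^ 2 +
    (f p - α p * g p) ^ 2 *
      (-2 * P.websterCurvature (ι p) +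
        2 * (P.torsion (ι p) (mfderiv I (𝓡 3) ι p (e₁ p))).im -
        4 * charDeriv I e₁ α p - 4 * α p ^ 2)

variable [IsManifold I ∞ N]

/-- `e₁` is a characteristic field of the immersed surface: a smooth tangent vector field on the
nonsingular part of the surface which lies in `ξ` and has unit length. -/
structure IsCharacteristicField (P : PseudohermitianStructure M) (ι : N → M)
    (e₁ : (p : N) → TangentSpace I p) : Prop where
  smooth : ContMDiffOn I I.tangent ∞ (fun p => (⟨p, e₁ p⟩ : TangentBundle I N))
    (singularSet I P ι)ᶜ
  horizontal : ∀ p ∉ singularSet I P ι, P.Θ (ι p) (mfderiv I (𝓡 3) ι p (e₁ p)) = 0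
  unit : ∀ p ∉ singularSet I P ι,
    P.levi (ι p) (mfderiv I (𝓡 3) ι p (e₁ p)) (mfderiv I (𝓡 3) ι p (e₁ p)) = 1

variable [T2Space N] [SigmaCompactSpace N]

variable (N) in
/-- A smooth partition of unity on `N`, indexed by the points `x` of `N`, such that the support of
the function with index `x` lies in the domain of the chart at `x`. -/
def chartPartition : SmoothPartitionOfUnity N I N univ :=
  Classical.choose (SmoothPartitionOfUnity.exists_isSubordinate_chartAt_source I N)

variable [MeasurableSpace N]

/-- The p-area measure of a map `X : N → M`: integration of the p-area 2-form `|Θ ∧ e¹|` pulled back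
to `N`. As usual the integral of a 2-form (here a density) is defined through a partition of unity
`ρ` subordinate to charts, as `∑ₓ ∫ (ρₓ · |Θ ∧ e¹|(∂₁X, ∂₂X)) du` in the charts; it does not depend
on `ρ`. -/
def pAreaMeasure (P : PseudohermitianStructure M) (X : N → M) : Measure N :=
  Measure.sum fun x : N =>
    Measure.map (extChartAt I x).symm
      ((volume.restrict (extChartAt I x).target).withDensity fun u =>
        ENNReal.ofReal (chartPartition I N x ((extChartAt I x).symm u) *
          P.areaDensity (X ((extChartAt I x).symm u))
            (chartPartial I X x u 0) (chartPartial I X x u 1)))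

end Surfaces

end

/-! On ℝ × Σ, pull all forms back by (t, q) ↦ Φ_t(q) and write V = ∂_t. Suppose first that the
unitary frame is adapted at every time: e₁ is tangent to Φ_t(Σ), so that e² = αΘ on the slices and
the p-area form is ±Θ∧e¹. The structure equations give d(Θ∧e¹) = Θ∧e²∧ω. With F = e²(V) − αΘ(V),
Cartan's formula on a slice reads ∂_t(Θ∧e¹) = d(ι_V(Θ∧e¹)) − F H Θ∧e¹, where H = ω(e₁). As H = 0 at
t = 0, the second derivative there is −F (∂_t H) Θ∧e¹ plus an exact form.

To find ∂_t H, use that e² − αΘ vanishes on all slices. The equation for de² then determines ω(V) at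
t = 0 through e₁(F) + 2αF, and dω = −2W e¹∧e² mod Θ yields ∂_t H = e₁e₁F + 2αe₁F + F(2W − 2 Im A₁₁ +
4e₁(α) + 4α²). Finally −F(e₁e₁F + 2αe₁F) Θ∧e¹ differs from (e₁F)² Θ∧e¹ by d(F e₁(F) Θ). At t = 0 the
function F is f − αg, which gives the integrand. This calculation is `second_variation_flat`.

A frame that extends the characteristic field of Σ to M is adapted only at t = 0.
`second_variation_forms` removes the extra assumption: rotate by the angle φ whose cosine and sine
are proportional to the values of Θ∧e¹ and Θ∧e² on the slices. The rotation changes ω by dφ and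
leaves dω alone, and it is trivial at t = 0.

The curvature, torsion and H of the statement are chosen through arbitrary frames, so the connection
must be shown to exist (this uses d(dΘ) = 0) and to be unique, and the three quantities to be
independent of the frame. Frames that extend the characteristic field come from a local smooth left
inverse of the immersion (`IsCharacteristicField.exists_frame_extension`).

All this is local; `exists_local_variation` collects it in one chart. To globalize, the exact term
is recognized as the divergence, with respect to the p-area, of the globally defined field
`fluxField`. This field vanishes off K, and K avoids the singular set and the boundary, so the
divergence integrates to zero by `integral_eq_zero_of_local_divergence`. Differentiation of the area
under the integral sign is `hasDerivAt_area`. -/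

noncomputable section

/-! ### Structure equations on a normed space and rotation of the coframe -/

section FlatForms

variable {E : Type*} [NormedAddCommGroup E] [NormedSpace ℝ E]

/-- The exterior derivative of a 1-form on a normed space. -/
def flatD (β : E → E →L[ℝ] ℝ) (z v w : E) : ℝ := fderiv ℝ β z v w - fderiv ℝ β z w v

/-- The real form of the structure equations of a pseudohermitian 3-manifold, for 1-forms on a
normed space: `dΘ = 2 e¹ ∧ e²` and `dθ¹ = θ¹ ∧ i w + (Aᵣ + i Aᵢ) Θ ∧ θ^{\bar 1}`. -/
structure StructureEqs (Θ e f w : E → E →L[ℝ] ℝ) (Ar Ai : ℝ) (z : E) : Prop where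
  dΘ : ∀ x y, flatD Θ z x y = 2 * (e z x * f z y - e z y * f z x)
  de : ∀ x y, flatD e z x y = -(f z x * w z y - f z y * w z x) +
    Ar * (Θ z x * e z y - Θ z y * e z x) + Ai * (Θ z x * f z y - Θ z y * f z x)
  df : ∀ x y, flatD f z x y = (e z x * w z y - e z y * w z x) +
    Ai * (Θ z x * e z y - Θ z y * e z x) - Ar * (Θ z x * f z y - Θ z y * f z x)

theorem flatD_congr {β γ : E → E →L[ℝ] ℝ} {z : E} (h : β =ᶠ[𝓝 z] γ) (v w : E) :
    flatD β z v w = flatD γ z v w := by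
  simp only [flatD, h.fderiv_eq]

theorem flatD_add {β γ : E → E →L[ℝ] ℝ} {z : E} (hβ : DifferentiableAt ℝ β z)
    (hγ : DifferentiableAt ℝ γ z) (v w : E) :
    flatD (fun z => β z + γ z) z v w = flatD β z v w + flatD γ z v w := by
  simp only [flatD, fderiv_fun_add hβ hγ, add_apply]; ring

theorem flatD_sub {β γ : E → E →L[ℝ] ℝ} {z : E} (hβ : DifferentiableAt ℝ β z)
    (hγ : DifferentiableAt ℝ γ z) (v w : E) :
    flatD (fun z => β z - γ z) z v w = flatD β z v w - flatD γ z v w := by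
  simp only [flatD, fderiv_fun_sub hβ hγ, sub_apply]; ring

theorem flatD_smul {β : E → E →L[ℝ] ℝ} {c : E → ℝ} {z : E} (hc : DifferentiableAt ℝ c z)
    (hβ : DifferentiableAt ℝ β z) (v w : E) :
    flatD (fun z => c z • β z) z v w =
      c z * flatD β z v w + (fderiv ℝ c z v * β z w - fderiv ℝ c z w * β z v) := by
  simp only [flatD, fderiv_fun_smul hc hβ, add_apply,
    smul_apply, ContinuousLinearMap.smulRight_apply, smul_eq_mul]
  ring

theorem flatD_fderiv {s : E → ℝ} {z : E} (hs : ContDiffAt ℝ ∞ s z) (v w : E) :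
    flatD (fderiv ℝ s) z v w = 0 := by
  have := (hs.isSymmSndFDerivAt (by simp; norm_cast)).eq v w
  simp only [flatD]
  linarith

theorem fderiv_rotation {c s : E → ℝ} {z : E} (hc : DifferentiableAt ℝ c z)
    (hs : DifferentiableAt ℝ s z) (hcs : ∀ᶠ y in 𝓝 z, c y ^ 2 + s y ^ 2 = 1) (v : E) :
    c z * fderiv ℝ c z v + s z * fderiv ℝ s z v = 0 := by
  have h1 : (fun y => c y ^ 2 + s y ^ 2) =ᶠ[𝓝 z] fun _ => 1 := hcs
  have h2 := congrArg (fun L : E →L[ℝ] ℝ => L v) h1.fderiv_eq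
  have h3 : fderiv ℝ (fun y => c y ^ 2 + s y ^ 2) z =
      fderiv ℝ (fun y => c y ^ 2) z + fderiv ℝ (fun y => s y ^ 2) z :=
    fderiv_fun_add (hc.pow 2) (hs.pow 2)
  rw [h3, fderiv_fun_pow 2 hc, fderiv_fun_pow 2 hs] at h2
  simp at h2
  linarith

/-- The connection form of a rotated frame. -/
def rotConn (w : E → E →L[ℝ] ℝ) (c s : E → ℝ) (z : E) : E →L[ℝ] ℝ :=
  w z + (c z • fderiv ℝ s z - s z • fderiv ℝ c z)

/-- With c = cos φ and s = sin φ the complex form θ¹ = e + if is multiplied by c − is. Hence ω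
changes by dφ = c ds − s dc, and the torsion A by the factor (c − is)². Working with c and s avoids
choosing an angle. -/
theorem StructureEqs.rotate {Θ e f w : E → E →L[ℝ] ℝ} {Ar Ai : ℝ} {z : E}
    (h : StructureEqs Θ e f w Ar Ai z) {c s : E → ℝ} (he : DifferentiableAt ℝ e z)
    (hf : DifferentiableAt ℝ f z) (hc : DifferentiableAt ℝ c z) (hs : DifferentiableAt ℝ s z)
    (hcs : ∀ᶠ y in 𝓝 z, c y ^ 2 + s y ^ 2 = 1) :
    StructureEqs Θ (fun y => c y • e y + s y • f y) (fun y => c y • f y - s y • e y)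
      (rotConn w c s) (Ar * (c z ^ 2 - s z ^ 2) + 2 * Ai * c z * s z)
      (Ai * (c z ^ 2 - s z ^ 2) - 2 * Ar * c z * s z) z := by
  have h1 : c z ^ 2 + s z ^ 2 = 1 := hcs.self_of_nhds
  have hd := fderiv_rotation hc hs hcs
  constructor
  · intro x y
    simp only [h.dΘ, add_apply, sub_apply,
      smul_apply, smul_eq_mul]
    linear_combination (-2 * (e z x * f z y - e z y * f z x)) * h1
  · intro x y
    rw [flatD_add (hc.fun_smul he) (hs.fun_smul hf), flatD_smul hc he, flatD_smul hs hf, h.de, h.df]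
    simp only [rotConn, add_apply, sub_apply,
      smul_apply, smul_eq_mul]
    have hx := hd x
    have hy := hd y
    -- The next four identities say dc = −s dφ and ds = c dφ. Once dφ(x) and dφ(y) are renamed `px`
    -- and `py`, the claim is polynomial modulo c² + s² = 1.
    have gx : fderiv ℝ c z x = -s z * (c z * fderiv ℝ s z x - s z * fderiv ℝ c z x) := by
      linear_combination (-fderiv ℝ c z x) * h1 + c z * hx
    have gy : fderiv ℝ c z y = -s z * (c z * fderiv ℝ s z y - s z * fderiv ℝ c z y) := by
      linear_combination (-fderiv ℝ c z y) * h1 + c z * hy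
    have kx : fderiv ℝ s z x = c z * (c z * fderiv ℝ s z x - s z * fderiv ℝ c z x) := by
      linear_combination (-fderiv ℝ s z x) * h1 + s z * hx
    have ky : fderiv ℝ s z y = c z * (c z * fderiv ℝ s z y - s z * fderiv ℝ c z y) := by
      linear_combination (-fderiv ℝ s z y) * h1 + s z * hy
    generalize c z * fderiv ℝ s z x - s z * fderiv ℝ c z x = px at *
    generalize c z * fderiv ℝ s z y - s z * fderiv ℝ c z y = py at *
    rw [gx, gy, kx, ky]
    linear_combination (-((Ar * c z + Ai * s z) * (Θ z x * e z y - Θ z y * e z x) +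
      (Ai * c z - Ar * s z) * (Θ z x * f z y - Θ z y * f z x))) * h1
  · intro x y
    rw [flatD_sub (hc.fun_smul hf) (hs.fun_smul he), flatD_smul hc hf, flatD_smul hs he, h.de, h.df]
    simp only [rotConn, add_apply, sub_apply,
      smul_apply, smul_eq_mul]
    have hx := hd x
    have hy := hd y
    have gx : fderiv ℝ c z x = -s z * (c z * fderiv ℝ s z x - s z * fderiv ℝ c z x) := by
      linear_combination (-fderiv ℝ c z x) * h1 + c z * hx
    have gy : fderiv ℝ c z y = -s z * (c z * fderiv ℝ s z y - s z * fderiv ℝ c z y) := by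
      linear_combination (-fderiv ℝ c z y) * h1 + c z * hy
    have kx : fderiv ℝ s z x = c z * (c z * fderiv ℝ s z x - s z * fderiv ℝ c z x) := by
      linear_combination (-fderiv ℝ s z x) * h1 + s z * hx
    have ky : fderiv ℝ s z y = c z * (c z * fderiv ℝ s z y - s z * fderiv ℝ c z y) := by
      linear_combination (-fderiv ℝ s z y) * h1 + s z * hy
    generalize c z * fderiv ℝ s z x - s z * fderiv ℝ c z x = px at *
    generalize c z * fderiv ℝ s z y - s z * fderiv ℝ c z y = py at *
    rw [gx, gy, kx, ky]
    linear_combination (-((Ai * c z - Ar * s z) * (Θ z x * e z y - Θ z y * e z x) -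
      (Ar * c z + Ai * s z) * (Θ z x * f z y - Θ z y * f z x))) * h1

/-- Locally the correction is the closed form dφ: d(c ds − s dc) = 2 dc∧ds, and dc∧ds = 0 because c
dc + s ds = 0 makes dc and ds proportional. -/
theorem flatD_rotConn {w : E → E →L[ℝ] ℝ} {z : E} {c s : E → ℝ} (hw : DifferentiableAt ℝ w z)
    (hc : ContDiffAt ℝ ∞ c z) (hs : ContDiffAt ℝ ∞ s z)
    (hcs : ∀ᶠ y in 𝓝 z, c y ^ 2 + s y ^ 2 = 1) (x y : E) :
    flatD (rotConn w c s) z x y = flatD w z x y := by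
  have h1 : c z ^ 2 + s z ^ 2 = 1 := hcs.self_of_nhds
  have dc := hc.differentiableAt (by simp)
  have ds := hs.differentiableAt (by simp)
  have hd := fderiv_rotation dc ds hcs
  have dc' : DifferentiableAt ℝ (fderiv ℝ c) z :=
    (hc.fderiv_right (m := 1) (by norm_cast)).differentiableAt (by simp)
  have ds' : DifferentiableAt ℝ (fderiv ℝ s) z :=
    (hs.fderiv_right (m := 1) (by norm_cast)).differentiableAt (by simp)
  have : rotConn w c s = fun z => w z + (c z • fderiv ℝ s z - s z • fderiv ℝ c z) := rfl
  rw [this, flatD_add hw ((dc.fun_smul ds').fun_sub (ds.fun_smul dc')), flatD_sub (dc.fun_smul ds') (ds.fun_smul dc'),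
    flatD_smul dc ds', flatD_smul ds dc', flatD_fderiv hc, flatD_fderiv hs]
  have e1 : fderiv ℝ c z x * fderiv ℝ s z y - fderiv ℝ c z y * fderiv ℝ s z x = 0 := by
    have hc2 : c z * (fderiv ℝ c z x * fderiv ℝ s z y - fderiv ℝ c z y * fderiv ℝ s z x) = 0 := by
      linear_combination fderiv ℝ s z y * hd x - fderiv ℝ s z x * hd y
    have hs2 : s z * (fderiv ℝ c z x * fderiv ℝ s z y - fderiv ℝ c z y * fderiv ℝ s z x) = 0 := by
      linear_combination fderiv ℝ c z x * hd y - fderiv ℝ c z y * hd x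
    linear_combination (-(fderiv ℝ c z x * fderiv ℝ s z y - fderiv ℝ c z y * fderiv ℝ s z x)) * h1 +
      c z * hc2 + s z * hs2
  linear_combination 2 * e1

end FlatForms

/-! ### The second variation in coordinates, for a coframe adapted at all times -/

section FlatVariation

variable {E : Type*} [NormedAddCommGroup E] [NormedSpace ℝ E]

theorem fderiv_mul_apply' {f g : E → ℝ} {z : E} (hf : DifferentiableAt ℝ f z)
    (hg : DifferentiableAt ℝ g z) (v : E) :
    fderiv ℝ (fun y => f y * g y) z v = f z * fderiv ℝ g z v + g z * fderiv ℝ f z v := by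
  rw [fderiv_fun_mul hf hg]; simp

theorem fderiv_sub_apply' {f g : E → ℝ} {z : E} (hf : DifferentiableAt ℝ f z)
    (hg : DifferentiableAt ℝ g z) (v : E) :
    fderiv ℝ (fun y => f y - g y) z v = fderiv ℝ f z v - fderiv ℝ g z v := by
  rw [fderiv_fun_sub hf hg]; simp

theorem fderiv_add_apply' {f g : E → ℝ} {z : E} (hf : DifferentiableAt ℝ f z)
    (hg : DifferentiableAt ℝ g z) (v : E) :
    fderiv ℝ (fun y => f y + g y) z v = fderiv ℝ f z v + fderiv ℝ g z v := by
  rw [fderiv_fun_add hf hg]; simp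

theorem fderiv_mul_sub_mul_apply {f g h k : E → ℝ} {z : E} (hf : DifferentiableAt ℝ f z)
    (hg : DifferentiableAt ℝ g z) (hh : DifferentiableAt ℝ h z) (hk : DifferentiableAt ℝ k z)
    (v : E) :
    fderiv ℝ (fun y => f y * g y - h y * k y) z v =
      f z * fderiv ℝ g z v + g z * fderiv ℝ f z v -
        (h z * fderiv ℝ k z v + k z * fderiv ℝ h z v) := by
  rw [fderiv_sub_apply' (hf.fun_mul hg) (hh.fun_mul hk), fderiv_mul_apply' hf hg,
    fderiv_mul_apply' hh hk]

theorem fderiv_comm_of_contDiffAt {s : E → ℝ} {z : E} (hs : ContDiffAt ℝ ∞ s z) (v w : E) :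
    fderiv ℝ (fun y => fderiv ℝ s y v) z w = fderiv ℝ (fun y => fderiv ℝ s y w) z v := by
  have hd : DifferentiableAt ℝ (fderiv ℝ s) z :=
    (hs.fderiv_right (m := 1) (by norm_cast)).differentiableAt (by simp)
  have h := (hs.isSymmSndFDerivAt (by simp; norm_cast)).eq v w
  rw [fderiv_clm_apply hd (by fun_prop), fderiv_clm_apply hd (by fun_prop)]
  simpa using h.symm

theorem ContDiffAt.fderiv_apply_const {s : E → ℝ} {z : E} (hs : ContDiffAt ℝ ∞ s z) (v : E) :
    ContDiffAt ℝ ∞ (fun y => fderiv ℝ s y v) z :=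
  (hs.fderiv_right (m := ∞) (by simp)).clm_apply contDiffAt_const

/-- The line through z in a direction of ker τ stays in the hyperplane. This is how identities known
only at time zero get differentiated: in directions tangent to the slice, never in time. -/
theorem fderiv_eq_of_eqOn_slice {φ ψ : E → ℝ} {z : E} {τ : E →L[ℝ] ℝ} {v : E}
    (hφ : DifferentiableAt ℝ φ z) (hψ : DifferentiableAt ℝ ψ z) (hv : τ v = 0) (hz : τ z = 0)
    (h : ∀ᶠ y in 𝓝 z, τ y = 0 → φ y = ψ y) : fderiv ℝ φ z v = fderiv ℝ ψ z v := by
  have h1 : HasDerivAt (fun t : ℝ => φ (z + t • v)) (fderiv ℝ φ z v) 0 := by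
    have := hφ.hasFDerivAt.hasLineDerivAt v
    exact this
  have h2 : HasDerivAt (fun t : ℝ => ψ (z + t • v)) (fderiv ℝ ψ z v) 0 := by
    have := hψ.hasFDerivAt.hasLineDerivAt v
    exact this
  refine h1.unique (h2.congr_of_eventuallyEq ?_)
  have hc : ContinuousAt (fun t : ℝ => z + t • v) 0 := by fun_prop
  have : Tendsto (fun t : ℝ => z + t • v) (𝓝 0) (𝓝 z) := by
    simpa [ContinuousAt] using hc
  filter_upwards [this.eventually h] with t ht
  exact ht (by simp [hv, hz])

/-- Second variation of the p-area form in coordinates. The functions `T_i, e_i, f_i, w_i` are the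
components of `Θ, e¹, e²` and of the connection form with respect to the constant vectors `b₀` (the
direction of the variation) and `b₁, b₂` (tangent to the slices). -/
theorem second_variation_flat {b₀ b₁ b₂ : E} {τ : E →L[ℝ] ℝ} (hb₁ : τ b₁ = 0) (hb₂ : τ b₂ = 0)
    {O : Set E} (hO : IsOpen O) {T₀ T₁ T₂ e₀ e₁ e₂ f₀ f₁ f₂ w₀ w₁ w₂ α Ar Ai : E → ℝ}
    (hT₀ : ∀ z ∈ O, ContDiffAt ℝ ∞ T₀ z) (hT₁ : ∀ z ∈ O, ContDiffAt ℝ ∞ T₁ z)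
    (hT₂ : ∀ z ∈ O, ContDiffAt ℝ ∞ T₂ z) (he₀ : ∀ z ∈ O, ContDiffAt ℝ ∞ e₀ z)
    (he₁ : ∀ z ∈ O, ContDiffAt ℝ ∞ e₁ z) (he₂ : ∀ z ∈ O, ContDiffAt ℝ ∞ e₂ z)
    (hf₀ : ∀ z ∈ O, ContDiffAt ℝ ∞ f₀ z) (hw₀ : ∀ z ∈ O, ContDiffAt ℝ ∞ w₀ z)
    (hw₁ : ∀ z ∈ O, ContDiffAt ℝ ∞ w₁ z) (hw₂ : ∀ z ∈ O, ContDiffAt ℝ ∞ w₂ z)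
    (hα : ∀ z ∈ O, ContDiffAt ℝ ∞ α z)
    (dT₀₁ : ∀ z ∈ O, fderiv ℝ T₁ z b₀ - fderiv ℝ T₀ z b₁ = 2 * (e₀ z * f₁ z - e₁ z * f₀ z))
    (dT₀₂ : ∀ z ∈ O, fderiv ℝ T₂ z b₀ - fderiv ℝ T₀ z b₂ = 2 * (e₀ z * f₂ z - e₂ z * f₀ z))
    (dT₁₂ : ∀ z ∈ O, fderiv ℝ T₂ z b₁ - fderiv ℝ T₁ z b₂ = 2 * (e₁ z * f₂ z - e₂ z * f₁ z))
    (de₀₁ : ∀ z ∈ O, fderiv ℝ e₁ z b₀ - fderiv ℝ e₀ z b₁ = -(f₀ z * w₁ z - f₁ z * w₀ z) +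
      Ar z * (T₀ z * e₁ z - T₁ z * e₀ z) + Ai z * (T₀ z * f₁ z - T₁ z * f₀ z))
    (de₀₂ : ∀ z ∈ O, fderiv ℝ e₂ z b₀ - fderiv ℝ e₀ z b₂ = -(f₀ z * w₂ z - f₂ z * w₀ z) +
      Ar z * (T₀ z * e₂ z - T₂ z * e₀ z) + Ai z * (T₀ z * f₂ z - T₂ z * f₀ z))
    (de₁₂ : ∀ z ∈ O, fderiv ℝ e₂ z b₁ - fderiv ℝ e₁ z b₂ = -(f₁ z * w₂ z - f₂ z * w₁ z) +
      Ar z * (T₁ z * e₂ z - T₂ z * e₁ z) + Ai z * (T₁ z * f₂ z - T₂ z * f₁ z))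
    (df₀₁ : ∀ z ∈ O, fderiv ℝ f₁ z b₀ - fderiv ℝ f₀ z b₁ = (e₀ z * w₁ z - e₁ z * w₀ z) +
      Ai z * (T₀ z * e₁ z - T₁ z * e₀ z) - Ar z * (T₀ z * f₁ z - T₁ z * f₀ z))
    (df₀₂ : ∀ z ∈ O, fderiv ℝ f₂ z b₀ - fderiv ℝ f₀ z b₂ = (e₀ z * w₂ z - e₂ z * w₀ z) +
      Ai z * (T₀ z * e₂ z - T₂ z * e₀ z) - Ar z * (T₀ z * f₂ z - T₂ z * f₀ z))
    (df₁₂ : ∀ z ∈ O, fderiv ℝ f₂ z b₁ - fderiv ℝ f₁ z b₂ = (e₁ z * w₂ z - e₂ z * w₁ z) +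
      Ai z * (T₁ z * e₂ z - T₂ z * e₁ z) - Ar z * (T₁ z * f₂ z - T₂ z * f₁ z))
    (hα₁ : ∀ z ∈ O, f₁ z = α z * T₁ z) (hα₂ : ∀ z ∈ O, f₂ z = α z * T₂ z)
    {a F eF u : E → ℝ} (ha : ∀ z, a z = T₁ z * e₂ z - T₂ z * e₁ z) (ha0 : ∀ z ∈ O, a z ≠ 0)
    (hF : ∀ z, F z = f₀ z - α z * T₀ z)
    (heF : ∀ z, eF z = (T₁ z * fderiv ℝ F z b₂ - T₂ z * fderiv ℝ F z b₁) / a z)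
    (hu : ∀ z, u z = -F z * eF z)
    (slice_e₀ : ∀ z ∈ O, τ z = 0 → e₀ z = 0)
    (slice_w : ∀ z ∈ O, τ z = 0 → T₁ z * w₂ z - T₂ z * w₁ z = 0)
    {z : E} (hz : z ∈ O) (hτ : τ z = 0) {W l₀ l₁ l₂ : ℝ}
    (dw₀₁ : fderiv ℝ w₁ z b₀ - fderiv ℝ w₀ z b₁ = -2 * W * (e₀ z * f₁ z - e₁ z * f₀ z) +
      (T₀ z * l₁ - T₁ z * l₀))
    (dw₀₂ : fderiv ℝ w₂ z b₀ - fderiv ℝ w₀ z b₂ = -2 * W * (e₀ z * f₂ z - e₂ z * f₀ z) +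
      (T₀ z * l₂ - T₂ z * l₀))
    (dw₁₂ : fderiv ℝ w₂ z b₁ - fderiv ℝ w₁ z b₂ = -2 * W * (e₁ z * f₂ z - e₂ z * f₁ z) +
      (T₁ z * l₂ - T₂ z * l₁)) :
    fderiv ℝ (fun y => fderiv ℝ a y b₀) z b₀ =
      a z * (eF z ^ 2 + F z ^ 2 * (-2 * W - 2 * Ai z -
        4 * ((T₁ z * fderiv ℝ α z b₂ - T₂ z * fderiv ℝ α z b₁) / a z) - 4 * α z ^ 2)) +
      (fderiv ℝ (fun y => fderiv ℝ (fun x => T₀ x * e₂ x - e₀ x * T₂ x) y b₀ - u y * T₂ y) z b₁ +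
       fderiv ℝ (fun y => -fderiv ℝ (fun x => T₀ x * e₁ x - e₀ x * T₁ x) y b₀ + u y * T₁ y) z b₂)
      := by
  have dd : ∀ {φ : E → ℝ} {y : E}, ContDiffAt ℝ ∞ φ y → DifferentiableAt ℝ φ y :=
    fun h => h.differentiableAt (by simp)
  have hnear : ∀ᶠ y in 𝓝 z, y ∈ O := hO.mem_nhds hz
  have ha' : a = fun z => T₁ z * e₂ z - T₂ z * e₁ z := funext ha
  have hF' : F = fun z => f₀ z - α z * T₀ z := funext hF
  have heF' : eF = fun z => (T₁ z * fderiv ℝ F z b₂ - T₂ z * fderiv ℝ F z b₁) / a z := funext heF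
  have hu' : u = fun z => -F z * eF z := funext hu
  have ca : ∀ y ∈ O, ContDiffAt ℝ ∞ a y := fun y hy => by
    rw [ha']; exact ((hT₁ y hy).mul (he₂ y hy)).sub ((hT₂ y hy).mul (he₁ y hy))
  have cF : ∀ y ∈ O, ContDiffAt ℝ ∞ F y := fun y hy => by
    rw [hF']; exact (hf₀ y hy).sub ((hα y hy).mul (hT₀ y hy))
  have ceF : ∀ y ∈ O, ContDiffAt ℝ ∞ eF y := fun y hy => by
    rw [heF']
    exact (((hT₁ y hy).mul ((cF y hy).fderiv_apply_const b₂)).sub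
      ((hT₂ y hy).mul ((cF y hy).fderiv_apply_const b₁))).div (ca y hy) (ha0 y hy)
  have cu : ∀ y ∈ O, ContDiffAt ℝ ∞ u y := fun y hy => by
    rw [hu']; exact (cF y hy).neg.mul (ceF y hy)
  have cμ₁ : ∀ y ∈ O, ContDiffAt ℝ ∞ (fun x => T₀ x * e₁ x - e₀ x * T₁ x) y := fun y hy =>
    ((hT₀ y hy).mul (he₁ y hy)).sub ((he₀ y hy).mul (hT₁ y hy))
  have cμ₂ : ∀ y ∈ O, ContDiffAt ℝ ∞ (fun x => T₀ x * e₂ x - e₀ x * T₂ x) y := fun y hy =>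
    ((hT₀ y hy).mul (he₂ y hy)).sub ((he₀ y hy).mul (hT₂ y hy))
  have cc : ∀ y ∈ O, ContDiffAt ℝ ∞ (fun x => T₁ x * w₂ x - T₂ x * w₁ x) y := fun y hy =>
    ((hT₁ y hy).mul (hw₂ y hy)).sub ((hT₂ y hy).mul (hw₁ y hy))
  -- the first variation
  have first : ∀ y ∈ O, fderiv ℝ a y b₀ = fderiv ℝ (fun x => T₀ x * e₂ x - e₀ x * T₂ x) y b₁ -
      fderiv ℝ (fun x => T₀ x * e₁ x - e₀ x * T₁ x) y b₂ -
      F y * (T₁ y * w₂ y - T₂ y * w₁ y) := fun y hy => by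
    rw [ha', fderiv_mul_sub_mul_apply (dd (hT₁ y hy)) (dd (he₂ y hy)) (dd (hT₂ y hy))
      (dd (he₁ y hy)), fderiv_mul_sub_mul_apply (dd (hT₀ y hy)) (dd (he₂ y hy)) (dd (he₀ y hy))
      (dd (hT₂ y hy)), fderiv_mul_sub_mul_apply (dd (hT₀ y hy)) (dd (he₁ y hy)) (dd (he₀ y hy))
      (dd (hT₁ y hy)), hF]
    have t01 := dT₀₁ y hy
    have t02 := dT₀₂ y hy
    have t12 := dT₁₂ y hy
    have e01 := de₀₁ y hy
    have e02 := de₀₂ y hy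
    have e12 := de₁₂ y hy
    rw [hα₁ y hy, hα₂ y hy] at *
    -- The coefficients are those in the expansion of dΘ∧e¹ − Θ∧de¹ on (b₀, b₁, b₂). The torsion
    -- terms cancel because they contain Θ, and e² = αΘ on slices turns Θ∧e²∧ω into −F times Θ∧ω.
    linear_combination e₂ y * t01 - e₁ y * t02 + e₀ y * t12 - T₂ y * e01 + T₁ y * e02 - T₀ y * e12
  -- The factor T₁w₂ − T₂w₁ equals aH and vanishes at time zero, so of the derivative of the product
  -- F · aH only F ∂₀(aH) remains.
  have second : fderiv ℝ (fun y => fderiv ℝ a y b₀) z b₀ =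
      fderiv ℝ (fun y => fderiv ℝ (fun x => T₀ x * e₂ x - e₀ x * T₂ x) y b₀) z b₁ -
      fderiv ℝ (fun y => fderiv ℝ (fun x => T₀ x * e₁ x - e₀ x * T₁ x) y b₀) z b₂ -
      F z * fderiv ℝ (fun x => T₁ x * w₂ x - T₂ x * w₁ x) z b₀ := by
    have h1 : (fun y => fderiv ℝ a y b₀) =ᶠ[𝓝 z] fun y =>
        (fderiv ℝ (fun x => T₀ x * e₂ x - e₀ x * T₂ x) y b₁ -
          fderiv ℝ (fun x => T₀ x * e₁ x - e₀ x * T₁ x) y b₂) -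
        F y * (T₁ y * w₂ y - T₂ y * w₁ y) := by
      filter_upwards [hnear] with y hy using first y hy
    rw [h1.fderiv_eq, fderiv_sub_apply'
      (((dd ((cμ₂ z hz).fderiv_apply_const b₁))).fun_sub (dd ((cμ₁ z hz).fderiv_apply_const b₂)))
      ((dd (cF z hz)).fun_mul (dd (cc z hz))),
      fderiv_sub_apply' (dd ((cμ₂ z hz).fderiv_apply_const b₁))
        (dd ((cμ₁ z hz).fderiv_apply_const b₂)),
      fderiv_mul_apply' (dd (cF z hz)) (dd (cc z hz)), slice_w z hz hτ,
      fderiv_comm_of_contDiffAt (cμ₂ z hz), fderiv_comm_of_contDiffAt (cμ₁ z hz)]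
    ring
  -- the connection form along the slice
  set k : E → ℝ := fun y => eF y + 2 * α y * F y with hk
  have ck : ∀ y ∈ O, ContDiffAt ℝ ∞ k y := fun y hy =>
    (ceF y hy).add ((contDiffAt_const.mul (hα y hy)).mul (cF y hy))
  have aeF : ∀ y ∈ O, a y * eF y = T₁ y * fderiv ℝ F y b₂ - T₂ y * fderiv ℝ F y b₁ := fun y hy => by
    rw [heF]; field_simp [ha0 y hy]
  have fα : ∀ y ∈ O, ∀ v, fderiv ℝ f₁ y v = α y * fderiv ℝ T₁ y v + T₁ y * fderiv ℝ α y v ∧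
      fderiv ℝ f₂ y v = α y * fderiv ℝ T₂ y v + T₂ y * fderiv ℝ α y v := fun y hy v => by
    have h1 : f₁ =ᶠ[𝓝 y] fun x => α x * T₁ x := by
      filter_upwards [hO.mem_nhds hy] with x hx using hα₁ x hx
    have h2 : f₂ =ᶠ[𝓝 y] fun x => α x * T₂ x := by
      filter_upwards [hO.mem_nhds hy] with x hx using hα₂ x hx
    rw [h1.fderiv_eq, h2.fderiv_eq, fderiv_mul_apply' (dd (hα y hy)) (dd (hT₁ y hy)),
      fderiv_mul_apply' (dd (hα y hy)) (dd (hT₂ y hy))]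
    exact ⟨rfl, rfl⟩
  have Fd : ∀ y ∈ O, ∀ v, fderiv ℝ F y v = fderiv ℝ f₀ y v -
      (α y * fderiv ℝ T₀ y v + T₀ y * fderiv ℝ α y v) := fun y hy v => by
    rw [hF', fderiv_sub_apply' (dd (hf₀ y hy)) ((dd (hα y hy)).fun_mul (dd (hT₀ y hy))),
      fderiv_mul_apply' (dd (hα y hy)) (dd (hT₀ y hy))]
  -- This evaluates the equation for de² on (b₀, a·e₁) after substituting e² = αΘ on slice vectors,
  -- which holds at all times and may be differentiated along b₀. The (b₁, b₂) component then
  -- removes the terms in which T₀ multiplies the torsion and the derivative of α.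
  have w0 : ∀ y ∈ O, τ y = 0 → a y * w₀ y = T₀ y * (w₁ y * e₂ y - w₂ y * e₁ y) + a y * k y := by
    intro y hy hτy
    obtain ⟨g1, g2⟩ := fα y hy b₀
    obtain ⟨-, g3⟩ := fα y hy b₁
    obtain ⟨g4, -⟩ := fα y hy b₂
    have t01 := dT₀₁ y hy
    have t02 := dT₀₂ y hy
    have t12 := dT₁₂ y hy
    have f01 := df₀₁ y hy
    have f02 := df₀₂ y hy
    have f12 := df₁₂ y hy
    have he := slice_e₀ y hy hτy
    have h1 := Fd y hy b₁
    have h2 := Fd y hy b₂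
    have h3 := aeF y hy
    rw [hα₁ y hy, he] at t01 f01
    rw [hα₂ y hy, he] at t02 f02
    rw [hα₁ y hy, hα₂ y hy] at t12 f12
    rw [g1] at f01
    rw [g2] at f02
    rw [g3, g4] at f12
    simp only [hk, mul_add]
    rw [h3, h1, h2, hF, ha]
    linear_combination T₁ y * f02 - T₂ y * f01 - α y * (T₁ y * t02 - T₂ y * t01) - T₀ y * f12 +
      α y * T₀ y * t12
  -- Restricted to the slice, ω and Θ both kill e₁, hence so does Θ(V)ω − ω(V)Θ. It is therefore a
  -- multiple of Θ, and `w0` identifies the factor as −k.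
  have slice1 : ∀ y ∈ O, τ y = 0 → T₀ y * w₁ y - w₀ y * T₁ y = -k y * T₁ y := by
    intro y hy hτy
    have h1 := w0 y hy hτy
    have hw := slice_w y hy hτy
    apply mul_left_cancel₀ (ha0 y hy)
    have := ha y
    linear_combination (-T₁ y) * h1 + T₀ y * w₁ y * this + T₀ y * e₁ y * hw
  have slice2 : ∀ y ∈ O, τ y = 0 → T₀ y * w₂ y - w₀ y * T₂ y = -k y * T₂ y := by
    intro y hy hτy
    have h1 := w0 y hy hτy
    have hw := slice_w y hy hτy
    apply mul_left_cancel₀ (ha0 y hy)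
    have := ha y
    linear_combination (-T₂ y) * h1 + T₀ y * w₂ y * this + T₀ y * e₂ y * hw
  -- The two identities hold only on the slice, but the derivatives needed are along b₁ and b₂.
  have s1 := fderiv_eq_of_eqOn_slice (v := b₂)
    (((dd (hT₀ z hz)).fun_mul (dd (hw₁ z hz))).fun_sub ((dd (hw₀ z hz)).fun_mul (dd (hT₁ z hz))))
    ((dd (ck z hz)).fun_neg.fun_mul (dd (hT₁ z hz))) hb₂ hτ
    (by filter_upwards [hnear] with y hy hτy using slice1 y hy hτy)
  have s2 := fderiv_eq_of_eqOn_slice (v := b₁)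
    (((dd (hT₀ z hz)).fun_mul (dd (hw₂ z hz))).fun_sub ((dd (hw₀ z hz)).fun_mul (dd (hT₂ z hz))))
    ((dd (ck z hz)).fun_neg.fun_mul (dd (hT₂ z hz))) hb₁ hτ
    (by filter_upwards [hnear] with y hy hτy using slice2 y hy hτy)
  have kd : ∀ v, fderiv ℝ k z v = fderiv ℝ eF z v +
      (2 * α z * fderiv ℝ F z v + F z * (2 * fderiv ℝ α z v)) := fun v => by
    rw [hk, fderiv_add_apply' (dd (ceF z hz))
      (((dd (hα z hz)).const_mul 2).fun_mul (dd (cF z hz))),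
      fderiv_mul_apply' ((dd (hα z hz)).const_mul 2) (dd (cF z hz)),
      fderiv_const_mul (dd (hα z hz))]
    simp
  have negk : ∀ v, fderiv ℝ (fun y => -k y) z v = -fderiv ℝ k z v := fun v => by
    rw [fderiv_fun_neg]; simp
  rw [fderiv_mul_sub_mul_apply (dd (hT₀ z hz)) (dd (hw₁ z hz)) (dd (hw₀ z hz)) (dd (hT₁ z hz)),
    fderiv_mul_apply' (dd (ck z hz)).fun_neg (dd (hT₁ z hz)), negk] at s1
  rw [fderiv_mul_sub_mul_apply (dd (hT₀ z hz)) (dd (hw₂ z hz)) (dd (hw₀ z hz)) (dd (hT₂ z hz)),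
    fderiv_mul_apply' (dd (ck z hz)).fun_neg (dd (hT₂ z hz)), negk] at s2
  have ud : ∀ v, fderiv ℝ u z v = -F z * fderiv ℝ eF z v - eF z * fderiv ℝ F z v := fun v => by
    rw [hu', fderiv_mul_apply' (dd (cF z hz)).fun_neg (dd (ceF z hz)), fderiv_fun_neg]
    simp only [neg_apply]; ring
  rw [second, fderiv_mul_sub_mul_apply (dd (hT₁ z hz)) (dd (hw₂ z hz)) (dd (hT₂ z hz))
    (dd (hw₁ z hz)), fderiv_sub_apply' (dd ((cμ₂ z hz).fderiv_apply_const b₀))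
    ((dd (cu z hz)).fun_mul (dd (hT₂ z hz))), fderiv_add_apply'
    (dd ((cμ₁ z hz).fderiv_apply_const b₀)).fun_neg ((dd (cu z hz)).fun_mul (dd (hT₁ z hz))),
    fderiv_mul_apply' (dd (cu z hz)) (dd (hT₂ z hz)),
    fderiv_mul_apply' (dd (cu z hz)) (dd (hT₁ z hz)), fderiv_fun_neg, ud, ud, hu]
  simp only [neg_apply]
  have hX := w0 z hz hτ
  obtain ⟨-, g3⟩ := fα z hz b₁
  obtain ⟨g4, -⟩ := fα z hz b₂
  have t01 := dT₀₁ z hz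
  have t02 := dT₀₂ z hz
  have t12 := dT₁₂ z hz
  have f12 := df₁₂ z hz
  have he := slice_e₀ z hz hτ
  have h3 := aeF z hz
  have haz := ha z
  rw [kd] at s1 s2
  rw [g3, g4] at f12
  rw [hα₁ z hz, hα₂ z hz] at t12 f12 dw₁₂
  rw [he] at t01 t02 dw₀₁ dw₀₂
  -- The (b₁, b₂) component of de² with e² = αΘ inserted: it expresses ω in the remaining tangent
  -- direction through the torsion, e₁(α) and α².
  have hh : w₁ z * e₂ z - w₂ z * e₁ z =
      Ai z * a z + (T₁ z * fderiv ℝ α z b₂ - T₂ z * fderiv ℝ α z b₁) + 2 * α z ^ 2 * a z := by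
    linear_combination f12 - α z * t12 - (Ai z + 2 * α z ^ 2) * haz
  have hq : a z * ((T₁ z * fderiv ℝ α z b₂ - T₂ z * fderiv ℝ α z b₁) / a z) =
      T₁ z * fderiv ℝ α z b₂ - T₂ z * fderiv ℝ α z b₁ := by
    field_simp [ha0 z hz]
  have hFz := hF z
  have hkz : k z = eF z + 2 * α z * F z := rfl
  -- This is ∂₀(aH). The curvature equation trades ∂₀wᵢ for ∂ᵢw₀, which the differentiated slice
  -- identities supply. The unknown components `l₀`, `l₁`, `l₂` cancel because they enter wedged
  -- with Θ twice.
  have hD : T₁ z * fderiv ℝ w₂ z b₀ + w₂ z * fderiv ℝ T₁ z b₀ -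
      (T₂ z * fderiv ℝ w₁ z b₀ + w₁ z * fderiv ℝ T₂ z b₀) =
      T₁ z * (fderiv ℝ eF z b₂ + (2 * α z * fderiv ℝ F z b₂ + F z * (2 * fderiv ℝ α z b₂))) -
      T₂ z * (fderiv ℝ eF z b₁ + (2 * α z * fderiv ℝ F z b₁ + F z * (2 * fderiv ℝ α z b₁))) +
      2 * W * a z * F z + 2 * F z * (w₁ z * e₂ z - w₂ z * e₁ z) := by
    linear_combination s2 - s1 + T₁ z * dw₀₂ - T₂ z * dw₀₁ - T₀ z * dw₁₂ + w₂ z * t01 -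
      w₁ z * t02 + w₀ z * t12 - k z * t12 - 2 * α z * hX -
      (2 * W * F z + 2 * α z * k z) * haz - 2 * W * (T₁ z * e₂ z - T₂ z * e₁ z) * hFz -
      2 * (w₁ z * e₂ z - w₂ z * e₁ z) * hFz + 2 * α z * w₀ z * haz
  -- What remains is the product rule for d(F e₁(F) Θ), in which dΘ = 2 e¹∧e² accounts for the term
  -- 2αF e₁(F).
  rw [hD, hh]
  generalize (T₁ z * fderiv ℝ α z b₂ - T₂ z * fderiv ℝ α z b₁) / a z = q at *
  linear_combination (-F z) * eF z * t12 + (2 * α z * F z - eF z) * h3 + 4 * F z ^ 2 * hq -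
    2 * F z * eF z * α z * haz

end FlatVariation

/-! ### Pull-back of forms from the manifold to a normed space -/

section Pullback

variable {M : Type*} [TopologicalSpace M] [ChartedSpace (EuclideanSpace ℝ (Fin 3)) M]
variable {E : Type*} [NormedAddCommGroup E] [NormedSpace ℝ E]

/-- The pull-back of a 1-form on `M` under a map from a normed space. -/
def pullbackForm (F : E → M) (β : (q : M) → TangentSpace (𝓡 3) q →L[ℝ] ℝ) : E → E →L[ℝ] ℝ :=
  fun z => (β (F z)).comp (mfderiv 𝓘(ℝ, E) (𝓡 3) F z)

/-- Smoothness of a 1-form at a point. -/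
def SmoothFormAt (β : (q : M) → TangentSpace (𝓡 3) q →L[ℝ] ℝ) (q : M) : Prop :=
  ContDiffAt ℝ ∞ (oneFormInChart β q) (extChartAt (𝓡 3) q q)

theorem extDerivOneForm_apply (β : (q : M) → TangentSpace (𝓡 3) q →L[ℝ] ℝ) (q : M)
    (v w : TangentSpace (𝓡 3) q) : extDerivOneForm β q v w =
      flatD (oneFormInChart β q) (extChartAt (𝓡 3) q q)
        (mfderiv (𝓡 3) 𝓘(ℝ, EuclideanSpace ℝ (Fin 3)) (extChartAt (𝓡 3) q) q v)
        (mfderiv (𝓡 3) 𝓘(ℝ, EuclideanSpace ℝ (Fin 3)) (extChartAt (𝓡 3) q) q w) := rfl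

theorem extDerivOneForm_antisymm (β : (q : M) → TangentSpace (𝓡 3) q →L[ℝ] ℝ) (q : M)
    (v w : TangentSpace (𝓡 3) q) : extDerivOneForm β q v w = -extDerivOneForm β q w v := by
  rw [extDerivOneForm_apply, extDerivOneForm_apply]
  exact (neg_sub _ _).symm

variable [IsManifold (𝓡 3) ∞ M]

theorem mfderiv_chart_symm_chart {p q : M} (hq : q ∈ (extChartAt (𝓡 3) p).source) :
    (mfderiv 𝓘(ℝ, EuclideanSpace ℝ (Fin 3)) (𝓡 3) (extChartAt (𝓡 3) p).symm
      (extChartAt (𝓡 3) p q)).comp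
      (mfderiv (𝓡 3) 𝓘(ℝ, EuclideanSpace ℝ (Fin 3)) (extChartAt (𝓡 3) p) q) =
      ContinuousLinearMap.id ℝ (EuclideanSpace ℝ (Fin 3)) := by
  have := mfderivWithin_extChartAt_symm_comp_mfderiv_extChartAt' (I := 𝓡 3) hq
  rw [ModelWithCorners.range_eq_univ, mfderivWithin_univ] at this
  exact this

theorem oneFormInChart_comp {β : (q : M) → TangentSpace (𝓡 3) q →L[ℝ] ℝ} {p q : M}
    (hq : q ∈ (extChartAt (𝓡 3) p).source) (v : TangentSpace (𝓡 3) q) :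
    oneFormInChart β p (extChartAt (𝓡 3) p q)
      (mfderiv (𝓡 3) 𝓘(ℝ, EuclideanSpace ℝ (Fin 3)) (extChartAt (𝓡 3) p) q v) = β q v := by
  have h := congrArg (fun L : EuclideanSpace ℝ (Fin 3) →L[ℝ] EuclideanSpace ℝ (Fin 3) => L v)
    (mfderiv_chart_symm_chart hq)
  have h2 : ∀ q', q' = q → ∀ x : EuclideanSpace ℝ (Fin 3),
      (show EuclideanSpace ℝ (Fin 3) →L[ℝ] ℝ from β q') x =
      (show EuclideanSpace ℝ (Fin 3) →L[ℝ] ℝ from β q) x := by rintro q' rfl x; rfl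
  have h3 := h2 _ ((extChartAt (𝓡 3) p).left_inv hq)
    (mfderiv 𝓘(ℝ, EuclideanSpace ℝ (Fin 3)) (𝓡 3) (extChartAt (𝓡 3) p).symm
      (extChartAt (𝓡 3) p q)
      (mfderiv (𝓡 3) 𝓘(ℝ, EuclideanSpace ℝ (Fin 3)) (extChartAt (𝓡 3) p) q v))
  refine h3.trans ?_
  exact congrArg (show EuclideanSpace ℝ (Fin 3) →L[ℝ] ℝ from β q) h

theorem ContMDiffAt.eventually_mdifferentiableAt {H' : Type*} [TopologicalSpace H']
    {E' : Type*} [NormedAddCommGroup E'] [NormedSpace ℝ E'] {J : ModelWithCorners ℝ E' H'}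
    {N' : Type*} [TopologicalSpace N'] [ChartedSpace H' N'] [IsManifold J ∞ N'] {F : N' → M}
    {z : N'} (hF : ContMDiffAt J (𝓡 3) ∞ F z) :
    ∀ᶠ y in 𝓝 z, MDifferentiableAt J (𝓡 3) F y := by
  have h1 : ContMDiffAt J (𝓡 3) 1 F z := hF.of_le (by norm_cast)
  rw [contMDiffAt_iff_contMDiffAt_nhds (by simp)] at h1
  filter_upwards [h1] with y hy
  exact hy.mdifferentiableAt (by simp)

theorem extChartAt_comp_contDiffAt {F : E → M} {z : E} {p : M}
    (hF : ContMDiffAt 𝓘(ℝ, E) (𝓡 3) ∞ F z) (hz : F z ∈ (extChartAt (𝓡 3) p).source) :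
    ContDiffAt ℝ ∞ (fun y => extChartAt (𝓡 3) p (F y)) z := by
  rw [← contMDiffAt_iff_contDiffAt]
  exact (contMDiffAt_extChartAt' (by simpa using hz)).comp z hF

theorem fderiv_chart_comp {F : E → M} {z : E} {p : M}
    (hF : MDifferentiableAt 𝓘(ℝ, E) (𝓡 3) F z) (hz : F z ∈ (extChartAt (𝓡 3) p).source) (v : E) :
    fderiv ℝ (fun y => extChartAt (𝓡 3) p (F y)) z v =
      mfderiv (𝓡 3) 𝓘(ℝ, EuclideanSpace ℝ (Fin 3)) (extChartAt (𝓡 3) p) (F z)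
        (mfderiv 𝓘(ℝ, E) (𝓡 3) F z v) := by
  have h := mfderiv_comp z (mdifferentiableAt_extChartAt (I := 𝓡 3) (x := p)
    (by simpa using hz)) hF
  rw [mfderiv_eq_fderiv] at h
  exact congrArg (fun L : E →L[ℝ] EuclideanSpace ℝ (Fin 3) => L v) h

/-- The pull-back mentions no chart. Near one point it can be computed in a single fixed chart,
where it becomes an ordinary composition that can be differentiated. -/
theorem pullbackForm_eventuallyEq {F : E → M} {z : E} {p : M}
    (β : (q : M) → TangentSpace (𝓡 3) q →L[ℝ] ℝ)
    (hF : ContMDiffAt 𝓘(ℝ, E) (𝓡 3) ∞ F z) (hz : F z ∈ (extChartAt (𝓡 3) p).source) :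
    pullbackForm F β =ᶠ[𝓝 z] fun y => (oneFormInChart β p (extChartAt (𝓡 3) p (F y))).comp
      (fderiv ℝ (fun y => extChartAt (𝓡 3) p (F y)) y) := by
  filter_upwards [hF.eventually_mdifferentiableAt, hF.continuousAt.eventually_mem
    ((isOpen_extChartAt_source p).mem_nhds hz)] with y hy hy'
  ext v
  rw [ContinuousLinearMap.comp_apply, fderiv_chart_comp hy hy', oneFormInChart_comp hy']
  rfl

/-- The term with the second derivative of G is symmetric and drops out of the antisymmetrization.
-/
theorem flatD_comp {E' : Type*} [NormedAddCommGroup E'] [NormedSpace ℝ E'] {γ : E' → E' →L[ℝ] ℝ}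
    {G : E → E'} {z : E} (hγ : DifferentiableAt ℝ γ (G z)) (hG : ContDiffAt ℝ ∞ G z) (v w : E) :
    flatD (fun y => (γ (G y)).comp (fderiv ℝ G y)) z v w =
      flatD γ (G z) (fderiv ℝ G z v) (fderiv ℝ G z w) := by
  have hd : DifferentiableAt ℝ (fderiv ℝ G) z :=
    (hG.fderiv_right (m := 1) (by norm_cast)).differentiableAt (by simp)
  have hG1 : DifferentiableAt ℝ G z := hG.differentiableAt (by simp)
  have hsymm := (hG.isSymmSndFDerivAt (by simp; norm_cast)).eq v w
  have h1 : DifferentiableAt ℝ (fun y => γ (G y)) z := hγ.comp z hG1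
  have h2 : fderiv ℝ (fun y => γ (G y)) z = (fderiv ℝ γ (G z)).comp (fderiv ℝ G z) :=
    fderiv_comp z hγ hG1
  simp only [flatD, fderiv_clm_comp h1 hd, h2]
  simp [hsymm]

theorem contDiffAt_pullbackForm {F : E → M} {z : E}
    {β : (q : M) → TangentSpace (𝓡 3) q →L[ℝ] ℝ}
    (hF : ContMDiffAt 𝓘(ℝ, E) (𝓡 3) ∞ F z) (hβ : SmoothFormAt β (F z)) :
    ContDiffAt ℝ ∞ (pullbackForm F β) z := by
  have hz := mem_extChartAt_source (I := 𝓡 3) (F z)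
  refine ContDiffAt.congr_of_eventuallyEq ?_ (pullbackForm_eventuallyEq β hF hz)
  have h1 := extChartAt_comp_contDiffAt hF hz
  exact (ContDiffAt.comp (g := oneFormInChart β (F z))
    (f := fun y => extChartAt (𝓡 3) (F z) (F y)) z hβ h1).clm_comp (h1.fderiv_right (by simp))

/-- The exterior derivative commutes with pull-back. Applied to inverse charts, this also shows that
`extDerivOneForm`, which uses the preferred chart of each point separately, does not depend on the
chart. -/
theorem flatD_pullbackForm {F : E → M} {z : E}
    {β : (q : M) → TangentSpace (𝓡 3) q →L[ℝ] ℝ}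
    (hF : ContMDiffAt 𝓘(ℝ, E) (𝓡 3) ∞ F z) (hβ : SmoothFormAt β (F z)) (v w : E) :
    flatD (pullbackForm F β) z v w = extDerivOneForm β (F z) (mfderiv 𝓘(ℝ, E) (𝓡 3) F z v)
      (mfderiv 𝓘(ℝ, E) (𝓡 3) F z w) := by
  have hz := mem_extChartAt_source (I := 𝓡 3) (F z)
  have h1 := extChartAt_comp_contDiffAt hF hz
  rw [flatD_congr (pullbackForm_eventuallyEq β hF hz),
    flatD_comp (γ := oneFormInChart β (F z))
    (G := fun y => extChartAt (𝓡 3) (F z) (F y)) (hβ.differentiableAt (by simp)) h1,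
    extDerivOneForm_apply, fderiv_chart_comp (hF.mdifferentiableAt (by simp)) hz,
    fderiv_chart_comp (hF.mdifferentiableAt (by simp)) hz]

end Pullback

/-! ### Smoothness of vector fields and forms in charts -/

section VectorFields

/-- The trivialization of the tangent bundle at p is the derivative of the chart at p. Smoothness at
q can thus be tested in the chart of a different point p. -/
theorem contMDiffAt_tangent_section_iff {E : Type*} [NormedAddCommGroup E] [NormedSpace ℝ E]
    {H : Type*} [TopologicalSpace H] {I : ModelWithCorners ℝ E H} {N : Type*} [TopologicalSpace N]
    [ChartedSpace H N] [IsManifold I ∞ N] {X : (q : N) → TangentSpace I q} {p q : N}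
    (hq : q ∈ (extChartAt I p).source) :
    ContMDiffAt I I.tangent ∞ (fun r => (⟨r, X r⟩ : TangentBundle I N)) q ↔
      ContMDiffAt I 𝓘(ℝ, E) ∞ (fun r => (mfderiv I 𝓘(ℝ, E) (extChartAt I p) r (X r) : E)) q := by
  have : IsManifold I (∞ + 1) N := inferInstanceAs (IsManifold I ∞ N)
  have hb : q ∈ (trivializationAt E (TangentSpace I) p).baseSet := by simpa using hq
  refine (Trivialization.contMDiffAt_section_iff
    (trivializationAt E (TangentSpace I) p) hb).trans ?_
  have : (fun r => (trivializationAt E (TangentSpace I) p (⟨r, X r⟩ : TangentBundle I N)).2) =ᶠ[𝓝 q]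
      fun r => (mfderiv I 𝓘(ℝ, E) (extChartAt I p) r (X r) : E) := by
    filter_upwards [(isOpen_extChartAt_source p).mem_nhds hq] with r hr
    have hr' : r ∈ (chartAt H p).source := by simpa using hr
    have e2 : (trivializationAt E (TangentSpace I) p).continuousLinearMapAt ℝ r (X r) =
        (trivializationAt E (TangentSpace I) p (⟨r, X r⟩ : TangentBundle I N)).2 := by
      rw [Trivialization.continuousLinearMapAt_apply, Trivialization.linearMapAt_apply,
        if_pos (by simpa using hr)]
    exact e2.symm.trans (congrArg (fun L : TangentSpace I r →L[ℝ] E => L (X r))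
      (TangentBundle.continuousLinearMapAt_trivializationAt hr'))
  exact ⟨fun h => h.congr_of_eventuallyEq this.symm, fun h => h.congr_of_eventuallyEq this⟩

variable {M : Type*} [TopologicalSpace M] [ChartedSpace (EuclideanSpace ℝ (Fin 3)) M]

variable [IsManifold (𝓡 3) ∞ M]

/-- Smoothness of a vector field at a point. -/
def SmoothFieldAt (X : (q : M) → TangentSpace (𝓡 3) q) (q : M) : Prop :=
  ContMDiffAt (𝓡 3) (𝓡 3).tangent ∞ (fun r => (⟨r, X r⟩ : TangentBundle (𝓡 3) M)) q

/-- The coordinate representation of a vector field. -/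
def fieldInChart (X : (q : M) → TangentSpace (𝓡 3) q) (p : M) (y : EuclideanSpace ℝ (Fin 3)) :
    EuclideanSpace ℝ (Fin 3) :=
  mfderiv (𝓡 3) 𝓘(ℝ, EuclideanSpace ℝ (Fin 3)) (extChartAt (𝓡 3) p) ((extChartAt (𝓡 3) p).symm y)
    (X ((extChartAt (𝓡 3) p).symm y))

/-- A vector field with constant coordinates in the chart at `p`. -/
def coordField (p : M) (x : EuclideanSpace ℝ (Fin 3)) (q : M) : TangentSpace (𝓡 3) q :=
  (mfderiv 𝓘(ℝ, EuclideanSpace ℝ (Fin 3)) (𝓡 3) (extChartAt (𝓡 3) p).symm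
    (extChartAt (𝓡 3) p q) x : EuclideanSpace ℝ (Fin 3))

theorem contMDiffAt_chart_symm {p : M} {y : EuclideanSpace ℝ (Fin 3)}
    (hy : y ∈ (extChartAt (𝓡 3) p).target) :
    ContMDiffAt 𝓘(ℝ, EuclideanSpace ℝ (Fin 3)) (𝓡 3) ∞ (extChartAt (𝓡 3) p).symm y :=
  (contMDiffOn_extChartAt_symm p).contMDiffAt ((isOpen_extChartAt_target p).mem_nhds hy)

theorem mfderiv_chart_chart_symm {p q : M} (hq : q ∈ (extChartAt (𝓡 3) p).source) :
    (mfderiv (𝓡 3) 𝓘(ℝ, EuclideanSpace ℝ (Fin 3)) (extChartAt (𝓡 3) p) q).comp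
      (mfderiv 𝓘(ℝ, EuclideanSpace ℝ (Fin 3)) (𝓡 3) (extChartAt (𝓡 3) p).symm
      (extChartAt (𝓡 3) p q)) =
      ContinuousLinearMap.id ℝ (EuclideanSpace ℝ (Fin 3)) := by
  have := mfderiv_extChartAt_comp_mfderivWithin_extChartAt_symm' (I := 𝓡 3) hq
  rw [ModelWithCorners.range_eq_univ, mfderivWithin_univ] at this
  exact this

theorem mfderiv_chart_symm_fieldInChart (X : (q : M) → TangentSpace (𝓡 3) q) {p : M}
    {y : EuclideanSpace ℝ (Fin 3)} (hy : y ∈ (extChartAt (𝓡 3) p).target) :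
    mfderiv 𝓘(ℝ, EuclideanSpace ℝ (Fin 3)) (𝓡 3) (extChartAt (𝓡 3) p).symm y
      (fieldInChart X p y) = X ((extChartAt (𝓡 3) p).symm y) := by
  have := mfderivWithin_extChartAt_symm_comp_mfderiv_extChartAt (I := 𝓡 3) hy
  rw [ModelWithCorners.range_eq_univ, mfderivWithin_univ] at this
  exact congrArg (fun L : EuclideanSpace ℝ (Fin 3) →L[ℝ] EuclideanSpace ℝ (Fin 3) =>
    L (X ((extChartAt (𝓡 3) p).symm y))) this

theorem SmoothFieldAt.contDiffAt {X : (q : M) → TangentSpace (𝓡 3) q} {q : M}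
    (hX : SmoothFieldAt X q) : ContDiffAt ℝ ∞ (fieldInChart X q) (extChartAt (𝓡 3) q q) := by
  have h1 := (contMDiffAt_tangent_section_iff (mem_extChartAt_source (I := 𝓡 3) q)).1 hX
  rw [← contMDiffAt_iff_contDiffAt]
  refine ContMDiffAt.comp (extChartAt (𝓡 3) q q) (f := (extChartAt (𝓡 3) q).symm)
    (g := fun r => (mfderiv (𝓡 3) 𝓘(ℝ, EuclideanSpace ℝ (Fin 3)) (extChartAt (𝓡 3) q) r (X r) :
      EuclideanSpace ℝ (Fin 3))) ?_ (contMDiffAt_chart_symm (mem_extChartAt_target q))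
  rw [extChartAt_to_inv]
  exact h1

theorem smoothFieldAt_coordField {p q : M} (x : EuclideanSpace ℝ (Fin 3))
    (hq : q ∈ (extChartAt (𝓡 3) p).source) : SmoothFieldAt (coordField p x) q := by
  refine (contMDiffAt_tangent_section_iff hq).2 ?_
  have : (fun r => (mfderiv (𝓡 3) 𝓘(ℝ, EuclideanSpace ℝ (Fin 3)) (extChartAt (𝓡 3) p) r
      (coordField p x r) : EuclideanSpace ℝ (Fin 3))) =ᶠ[𝓝 q] fun _ => x := by
    filter_upwards [(isOpen_extChartAt_source p).mem_nhds hq] with r hr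
    exact congrArg (fun L : EuclideanSpace ℝ (Fin 3) →L[ℝ] EuclideanSpace ℝ (Fin 3) => L x)
      (mfderiv_chart_chart_symm hr)
  exact contMDiffAt_const.congr_of_eventuallyEq this

theorem coordField_self {p : M} (x : TangentSpace (𝓡 3) p) :
    coordField p (mfderiv (𝓡 3) 𝓘(ℝ, EuclideanSpace ℝ (Fin 3)) (extChartAt (𝓡 3) p) p x) p = x :=
  congrArg (fun L : EuclideanSpace ℝ (Fin 3) →L[ℝ] EuclideanSpace ℝ (Fin 3) => L x)
      (mfderiv_chart_symm_chart (mem_extChartAt_source p))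

theorem SmoothFieldAt.smul {c : M → ℝ} {X : (q : M) → TangentSpace (𝓡 3) q} {q : M}
    (hc : ContMDiffAt (𝓡 3) 𝓘(ℝ, ℝ) ∞ c q) (hX : SmoothFieldAt X q) :
    SmoothFieldAt (fun r => c r • X r) q :=
  ContMDiffAt.smul_section hc hX

theorem SmoothFieldAt.add {X Y : (q : M) → TangentSpace (𝓡 3) q} {q : M}
    (hX : SmoothFieldAt X q) (hY : SmoothFieldAt Y q) :
    SmoothFieldAt (fun r => X r + Y r) q :=
  ContMDiffAt.add_section hX hY

theorem SmoothFieldAt.sub {X Y : (q : M) → TangentSpace (𝓡 3) q} {q : M}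
    (hX : SmoothFieldAt X q) (hY : SmoothFieldAt Y q) :
    SmoothFieldAt (fun r => X r - Y r) q :=
  ContMDiffAt.sub_section hX hY

theorem PseudohermitianStructure.smoothFieldAt_J (P : PseudohermitianStructure M)
    {X : (q : M) → TangentSpace (𝓡 3) q} {q : M} (hX : SmoothFieldAt X q) :
    SmoothFieldAt (fun r => P.J r (X r)) q :=
  ContMDiffAt.clm_bundle_apply (F₁ := EuclideanSpace ℝ (Fin 3)) (F₂ := EuclideanSpace ℝ (Fin 3))
    (E₁ := fun p : M => TangentSpace (𝓡 3) p) (E₂ := fun p : M => TangentSpace (𝓡 3) p)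
    (b := fun r : M => r) (P.smooth_J q) hX

theorem PseudohermitianStructure.smoothFormAt_Θ (P : PseudohermitianStructure M) (q : M) :
    SmoothFormAt P.Θ q := by
  have h := (contMDiffAt_hom_bundle _).1 (P.smooth_Θ q)
  have h2 := h.2
  rw [SmoothFormAt, ← contMDiffAt_iff_contDiffAt]
  have h3 : ContMDiffAt 𝓘(ℝ, EuclideanSpace ℝ (Fin 3)) 𝓘(ℝ, EuclideanSpace ℝ (Fin 3) →L[ℝ] ℝ) ∞
    (fun y => ContinuousLinearMap.inCoordinates (EuclideanSpace ℝ (Fin 3)) (TangentSpace (𝓡 3)) ℝ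
      (Bundle.Trivial M ℝ) q ((extChartAt (𝓡 3) q).symm y) q ((extChartAt (𝓡 3) q).symm y)
      (P.Θ ((extChartAt (𝓡 3) q).symm y))) (extChartAt (𝓡 3) q q) := by
    refine ContMDiffAt.comp (extChartAt (𝓡 3) q q) (f := (extChartAt (𝓡 3) q).symm)
      (g := fun r => ContinuousLinearMap.inCoordinates (EuclideanSpace ℝ (Fin 3))
        (TangentSpace (𝓡 3)) ℝ (Bundle.Trivial M ℝ) q r q r (P.Θ r)) ?_
      (contMDiffAt_chart_symm (mem_extChartAt_target q))
    rw [extChartAt_to_inv]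
    exact h2
  refine h3.congr_of_eventuallyEq ?_
  filter_upwards [(isOpen_extChartAt_target q).mem_nhds (mem_extChartAt_target q)] with y hy
  have hy' : (extChartAt (𝓡 3) q).symm y ∈ (chartAt (EuclideanSpace ℝ (Fin 3)) q).source := by
    simpa using (extChartAt (𝓡 3) q).map_target hy
  rw [ContinuousLinearMap.inCoordinates, TangentBundle.symmL_trivializationAt hy',
    ModelWithCorners.range_eq_univ, mfderivWithin_univ, (extChartAt (𝓡 3) q).right_inv hy]
  ext v
  simp [oneFormInChart]

theorem contMDiffAt_comp_chart_symm {c : M → ℝ} {q : M} (hc : ContMDiffAt (𝓡 3) 𝓘(ℝ, ℝ) ∞ c q) :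
    ContDiffAt ℝ ∞ (fun y => c ((extChartAt (𝓡 3) q).symm y)) (extChartAt (𝓡 3) q q) := by
  rw [← contMDiffAt_iff_contDiffAt]
  refine ContMDiffAt.comp (extChartAt (𝓡 3) q q) (f := (extChartAt (𝓡 3) q).symm) (g := c) ?_
    (contMDiffAt_chart_symm (mem_extChartAt_target q))
  rwa [extChartAt_to_inv]

theorem SmoothFormAt.smul {c : M → ℝ} {β : (q : M) → TangentSpace (𝓡 3) q →L[ℝ] ℝ} {q : M}
    (hc : ContMDiffAt (𝓡 3) 𝓘(ℝ, ℝ) ∞ c q) (hβ : SmoothFormAt β q) :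
    SmoothFormAt (fun r => c r • β r) q :=
  ContDiffAt.smul (contMDiffAt_comp_chart_symm hc) hβ

theorem SmoothFormAt.add {β γ : (q : M) → TangentSpace (𝓡 3) q →L[ℝ] ℝ} {q : M}
    (hβ : SmoothFormAt β q) (hγ : SmoothFormAt γ q) : SmoothFormAt (fun r => β r + γ r) q :=
  ContDiffAt.add (f := oneFormInChart β q) (g := oneFormInChart γ q) hβ hγ

theorem SmoothFormAt.contMDiffAt_apply {β : (q : M) → TangentSpace (𝓡 3) q →L[ℝ] ℝ} {q : M}
    {X : (q : M) → TangentSpace (𝓡 3) q} (hβ : SmoothFormAt β q) (hX : SmoothFieldAt X q) :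
    ContMDiffAt (𝓡 3) 𝓘(ℝ, ℝ) ∞ (fun r => β r (X r)) q := by
  have h1 : ContDiffAt ℝ ∞ (fun y => oneFormInChart β q y (fieldInChart X q y))
      (extChartAt (𝓡 3) q q) := ContDiffAt.clm_apply (f := oneFormInChart β q) hβ hX.contDiffAt
  have h2 := ContMDiffAt.comp q (f := extChartAt (𝓡 3) q) h1.contMDiffAt contMDiffAt_extChartAt
  refine h2.congr_of_eventuallyEq ?_
  filter_upwards [extChartAt_source_mem_nhds (I := 𝓡 3) q] with r hr
  simp only [Function.comp]
  have h3 : ∀ r', r' = r → (mfderiv (𝓡 3) 𝓘(ℝ, EuclideanSpace ℝ (Fin 3)) (extChartAt (𝓡 3) q) r'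
    (X r') : EuclideanSpace ℝ (Fin 3)) =
    mfderiv (𝓡 3) 𝓘(ℝ, EuclideanSpace ℝ (Fin 3)) (extChartAt (𝓡 3) q) r (X r) := by
    rintro r' rfl; rfl
  rw [fieldInChart, h3 _ ((extChartAt (𝓡 3) q).left_inv hr)]
  exact (oneFormInChart_comp hr (X r)).symm

/-- In the chart at q the contraction is built from first derivatives of the coefficients of β. At
nearby points r the definition of dβ uses another chart, and the two agree by naturality under the
inverse chart. The smoothness of e¹, e² and of the connection form all comes from here. -/
theorem SmoothFormAt.extDeriv {β γ : (q : M) → TangentSpace (𝓡 3) q →L[ℝ] ℝ} {q : M}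
    {X : (q : M) → TangentSpace (𝓡 3) q} (hβ : ∀ᶠ r in 𝓝 q, SmoothFormAt β r)
    (hX : SmoothFieldAt X q)
    (hγ : ∀ᶠ r in 𝓝 q, ∀ v, γ r v = extDerivOneForm β r v (X r)) : SmoothFormAt γ q := by
  have hd : ContDiffAt ℝ ∞ (fderiv ℝ (oneFormInChart β q)) (extChartAt (𝓡 3) q q) :=
    ContDiffAt.fderiv_right (f := oneFormInChart β q) hβ.self_of_nhds (by simp)
  have hX' := hX.contDiffAt
  have h1 : ContDiffAt ℝ ∞ (fun y => (ContinuousLinearMap.apply ℝ ℝ (fieldInChart X q y)).comp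
      (fderiv ℝ (oneFormInChart β q) y) - fderiv ℝ (oneFormInChart β q) y (fieldInChart X q y))
      (extChartAt (𝓡 3) q q) := by
    refine ContDiffAt.sub ?_ (hd.clm_apply hX')
    refine ContDiffAt.clm_comp ?_ hd
    exact ContDiffAt.comp (g := (ContinuousLinearMap.apply ℝ ℝ : EuclideanSpace ℝ (Fin 3) →L[ℝ]
      (EuclideanSpace ℝ (Fin 3) →L[ℝ] ℝ) →L[ℝ] ℝ)) _ (ContinuousLinearMap.contDiff _).contDiffAt hX'
  refine ContDiffAt.congr_of_eventuallyEq h1 ?_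
  have hc := (continuousAt_extChartAt_symm (I := 𝓡 3) q)
  rw [ContinuousAt, extChartAt_to_inv] at hc
  filter_upwards [hc.eventually hβ, hc.eventually hγ,
    (isOpen_extChartAt_target q).mem_nhds (mem_extChartAt_target q)] with y h1 h2 hy
  ext v
  have h3 := flatD_pullbackForm (contMDiffAt_chart_symm hy) h1 v (fieldInChart X q y)
  rw [mfderiv_chart_symm_fieldInChart X hy, ← h2] at h3
  exact h3.symm

end VectorFields

/-! ### Pointwise algebra: Reeb vector, dual coframe, p-area density -/

section LinearAlgebra

/-- The kernel of θ is two-dimensional, and an alternating form that does not vanish on (x, y)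
forces x and y to be independent. -/
theorem exists_ker_decomposition {V : Type*} [AddCommGroup V] [Module ℝ V] [FiniteDimensional ℝ V]
    (hV : Module.finrank ℝ V = 3) {θ : V →ₗ[ℝ] ℝ} (hθ : θ ≠ 0) {B : V →ₗ[ℝ] V →ₗ[ℝ] ℝ}
    (hB : ∀ v w, B v w = -B w v) {x y : V} (hx : θ x = 0) (hy : θ y = 0) (hxy : B x y ≠ 0) {v : V}
    (hv : θ v = 0) : ∃ a b : ℝ, v = a • x + b • y := by
  have hr : Module.finrank ℝ (LinearMap.range θ) = 1 := by
    rw [LinearMap.range_eq_top.2 (LinearMap.surjective hθ)]; simp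
  have hk : Module.finrank ℝ (LinearMap.ker θ) = 2 := by
    have := LinearMap.finrank_range_add_finrank_ker θ
    omega
  have hself : ∀ u, B u u = 0 := fun u => by linarith [hB u u]
  let x' : LinearMap.ker θ := ⟨x, hx⟩
  let y' : LinearMap.ker θ := ⟨y, hy⟩
  have hli : LinearIndependent ℝ ![x', y'] := by
    rw [LinearIndependent.pair_iff]
    intro s t hst
    have h1 : s • x + t • y = 0 := congrArg Subtype.val hst
    have h2 : s * B x y = 0 := by
      have := congrArg (fun u => B u y) h1
      simpa [hself] using this
    have h3 : t * B x y = 0 := by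
      have := congrArg (fun u => B x u) h1
      simpa [hself] using this
    exact ⟨(mul_eq_zero.1 h2).resolve_right hxy, (mul_eq_zero.1 h3).resolve_right hxy⟩
  let b := basisOfLinearIndependentOfCardEqFinrank hli (by simp [hk])
  have h1 := b.sum_repr ⟨v, hv⟩
  rw [Fin.sum_univ_two] at h1
  simp only [b, coe_basisOfLinearIndependentOfCardEqFinrank] at h1
  exact ⟨_, _, (congrArg Subtype.val h1).symm⟩

end LinearAlgebra

namespace PseudohermitianStructure

variable {M : Type*} [TopologicalSpace M] [ChartedSpace (EuclideanSpace ℝ (Fin 3)) M]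
  [IsManifold (𝓡 3) ∞ M] (P : PseudohermitianStructure M)

theorem exists_decomposition {p : M} {x y v : TangentSpace (𝓡 3) p} (hx : P.Θ p x = 0)
    (hy : P.Θ p y = 0) (hxy : extDerivOneForm P.Θ p x y ≠ 0) (hv : P.Θ p v = 0) :
    ∃ a b : ℝ, v = a • x + b • y := by
  let θ : EuclideanSpace ℝ (Fin 3) →L[ℝ] ℝ := P.Θ p
  let B : EuclideanSpace ℝ (Fin 3) →L[ℝ] EuclideanSpace ℝ (Fin 3) →L[ℝ] ℝ :=
    extDerivOneForm P.Θ p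
  have hθ : (θ : EuclideanSpace ℝ (Fin 3) →ₗ[ℝ] ℝ) ≠ 0 := by
    intro h
    apply P.Θ_ne_zero p
    ext w
    exact congrArg (fun L : EuclideanSpace ℝ (Fin 3) →ₗ[ℝ] ℝ => L w) h
  exact exists_ker_decomposition (V := EuclideanSpace ℝ (Fin 3)) (by simp) hθ
    (B := LinearMap.mk₂ ℝ (fun v w => B v w) (by simp) (by simp) (by simp) (by simp))
    (fun v w => extDerivOneForm_antisymm P.Θ p v w) hx hy hxy hv

theorem dΘ_self (p : M) (v : TangentSpace (𝓡 3) p) : extDerivOneForm P.Θ p v v = 0 := by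
  have := extDerivOneForm_antisymm P.Θ p v v
  linarith

theorem exists_Θ_eq_one (p : M) : ∃ v, P.Θ p v = 1 := by
  obtain ⟨v, hv⟩ : ∃ v, P.Θ p v ≠ 0 := by
    by_contra! h
    exact P.Θ_ne_zero p (ContinuousLinearMap.ext h)
  exact ⟨(P.Θ p v)⁻¹ • v, by simp [hv]⟩

theorem exists_horizontal_ne_zero (p : M) : ∃ x, P.Θ p x = 0 ∧ x ≠ 0 := by
  by_contra! h
  let θ : EuclideanSpace ℝ (Fin 3) →L[ℝ] ℝ := P.Θ p
  have hinj : Function.Injective (θ : EuclideanSpace ℝ (Fin 3) →ₗ[ℝ] ℝ) := by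
    rw [injective_iff_map_eq_zero]
    exact fun a ha => h a ha
  have := LinearMap.finrank_le_finrank_of_injective hinj
  simp at this

theorem exists_unit (p : M) : ∃ x, P.Θ p x = 0 ∧ P.levi p x x = 1 := by
  obtain ⟨x, hx, hx0⟩ := P.exists_horizontal_ne_zero p
  have hpos := P.pos p x hx hx0
  set s := extDerivOneForm P.Θ p x (P.J p x) with hs
  refine ⟨(√(s / 2))⁻¹ • x, by simp [hx], ?_⟩
  have h1 : √(s / 2) ≠ 0 := by positivity
  have h2 : √(s / 2) ^ 2 = s / 2 := Real.sq_sqrt (by positivity)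
  simp only [levi, map_smul, ContinuousLinearMap.smul_apply, smul_eq_mul, ← hs]
  field_simp
  linarith

/-- Start from any vector with Θ = 1 and correct it by horizontal vectors, on which dΘ is
nondegenerate. It is enough to annihilate x and Jx, since T itself is annihilated automatically. -/
theorem exists_reeb (p : M) : ∃ T, P.Θ p T = 1 ∧ ∀ w, extDerivOneForm P.Θ p T w = 0 := by
  obtain ⟨v, hv⟩ := P.exists_Θ_eq_one p
  obtain ⟨x, hx, hx0⟩ := P.exists_horizontal_ne_zero p
  have hpos := P.pos p x hx hx0
  have hJx := P.J_mem p x hx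
  set B := extDerivOneForm P.Θ p with hB
  have hanti : ∀ a b, B a b = -B b a := extDerivOneForm_antisymm P.Θ p
  have hself : ∀ a, B a a = 0 := P.dΘ_self p
  set y := P.J p x
  set s := B x y with hs
  -- The coefficients solve dΘ(T, x) = dΘ(T, y) = 0, using dΘ(x, y) = s.
  let T := v - (B v y / s) • x + (B v x / s) • y
  have hT : P.Θ p T = 1 := by simp [T, hv, hx, hJx]
  have hTx : B T x = 0 := by
    simp only [T, map_sub, map_add, map_smul, sub_apply, add_apply, smul_apply, hself, hanti y x,
      ← hs, smul_eq_mul]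
    field_simp
    ring
  have hTy : B T y = 0 := by
    simp only [T, map_sub, map_add, map_smul, sub_apply, add_apply, smul_apply, hself,
      ← hs, smul_eq_mul]
    field_simp
    ring
  refine ⟨T, hT, fun w => ?_⟩
  obtain ⟨a, b, hab⟩ := P.exists_decomposition hx hJx hpos.ne' (v := w - P.Θ p w • T)
    (by simp [hT])
  have : w = a • x + b • y + P.Θ p w • T := by rw [← hab]; simp
  rw [this]
  simp [hTx, hTy, hself]

theorem Θ_reeb (p : M) : P.Θ p (P.reeb p) = 1 := (Classical.epsilon_spec (P.exists_reeb p)).1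

theorem dΘ_reeb (p : M) (w : TangentSpace (𝓡 3) p) : extDerivOneForm P.Θ p (P.reeb p) w = 0 :=
  (Classical.epsilon_spec (P.exists_reeb p)).2 w

theorem dualForm_apply (p : M) (x v : TangentSpace (𝓡 3) p) :
    P.dualForm p x v = 1 / 2 * extDerivOneForm P.Θ p v (P.J p x) := by
  have h : P.dualForm p x v =
    1 / 2 * extDerivOneForm P.Θ p (v - P.Θ p v • P.reeb p) (P.J p x) := rfl
  rw [h, map_sub, map_smul, sub_apply, smul_apply, P.dΘ_reeb]
  simp

theorem dualForm_J_apply {p : M} {x : TangentSpace (𝓡 3) p} (hx : P.Θ p x = 0)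
    (v : TangentSpace (𝓡 3) p) :
    P.dualForm p (P.J p x) v = -(1 / 2 * extDerivOneForm P.Θ p v x) := by
  rw [dualForm_apply, P.J_sq p x hx, map_neg]; ring

/-- `x` is a unit vector of the contact plane at `p`. -/
def IsUnit (p : M) (x : TangentSpace (𝓡 3) p) : Prop := P.Θ p x = 0 ∧ P.levi p x x = 1

variable {P} {p : M} {x : TangentSpace (𝓡 3) p}

theorem IsUnit.dΘ (hx : P.IsUnit p x) : extDerivOneForm P.Θ p x (P.J p x) = 2 := by
  have := hx.2
  rw [levi] at this
  linarith

theorem IsUnit.J (hx : P.IsUnit p x) : P.IsUnit p (P.J p x) := by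
  refine ⟨P.J_mem p x hx.1, ?_⟩
  rw [levi, P.J_sq p x hx.1, map_neg, extDerivOneForm_antisymm, hx.dΘ]
  norm_num

theorem IsUnit.dualForm_self (hx : P.IsUnit p x) : P.dualForm p x x = 1 := by
  rw [dualForm_apply, hx.dΘ]; norm_num

theorem IsUnit.dualForm_J_self (hx : P.IsUnit p x) : P.dualForm p (P.J p x) x = 0 := by
  rw [dualForm_J_apply P hx.1, dΘ_self]; norm_num

theorem IsUnit.dualForm_self_J (hx : P.IsUnit p x) : P.dualForm p x (P.J p x) = 0 := by
  rw [dualForm_apply, dΘ_self]; norm_num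

theorem dualForm_reeb (y : TangentSpace (𝓡 3) p) : P.dualForm p y (P.reeb p) = 0 := by
  rw [dualForm_apply, dΘ_reeb]; norm_num

theorem IsUnit.decomposition (hx : P.IsUnit p x) (v : TangentSpace (𝓡 3) p) :
    v = P.dualForm p x v • x + P.dualForm p (P.J p x) v • P.J p x + P.Θ p v • P.reeb p := by
  have h2 := hx.J
  obtain ⟨a, b, hab⟩ := P.exists_decomposition hx.1 h2.1 (by rw [hx.dΘ]; norm_num)
    (v := v - P.Θ p v • P.reeb p) (by simp [P.Θ_reeb])
  have hv : v = a • x + b • P.J p x + P.Θ p v • P.reeb p := by rw [← hab]; simp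
  have ha : P.dualForm p x v = a := by
    rw [hv]; simp [hx.dualForm_self, hx.dualForm_self_J, dualForm_reeb]
  have hb : P.dualForm p (P.J p x) v = b := by
    rw [hv]; simp [hx.dualForm_J_self, h2.dualForm_self, dualForm_reeb]
  rw [ha, hb]
  exact hv

/-- Expansion in the basis x, Jx, T, with the part containing Θ left unexpanded. This is the form
needed for dω, whose e¹∧e² coefficient is the curvature while the rest is irrelevant. -/
theorem IsUnit.alternating_apply (hx : P.IsUnit p x)
    {B : TangentSpace (𝓡 3) p →L[ℝ] TangentSpace (𝓡 3) p →L[ℝ] ℝ} (hB : ∀ v w, B v w = -B w v)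
    (v w : TangentSpace (𝓡 3) p) :
    B v w = B x (P.J p x) * (P.dualForm p x v * P.dualForm p (P.J p x) w -
      P.dualForm p x w * P.dualForm p (P.J p x) v) +
      (P.Θ p v * B (P.reeb p) w - P.Θ p w * B (P.reeb p) v) := by
  have hself : ∀ a, B a a = 0 := fun a => by linarith [hB a a]
  have hv := hx.decomposition v
  have hw := hx.decomposition w
  set a := P.dualForm p x v
  set b := P.dualForm p (P.J p x) v
  set c := P.Θ p v
  set a' := P.dualForm p x w
  set b' := P.dualForm p (P.J p x) w
  set c' := P.Θ p w
  rw [hv, hw]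
  simp only [map_add, map_smul, add_apply, smul_apply, smul_eq_mul, hself, hB (P.J p x) x,
    hB _ (P.reeb p)]
  ring

theorem IsUnit.dΘ_apply (hx : P.IsUnit p x) (v w : TangentSpace (𝓡 3) p) :
    extDerivOneForm P.Θ p v w = 2 * (P.dualForm p x v * P.dualForm p (P.J p x) w -
      P.dualForm p x w * P.dualForm p (P.J p x) v) := by
  rw [hx.alternating_apply (extDerivOneForm_antisymm P.Θ p) v w, hx.dΘ, dΘ_reeb, dΘ_reeb]
  ring

theorem IsUnit.dualForm_eq (hx : P.IsUnit p x) {z : TangentSpace (𝓡 3) p} (hz : P.Θ p z = 0)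
    (v : TangentSpace (𝓡 3) p) :
    P.dualForm p z v = P.dualForm p x z * P.dualForm p x v +
      P.dualForm p (P.J p x) z * P.dualForm p (P.J p x) v := by
  have hd := hx.decomposition z
  rw [hz, zero_smul, add_zero] at hd
  set a := P.dualForm p x z
  set b := P.dualForm p (P.J p x) z
  have hJ : P.J p z = a • P.J p x - b • x := by
    rw [hd, map_add, map_smul, map_smul, P.J_sq p x hx.1, smul_neg, sub_eq_add_neg]
  rw [dualForm_apply, hJ, dualForm_apply, dualForm_J_apply P hx.1, map_sub, map_smul, map_smul]
  simp only [smul_eq_mul]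
  ring

theorem IsUnit.alternating_apply' (hx : P.IsUnit p x)
    {B : TangentSpace (𝓡 3) p →L[ℝ] TangentSpace (𝓡 3) p →L[ℝ] ℝ} (hB : ∀ v w, B v w = -B w v)
    (v w : TangentSpace (𝓡 3) p) :
    B v w = B x (P.J p x) * (P.dualForm p x v * P.dualForm p (P.J p x) w -
      P.dualForm p x w * P.dualForm p (P.J p x) v) +
      B (P.reeb p) x * (P.Θ p v * P.dualForm p x w - P.Θ p w * P.dualForm p x v) +
      B (P.reeb p) (P.J p x) * (P.Θ p v * P.dualForm p (P.J p x) w -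
        P.Θ p w * P.dualForm p (P.J p x) v) := by
  have hself : B (P.reeb p) (P.reeb p) = 0 := by linarith [hB (P.reeb p) (P.reeb p)]
  have key : ∀ u, B (P.reeb p) u = P.dualForm p x u * B (P.reeb p) x +
      P.dualForm p (P.J p x) u * B (P.reeb p) (P.J p x) := fun u => by
    conv_lhs => rw [hx.decomposition u]
    simp [hself]
  rw [hx.alternating_apply hB v w, key v, key w]
  ring

theorem levi_eq_dualForm {z : TangentSpace (𝓡 3) p} (w : TangentSpace (𝓡 3) p) :
    P.levi p w z = P.dualForm p z w := by
  rw [dualForm_apply, levi]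

/-- The horizontal vector z = Θ(v)w − Θ(w)v has the coordinates (Θ∧e¹)(v, w) and (Θ∧e²)(v, w) in any
unitary frame, and the density is its Levi length. Unlike the definition, this expression uses a
fixed frame and is visibly smooth where it is positive. -/
theorem IsUnit.areaDensity_eq (hx : P.IsUnit p x) (v w : TangentSpace (𝓡 3) p) :
    P.areaDensity p v w =
      √((P.Θ p v * P.dualForm p x w - P.Θ p w * P.dualForm p x v) ^ 2 +
        (P.Θ p v * P.dualForm p (P.J p x) w - P.Θ p w * P.dualForm p (P.J p x) v) ^ 2) := by
  set z := P.Θ p v • w - P.Θ p w • v with hz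
  have hz0 : P.Θ p z = 0 := by simp [hz]; ring
  have he : P.dualForm p x z = P.Θ p v * P.dualForm p x w - P.Θ p w * P.dualForm p x v := by
    simp [hz]
  have hf : P.dualForm p (P.J p x) z =
      P.Θ p v * P.dualForm p (P.J p x) w - P.Θ p w * P.dualForm p (P.J p x) v := by
    simp [hz]
  have hl : P.levi p z z = P.dualForm p x z ^ 2 + P.dualForm p (P.J p x) z ^ 2 := by
    rw [levi_eq_dualForm, hx.dualForm_eq hz0]; ring
  have hdef : P.areaDensity p v w = |P.Θ p v * P.dualForm p ((√(P.levi p z z))⁻¹ • z) w -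
    P.Θ p w * P.dualForm p ((√(P.levi p z z))⁻¹ • z) v| := rfl
  set r := √(P.levi p z z) with hr
  have hrz : P.Θ p (r⁻¹ • z) = 0 := by simp [hz0]
  rw [hdef, hx.dualForm_eq hrz, hx.dualForm_eq hrz, ← he, ← hf, ← hl, ← hr]
  have h0 : 0 ≤ P.levi p z z := by rw [hl]; positivity
  have hrr : r * r = P.levi p z z := Real.mul_self_sqrt h0
  simp only [map_smul, smul_eq_mul]
  have : P.Θ p v * (r⁻¹ * P.dualForm p x z * P.dualForm p x w +
      r⁻¹ * P.dualForm p (P.J p x) z * P.dualForm p (P.J p x) w) -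
      P.Θ p w * (r⁻¹ * P.dualForm p x z * P.dualForm p x v +
      r⁻¹ * P.dualForm p (P.J p x) z * P.dualForm p (P.J p x) v) = r := by
    have : P.Θ p v * (r⁻¹ * P.dualForm p x z * P.dualForm p x w +
      r⁻¹ * P.dualForm p (P.J p x) z * P.dualForm p (P.J p x) w) -
      P.Θ p w * (r⁻¹ * P.dualForm p x z * P.dualForm p x v +
      r⁻¹ * P.dualForm p (P.J p x) z * P.dualForm p (P.J p x) v) = r⁻¹ * (r * r) := by
      rw [hrr, hl, he, hf]; ring
    rw [this]
    -- If z = 0, the convention 0⁻¹ = 0 makes the density zero, in agreement with the value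
    -- prescribed at singular points.
    by_cases h : r = 0
    · simp [h]
    · field_simp
  rw [this, abs_of_nonneg (Real.sqrt_nonneg _)]

variable (P) in
-- Both entries under the square root are squares of alternating bilinear functions of (v, w), so
-- each is multiplied by the squared determinant.
theorem areaDensity_linear_comb (v w : TangentSpace (𝓡 3) p) (a b c d : ℝ) :
    P.areaDensity p (a • v + b • w) (c • v + d • w) = |a * d - b * c| * P.areaDensity p v w := by
  obtain ⟨x, hx⟩ := P.exists_unit p
  have hx : P.IsUnit p x := hx
  rw [hx.areaDensity_eq, hx.areaDensity_eq, ← Real.sqrt_sq_eq_abs, ← Real.sqrt_mul (sq_nonneg _)]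
  congr 1
  simp only [map_add, map_smul, smul_eq_mul]
  ring

end PseudohermitianStructure

/-! ### The identity d(dΘ) = 0 and uniqueness of the connection form -/

section FlatForms

variable {E : Type*} [NormedAddCommGroup E] [NormedSpace ℝ E]

theorem fderiv_clm_apply_const {F G : Type*} [NormedAddCommGroup F] [NormedSpace ℝ F]
    [NormedAddCommGroup G] [NormedSpace ℝ G] {β : E → F →L[ℝ] G} {z : E}
    (h : DifferentiableAt ℝ β z) (a : F) (c : E) :
    fderiv ℝ (fun y => β y a) z c = fderiv ℝ β z c a := by
  rw [fderiv_clm_apply h (differentiableAt_const a)]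
  simp

/-- The identity `d(dΘ) = 0` for `dΘ = 2 e ∧ f`. -/
theorem cyclic_sum_eq_zero {Θ e f : E → E →L[ℝ] ℝ} {z : E} (hΘ : ContDiffAt ℝ ∞ Θ z)
    (he : DifferentiableAt ℝ e z) (hf : DifferentiableAt ℝ f z)
    (h : ∀ᶠ y in 𝓝 z, ∀ v w, flatD Θ y v w = 2 * (e y v * f y w - e y w * f y v)) (u v w : E) :
    (flatD e z u v * f z w - flatD f z u v * e z w) +
      (flatD e z v w * f z u - flatD f z v w * e z u) +
      (flatD e z w u * f z v - flatD f z w u * e z v) = 0 := by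
  have h2 : DifferentiableAt ℝ (fderiv ℝ Θ) z :=
    (hΘ.fderiv_right (m := 1) (by norm_cast)).differentiableAt (by simp)
  have hsymm : ∀ a b, fderiv ℝ (fderiv ℝ Θ) z a b = fderiv ℝ (fderiv ℝ Θ) z b a := fun a b =>
    (hΘ.isSymmSndFDerivAt (by simp; norm_cast)).eq a b
  -- The hypothesis on dΘ(a, b), differentiated in the direction c. In the cyclic sum the second
  -- derivatives of Θ cancel by symmetry.
  have key : ∀ a b c, fderiv ℝ (fderiv ℝ Θ) z c a b - fderiv ℝ (fderiv ℝ Θ) z c b a =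
      2 * (fderiv ℝ e z c a * f z b + e z a * fderiv ℝ f z c b -
        fderiv ℝ e z c b * f z a - e z b * fderiv ℝ f z c a) := by
    intro a b c
    have h3 : (fun y => fderiv ℝ Θ y a b - fderiv ℝ Θ y b a) =ᶠ[𝓝 z]
        fun y => 2 * (e y a * f y b - e y b * f y a) := by
      filter_upwards [h] with y hy using hy a b
    have h4 := congrArg (fun L : E →L[ℝ] ℝ => L c) h3.fderiv_eq
    have d0 : ∀ a, DifferentiableAt ℝ (fun y => fderiv ℝ Θ y a) z := fun a =>
      h2.clm_apply (differentiableAt_const a)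
    have d1 : ∀ a b, DifferentiableAt ℝ (fun y => fderiv ℝ Θ y a b) z := fun a b =>
      (d0 a).clm_apply (differentiableAt_const b)
    have d2 : ∀ a b, fderiv ℝ (fun y => fderiv ℝ Θ y a b) z c = fderiv ℝ (fderiv ℝ Θ) z c a b :=
      fun a b => by rw [fderiv_clm_apply_const (d0 a), fderiv_clm_apply_const h2]
    have de : ∀ a, DifferentiableAt ℝ (fun y => e y a) z := fun a =>
      he.clm_apply (differentiableAt_const a)
    have df : ∀ a, DifferentiableAt ℝ (fun y => f y a) z := fun a =>
      hf.clm_apply (differentiableAt_const a)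
    rw [fderiv_fun_sub (d1 a b) (d1 b a), fderiv_const_mul (((de a).fun_mul (df b)).fun_sub
      ((de b).fun_mul (df a))), fderiv_fun_sub ((de a).fun_mul (df b)) ((de b).fun_mul (df a)),
      fderiv_fun_mul (de a) (df b), fderiv_fun_mul (de b) (df a)] at h4
    simp only [add_apply, sub_apply, smul_apply, smul_eq_mul, d2, fderiv_clm_apply_const he,
      fderiv_clm_apply_const hf] at h4
    linarith
  simp only [flatD]
  have k1 := key u v w
  have k2 := key v w u
  have k3 := key w u v
  rw [hsymm w u, hsymm w v] at k1
  rw [hsymm u v] at k2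
  linarith

/-- On the dual basis X, Y, T five components of de and df isolate the three values of w and the two
torsion coefficients. -/
theorem StructureEqs.unique {Θ e f w w' : E → E →L[ℝ] ℝ} {Ar Ai Ar' Ai' : ℝ} {z : E}
    (h : StructureEqs Θ e f w Ar Ai z) (h' : StructureEqs Θ e f w' Ar' Ai' z) {X Y T : E}
    (hX : Θ z X = 0 ∧ e z X = 1 ∧ f z X = 0) (hY : Θ z Y = 0 ∧ e z Y = 0 ∧ f z Y = 1)
    (hT : Θ z T = 1 ∧ e z T = 0 ∧ f z T = 0) (hs : ∀ v, v = e z v • X + f z v • Y + Θ z v • T) :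
    w z = w' z ∧ Ar = Ar' ∧ Ai = Ai' := by
  have e1 := (h.de X Y).symm.trans (h'.de X Y)
  have e2 := (h.df X Y).symm.trans (h'.df X Y)
  have e3 := (h.de T X).symm.trans (h'.de T X)
  have e4 := (h.de T Y).symm.trans (h'.de T Y)
  have e5 := (h.df T X).symm.trans (h'.df T X)
  simp only [hX, hY, hT] at e1 e2 e3 e4 e5
  have wX : w z X = w' z X := by linarith
  have wY : w z Y = w' z Y := by linarith
  have wT : w z T = w' z T := by linarith
  refine ⟨?_, by linarith, by linarith⟩
  ext v
  rw [hs v]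
  simp [wX, wY, wT]

end FlatForms

section ManifoldForms

variable {M : Type*} [TopologicalSpace M] [ChartedSpace (EuclideanSpace ℝ (Fin 3)) M]

/-- The 1-form `v ↦ dβ(v, X)`. -/
def extDerivContract (β : (q : M) → TangentSpace (𝓡 3) q →L[ℝ] ℝ)
    (X : (q : M) → TangentSpace (𝓡 3) q) (q : M) : TangentSpace (𝓡 3) q →L[ℝ] ℝ :=
  let B : EuclideanSpace ℝ (Fin 3) →L[ℝ] EuclideanSpace ℝ (Fin 3) →L[ℝ] ℝ := extDerivOneForm β q
  B.flip (X q)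

theorem extDerivOneForm_congr {β γ : (q : M) → TangentSpace (𝓡 3) q →L[ℝ] ℝ} {q : M}
    (h : ∀ᶠ r in 𝓝 q, β r = γ r) : extDerivOneForm β q = extDerivOneForm γ q := by
  ext v w
  rw [extDerivOneForm_apply, extDerivOneForm_apply]
  refine flatD_congr ?_ _ _
  have hc := (continuousAt_extChartAt_symm (I := 𝓡 3) q)
  rw [ContinuousAt, extChartAt_to_inv] at hc
  filter_upwards [hc.eventually h] with y hy
  simp only [oneFormInChart, hy]

variable [IsManifold (𝓡 3) ∞ M]

theorem contMDiffAt_extDerivOneForm {β : (q : M) → TangentSpace (𝓡 3) q →L[ℝ] ℝ} {q : M}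
    {X Y : (q : M) → TangentSpace (𝓡 3) q} (hβ : ∀ᶠ r in 𝓝 q, SmoothFormAt β r)
    (hX : SmoothFieldAt X q) (hY : SmoothFieldAt Y q) :
    ContMDiffAt (𝓡 3) 𝓘(ℝ, ℝ) ∞ (fun r => extDerivOneForm β r (X r) (Y r)) q :=
  (SmoothFormAt.extDeriv (γ := extDerivContract β Y) hβ hY
    (Eventually.of_forall fun _ _ => rfl)).contMDiffAt_apply hX

theorem extDerivOneForm_cyclic {Θ e f : (q : M) → TangentSpace (𝓡 3) q →L[ℝ] ℝ} {q : M}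
    (hΘ : ∀ᶠ r in 𝓝 q, SmoothFormAt Θ r) (he : SmoothFormAt e q) (hf : SmoothFormAt f q)
    (h : ∀ᶠ r in 𝓝 q, ∀ v w, extDerivOneForm Θ r v w = 2 * (e r v * f r w - e r w * f r v))
    (u v w : TangentSpace (𝓡 3) q) :
    (extDerivOneForm e q u v * f q w - extDerivOneForm f q u v * e q w) +
      (extDerivOneForm e q v w * f q u - extDerivOneForm f q v w * e q u) +
      (extDerivOneForm e q w u * f q v - extDerivOneForm f q w u * e q v) = 0 := by
  have hq := mem_extChartAt_source (I := 𝓡 3) q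
  have hc := (continuousAt_extChartAt_symm (I := 𝓡 3) q)
  rw [ContinuousAt, extChartAt_to_inv] at hc
  have key := cyclic_sum_eq_zero (Θ := oneFormInChart Θ q) (e := oneFormInChart e q)
    (f := oneFormInChart f q) (z := extChartAt (𝓡 3) q q) hΘ.self_of_nhds
    (ContDiffAt.differentiableAt he (by simp)) (ContDiffAt.differentiableAt hf (by simp)) (by
      filter_upwards [hc.eventually hΘ, hc.eventually h,
        (isOpen_extChartAt_target q).mem_nhds (mem_extChartAt_target q)] with y h1 h2 hy v w
      exact (flatD_pullbackForm (contMDiffAt_chart_symm hy) h1 v w).trans (h2 _ _))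
    (mfderiv (𝓡 3) 𝓘(ℝ, EuclideanSpace ℝ (Fin 3)) (extChartAt (𝓡 3) q) q u)
    (mfderiv (𝓡 3) 𝓘(ℝ, EuclideanSpace ℝ (Fin 3)) (extChartAt (𝓡 3) q) q v)
    (mfderiv (𝓡 3) 𝓘(ℝ, EuclideanSpace ℝ (Fin 3)) (extChartAt (𝓡 3) q) q w)
  simp only [oneFormInChart_comp hq, ← extDerivOneForm_apply] at key
  exact key

end ManifoldForms

/-! ### Existence and uniqueness of the pseudohermitian connection -/

namespace PseudohermitianStructure

variable {M : Type*} [TopologicalSpace M] [ChartedSpace (EuclideanSpace ℝ (Fin 3)) M]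
  [IsManifold (𝓡 3) ∞ M] {P : PseudohermitianStructure M} {U : Set M}
  {E₁ : (q : M) → TangentSpace (𝓡 3) q} {q : M}

theorem IsUnitaryFrameOn.isUnit (h : P.IsUnitaryFrameOn U E₁) (hq : q ∈ U) : P.IsUnit q (E₁ q) :=
  ⟨h.horizontal q hq, h.unit q hq⟩

theorem IsUnitaryFrameOn.smoothFieldAt (h : P.IsUnitaryFrameOn U E₁) (hq : q ∈ U) :
    SmoothFieldAt E₁ q :=
  (h.smooth q hq).contMDiffAt (h.isOpen.mem_nhds hq)

theorem IsUnitaryFrameOn.eventually_mem (h : P.IsUnitaryFrameOn U E₁) (hq : q ∈ U) :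
    ∀ᶠ r in 𝓝 q, r ∈ U := h.isOpen.mem_nhds hq

variable (P E₁) in
/-- The form `e¹` of the coframe. -/
def coframe₁ (r : M) : TangentSpace (𝓡 3) r →L[ℝ] ℝ := P.dualForm r (E₁ r)

variable (P E₁) in
/-- The form `e²` of the coframe. -/
def coframe₂ (r : M) : TangentSpace (𝓡 3) r →L[ℝ] ℝ := P.dualForm r (P.J r (E₁ r))

theorem smoothFormAt_dualForm {X : (q : M) → TangentSpace (𝓡 3) q} (hX : SmoothFieldAt X q) :
    SmoothFormAt (fun r => P.dualForm r (X r)) q := by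
  refine SmoothFormAt.extDeriv (β := P.Θ) (X := fun r => (1 / 2 : ℝ) • P.J r (X r))
    (Eventually.of_forall P.smoothFormAt_Θ)
    (SmoothFieldAt.smul contMDiffAt_const (P.smoothFieldAt_J hX)) (Eventually.of_forall ?_)
  intro r v
  rw [dualForm_apply, map_smul, smul_eq_mul]

theorem IsUnitaryFrameOn.smoothFormAt_coframe₁ (h : P.IsUnitaryFrameOn U E₁) (hq : q ∈ U) :
    SmoothFormAt (P.coframe₁ E₁) q := smoothFormAt_dualForm (h.smoothFieldAt hq)

theorem IsUnitaryFrameOn.smoothFormAt_coframe₂ (h : P.IsUnitaryFrameOn U E₁) (hq : q ∈ U) :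
    SmoothFormAt (P.coframe₂ E₁) q := smoothFormAt_dualForm (P.smoothFieldAt_J (h.smoothFieldAt hq))

/-- The Reeb field is chosen pointwise, so its smoothness needs a formula: T = (V − e¹(V)e₁ −
e²(V)e₂)/Θ(V) for any smooth V with Θ(V) ≠ 0. -/
theorem IsUnitaryFrameOn.smoothFieldAt_reeb (h : P.IsUnitaryFrameOn U E₁) (hq : q ∈ U) :
    SmoothFieldAt P.reeb q := by
  let V := coordField q (mfderiv (𝓡 3) 𝓘(ℝ, EuclideanSpace ℝ (Fin 3)) (extChartAt (𝓡 3) q) q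
    (P.reeb q))
  have hV : SmoothFieldAt V q := smoothFieldAt_coordField _ (mem_extChartAt_source q)
  have hVq : V q = P.reeb q := coordField_self _
  have hθ : ContMDiffAt (𝓡 3) 𝓘(ℝ, ℝ) ∞ (fun r => P.Θ r (V r)) q :=
    (P.smoothFormAt_Θ q).contMDiffAt_apply hV
  have hθq : P.Θ q (V q) ≠ 0 := by rw [hVq, Θ_reeb]; norm_num
  have hinv : ContMDiffAt (𝓡 3) 𝓘(ℝ, ℝ) ∞ (fun r => (P.Θ r (V r))⁻¹) q := hθ.inv₀ hθq
  have hE := h.smoothFieldAt hq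
  have hS := SmoothFieldAt.smul hinv ((hV.sub
    (SmoothFieldAt.smul ((h.smoothFormAt_coframe₁ hq).contMDiffAt_apply hV) hE)).sub
    (SmoothFieldAt.smul ((h.smoothFormAt_coframe₂ hq).contMDiffAt_apply hV) (P.smoothFieldAt_J hE)))
  refine ContMDiffAt.congr_of_eventuallyEq hS ?_
  filter_upwards [h.eventually_mem hq, hθ.continuousAt.eventually_ne hθq] with r hr hr0
  refine congrArg (TotalSpace.mk r) ?_
  have hd := (h.isUnit hr).decomposition (V r)
  have : V r - P.coframe₁ E₁ r (V r) • E₁ r - P.coframe₂ E₁ r (V r) • P.J r (E₁ r) =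
      P.Θ r (V r) • P.reeb r := by
    rw [sub_sub, sub_eq_iff_eq_add']
    exact hd
  rw [this, smul_smul, inv_mul_cancel₀ hr0, one_smul]

/-- The structure equations of the pseudohermitian connection in real form. -/
theorem isConnectionForm_iff {η : (q : M) → TangentSpace (𝓡 3) q →L[ℝ] ℝ} {A : M → ℂ} :
    P.IsConnectionForm U E₁ η A ↔ ∀ q ∈ U, ∀ v w,
      extDerivOneForm (P.coframe₁ E₁) q v w =
        -(P.coframe₂ E₁ q v * η q w - P.coframe₂ E₁ q w * η q v) +
        (A q).re * (P.Θ q v * P.coframe₁ E₁ q w - P.Θ q w * P.coframe₁ E₁ q v) +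
        (A q).im * (P.Θ q v * P.coframe₂ E₁ q w - P.Θ q w * P.coframe₂ E₁ q v) ∧
      extDerivOneForm (P.coframe₂ E₁) q v w =
        (P.coframe₁ E₁ q v * η q w - P.coframe₁ E₁ q w * η q v) +
        (A q).im * (P.Θ q v * P.coframe₁ E₁ q w - P.Θ q w * P.coframe₁ E₁ q v) -
        (A q).re * (P.Θ q v * P.coframe₂ E₁ q w - P.Θ q w * P.coframe₂ E₁ q v) := by
  refine forall₂_congr fun q _ => forall₂_congr fun v w => ?_
  rw [Complex.ext_iff]
  have h1 : extDerivOneForm (fun r => P.dualForm r (E₁ r)) q =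
    extDerivOneForm (P.coframe₁ E₁) q := rfl
  have h2 : extDerivOneForm (fun r => P.dualForm r (P.J r (E₁ r))) q =
    extDerivOneForm (P.coframe₂ E₁) q := rfl
  have h3 : P.dualForm q (E₁ q) = P.coframe₁ E₁ q := rfl
  have h4 : P.dualForm q (P.J q (E₁ q)) = P.coframe₂ E₁ q := rfl
  simp only [dTheta, theta, h1, h2, h3, h4]
  simp
  refine and_congr ⟨fun h => h.trans (by ring), fun h => h.trans (by ring)⟩
    ⟨fun h => h.trans (by ring), fun h => h.trans (by ring)⟩

variable (P E₁) in
/-- The connection form of a unitary frame. -/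
def connForm (q : M) : TangentSpace (𝓡 3) q →L[ℝ] ℝ :=
  extDerivOneForm (P.coframe₁ E₁) q (E₁ q) (P.J q (E₁ q)) • P.coframe₁ E₁ q +
  extDerivOneForm (P.coframe₂ E₁) q (E₁ q) (P.J q (E₁ q)) • P.coframe₂ E₁ q +
  (1 / 2 * (extDerivOneForm (P.coframe₁ E₁) q (P.reeb q) (P.J q (E₁ q)) -
    extDerivOneForm (P.coframe₂ E₁) q (P.reeb q) (E₁ q))) • P.Θ q

variable (P E₁) in
/-- The torsion coefficient `A^1_{\bar 1}` of a unitary frame. -/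
def torsionCoeff (q : M) : ℂ :=
  ⟨extDerivOneForm (P.coframe₁ E₁) q (P.reeb q) (E₁ q),
    1 / 2 * (extDerivOneForm (P.coframe₁ E₁) q (P.reeb q) (P.J q (E₁ q)) +
      extDerivOneForm (P.coframe₂ E₁) q (P.reeb q) (E₁ q))⟩

theorem IsUnitaryFrameOn.coframe_values (h : P.IsUnitaryFrameOn U E₁) (hq : q ∈ U) :
    (P.coframe₁ E₁ q (E₁ q) = 1 ∧ P.coframe₁ E₁ q (P.J q (E₁ q)) = 0 ∧
      P.coframe₁ E₁ q (P.reeb q) = 0) ∧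
    (P.coframe₂ E₁ q (E₁ q) = 0 ∧ P.coframe₂ E₁ q (P.J q (E₁ q)) = 1 ∧
      P.coframe₂ E₁ q (P.reeb q) = 0) ∧
    (P.Θ q (E₁ q) = 0 ∧ P.Θ q (P.J q (E₁ q)) = 0 ∧ P.Θ q (P.reeb q) = 1) :=
  have hx := h.isUnit hq
  ⟨⟨hx.dualForm_self, hx.dualForm_self_J, dualForm_reeb _⟩,
    ⟨hx.dualForm_J_self, hx.J.dualForm_self, dualForm_reeb _⟩, hx.1, hx.J.1, P.Θ_reeb q⟩

/-- This is d(dΘ) = 2 d(e¹∧e²) = 0 evaluated on (T, e₁, e₂). It says that the torsion is trace-free,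
the one compatibility condition for solving the structure equation. -/
theorem IsUnitaryFrameOn.extDeriv_reeb (h : P.IsUnitaryFrameOn U E₁) (hq : q ∈ U) :
    extDerivOneForm (P.coframe₂ E₁) q (P.reeb q) (P.J q (E₁ q)) =
      -extDerivOneForm (P.coframe₁ E₁) q (P.reeb q) (E₁ q) := by
  have key := extDerivOneForm_cyclic (Eventually.of_forall P.smoothFormAt_Θ)
    (h.smoothFormAt_coframe₁ hq) (h.smoothFormAt_coframe₂ hq) (by
      filter_upwards [h.eventually_mem hq] with r hr v w
      exact (h.isUnit hr).dΘ_apply v w) (P.reeb q) (E₁ q) (P.J q (E₁ q))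
  obtain ⟨⟨a1, a2, a3⟩, ⟨b1, b2, b3⟩, -⟩ := h.coframe_values hq
  rw [a1, a2, a3, b1, b2, b3, extDerivOneForm_antisymm (P.coframe₂ E₁) q (P.J q (E₁ q))] at key
  linarith

/-- The forms de¹ and de² have six components in the frame. The three components of ω and the two of
the torsion account for five of them, and the sixth is the trace condition `extDeriv_reeb`. -/
theorem IsUnitaryFrameOn.isConnectionForm (h : P.IsUnitaryFrameOn U E₁) :
    P.IsConnectionForm U E₁ (P.connForm E₁) (P.torsionCoeff E₁) := by
  rw [isConnectionForm_iff]
  intro q hq v w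
  have hx := h.isUnit hq
  have h1 := hx.alternating_apply' (extDerivOneForm_antisymm (P.coframe₁ E₁) q) v w
  have h2 := hx.alternating_apply' (extDerivOneForm_antisymm (P.coframe₂ E₁) q) v w
  rw [h.extDeriv_reeb hq] at h2
  have h3 : P.dualForm q (E₁ q) = P.coframe₁ E₁ q := rfl
  have h4 : P.dualForm q (P.J q (E₁ q)) = P.coframe₂ E₁ q := rfl
  rw [h1, h2]
  simp only [connForm, torsionCoeff, add_apply, smul_apply, smul_eq_mul, h3, h4]
  constructor <;> ring

/-- Whatever connection form was selected in the definitions of torsion, curvature and H, it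
coincides with the explicit `connForm`. -/
theorem IsConnectionForm.eq {η η' : (q : M) → TangentSpace (𝓡 3) q →L[ℝ] ℝ} {A A' : M → ℂ}
    {U' : Set M} (hx : P.IsUnit q (E₁ q)) (h : P.IsConnectionForm U E₁ η A) (hq : q ∈ U)
    (h' : P.IsConnectionForm U' E₁ η' A') (hq' : q ∈ U') : η q = η' q ∧ A q = A' q := by
  rw [isConnectionForm_iff] at h h'
  have a1 : P.coframe₁ E₁ q (E₁ q) = 1 := hx.dualForm_self
  have a2 : P.coframe₁ E₁ q (P.J q (E₁ q)) = 0 := hx.dualForm_self_J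
  have a3 : P.coframe₁ E₁ q (P.reeb q) = 0 := dualForm_reeb _
  have b1 : P.coframe₂ E₁ q (E₁ q) = 0 := hx.dualForm_J_self
  have b2 : P.coframe₂ E₁ q (P.J q (E₁ q)) = 1 := hx.J.dualForm_self
  have b3 : P.coframe₂ E₁ q (P.reeb q) = 0 := dualForm_reeb _
  have e := fun v w => (h q hq v w).1.symm.trans (h' q hq' v w).1
  have f := fun v w => (h q hq v w).2.symm.trans (h' q hq' v w).2
  have e1 := e (E₁ q) (P.J q (E₁ q))
  have e2 := f (E₁ q) (P.J q (E₁ q))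
  have e3 := e (P.reeb q) (E₁ q)
  have e4 := e (P.reeb q) (P.J q (E₁ q))
  have e5 := f (P.reeb q) (E₁ q)
  simp only [a1, a2, a3, b1, b2, b3, hx.1, hx.J.1, P.Θ_reeb] at e1 e2 e3 e4 e5
  have wX : η q (E₁ q) = η' q (E₁ q) := by linarith
  have wY : η q (P.J q (E₁ q)) = η' q (P.J q (E₁ q)) := by linarith
  have wT : η q (P.reeb q) = η' q (P.reeb q) := by linarith
  refine ⟨?_, Complex.ext (by linarith) (by linarith)⟩
  ext v
  rw [hx.decomposition v]
  simp [wX, wY, wT]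

theorem IsUnitaryFrameOn.smoothFormAt_connForm (h : P.IsUnitaryFrameOn U E₁) (hq : q ∈ U) :
    SmoothFormAt (P.connForm E₁) q := by
  have hE := h.smoothFieldAt hq
  have hJ := P.smoothFieldAt_J hE
  have hT := h.smoothFieldAt_reeb hq
  have h1 : ∀ᶠ r in 𝓝 q, SmoothFormAt (P.coframe₁ E₁) r := by
    filter_upwards [h.eventually_mem hq] with r hr using h.smoothFormAt_coframe₁ hr
  have h2 : ∀ᶠ r in 𝓝 q, SmoothFormAt (P.coframe₂ E₁) r := by
    filter_upwards [h.eventually_mem hq] with r hr using h.smoothFormAt_coframe₂ hr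
  exact ((SmoothFormAt.smul (contMDiffAt_extDerivOneForm h1 hE hJ) h1.self_of_nhds).add
    (SmoothFormAt.smul (contMDiffAt_extDerivOneForm h2 hE hJ) h2.self_of_nhds)).add
    (SmoothFormAt.smul (contMDiffAt_const.mul ((contMDiffAt_extDerivOneForm h1 hT hJ).sub
      (contMDiffAt_extDerivOneForm h2 hT hE))) (P.smoothFormAt_Θ q))

theorem IsUnitaryFrameOn.structureEqs {E : Type*} [NormedAddCommGroup E] [NormedSpace ℝ E]
    (h : P.IsUnitaryFrameOn U E₁) {F : E → M} {z : E} (hF : ContMDiffAt 𝓘(ℝ, E) (𝓡 3) ∞ F z)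
    (hz : F z ∈ U) :
    StructureEqs (pullbackForm F P.Θ) (pullbackForm F (P.coframe₁ E₁))
      (pullbackForm F (P.coframe₂ E₁)) (pullbackForm F (P.connForm E₁))
      (P.torsionCoeff E₁ (F z)).re (P.torsionCoeff E₁ (F z)).im z := by
  have hc := isConnectionForm_iff.1 h.isConnectionForm (F z) hz
  constructor
  · intro x y
    rw [flatD_pullbackForm hF (P.smoothFormAt_Θ _)]
    exact (h.isUnit hz).dΘ_apply _ _
  · intro x y
    rw [flatD_pullbackForm hF (h.smoothFormAt_coframe₁ hz)]
    exact (hc _ _).1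
  · intro x y
    rw [flatD_pullbackForm hF (h.smoothFormAt_coframe₂ hz)]
    exact (hc _ _).2

end PseudohermitianStructure

/-! ### Change of frame: invariance of torsion, curvature and p-mean curvature -/

section FlatForms

variable {E : Type*} [NormedAddCommGroup E] [NormedSpace ℝ E]

theorem StructureEqs.congr {Θ e f w e' f' : E → E →L[ℝ] ℝ} {Ar Ai : ℝ} {z : E}
    (h : StructureEqs Θ e f w Ar Ai z) (he : e =ᶠ[𝓝 z] e') (hf : f =ᶠ[𝓝 z] f') :
    StructureEqs Θ e' f' w Ar Ai z := by
  have e0 := he.self_of_nhds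
  have f0 := hf.self_of_nhds
  constructor
  · intro x y; rw [← e0, ← f0]; exact h.dΘ x y
  · intro x y; rw [← e0, ← f0, ← flatD_congr he]; exact h.de x y
  · intro x y; rw [← e0, ← f0, ← flatD_congr hf]; exact h.df x y

end FlatForms

namespace PseudohermitianStructure

variable {M : Type*} [TopologicalSpace M] [ChartedSpace (EuclideanSpace ℝ (Fin 3)) M]
  [IsManifold (𝓡 3) ∞ M] {P : PseudohermitianStructure M} {U U' : Set M}
  {E₁ E₁' : (q : M) → TangentSpace (𝓡 3) q} {q : M}

theorem exists_unitaryFrame_of_field {X : (q : M) → TangentSpace (𝓡 3) q} {p : M} {V : Set M}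
    (hV : IsOpen V) (hp : p ∈ V) (hX : ∀ q ∈ V, SmoothFieldAt X q)
    (hor : ∀ q ∈ V, P.Θ q (X q) = 0) (hne : X p ≠ 0) :
    ∃ U ⊆ V, p ∈ U ∧ P.IsUnitaryFrameOn U (fun r => (√(P.levi r (X r) (X r)))⁻¹ • X r) := by
  have hl : ∀ q ∈ V, ContMDiffAt (𝓡 3) 𝓘(ℝ, ℝ) ∞ (fun r => P.levi r (X r) (X r)) q := fun q hq =>
    contMDiffAt_const.mul (contMDiffAt_extDerivOneForm (Eventually.of_forall P.smoothFormAt_Θ)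
      (hX q hq) (P.smoothFieldAt_J (hX q hq)))
  have hlc : ContinuousOn (fun r => P.levi r (X r) (X r)) V := fun q hq =>
    (hl q hq).continuousAt.continuousWithinAt
  refine ⟨V ∩ (fun r => P.levi r (X r) (X r)) ⁻¹' Ioi 0, inter_subset_left, ⟨hp, ?_⟩,
    hlc.isOpen_inter_preimage hV isOpen_Ioi, ?_, ?_, ?_⟩
  · have := P.pos p (X p) (hor p hp) hne
    simp only [mem_preimage, mem_Ioi, levi]
    linarith
  · rintro q ⟨hq, hq0⟩
    have hq0 : 0 < P.levi q (X q) (X q) := hq0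
    refine ContMDiffAt.contMDiffWithinAt (SmoothFieldAt.smul ?_ (hX q hq))
    refine ContMDiffAt.inv₀ ?_ (Real.sqrt_ne_zero'.2 hq0)
    exact ContMDiffAt.comp q (g := Real.sqrt)
      (Real.contDiffAt_sqrt hq0.ne').contMDiffAt (hl q hq)
  · rintro q ⟨hq, -⟩
    simp [hor q hq]
  · rintro q ⟨hq, hq0⟩
    have hq0 : 0 < P.levi q (X q) (X q) := hq0
    have h2 : √(P.levi q (X q) (X q)) ^ 2 = P.levi q (X q) (X q) := Real.sq_sqrt hq0.le
    have h3 : √(P.levi q (X q) (X q)) ≠ 0 := Real.sqrt_ne_zero'.2 hq0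
    have : ∀ c : ℝ, P.levi q (c • X q) (c • X q) = c * (c * P.levi q (X q) (X q)) := fun c => by
      simp only [levi, map_smul, smul_apply, smul_eq_mul]; ring
    rw [this]
    field_simp
    exact h2.symm

variable (P) in
theorem exists_unitaryFrame (p : M) : ∃ U E₁, p ∈ U ∧ P.IsUnitaryFrameOn U E₁ := by
  obtain ⟨v, hv⟩ := P.exists_Θ_eq_one p
  obtain ⟨x, hx, hx0⟩ := P.exists_horizontal_ne_zero p
  let V := coordField p (mfderiv (𝓡 3) 𝓘(ℝ, EuclideanSpace ℝ (Fin 3)) (extChartAt (𝓡 3) p) p v)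
  let Y := coordField p (mfderiv (𝓡 3) 𝓘(ℝ, EuclideanSpace ℝ (Fin 3)) (extChartAt (𝓡 3) p) p x)
  have hV : ∀ q ∈ (extChartAt (𝓡 3) p).source, SmoothFieldAt V q := fun q hq =>
    smoothFieldAt_coordField _ hq
  have hY : ∀ q ∈ (extChartAt (𝓡 3) p).source, SmoothFieldAt Y q := fun q hq =>
    smoothFieldAt_coordField _ hq
  have hVp : V p = v := coordField_self _
  have hYp : Y p = x := coordField_self _
  obtain ⟨U, -, hU, h⟩ := exists_unitaryFrame_of_field (P := P)
    -- This combination is horizontal everywhere, and at p it equals x, since there Θ(V) = 1 and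
    -- Θ(Y) = 0.
    (X := fun r => P.Θ r (V r) • Y r - P.Θ r (Y r) • V r)
    (isOpen_extChartAt_source (I := 𝓡 3) p) (mem_extChartAt_source p) (fun q hq =>
      (SmoothFieldAt.smul ((P.smoothFormAt_Θ q).contMDiffAt_apply (hV q hq)) (hY q hq)).sub
      (SmoothFieldAt.smul ((P.smoothFormAt_Θ q).contMDiffAt_apply (hY q hq)) (hV q hq)))
    (fun q _ => by simp; ring) (by rw [hVp, hYp, hv, hx]; simpa using hx0)
  exact ⟨U, _, hU, h⟩

theorem IsUnit.rotate {p : M} {x y : TangentSpace (𝓡 3) p} (hx : P.IsUnit p x)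
    (hy : P.IsUnit p y) :
    P.dualForm p x y ^ 2 + P.dualForm p (P.J p x) y ^ 2 = 1 ∧
    y = P.dualForm p x y • x + P.dualForm p (P.J p x) y • P.J p x ∧
    P.J p y = P.dualForm p x y • P.J p x - P.dualForm p (P.J p x) y • x ∧
    (∀ v, P.dualForm p y v =
      P.dualForm p x y * P.dualForm p x v + P.dualForm p (P.J p x) y * P.dualForm p (P.J p x) v) ∧
    (∀ v, P.dualForm p (P.J p y) v =
      P.dualForm p x y * P.dualForm p (P.J p x) v - P.dualForm p (P.J p x) y * P.dualForm p x v) := by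
  have hd := hx.decomposition y
  rw [hy.1, zero_smul, add_zero] at hd
  have h4 := hx.dualForm_eq hy.1
  have h1 := h4 y
  rw [hy.dualForm_self] at h1
  set a := P.dualForm p x y
  set b := P.dualForm p (P.J p x) y
  have hJ : P.J p y = a • P.J p x - b • x := by
    rw [hd, map_add, map_smul, map_smul, P.J_sq p x hx.1, smul_neg, sub_eq_add_neg]
  refine ⟨by linarith, hd, hJ, h4, fun v => ?_⟩
  rw [hx.dualForm_eq hy.J.1, hJ]
  simp only [map_sub, map_smul, hx.dualForm_self, hx.J.dualForm_self, hx.dualForm_self_J,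
    hx.dualForm_J_self, smul_eq_mul]
  ring

variable (P) in
/-- The coefficients of the frame vector `E₁'` with respect to the frame `E₁`. -/
def cosFun (E₁ E₁' : (q : M) → TangentSpace (𝓡 3) q) (r : M) : ℝ := P.coframe₁ E₁ r (E₁' r)

variable (P) in
/-- The coefficients of the frame vector `E₁'` with respect to the frame `E₁`. -/
def sinFun (E₁ E₁' : (q : M) → TangentSpace (𝓡 3) q) (r : M) : ℝ := P.coframe₂ E₁ r (E₁' r)

theorem IsUnitaryFrameOn.contMDiffAt_cosFun (h : P.IsUnitaryFrameOn U E₁)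
    (h' : P.IsUnitaryFrameOn U' E₁') (hq : q ∈ U) (hq' : q ∈ U') :
    ContMDiffAt (𝓡 3) 𝓘(ℝ, ℝ) ∞ (P.cosFun E₁ E₁') q :=
  (h.smoothFormAt_coframe₁ hq).contMDiffAt_apply (h'.smoothFieldAt hq')

theorem IsUnitaryFrameOn.contMDiffAt_sinFun (h : P.IsUnitaryFrameOn U E₁)
    (h' : P.IsUnitaryFrameOn U' E₁') (hq : q ∈ U) (hq' : q ∈ U') :
    ContMDiffAt (𝓡 3) 𝓘(ℝ, ℝ) ∞ (P.sinFun E₁ E₁') q :=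
  (h.smoothFormAt_coframe₂ hq).contMDiffAt_apply (h'.smoothFieldAt hq')

/-- The transformation law of the connection form and of the torsion, in the pull-back under a
local diffeomorphism `F` from a vector space. -/
theorem IsUnitaryFrameOn.pullback_rotate {E : Type*} [NormedAddCommGroup E] [NormedSpace ℝ E]
    (h : P.IsUnitaryFrameOn U E₁) (h' : P.IsUnitaryFrameOn U' E₁') {F : E → M} {z : E}
    (hF : ContMDiffAt 𝓘(ℝ, E) (𝓡 3) ∞ F z) (hFd : ((mfderiv 𝓘(ℝ, E) (𝓡 3) F z :
      E →L[ℝ] EuclideanSpace ℝ (Fin 3)) : E → EuclideanSpace ℝ (Fin 3)).Bijective)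
    (hz : F z ∈ U) (hz' : F z ∈ U') :
    pullbackForm F (P.connForm E₁') z = rotConn (pullbackForm F (P.connForm E₁))
      (fun y => P.cosFun E₁ E₁' (F y)) (fun y => P.sinFun E₁ E₁' (F y)) z ∧
    (P.torsionCoeff E₁' (F z)).re =
      (P.torsionCoeff E₁ (F z)).re * (P.cosFun E₁ E₁' (F z) ^ 2 - P.sinFun E₁ E₁' (F z) ^ 2) +
      2 * (P.torsionCoeff E₁ (F z)).im * P.cosFun E₁ E₁' (F z) * P.sinFun E₁ E₁' (F z) ∧
    (P.torsionCoeff E₁' (F z)).im =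
      (P.torsionCoeff E₁ (F z)).im * (P.cosFun E₁ E₁' (F z) ^ 2 - P.sinFun E₁ E₁' (F z) ^ 2) -
      2 * (P.torsionCoeff E₁ (F z)).re * P.cosFun E₁ E₁' (F z) * P.sinFun E₁ E₁' (F z) := by
  have hUU : ∀ᶠ y in 𝓝 z, F y ∈ U ∧ F y ∈ U' :=
    (hF.continuousAt.eventually (h.eventually_mem hz)).and
      (hF.continuousAt.eventually (h'.eventually_mem hz'))
  have hc : ContDiffAt ℝ ∞ (fun y => P.cosFun E₁ E₁' (F y)) z := by
    rw [← contMDiffAt_iff_contDiffAt]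
    exact (h.contMDiffAt_cosFun h' hz hz').comp z hF
  have hs : ContDiffAt ℝ ∞ (fun y => P.sinFun E₁ E₁' (F y)) z := by
    rw [← contMDiffAt_iff_contDiffAt]
    exact (h.contMDiffAt_sinFun h' hz hz').comp z hF
  have he := contDiffAt_pullbackForm hF (h.smoothFormAt_coframe₁ hz)
  have hf := contDiffAt_pullbackForm hF (h.smoothFormAt_coframe₂ hz)
  have h1 := (h.structureEqs hF hz).rotate (he.differentiableAt (by simp))
    (hf.differentiableAt (by simp)) (hc.differentiableAt (by simp)) (hs.differentiableAt (by simp))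
    (by filter_upwards [hUU] with y hy using ((h.isUnit hy.1).rotate (h'.isUnit hy.2)).1)
  have h2 := h1.congr (e' := pullbackForm F (P.coframe₁ E₁')) (f' := pullbackForm F (P.coframe₂ E₁'))
    (by
      filter_upwards [hUU] with y hy
      ext v
      exact (((h.isUnit hy.1).rotate (h'.isUnit hy.2)).2.2.2.1 _).symm)
    (by
      filter_upwards [hUU] with y hy
      ext v
      exact (((h.isUnit hy.1).rotate (h'.isUnit hy.2)).2.2.2.2 _).symm)
  -- Preimages of e₁', e₂' and T. Since dF is bijective they form the basis dual to the pulled-back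
  -- coframe, so uniqueness can be applied on the vector space.
  obtain ⟨X, hX⟩ := hFd.2 (E₁' (F z))
  obtain ⟨Y, hY⟩ := hFd.2 (P.J (F z) (E₁' (F z)))
  obtain ⟨T, hT⟩ := hFd.2 (P.reeb (F z))
  obtain ⟨⟨a1, a2, a3⟩, ⟨b1, b2, b3⟩, c1, c2, c3⟩ := h'.coframe_values hz'
  refine (h'.structureEqs hF hz').unique h2 (X := X) (Y := Y) (T := T) ?_ ?_ ?_ ?_
  · exact ⟨(congrArg (P.Θ (F z)) hX).trans c1, (congrArg (P.coframe₁ E₁' (F z)) hX).trans a1,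
      (congrArg (P.coframe₂ E₁' (F z)) hX).trans b1⟩
  · exact ⟨(congrArg (P.Θ (F z)) hY).trans c2, (congrArg (P.coframe₁ E₁' (F z)) hY).trans a2,
      (congrArg (P.coframe₂ E₁' (F z)) hY).trans b2⟩
  · exact ⟨(congrArg (P.Θ (F z)) hT).trans c3, (congrArg (P.coframe₁ E₁' (F z)) hT).trans a3,
      (congrArg (P.coframe₂ E₁' (F z)) hT).trans b3⟩
  · intro v
    let L : E →L[ℝ] EuclideanSpace ℝ (Fin 3) := mfderiv 𝓘(ℝ, E) (𝓡 3) F z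
    have hd : L v = pullbackForm F (P.coframe₁ E₁') z v • L X +
        pullbackForm F (P.coframe₂ E₁') z v • L Y + pullbackForm F P.Θ z v • L T := by
      have hX' : L X = E₁' (F z) := hX
      have hY' : L Y = P.J (F z) (E₁' (F z)) := hY
      have hT' : L T = P.reeb (F z) := hT
      rw [hX', hY', hT']
      exact (h'.isUnit hz').decomposition (L v)
    have hlin : ∀ (a b c : ℝ) (x y z : E), a • L x + b • L y + c • L z =
      L (a • x + b • y + c • z) := fun a b c x y z => by simp
    exact hFd.1 (hd.trans (hlin _ _ _ _ _ _))

theorem mfderiv_chart_symm_bijective {p : M} {y : EuclideanSpace ℝ (Fin 3)}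
    (hy : y ∈ (extChartAt (𝓡 3) p).target) : ((mfderiv 𝓘(ℝ, EuclideanSpace ℝ (Fin 3)) (𝓡 3)
      (extChartAt (𝓡 3) p).symm y : EuclideanSpace ℝ (Fin 3) →L[ℝ] EuclideanSpace ℝ (Fin 3)) :
      EuclideanSpace ℝ (Fin 3) → EuclideanSpace ℝ (Fin 3)).Bijective := by
  have h1 := mfderivWithin_extChartAt_symm_comp_mfderiv_extChartAt (I := 𝓡 3) hy
  have h2 := mfderiv_extChartAt_comp_mfderivWithin_extChartAt_symm (I := 𝓡 3) hy
  rw [ModelWithCorners.range_eq_univ, mfderivWithin_univ] at h1 h2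
  refine Function.bijective_iff_has_inverse.2 ⟨(mfderiv (𝓡 3) 𝓘(ℝ, EuclideanSpace ℝ (Fin 3))
    (extChartAt (𝓡 3) p) ((extChartAt (𝓡 3) p).symm y) :
      EuclideanSpace ℝ (Fin 3) →L[ℝ] EuclideanSpace ℝ (Fin 3)), fun v => ?_, fun v => ?_⟩
  · exact congrArg (fun L : EuclideanSpace ℝ (Fin 3) →L[ℝ] EuclideanSpace ℝ (Fin 3) => L v) h2
  · exact congrArg (fun L : EuclideanSpace ℝ (Fin 3) →L[ℝ] EuclideanSpace ℝ (Fin 3) => L v) h1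

/-- The torsion is multiplied by (c − is)², without derivatives of the rotation. It depends only on
the frame vector at q, where here c = 1 and s = 0. -/
theorem IsUnitaryFrameOn.torsionCoeff_eq (h : P.IsUnitaryFrameOn U E₁)
    (h' : P.IsUnitaryFrameOn U' E₁') (hq : q ∈ U) (hq' : q ∈ U') (hE : E₁' q = E₁ q) :
    P.torsionCoeff E₁' q = P.torsionCoeff E₁ q := by
  have h0 : ∀ r, r = q → r ∈ U ∧ r ∈ U' := by rintro r rfl; exact ⟨hq, hq'⟩
  have hl := (extChartAt_to_inv (I := 𝓡 3) q)
  obtain ⟨-, h1, h2⟩ := h.pullback_rotate h' (F := (extChartAt (𝓡 3) q).symm)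
    (contMDiffAt_chart_symm (mem_extChartAt_target q))
    (mfderiv_chart_symm_bijective (mem_extChartAt_target q)) (h0 _ hl).1 (h0 _ hl).2
  rw [hl] at h1 h2
  have c1 : P.cosFun E₁ E₁' q = 1 := by rw [cosFun, hE]; exact (h.coframe_values hq).1.1
  have s1 : P.sinFun E₁ E₁' q = 0 := by rw [sinFun, hE]; exact (h.coframe_values hq).2.1.1
  rw [c1, s1] at h1 h2
  exact Complex.ext (by linarith) (by linarith)

theorem IsUnitaryFrameOn.torsion_eq (h : P.IsUnitaryFrameOn U E₁) (hq : q ∈ U) :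
    P.torsion q (E₁ q) = starRingEnd ℂ (P.torsionCoeff E₁ q) := by
  obtain ⟨U', E₁', η, A, hq', h', hc, hE, ha⟩ := Classical.epsilon_spec
    (p := fun a : ℂ => ∃ U' E₁' η A, q ∈ U' ∧ P.IsUnitaryFrameOn U' E₁' ∧
    P.IsConnectionForm U' E₁' η A ∧ E₁' q = E₁ q ∧ a = starRingEnd ℂ (A q))
    ⟨_, U, E₁, _, _, hq, h, h.isConnectionForm, rfl, rfl⟩
  rw [← h.torsionCoeff_eq h' hq hq' hE,
    ← (hc.eq (h'.isUnit hq') hq' h'.isConnectionForm hq').2]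
  exact ha

/-- The connection forms of two frames differ by the closed form c ds − s dc. -/
theorem IsUnitaryFrameOn.extDeriv_connForm_eq (h : P.IsUnitaryFrameOn U E₁)
    (h' : P.IsUnitaryFrameOn U' E₁') (hq : q ∈ U) (hq' : q ∈ U') (v w : TangentSpace (𝓡 3) q) :
    extDerivOneForm (P.connForm E₁') q v w = extDerivOneForm (P.connForm E₁) q v w := by
  have h0 : ∀ r, r = q → r ∈ U ∧ r ∈ U' := by rintro r rfl; exact ⟨hq, hq'⟩
  have hl := (extChartAt_to_inv (I := 𝓡 3) q)
  have hψ := contMDiffAt_chart_symm (mem_extChartAt_target (I := 𝓡 3) q)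
  have hcont := (continuousAt_extChartAt_symm (I := 𝓡 3) q)
  rw [ContinuousAt, extChartAt_to_inv] at hcont
  have hUU := hcont.eventually ((h.eventually_mem hq).and (h'.eventually_mem hq'))
  have h1 : oneFormInChart (P.connForm E₁') q =ᶠ[𝓝 (extChartAt (𝓡 3) q q)]
      rotConn (oneFormInChart (P.connForm E₁) q)
      (fun y => P.cosFun E₁ E₁' ((extChartAt (𝓡 3) q).symm y))
      (fun y => P.sinFun E₁ E₁' ((extChartAt (𝓡 3) q).symm y)) := by
    filter_upwards [hUU, (isOpen_extChartAt_target q).mem_nhds (mem_extChartAt_target q)]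
      with y hy hyt
    exact (h.pullback_rotate h' (F := (extChartAt (𝓡 3) q).symm) (contMDiffAt_chart_symm hyt)
      (mfderiv_chart_symm_bijective hyt) hy.1 hy.2).1
  rw [extDerivOneForm_apply, extDerivOneForm_apply]
  refine (flatD_congr h1 _ _).trans ?_
  refine flatD_rotConn ((h.smoothFormAt_connForm hq).differentiableAt (by simp))
    (contMDiffAt_comp_chart_symm (h.contMDiffAt_cosFun h' hq hq'))
    (contMDiffAt_comp_chart_symm (h.contMDiffAt_sinFun h' hq hq')) ?_ _ _
  filter_upwards [hUU] with y hy using ((h.isUnit hy.1).rotate (h'.isUnit hy.2)).1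

/-- Neither dω nor the bivector e₁∧e₂ changes under a rotation of the frame; the latter because c² +
s² = 1. -/
theorem IsUnitaryFrameOn.websterCurvature_eq (h : P.IsUnitaryFrameOn U E₁) (hq : q ∈ U) :
    extDerivOneForm (P.connForm E₁) q (E₁ q) (P.J q (E₁ q)) = -2 * P.websterCurvature q := by
  obtain ⟨U', E₁', η, A, hq', h', hc, hW⟩ := Classical.epsilon_spec
    (p := fun W : ℝ => ∃ U' E₁' η A, q ∈ U' ∧ P.IsUnitaryFrameOn U' E₁' ∧
    P.IsConnectionForm U' E₁' η A ∧ extDerivOneForm η q (E₁' q) (P.J q (E₁' q)) = -2 * W)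
    ⟨-1 / 2 * extDerivOneForm (P.connForm E₁) q (E₁ q) (P.J q (E₁ q)), U, E₁, _, _, hq, h,
      h.isConnectionForm, by ring⟩
  have h1 : extDerivOneForm η q = extDerivOneForm (P.connForm E₁') q := by
    refine extDerivOneForm_congr ?_
    filter_upwards [h'.eventually_mem hq'] with r hr
    exact (hc.eq (h'.isUnit hr) hr h'.isConnectionForm hr).1
  have hW' : extDerivOneForm η q (E₁' q) (P.J q (E₁' q)) = -2 * P.websterCurvature q := hW
  rw [← hW', h1, h.extDeriv_connForm_eq h' hq hq']
  obtain ⟨r1, r2, r3, -, -⟩ := (h.isUnit hq).rotate (h'.isUnit hq')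
  set c := P.dualForm q (E₁ q) (E₁' q)
  set s := P.dualForm q (P.J q (E₁ q)) (E₁' q)
  set B := extDerivOneForm (P.connForm E₁) q with hB
  have hanti : ∀ a b, B a b = -B b a := extDerivOneForm_antisymm _ q
  have hself : ∀ a, B a a = 0 := fun a => by linarith [hanti a a]
  rw [r3, r2]
  simp only [map_add, map_sub, map_smul, add_apply, smul_apply, smul_eq_mul, hself,
    hanti (P.J q (E₁ q)) (E₁ q)]
  linear_combination (-B (E₁ q) (P.J q (E₁ q))) * r1

/-- Two frames with the same first vector along a map have the same connection form along it. -/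
theorem IsUnitaryFrameOn.connForm_eq_along {E H N : Type*} [NormedAddCommGroup E]
    [NormedSpace ℝ E] [TopologicalSpace H] {I : ModelWithCorners ℝ E H} [TopologicalSpace N]
    [ChartedSpace H N] {ι : N → M} {p : N} (hι : MDifferentiableAt I (𝓡 3) ι p)
    (h : P.IsUnitaryFrameOn U E₁) (h' : P.IsUnitaryFrameOn U' E₁') (hq : ι p ∈ U) (hq' : ι p ∈ U')
    (hE : ∀ᶠ x in 𝓝 p, E₁' (ι x) = E₁ (ι x)) (v : TangentSpace I p) :
    P.connForm E₁' (ι p) (mfderiv I (𝓡 3) ι p v) = P.connForm E₁ (ι p) (mfderiv I (𝓡 3) ι p v) := by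
  have h0 : ∀ r, r = ι p → r ∈ U ∧ r ∈ U' := by rintro r rfl; exact ⟨hq, hq'⟩
  have hl := (extChartAt_to_inv (I := 𝓡 3) (ι p))
  have hs := h.contMDiffAt_sinFun h' hq hq'
  have hEp : E₁' (ι p) = E₁ (ι p) := hE.self_of_nhds
  have h1 := (h.pullback_rotate h' (F := (extChartAt (𝓡 3) (ι p)).symm)
    (contMDiffAt_chart_symm (mem_extChartAt_target (ι p)))
    (mfderiv_chart_symm_bijective (mem_extChartAt_target (ι p))) (h0 _ hl).1 (h0 _ hl).2).1
  have c1 : P.cosFun E₁ E₁' (ι p) = 1 := by rw [cosFun, hEp]; exact (h.coframe_values hq).1.1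
  have s1 : P.sinFun E₁ E₁' (ι p) = 0 := by rw [sinFun, hEp]; exact (h.coframe_values hq).2.1.1
  -- Along the surface the two frames coincide, so s vanishes there, and hence so does ds in tangent
  -- directions. With c = 1 and s = 0 the correction c ds − s dc reduces to this ds.
  have hds : mfderiv (𝓡 3) 𝓘(ℝ, ℝ) (P.sinFun E₁ E₁') (ι p) (mfderiv I (𝓡 3) ι p v) = 0 := by
    have hev : P.sinFun E₁ E₁' ∘ ι =ᶠ[𝓝 p] fun _ => 0 := by
      filter_upwards [hE, hι.continuousAt.eventually (h.eventually_mem hq)] with x hx hxU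
      simp only [Function.comp, sinFun, hx]
      exact (h.coframe_values hxU).2.1.1
    have e1 := mfderiv_comp p (hs.mdifferentiableAt (by simp)) hι
    rw [hev.mfderiv_eq, mfderiv_const] at e1
    exact (congrArg (fun L : E →L[ℝ] ℝ => L v) e1).symm
  set u : EuclideanSpace ℝ (Fin 3) := mfderiv (𝓡 3) 𝓘(ℝ, EuclideanSpace ℝ (Fin 3))
    (extChartAt (𝓡 3) (ι p)) (ι p) (mfderiv I (𝓡 3) ι p v) with hu
  have h2 := congrArg (fun L : EuclideanSpace ℝ (Fin 3) →L[ℝ] ℝ => L u) h1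
  have hsrc := mem_extChartAt_source (I := 𝓡 3) (ι p)
  have k1 : pullbackForm (extChartAt (𝓡 3) (ι p)).symm (P.connForm E₁')
      (extChartAt (𝓡 3) (ι p) (ι p)) u = P.connForm E₁' (ι p) (mfderiv I (𝓡 3) ι p v) :=
    oneFormInChart_comp hsrc _
  have k2 : pullbackForm (extChartAt (𝓡 3) (ι p)).symm (P.connForm E₁)
      (extChartAt (𝓡 3) (ι p) (ι p)) u = P.connForm E₁ (ι p) (mfderiv I (𝓡 3) ι p v) :=
    oneFormInChart_comp hsrc _
  have k3 : fderiv ℝ (fun y => P.sinFun E₁ E₁' ((extChartAt (𝓡 3) (ι p)).symm y))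
      (extChartAt (𝓡 3) (ι p) (ι p)) u = 0 := by
    have hloc : P.sinFun E₁ E₁' =ᶠ[𝓝 (ι p)]
      (fun y => P.sinFun E₁ E₁' ((extChartAt (𝓡 3) (ι p)).symm y)) ∘ extChartAt (𝓡 3) (ι p) := by
      filter_upwards [extChartAt_source_mem_nhds (I := 𝓡 3) (ι p)] with x hx
      rw [Function.comp_apply, (extChartAt (𝓡 3) (ι p)).left_inv hx]
    have e1 := mfderiv_comp (ι p) (I' := 𝓘(ℝ, EuclideanSpace ℝ (Fin 3)))
      ((contMDiffAt_comp_chart_symm hs).differentiableAt (by simp)).mdifferentiableAt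
      (mdifferentiableAt_extChartAt (I := 𝓡 3) (mem_chart_source _ (ι p)))
    rw [hloc.mfderiv_eq, e1, mfderiv_eq_fderiv] at hds
    exact hds
  rw [k1] at h2
  rw [h2]
  simp only [rotConn, add_apply, sub_apply, smul_apply, k2, hl, c1, s1, k3]
  simp

end PseudohermitianStructure

open PseudohermitianStructure in
-- The definition selects some extension of e₁ to a frame of M. By `connForm_eq_along` all
-- extensions give the same value of ω(e₁).
theorem pMeanCurvature_eq {M : Type*} [TopologicalSpace M]
    [ChartedSpace (EuclideanSpace ℝ (Fin 3)) M] [IsManifold (𝓡 3) ∞ M]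
    {P : PseudohermitianStructure M} {U : Set M} {E₁ : (q : M) → TangentSpace (𝓡 3) q}
    {H : Type*} [TopologicalSpace H] {I : ModelWithCorners ℝ (EuclideanSpace ℝ (Fin 2)) H}
    {N : Type*} [TopologicalSpace N] [ChartedSpace H N] {ι : N → M} {p : N}
    {e₁ : (p : N) → TangentSpace I p} (hι : MDifferentiableAt I (𝓡 3) ι p)
    (h : P.IsUnitaryFrameOn U E₁) (hq : ι p ∈ U)
    (hE : ∀ᶠ q in 𝓝 p, E₁ (ι q) = mfderiv I (𝓡 3) ι q (e₁ q)) :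
    P.connForm E₁ (ι p) (mfderiv I (𝓡 3) ι p (e₁ p)) = pMeanCurvature I P ι e₁ p := by
  obtain ⟨U', E₁', η, A, hq', h', hc, hE', ha⟩ := Classical.epsilon_spec
    (p := fun h : ℝ => ∃ U E₁ η A, ι p ∈ U ∧ P.IsUnitaryFrameOn U E₁ ∧
    P.IsConnectionForm U E₁ η A ∧ (∀ᶠ q in 𝓝 p, E₁ (ι q) = mfderiv I (𝓡 3) ι q (e₁ q)) ∧
    h = η (ι p) (mfderiv I (𝓡 3) ι p (e₁ p)))
    ⟨_, U, E₁, _, _, hq, h, h.isConnectionForm, hE, rfl⟩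
  have ha' : pMeanCurvature I P ι e₁ p = η (ι p) (mfderiv I (𝓡 3) ι p (e₁ p)) := ha
  rw [ha', (hc.eq (h'.isUnit hq') hq' h'.isConnectionForm hq').1]
  refine (h.connForm_eq_along hι h' hq hq' ?_ _).symm
  filter_upwards [hE, hE'] with x h1 h2
  rw [h1, h2]

/-! ### The second variation for a coframe adapted only at time zero -/

section FlatForms

variable {E : Type*} [NormedAddCommGroup E] [NormedSpace ℝ E]

theorem flatD_eq_components {β : E → E →L[ℝ] ℝ} {z : E} (h : DifferentiableAt ℝ β z) (v w : E) :
    fderiv ℝ (fun y => β y w) z v - fderiv ℝ (fun y => β y v) z w = flatD β z v w := by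
  rw [fderiv_clm_apply_const h, fderiv_clm_apply_const h, flatD]

/-- Second variation of the p-area density in coordinates, for an arbitrary coframe adapted to the
surface only at time zero. -/
theorem second_variation_forms {b₀ b₁ b₂ : E} {τ : E →L[ℝ] ℝ} (hb₁ : τ b₁ = 0) (hb₂ : τ b₂ = 0)
    {O : Set E} (hO : IsOpen O) {Θ e f w : E → E →L[ℝ] ℝ}
    (cΘ : ∀ z ∈ O, ContDiffAt ℝ ∞ Θ z) (ce : ∀ z ∈ O, ContDiffAt ℝ ∞ e z)
    (cf : ∀ z ∈ O, ContDiffAt ℝ ∞ f z) (cw : ∀ z ∈ O, ContDiffAt ℝ ∞ w z) {Ar Ai : E → ℝ}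
    (h : ∀ z ∈ O, StructureEqs Θ e f w (Ar z) (Ai z) z) {ς : ℝ} (hς : ς ^ 2 = 1)
    {a b G c s : E → ℝ} (ha : ∀ z, a z = Θ z b₁ * e z b₂ - Θ z b₂ * e z b₁)
    (hb : ∀ z, b z = Θ z b₁ * f z b₂ - Θ z b₂ * f z b₁)
    (hG : ∀ z, G z = √(a z ^ 2 + b z ^ 2)) (hG0 : ∀ z ∈ O, 0 < G z)
    (hc : ∀ z, c z = ς * a z / G z) (hs : ∀ z, s z = ς * b z / G z)
    (slice_b : ∀ z ∈ O, τ z = 0 → b z = 0) (slice_a : ∀ z ∈ O, τ z = 0 → 0 < ς * a z)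
    (slice_e : ∀ z ∈ O, τ z = 0 → e z b₀ = 0)
    (slice_w : ∀ z ∈ O, τ z = 0 → Θ z b₁ * w z b₂ - Θ z b₂ * w z b₁ = 0)
    {α F eF u : E → ℝ} (cα : ∀ z ∈ O, ContDiffAt ℝ ∞ α z) (cF : ∀ z ∈ O, ContDiffAt ℝ ∞ F z)
    (hα₁ : ∀ z ∈ O, τ z = 0 → f z b₁ = α z * Θ z b₁)
    (hα₂ : ∀ z ∈ O, τ z = 0 → f z b₂ = α z * Θ z b₂)
    (hF : ∀ z ∈ O, τ z = 0 → F z = f z b₀ - α z * Θ z b₀)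
    (heF : ∀ z, eF z = (Θ z b₁ * fderiv ℝ F z b₂ - Θ z b₂ * fderiv ℝ F z b₁) / a z)
    (hu : ∀ z, u z = -F z * eF z) {z : E} (hz : z ∈ O) (hτ : τ z = 0) {W : ℝ} {l : E →L[ℝ] ℝ}
    (dw : ∀ x y, flatD w z x y = -2 * W * (e z x * f z y - e z y * f z x) +
      (Θ z x * l y - Θ z y * l x)) :
    fderiv ℝ (fun y => fderiv ℝ G y b₀) z b₀ =
      G z * (eF z ^ 2 + F z ^ 2 * (-2 * W - 2 * Ai z -
        4 * ((Θ z b₁ * fderiv ℝ α z b₂ - Θ z b₂ * fderiv ℝ α z b₁) / a z) - 4 * α z ^ 2)) +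
      (fderiv ℝ (fun y => ς * (fderiv ℝ (fun x => Θ x b₀ * (c x * e x b₂ + s x * f x b₂) -
        (c x * e x b₀ + s x * f x b₀) * Θ x b₂) y b₀ - u y * Θ y b₂)) z b₁ +
       fderiv ℝ (fun y => ς * (-fderiv ℝ (fun x => Θ x b₀ * (c x * e x b₁ + s x * f x b₁) -
        (c x * e x b₀ + s x * f x b₀) * Θ x b₁) y b₀ + u y * Θ y b₁)) z b₂) := by
  have dd : ∀ {φ : E → ℝ} {y : E}, ContDiffAt ℝ ∞ φ y → DifferentiableAt ℝ φ y :=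
    fun h => h.differentiableAt (by simp)
  have dd' : ∀ {φ : E → E →L[ℝ] ℝ} {y : E}, ContDiffAt ℝ ∞ φ y → DifferentiableAt ℝ φ y :=
    fun h => h.differentiableAt (by simp)
  have hnear : ∀ y ∈ O, ∀ᶠ x in 𝓝 y, x ∈ O := fun y hy => hO.mem_nhds hy
  have cap : ∀ {β : E → E →L[ℝ] ℝ} (v : E) {y : E}, ContDiffAt ℝ ∞ β y →
      ContDiffAt ℝ ∞ (fun x => β x v) y := fun v _ h => h.clm_apply contDiffAt_const
  have hG' : G = fun z => √(a z ^ 2 + b z ^ 2) := funext hG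
  have Gsq : ∀ y, G y ^ 2 = a y ^ 2 + b y ^ 2 := fun y => by
    rw [hG, Real.sq_sqrt (by positivity)]
  have ca : ∀ y ∈ O, ContDiffAt ℝ ∞ a y := fun y hy => by
    rw [funext ha]
    exact ((cap _ (cΘ y hy)).mul (cap _ (ce y hy))).sub ((cap _ (cΘ y hy)).mul (cap _ (ce y hy)))
  have cb : ∀ y ∈ O, ContDiffAt ℝ ∞ b y := fun y hy => by
    rw [funext hb]
    exact ((cap _ (cΘ y hy)).mul (cap _ (cf y hy))).sub ((cap _ (cΘ y hy)).mul (cap _ (cf y hy)))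
  have cG : ∀ y ∈ O, ContDiffAt ℝ ∞ G y := fun y hy => by
    rw [hG']
    refine (((ca y hy).pow 2).add ((cb y hy).pow 2)).sqrt ?_
    rw [← Gsq]
    exact (pow_pos (hG0 y hy) 2).ne'
  have cc : ∀ y ∈ O, ContDiffAt ℝ ∞ c y := fun y hy => by
    rw [funext hc]; exact (contDiffAt_const.mul (ca y hy)).div (cG y hy) (hG0 y hy).ne'
  have cs : ∀ y ∈ O, ContDiffAt ℝ ∞ s y := fun y hy => by
    rw [funext hs]; exact (contDiffAt_const.mul (cb y hy)).div (cG y hy) (hG0 y hy).ne'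
  have hcs : ∀ y ∈ O, c y ^ 2 + s y ^ 2 = 1 := fun y hy => by
    have := (hG0 y hy).ne'
    rw [hc, hs]
    field_simp
    rw [hς, Gsq]
    ring
  -- The sign ς is that of a on the slice. It makes the rotation the identity at time zero instead
  -- of the rotation by π.
  have slice_G : ∀ y ∈ O, τ y = 0 → G y = ς * a y := fun y hy hy0 => by
    have h1 : G y ^ 2 = (ς * a y) ^ 2 := by rw [Gsq, slice_b y hy hy0, mul_pow, hς]; ring
    exact (pow_left_inj₀ (hG0 y hy).le (slice_a y hy hy0).le (by norm_num)).1 h1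
  have slice_c : ∀ y ∈ O, τ y = 0 → c y = 1 := fun y hy hy0 => by
    rw [hc, slice_G y hy hy0, div_self (slice_a y hy hy0).ne']
  have slice_s : ∀ y ∈ O, τ y = 0 → s y = 0 := fun y hy hy0 => by
    rw [hs, slice_b y hy hy0]; simp
  -- the rotated coframe
  set e' : E → E →L[ℝ] ℝ := fun y => c y • e y + s y • f y with he'
  set f' : E → E →L[ℝ] ℝ := fun y => c y • f y - s y • e y with hf'
  set w' : E → E →L[ℝ] ℝ := rotConn w c s with hw'
  have h' : ∀ y ∈ O, StructureEqs Θ e' f' w' (Ar y * (c y ^ 2 - s y ^ 2) + 2 * Ai y * c y * s y)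
      (Ai y * (c y ^ 2 - s y ^ 2) - 2 * Ar y * c y * s y) y := fun y hy =>
    (h y hy).rotate (dd' (ce y hy)) (dd' (cf y hy)) (dd (cc y hy)) (dd (cs y hy))
      ((hnear y hy).mono hcs)
  have ce' : ∀ y ∈ O, ContDiffAt ℝ ∞ e' y := fun y hy =>
    ((cc y hy).smul (ce y hy)).add ((cs y hy).smul (cf y hy))
  have cf' : ∀ y ∈ O, ContDiffAt ℝ ∞ f' y := fun y hy =>
    ((cc y hy).smul (cf y hy)).sub ((cs y hy).smul (ce y hy))
  have cw' : ∀ y ∈ O, ContDiffAt ℝ ∞ w' y := fun y hy =>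
    (cw y hy).add (((cc y hy).smul ((cs y hy).fderiv_right (m := ∞) (by simp))).sub
      ((cs y hy).smul ((cc y hy).fderiv_right (m := ∞) (by simp))))
  have slice_e' : ∀ y ∈ O, τ y = 0 → e' y = e y := fun y hy hy0 => by
    simp [he', slice_c y hy hy0, slice_s y hy hy0]
  have slice_f' : ∀ y ∈ O, τ y = 0 → f' y = f y := fun y hy hy0 => by
    simp [hf', slice_c y hy hy0, slice_s y hy hy0]
  -- On the slice c = 1 and s = 0, and ds vanishes in slice directions, so w' = w there. No such
  -- equality holds in the time direction.
  have slice_w' : ∀ y ∈ O, τ y = 0 → Θ y b₁ * w' y b₂ - Θ y b₂ * w' y b₁ = 0 := by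
    intro y hy hy0
    have k : ∀ v, τ v = 0 → w' y v = w y v := fun v hv => by
      have : fderiv ℝ s y v = fderiv ℝ (fun _ : E => (0 : ℝ)) y v :=
        fderiv_eq_of_eqOn_slice (dd (cs y hy)) (differentiableAt_const _) hv hy0
          ((hnear y hy).mono slice_s)
      simp [hw', rotConn, slice_c y hy hy0, slice_s y hy hy0, this]
    rw [k b₁ hb₁, k b₂ hb₂]
    exact slice_w y hy hy0
  set a' : E → ℝ := fun y => Θ y b₁ * e' y b₂ - Θ y b₂ * e' y b₁ with ha'
  have a'G : ∀ y ∈ O, a' y = ς * G y := fun y hy => by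
    have h1 : a' y = c y * a y + s y * b y := by
      simp only [ha', he', ha, hb, add_apply, smul_apply, smul_eq_mul]; ring
    have := (hG0 y hy).ne'
    rw [h1, hc, hs]
    field_simp
    rw [Gsq]
  have ca' : ∀ y ∈ O, ContDiffAt ℝ ∞ a' y := fun y hy =>
    ((cap _ (cΘ y hy)).mul (cap _ (ce' y hy))).sub ((cap _ (cΘ y hy)).mul (cap _ (ce' y hy)))
  have ς0 : ς ≠ 0 := by rintro rfl; norm_num at hς
  have a'0 : ∀ y ∈ O, a' y ≠ 0 := fun y hy => by
    rw [a'G y hy]; exact mul_ne_zero ς0 (hG0 y hy).ne'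
  -- This is the purpose of the rotation: c and s are proportional to a and b, so (Θ∧f')(b₁, b₂) =
  -- cb − sa = 0 at all times and f' is a multiple of Θ on every slice.
  have b'0 : ∀ y ∈ O, Θ y b₁ * f' y b₂ - Θ y b₂ * f' y b₁ = 0 := fun y hy => by
    have h1 : Θ y b₁ * f' y b₂ - Θ y b₂ * f' y b₁ = c y * b y - s y * a y := by
      simp only [hf', ha, hb, sub_apply, smul_apply, smul_eq_mul]; ring
    rw [h1, hc, hs]
    ring
  set α' : E → ℝ := fun y => (f' y b₁ * e' y b₂ - f' y b₂ * e' y b₁) / a' y with hα'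
  have cα' : ∀ y ∈ O, ContDiffAt ℝ ∞ α' y := fun y hy =>
    (((cap _ (cf' y hy)).mul (cap _ (ce' y hy))).sub
      ((cap _ (cf' y hy)).mul (cap _ (ce' y hy)))).div (ca' y hy) (a'0 y hy)
  have slice_a' : ∀ y ∈ O, τ y = 0 → a' y = a y := fun y hy hy0 => by
    simp only [ha', slice_e' y hy hy0, ha]
  have slice_α : ∀ y ∈ O, τ y = 0 → α' y = α y := fun y hy hy0 => by
    have h0 := a'0 y hy
    rw [slice_a' y hy hy0] at h0
    simp only [hα', slice_a' y hy hy0, slice_f' y hy hy0, slice_e' y hy hy0, hα₁ y hy hy0,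
      hα₂ y hy hy0]
    rw [div_eq_iff h0, ha]
    ring
  set F' : E → ℝ := fun y => f' y b₀ - α' y * Θ y b₀ with hF'
  have cF' : ∀ y ∈ O, ContDiffAt ℝ ∞ F' y := fun y hy =>
    (cap _ (cf' y hy)).sub ((cα' y hy).mul (cap _ (cΘ y hy)))
  have slice_F : ∀ y ∈ O, τ y = 0 → F' y = F y := fun y hy hy0 => by
    simp only [hF', hF y hy hy0, slice_f' y hy hy0, slice_α y hy hy0]
  -- F and α are prescribed along the surface and agree with F' and α' at time zero only. The final
  -- formula differentiates them in slice directions alone.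
  have slice_dF : ∀ y ∈ O, τ y = 0 → ∀ v, τ v = 0 → fderiv ℝ F' y v = fderiv ℝ F y v :=
    fun y hy hy0 v hv => fderiv_eq_of_eqOn_slice (dd (cF' y hy)) (dd (cF y hy)) hv hy0
      ((hnear y hy).mono slice_F)
  have slice_dα : ∀ v, τ v = 0 → fderiv ℝ α' z v = fderiv ℝ α z v :=
    fun v hv => fderiv_eq_of_eqOn_slice (dd (cα' z hz)) (dd (cα z hz)) hv hτ
      ((hnear z hz).mono slice_α)
  set eF' : E → ℝ := fun y =>
    (Θ y b₁ * fderiv ℝ F' y b₂ - Θ y b₂ * fderiv ℝ F' y b₁) / a' y with heF'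
  have slice_eF : ∀ y ∈ O, τ y = 0 → eF' y = eF y := fun y hy hy0 => by
    simp only [heF', heF, slice_a' y hy hy0, slice_dF y hy hy0 _ hb₁, slice_dF y hy hy0 _ hb₂]
  have key := second_variation_flat hb₁ hb₂ hO (fun y hy => cap b₀ (cΘ y hy))
    (fun y hy => cap b₁ (cΘ y hy)) (fun y hy => cap b₂ (cΘ y hy)) (fun y hy => cap b₀ (ce' y hy))
    (fun y hy => cap b₁ (ce' y hy)) (fun y hy => cap b₂ (ce' y hy)) (fun y hy => cap b₀ (cf' y hy))
    (fun y hy => cap b₀ (cw' y hy)) (fun y hy => cap b₁ (cw' y hy)) (fun y hy => cap b₂ (cw' y hy))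
    cα'
    (fun y hy => (flatD_eq_components (dd' (cΘ y hy)) b₀ b₁).trans ((h' y hy).dΘ _ _))
    (fun y hy => (flatD_eq_components (dd' (cΘ y hy)) b₀ b₂).trans ((h' y hy).dΘ _ _))
    (fun y hy => (flatD_eq_components (dd' (cΘ y hy)) b₁ b₂).trans ((h' y hy).dΘ _ _))
    (fun y hy => (flatD_eq_components (dd' (ce' y hy)) b₀ b₁).trans ((h' y hy).de _ _))
    (fun y hy => (flatD_eq_components (dd' (ce' y hy)) b₀ b₂).trans ((h' y hy).de _ _))
    (fun y hy => (flatD_eq_components (dd' (ce' y hy)) b₁ b₂).trans ((h' y hy).de _ _))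
    (fun y hy => (flatD_eq_components (dd' (cf' y hy)) b₀ b₁).trans ((h' y hy).df _ _))
    (fun y hy => (flatD_eq_components (dd' (cf' y hy)) b₀ b₂).trans ((h' y hy).df _ _))
    (fun y hy => (flatD_eq_components (dd' (cf' y hy)) b₁ b₂).trans ((h' y hy).df _ _))
    (fun y hy => by
      have h0 := a'0 y hy
      have h1 := b'0 y hy
      simp only [hα']
      rw [div_mul_eq_mul_div, eq_div_iff h0]
      simp only [ha']
      linear_combination e' y b₁ * h1)
    (fun y hy => by
      have h0 := a'0 y hy
      have h1 := b'0 y hy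
      simp only [hα']
      rw [div_mul_eq_mul_div, eq_div_iff h0]
      simp only [ha']
      linear_combination e' y b₂ * h1)
    (a := a') (F := F') (eF := eF') (u := fun y => -F' y * eF' y) (fun y => rfl) a'0
    (fun y => rfl) (fun y => rfl) (fun y => rfl)
    (fun y hy hy0 => by rw [slice_e' y hy hy0]; exact slice_e y hy hy0) slice_w' hz hτ
    (W := W) (l₀ := l b₀) (l₁ := l b₁) (l₂ := l b₂)
    (by rw [flatD_eq_components (dd' (cw' z hz)), hw', flatD_rotConn (dd' (cw z hz)) (cc z hz)
          (cs z hz) ((hnear z hz).mono hcs), slice_e' z hz hτ, slice_f' z hz hτ]; exact dw _ _)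
    (by rw [flatD_eq_components (dd' (cw' z hz)), hw', flatD_rotConn (dd' (cw z hz)) (cc z hz)
          (cs z hz) ((hnear z hz).mono hcs), slice_e' z hz hτ, slice_f' z hz hτ]; exact dw _ _)
    (by rw [flatD_eq_components (dd' (cw' z hz)), hw', flatD_rotConn (dd' (cw z hz)) (cc z hz)
          (cs z hz) ((hnear z hz).mono hcs), slice_e' z hz hτ, slice_f' z hz hτ]; exact dw _ _)
  -- back to the given functions
  have ceF : ∀ y ∈ O, τ y = 0 → ContDiffAt ℝ ∞ eF y := fun y hy hy0 => by
    rw [funext heF]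
    refine (((cap _ (cΘ y hy)).mul ((cF y hy).fderiv_apply_const b₂)).sub
      ((cap _ (cΘ y hy)).mul ((cF y hy).fderiv_apply_const b₁))).div (ca y hy) ?_
    intro h0
    have := slice_a y hy hy0
    rw [h0, mul_zero] at this
    exact this.false
  have ceF' : ∀ y ∈ O, ContDiffAt ℝ ∞ eF' y := fun y hy =>
    (((cap _ (cΘ y hy)).mul ((cF' y hy).fderiv_apply_const b₂)).sub
      ((cap _ (cΘ y hy)).mul ((cF' y hy).fderiv_apply_const b₁))).div (ca' y hy) (a'0 y hy)
  have GG : ∀ y ∈ O, G y = ς * a' y := fun y hy => by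
    rw [a'G y hy, ← mul_assoc, ← pow_two, hς, one_mul]
  have e1 : (fun y => fderiv ℝ G y b₀) =ᶠ[𝓝 z] fun y => ς * fderiv ℝ a' y b₀ := by
    filter_upwards [hnear z hz] with y hy
    have : G =ᶠ[𝓝 y] fun x => ς * a' x := (hnear y hy).mono GG
    rw [this.fderiv_eq, fderiv_const_mul (dd (ca' y hy))]
    rfl
  rw [e1.fderiv_eq, fderiv_const_mul (dd ((ca' z hz).fderiv_apply_const b₀)), smul_apply,
    smul_eq_mul, key]
  have cμ : ∀ v, ContDiffAt ℝ ∞ (fun x => Θ x b₀ * e' x v - e' x b₀ * Θ x v) z := fun v =>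
    ((cap _ (cΘ z hz)).mul (cap _ (ce' z hz))).sub ((cap _ (ce' z hz)).mul (cap _ (cΘ z hz)))
  have cu : ContDiffAt ℝ ∞ u z := by
    rw [funext hu]; exact (cF z hz).neg.mul (ceF z hz hτ)
  have cu' : ContDiffAt ℝ ∞ (fun y => -F' y * eF' y) z := (cF' z hz).neg.mul (ceF' z hz)
  have slice_u : ∀ y ∈ O, τ y = 0 → -F' y * eF' y = u y := fun y hy hy0 => by
    rw [hu, slice_F y hy hy0, slice_eF y hy hy0]
  have d1 : fderiv ℝ (fun y => fderiv ℝ (fun x => Θ x b₀ * e' x b₂ - e' x b₀ * Θ x b₂) y b₀ -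
      -F' y * eF' y * Θ y b₂) z b₁ =
      fderiv ℝ (fun y => fderiv ℝ (fun x => Θ x b₀ * e' x b₂ - e' x b₀ * Θ x b₂) y b₀ -
      u y * Θ y b₂) z b₁ := by
    refine fderiv_eq_of_eqOn_slice
      (dd (((cμ b₂).fderiv_apply_const b₀).sub (cu'.mul (cap _ (cΘ z hz)))))
      (dd (((cμ b₂).fderiv_apply_const b₀).sub (cu.mul (cap _ (cΘ z hz))))) hb₁ hτ ?_
    filter_upwards [hnear z hz] with y hy hy0
    rw [slice_u y hy hy0]
  have d2 : fderiv ℝ (fun y => -fderiv ℝ (fun x => Θ x b₀ * e' x b₁ - e' x b₀ * Θ x b₁) y b₀ +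
      -F' y * eF' y * Θ y b₁) z b₂ =
      fderiv ℝ (fun y => -fderiv ℝ (fun x => Θ x b₀ * e' x b₁ - e' x b₀ * Θ x b₁) y b₀ +
      u y * Θ y b₁) z b₂ := by
    refine fderiv_eq_of_eqOn_slice
      (dd (((cμ b₁).fderiv_apply_const b₀).neg.add (cu'.mul (cap _ (cΘ z hz)))))
      (dd (((cμ b₁).fderiv_apply_const b₀).neg.add (cu.mul (cap _ (cΘ z hz))))) hb₂ hτ ?_
    filter_upwards [hnear z hz] with y hy hy0
    rw [slice_u y hy hy0]
  have m1 : fderiv ℝ (fun y => ς * (fderiv ℝ (fun x => Θ x b₀ * e' x b₂ - e' x b₀ * Θ x b₂) y b₀ -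
      u y * Θ y b₂)) z b₁ = ς * fderiv ℝ (fun y => fderiv ℝ (fun x => Θ x b₀ * e' x b₂ -
      e' x b₀ * Θ x b₂) y b₀ - u y * Θ y b₂) z b₁ := by
    rw [fderiv_const_mul (dd (((cμ b₂).fderiv_apply_const b₀).sub (cu.mul (cap _ (cΘ z hz)))))]
    rfl
  have m2 : fderiv ℝ (fun y => ς * (-fderiv ℝ (fun x => Θ x b₀ * e' x b₁ - e' x b₀ * Θ x b₁) y b₀ +
      u y * Θ y b₁)) z b₂ = ς * fderiv ℝ (fun y => -fderiv ℝ (fun x => Θ x b₀ * e' x b₁ -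
      e' x b₀ * Θ x b₁) y b₀ + u y * Θ y b₁) z b₂ := by
    rw [fderiv_const_mul (dd (((cμ b₁).fderiv_apply_const b₀).neg.add (cu.mul (cap _ (cΘ z hz)))))]
    rfl
  have G1 : fderiv ℝ (fun y => ς * (fderiv ℝ (fun x => Θ x b₀ * (c x * e x b₂ + s x * f x b₂) -
      (c x * e x b₀ + s x * f x b₀) * Θ x b₂) y b₀ - u y * Θ y b₂)) z b₁ = _ := m1
  have G2 : fderiv ℝ (fun y => ς * (-fderiv ℝ (fun x => Θ x b₀ * (c x * e x b₁ + s x * f x b₁) -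
      (c x * e x b₀ + s x * f x b₀) * Θ x b₁) y b₀ + u y * Θ y b₁)) z b₂ = _ := m2
  rw [G1, G2, d1, d2, slice_eF z hz hτ, slice_F z hz hτ, slice_α z hz hτ, slice_dα _ hb₁,
    slice_dα _ hb₂, slice_c z hz hτ, slice_s z hz hτ, slice_a' z hz hτ, slice_G z hz hτ]
  ring

end FlatForms

/-! ### Linear algebra in the plane; left inverses of immersions -/

section PlaneAlgebra

/-- The coordinate plane. -/
abbrev Plane := EuclideanSpace ℝ (Fin 2)

/-- The standard basis of the plane. -/
def planeBasis (i : Fin 2) : Plane := EuclideanSpace.single i (1 : ℝ)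

theorem plane_eq (y : Plane) : y = y 0 • planeBasis 0 + y 1 • planeBasis 1 := by
  ext i
  fin_cases i <;> simp [planeBasis]

theorem plane_apply {F : Type*} [NormedAddCommGroup F] [NormedSpace ℝ F] (θ : Plane →L[ℝ] F)
    (y : Plane) : θ y = y 0 • θ (planeBasis 0) + y 1 • θ (planeBasis 1) := by
  conv_lhs => rw [plane_eq y]
  simp

/-- Cramer's rule. For θ = Θ and η = e¹ restricted to the surface it gives the coordinates of the
characteristic vector. -/
theorem plane_wedge_smul {θ η : Plane →L[ℝ] ℝ} {y : Plane} (h1 : θ y = 0) (h2 : η y = 1) :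
    (θ (planeBasis 0) * η (planeBasis 1) - θ (planeBasis 1) * η (planeBasis 0)) • y =
      θ (planeBasis 0) • planeBasis 1 - θ (planeBasis 1) • planeBasis 0 := by
  rw [plane_apply] at h1 h2
  simp only [smul_eq_mul] at h1 h2
  set t0 := θ (planeBasis 0)
  set t1 := θ (planeBasis 1)
  set e0 := η (planeBasis 0)
  set e1 := η (planeBasis 1)
  ext i
  fin_cases i
  · simp [planeBasis]
    linear_combination e1 * h1 - t1 * h2
  · simp [planeBasis]
    linear_combination t0 * h2 - e0 * h1

theorem plane_wedge_ne_zero {θ η : Plane →L[ℝ] ℝ} {y : Plane} (h1 : θ y = 0) (h2 : η y = 1)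
    (hθ : θ ≠ 0) :
    θ (planeBasis 0) * η (planeBasis 1) - θ (planeBasis 1) * η (planeBasis 0) ≠ 0 := by
  intro h0
  have h := plane_wedge_smul h1 h2
  rw [h0, zero_smul] at h
  have e0 : θ (planeBasis 1) = 0 := by
    have := congrArg (fun v : Plane => v 0) h
    simpa [planeBasis] using this
  have e1 : θ (planeBasis 0) = 0 := by
    have := congrArg (fun v : Plane => v 1) h
    simpa [planeBasis] using this.symm
  apply hθ
  ext v
  rw [plane_apply, e0, e1]
  simp

theorem plane_ker_eq_smul {θ : Plane →L[ℝ] ℝ} (hθ : θ ≠ 0) {y h : Plane} (hy : θ y = 0)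
    (hy0 : y ≠ 0) (hh : θ h = 0) : ∃ c : ℝ, h = c • y := by
  have hθ' : (θ : Plane →ₗ[ℝ] ℝ) ≠ 0 := fun h0 =>
    hθ (ContinuousLinearMap.ext fun v => congrArg (fun L : Plane →ₗ[ℝ] ℝ => L v) h0)
  have hr : Module.finrank ℝ (LinearMap.range (θ : Plane →ₗ[ℝ] ℝ)) = 1 := by
    rw [LinearMap.range_eq_top.2 (LinearMap.surjective hθ')]; simp
  have hk : Module.finrank ℝ (LinearMap.ker (θ : Plane →ₗ[ℝ] ℝ)) = 1 := by
    have := LinearMap.finrank_range_add_finrank_ker (θ : Plane →ₗ[ℝ] ℝ)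
    rw [hr, finrank_euclideanSpace_fin] at this
    omega
  let y' : LinearMap.ker (θ : Plane →ₗ[ℝ] ℝ) := ⟨y, hy⟩
  have hy' : y' ≠ 0 := fun h0 => hy0 (congrArg Subtype.val h0)
  obtain ⟨c, hc⟩ := (finrank_eq_one_iff_of_nonzero' y' hy').1 hk ⟨h, hh⟩
  exact ⟨c, (congrArg Subtype.val hc).symm⟩

/-- Take a linear left inverse B of the derivative of f at z₀. The map B ∘ f has the identity as
derivative there, so it is locally invertible, and r = (B ∘ f)⁻¹ ∘ B. -/
theorem exists_smooth_leftInverse {E F : Type*} [NormedAddCommGroup E] [NormedSpace ℝ E]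
    [FiniteDimensional ℝ E] [NormedAddCommGroup F] [NormedSpace ℝ F] [FiniteDimensional ℝ F]
    {f : E → F} {O : Set E} (hO : IsOpen O) (hf : ∀ z ∈ O, ContDiffAt ℝ ∞ f z) {z₀ : E}
    (hz₀ : z₀ ∈ O) (hinj : Function.Injective (fderiv ℝ f z₀)) :
    ∃ (V : Set F) (r : F → E), IsOpen V ∧ f z₀ ∈ V ∧ (∀ y ∈ V, ContDiffAt ℝ ∞ r y ∧ r y ∈ O) ∧
      ∀ᶠ z in 𝓝 z₀, r (f z) = z := by
  have : CompleteSpace E := FiniteDimensional.complete ℝ E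
  obtain ⟨B, hB⟩ := LinearMap.exists_leftInverse_of_injective
    (fderiv ℝ f z₀ : E →ₗ[ℝ] F) (LinearMap.ker_eq_bot.2 hinj)
  let B' : F →L[ℝ] E := LinearMap.toContinuousLinearMap B
  let g : E → E := fun z => B' (f z)
  have hg : ∀ z ∈ O, ContDiffAt ℝ ∞ g z := fun z hz =>
    B'.contDiff.contDiffAt.comp z (hf z hz)
  have hgd : HasFDerivAt g ((ContinuousLinearEquiv.refl ℝ E : E ≃L[ℝ] E) : E →L[ℝ] E) z₀ := by
    have h1 : HasFDerivAt g (B'.comp (fderiv ℝ f z₀)) z₀ :=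
      B'.hasFDerivAt.comp z₀ ((hf z₀ hz₀).differentiableAt (by simp)).hasFDerivAt
    convert h1 using 1
    ext v
    exact (congrArg (fun L : E →ₗ[ℝ] E => L v) hB).symm
  let h := (hg z₀ hz₀).toOpenPartialHomeomorph g hgd (by simp)
  have hh : (h : E → E) = g := rfl
  have hz₀h : z₀ ∈ h.source := (hg z₀ hz₀).mem_toOpenPartialHomeomorph_source hgd (by simp)
  -- The points where the derivative of g is invertible: the inverse has to be smooth on an open
  -- set, not merely at the image of z₀.
  let O' : Set E := O ∩ fderiv ℝ g ⁻¹' range ((↑) : (E ≃L[ℝ] E) → E →L[ℝ] E)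
  have hO' : IsOpen O' := by
    refine ContinuousOn.isOpen_inter_preimage (fun z hz => ?_) hO ContinuousLinearEquiv.isOpen
    exact (((hg z hz).fderiv_right (m := 0) (by simp)).continuousAt).continuousWithinAt
  have hz₀' : z₀ ∈ O' := ⟨hz₀, ⟨_, hgd.fderiv.symm⟩⟩
  refine ⟨B' ⁻¹' (h.target ∩ h.symm ⁻¹' O'), fun y => h.symm (B' y),
    (h.symm.isOpen_inter_preimage hO').preimage B'.continuous, ?_, ?_, ?_⟩
  · refine ⟨h.map_source hz₀h, ?_⟩
    have : h.symm (B' (f z₀)) = z₀ := h.left_inv hz₀h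
    rw [mem_preimage, this]
    exact hz₀'
  · rintro y ⟨hy1, hy2⟩
    refine ⟨?_, hy2.1⟩
    obtain ⟨L, hL⟩ := hy2.2
    have h1 := hg _ hy2.1
    have h2 : ContDiffAt ℝ ∞ h.symm (B' y) := by
      refine h.contDiffAt_symm (f₀' := L) hy1 ?_ h1
      rw [hL]
      exact (h1.differentiableAt (by simp)).hasFDerivAt
    exact h2.comp y B'.contDiff.contDiffAt
  · filter_upwards [h.open_source.mem_nhds hz₀h] with z hz using h.left_inv hz

end PlaneAlgebra

/-! ### Charts of the surface away from the boundary -/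

section InteriorCharts

variable {H : Type*} [TopologicalSpace H] {I : ModelWithCorners ℝ (EuclideanSpace ℝ (Fin 2)) H}
  {N : Type*} [TopologicalSpace N] [ChartedSpace H N]

variable (I) in
/-- The interior part of the image of the chart at `p`. -/
def chartDomain (p : N) : Set Plane := interior (extChartAt I p).target

theorem isOpen_chartDomain (p : N) : IsOpen (chartDomain I p) := isOpen_interior

theorem chartDomain_subset {p : N} {u : Plane} (hu : u ∈ chartDomain I p) :
    u ∈ (extChartAt I p).target := interior_subset hu

theorem target_mem_nhds {p : N} {u : Plane} (hu : u ∈ chartDomain I p) :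
    (extChartAt I p).target ∈ 𝓝 u := mem_interior_iff_mem_nhds.1 hu

theorem range_mem_nhds {p : N} {u : Plane} (hu : u ∈ chartDomain I p) : range I ∈ 𝓝 u :=
  mem_of_superset (target_mem_nhds hu) (extChartAt_target_subset_range p)

theorem isOpen_source_inter_preimage {p : N} {O : Set Plane} (hO : IsOpen O) :
    IsOpen ((extChartAt I p).source ∩ extChartAt I p ⁻¹' O) :=
  (continuousOn_extChartAt p).isOpen_inter_preimage (isOpen_extChartAt_source p) hO

theorem chartPartial_eq {M : Type*} [TopologicalSpace M]
    [ChartedSpace (EuclideanSpace ℝ (Fin 3)) M] [IsManifold (𝓡 3) ∞ M] (X : N → M) {p : N} {u : Plane}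
    (hu : u ∈ chartDomain I p) (i : Fin 2) : chartPartial I X p u i =
      mfderiv 𝓘(ℝ, Plane) (𝓡 3) (X ∘ (extChartAt I p).symm) u (planeBasis i) := by
  have := mfderivWithin_of_mem_nhds (I := 𝓘(ℝ, Plane)) (I' := 𝓡 3)
    (f := X ∘ (extChartAt I p).symm) (range_mem_nhds hu)
  exact congrArg (fun L : Plane →L[ℝ] EuclideanSpace ℝ (Fin 3) => L (planeBasis i)) this

variable [IsManifold I ∞ N]

theorem mem_chartDomain {p q : N} (hq : q ∈ (extChartAt I p).source) (hb : q ∉ I.boundary N) :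
    extChartAt I p q ∈ chartDomain I p := by
  have h1 : I.IsInteriorPoint q := by
    rw [← ModelWithCorners.compl_interior, mem_compl_iff, not_not] at hb
    exact hb
  have hq' : q ∈ (chartAt H p).source := by rwa [extChartAt_source] at hq
  exact (ModelWithCorners.isInteriorPoint_iff_of_mem_atlas (n := ∞) (by simp)
    (chart_mem_atlas H p) hq').1 h1

theorem not_mem_boundary {p : N} {u : Plane} (hu : u ∈ chartDomain I p) :
    (extChartAt I p).symm u ∉ I.boundary N := by
  rw [← ModelWithCorners.compl_interior, mem_compl_iff, not_not]
  have hs : (extChartAt I p).symm u ∈ (chartAt H p).source := by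
    simpa using (extChartAt I p).map_target (chartDomain_subset hu)
  refine (ModelWithCorners.isInteriorPoint_iff_of_mem_atlas (n := ∞) (by simp)
    (chart_mem_atlas H p) hs).2 ?_
  have h1 : (chartAt H p).extend I ((extChartAt I p).symm u) = u :=
    (extChartAt I p).right_inv (chartDomain_subset hu)
  rw [h1]
  exact hu

theorem contMDiffAt_symm_of_mem {p : N} {u : Plane} (hu : u ∈ chartDomain I p) :
    ContMDiffAt 𝓘(ℝ, Plane) I ∞ (extChartAt I p).symm u :=
  (contMDiffOn_extChartAt_symm p).contMDiffAt (target_mem_nhds hu)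

theorem mfderiv_symm_mfderiv_chart {p : N} {u : Plane} (hu : u ∈ chartDomain I p)
    (v : TangentSpace I ((extChartAt I p).symm u)) :
    mfderiv 𝓘(ℝ, Plane) I (extChartAt I p).symm u
      (mfderiv I 𝓘(ℝ, Plane) (extChartAt I p) ((extChartAt I p).symm u) v : Plane) = v := by
  have := mfderivWithin_extChartAt_symm_comp_mfderiv_extChartAt (I := I) (chartDomain_subset hu)
  rw [mfderivWithin_of_mem_nhds (range_mem_nhds hu)] at this
  exact congrArg (fun L : Plane →L[ℝ] Plane => L v) this

theorem mfderiv_chart_mfderiv_symm {p : N} {u : Plane} (hu : u ∈ chartDomain I p) (v : Plane) :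
    (mfderiv I 𝓘(ℝ, Plane) (extChartAt I p) ((extChartAt I p).symm u)
      (mfderiv 𝓘(ℝ, Plane) I (extChartAt I p).symm u v) : Plane) = v := by
  have := mfderiv_extChartAt_comp_mfderivWithin_extChartAt_symm (I := I) (chartDomain_subset hu)
  rw [mfderivWithin_of_mem_nhds (range_mem_nhds hu)] at this
  exact congrArg (fun L : Plane →L[ℝ] Plane => L v) this

variable (I) in
/-- The coordinates of a tangent vector of a surface. -/
def tangentCoord (p : N) (u : Plane) (v : TangentSpace I ((extChartAt I p).symm u)) : Plane :=
  mfderiv I 𝓘(ℝ, Plane) (extChartAt I p) ((extChartAt I p).symm u) v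

theorem contDiffAt_tangentCoord {X : (q : N) → TangentSpace I q} {p : N} {u : Plane}
    (hu : u ∈ chartDomain I p) (hX : ContMDiffAt I I.tangent ∞
      (fun r => (⟨r, X r⟩ : TangentBundle I N)) ((extChartAt I p).symm u)) :
    ContDiffAt ℝ ∞ (fun y => tangentCoord I p y (X ((extChartAt I p).symm y))) u := by
  have hs := (extChartAt I p).map_target (chartDomain_subset hu)
  have h1 := (contMDiffAt_tangent_section_iff hs).1 hX
  rw [← contMDiffAt_iff_contDiffAt]
  exact ContMDiffAt.comp u (f := (extChartAt I p).symm)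
    (g := fun r => (mfderiv I 𝓘(ℝ, Plane) (extChartAt I p) r (X r) : Plane)) h1
    (contMDiffAt_symm_of_mem hu)

theorem contDiffAt_comp_symm {φ : N → ℝ} {p : N} {u : Plane} (hu : u ∈ chartDomain I p)
    (hφ : ContMDiffAt I 𝓘(ℝ, ℝ) ∞ φ ((extChartAt I p).symm u)) :
    ContDiffAt ℝ ∞ (fun y => φ ((extChartAt I p).symm y)) u := by
  rw [← contMDiffAt_iff_contDiffAt]
  exact ContMDiffAt.comp u hφ (contMDiffAt_symm_of_mem hu)

theorem fderiv_comp_symm {φ : N → ℝ} {p : N} {u : Plane} (hu : u ∈ chartDomain I p)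
    (hφ : MDifferentiableAt I 𝓘(ℝ, ℝ) φ ((extChartAt I p).symm u)) (v : Plane) :
    fderiv ℝ (fun y => φ ((extChartAt I p).symm y)) u v =
      mfderiv I 𝓘(ℝ, ℝ) φ ((extChartAt I p).symm u)
        (mfderiv 𝓘(ℝ, Plane) I (extChartAt I p).symm u v) := by
  have h := mfderiv_comp u hφ ((contMDiffAt_symm_of_mem hu).mdifferentiableAt (by simp))
  rw [mfderiv_eq_fderiv] at h
  exact congrArg (fun L : Plane →L[ℝ] ℝ => L v) h

theorem tendsto_symm {p : N} {u : Plane} (hu : u ∈ chartDomain I p) :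
    Tendsto (extChartAt I p).symm (𝓝 u) (𝓝 ((extChartAt I p).symm u)) :=
  (contMDiffAt_symm_of_mem hu).continuousAt

variable {M : Type*} [TopologicalSpace M] [ChartedSpace (EuclideanSpace ℝ (Fin 3)) M]

theorem mfderiv_comp_symm {X : N → M} {p : N} {u : Plane} (hu : u ∈ chartDomain I p)
    (hX : MDifferentiableAt I (𝓡 3) X ((extChartAt I p).symm u)) (v : Plane) :
    mfderiv 𝓘(ℝ, Plane) (𝓡 3) (X ∘ (extChartAt I p).symm) u v =
      mfderiv I (𝓡 3) X ((extChartAt I p).symm u)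
        (mfderiv 𝓘(ℝ, Plane) I (extChartAt I p).symm u v) := by
  have h := mfderiv_comp u hX ((contMDiffAt_symm_of_mem hu).mdifferentiableAt (by simp))
  exact congrArg (fun L : Plane →L[ℝ] EuclideanSpace ℝ (Fin 3) => L v) h

end InteriorCharts

/-! ### The function α and the extension of the characteristic field to a frame of M -/

section SurfaceGeometry

open PseudohermitianStructure

variable {M : Type*} [TopologicalSpace M] [ChartedSpace (EuclideanSpace ℝ (Fin 3)) M]
  [IsManifold (𝓡 3) ∞ M] {P : PseudohermitianStructure M}
  {H : Type*} [TopologicalSpace H] {I : ModelWithCorners ℝ (EuclideanSpace ℝ (Fin 2)) H}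
  {N : Type*} [TopologicalSpace N] [ChartedSpace H N] {ι : N → M}
  {e₁ : (p : N) → TangentSpace I p}

variable (I) in
/-- The restriction to a surface of a 1-form at a point. -/
def surfaceForm (X : N → M) (q : N) (β : TangentSpace (𝓡 3) (X q) →L[ℝ] ℝ) : Plane →L[ℝ] ℝ :=
  β.comp (mfderiv I (𝓡 3) X q)

theorem surfaceForm_ne_zero {q : N} (hq : q ∉ singularSet I P ι) :
    surfaceForm I ι q (P.Θ (ι q)) ≠ 0 := by
  intro h
  exact hq fun v => congrArg (fun L : Plane →L[ℝ] ℝ => L v) h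

theorem IsCharacteristicField.isUnit [IsManifold I ∞ N] (he₁ : IsCharacteristicField I P ι e₁)
    {q : N} (hq : q ∉ singularSet I P ι) : P.IsUnit (ι q) (mfderiv I (𝓡 3) ι q (e₁ q)) :=
  ⟨he₁.horizontal q hq, he₁.unit q hq⟩

/-- At a nonsingular point the kernel of Θ on the tangent plane is spanned by e₁. A complementary
vector w with Θ(w) = 1 and e¹(w) = 0 maps to a·e₂ + T, and e² = aΘ holds on the plane because it
holds on e₁ and on w. -/
theorem IsCharacteristicField.exists_lift [IsManifold I ∞ N]
    (he₁ : IsCharacteristicField I P ι e₁) {q : N} (hq : q ∉ singularSet I P ι) :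
    ∃ a : ℝ, (∃ w : TangentSpace I q, mfderiv I (𝓡 3) ι q w =
      a • legendrianNormal I P ι e₁ q + P.reeb (ι q)) ∧
      ∀ v : TangentSpace I q, P.dualForm (ι q) (legendrianNormal I P ι e₁ q)
        (mfderiv I (𝓡 3) ι q v) = a * P.Θ (ι q) (mfderiv I (𝓡 3) ι q v) := by
  have hx := he₁.isUnit hq
  have hθ := surfaceForm_ne_zero hq
  set x := mfderiv I (𝓡 3) ι q (e₁ q) with hxdef
  have hn : legendrianNormal I P ι e₁ q = P.J (ι q) x := rfl
  let θ := surfaceForm I ι q (P.Θ (ι q))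
  let e := surfaceForm I ι q (P.dualForm (ι q) x)
  let f := surfaceForm I ι q (P.dualForm (ι q) (P.J (ι q) x))
  obtain ⟨y, hy⟩ : ∃ y : Plane, y = e₁ q := ⟨e₁ q, rfl⟩
  have hθx : θ y = 0 := by rw [hy]; exact hx.1
  have hex : e y = 1 := by rw [hy]; exact hx.dualForm_self
  have hfx : f y = 0 := by rw [hy]; exact hx.dualForm_J_self
  obtain ⟨v₀, hv₀⟩ : ∃ v : Plane, θ v ≠ 0 := by
    by_contra! h
    exact hθ (ContinuousLinearMap.ext h)
  obtain ⟨v₁, hv₁⟩ : ∃ v₁ : Plane, θ v₁ = 1 := ⟨(θ v₀)⁻¹ • v₀, by simp [hv₀]⟩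
  -- Subtracting the e₁ component leaves Θ(w) = 1 unchanged, since Θ(e₁) = 0.
  let w : Plane := v₁ - e v₁ • y
  have hθw : θ w = 1 := by rw [map_sub, map_smul, hv₁, hθx]; simp
  have hew : e w = 0 := by rw [map_sub, map_smul, hex]; simp
  refine ⟨f w, ⟨w, ?_⟩, fun v => ?_⟩
  · have hd := hx.decomposition (mfderiv I (𝓡 3) ι q w)
    have h1 : P.dualForm (ι q) x (mfderiv I (𝓡 3) ι q w) = 0 := hew
    have h2 : P.Θ (ι q) (mfderiv I (𝓡 3) ι q w) = 1 := hθw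
    rw [h1, h2, zero_smul, zero_add, one_smul] at hd
    exact hd
  · obtain ⟨v', hv'⟩ : ∃ v' : Plane, v' = v := ⟨v, rfl⟩
    have h1 : θ (v' - θ v' • w) = 0 := by rw [map_sub, map_smul, hθw]; simp
    have h0 : y ≠ 0 := by rintro h0; rw [h0, map_zero] at hex; norm_num at hex
    obtain ⟨c, hc⟩ := plane_ker_eq_smul hθ hθx h0 h1
    have h2 : f (v' - θ v' • w) = 0 := by rw [hc, map_smul, hfx]; simp
    rw [map_sub, map_smul, sub_eq_zero] at h2
    rw [hn, mul_comm, ← hv']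
    exact h2

/-- Any number admissible in the choice of α is recovered by applying e² to the tangent vector, so
it is the one from `exists_lift`. -/
theorem IsCharacteristicField.alphaFun_spec [IsManifold I ∞ N]
    (he₁ : IsCharacteristicField I P ι e₁) {q : N} (hq : q ∉ singularSet I P ι) :
    (∃ w : TangentSpace I q, mfderiv I (𝓡 3) ι q w =
      alphaFun I P ι e₁ q • legendrianNormal I P ι e₁ q + P.reeb (ι q)) ∧
      ∀ v : TangentSpace I q, P.dualForm (ι q) (legendrianNormal I P ι e₁ q)
        (mfderiv I (𝓡 3) ι q v) =
          alphaFun I P ι e₁ q * P.Θ (ι q) (mfderiv I (𝓡 3) ι q v) := by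
  obtain ⟨a, hw, ha⟩ := he₁.exists_lift hq
  have hspec : ∃ w : TangentSpace I q, mfderiv I (𝓡 3) ι q w =
      alphaFun I P ι e₁ q • legendrianNormal I P ι e₁ q + P.reeb (ι q) :=
    Classical.epsilon_spec (p := fun a : ℝ => ∃ w : TangentSpace I q, mfderiv I (𝓡 3) ι q w =
      a • legendrianNormal I P ι e₁ q + P.reeb (ι q)) ⟨a, hw⟩
  have hx := he₁.isUnit hq
  have hJJ : P.dualForm (ι q) (legendrianNormal I P ι e₁ q) (legendrianNormal I P ι e₁ q) = 1 :=
    hx.J.dualForm_self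
  have hΘ : P.Θ (ι q) (legendrianNormal I P ι e₁ q) = 0 := hx.J.1
  obtain ⟨w, hw⟩ := hspec
  have h := ha w
  rw [hw] at h
  simp only [map_add, map_smul, hJJ, hΘ, dualForm_reeb, P.Θ_reeb, smul_eq_mul] at h
  have h' : alphaFun I P ι e₁ q = a := by linarith
  exact ⟨⟨w, hw⟩, h' ▸ ha⟩

variable (I P ι e₁) in
/-- A tangent vector that is mapped to `α e₂ + T`. -/
def charLift (q : N) : TangentSpace I q := Classical.epsilon fun w : TangentSpace I q =>
  mfderiv I (𝓡 3) ι q w = alphaFun I P ι e₁ q • legendrianNormal I P ι e₁ q + P.reeb (ι q)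

theorem IsCharacteristicField.mfderiv_charLift [IsManifold I ∞ N]
    (he₁ : IsCharacteristicField I P ι e₁) {q : N} (hq : q ∉ singularSet I P ι) :
    mfderiv I (𝓡 3) ι q (charLift P I ι e₁ q) =
      alphaFun I P ι e₁ q • legendrianNormal I P ι e₁ q + P.reeb (ι q) :=
  Classical.epsilon_spec (he₁.alphaFun_spec hq).1

variable [IsManifold I ∞ N]

theorem contMDiffAt_comp_symm {X : N → M} (hX : ContMDiff I (𝓡 3) ∞ X) {p : N} {u : Plane}
    (hu : u ∈ chartDomain I p) :
    ContMDiffAt 𝓘(ℝ, Plane) (𝓡 3) ∞ (X ∘ (extChartAt I p).symm) u :=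
  (hX _).comp u (contMDiffAt_symm_of_mem hu)

theorem pullbackForm_tangentCoord {X : N → M} (hX : ContMDiff I (𝓡 3) ∞ X) {p : N} {u : Plane}
    (hu : u ∈ chartDomain I p) (β : (q : M) → TangentSpace (𝓡 3) q →L[ℝ] ℝ)
    (v : TangentSpace I ((extChartAt I p).symm u)) :
    pullbackForm (X ∘ (extChartAt I p).symm) β u (tangentCoord I p u v) =
      β (X ((extChartAt I p).symm u)) (mfderiv I (𝓡 3) X ((extChartAt I p).symm u) v) := by
  have h := mfderiv_comp_symm (X := X) hu ((hX _).mdifferentiableAt (by simp))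
    (tangentCoord I p u v)
  have h2 := mfderiv_symm_mfderiv_chart hu v
  have h3 : mfderiv 𝓘(ℝ, Plane) (𝓡 3) (X ∘ (extChartAt I p).symm) u (tangentCoord I p u v) =
      mfderiv I (𝓡 3) X ((extChartAt I p).symm u) v :=
    h.trans (congrArg (mfderiv I (𝓡 3) X ((extChartAt I p).symm u)) h2)
  exact congrArg (β (X ((extChartAt I p).symm u))) h3

theorem not_mem_singularSet_iff (hι : ContMDiff I (𝓡 3) ∞ ι) {p : N} {u : Plane}
    (hu : u ∈ chartDomain I p) : (extChartAt I p).symm u ∉ singularSet I P ι ↔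
      pullbackForm (ι ∘ (extChartAt I p).symm) P.Θ u ≠ 0 := by
  refine not_congr ⟨fun h => ?_, fun h v => ?_⟩
  · ext v
    have h1 := mfderiv_comp_symm (X := ι) hu ((hι _).mdifferentiableAt (by simp)) v
    exact (congrArg (P.Θ (ι ((extChartAt I p).symm u))) h1).trans (h _)
  · rw [← pullbackForm_tangentCoord hι hu, h]
    rfl

theorem isOpen_chartDomain_diff_singularSet (hι : ContMDiff I (𝓡 3) ∞ ι) (p : N) :
    IsOpen {u | u ∈ chartDomain I p ∧ (extChartAt I p).symm u ∉ singularSet I P ι} := by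
  have h1 : ContinuousOn (pullbackForm (ι ∘ (extChartAt I p).symm) P.Θ) (chartDomain I p) :=
    fun u hu => (contDiffAt_pullbackForm (contMDiffAt_comp_symm hι hu)
      (P.smoothFormAt_Θ _)).continuousAt.continuousWithinAt
  have h2 := h1.isOpen_inter_preimage (isOpen_chartDomain p) (isOpen_compl_singleton (x := 0))
  convert h2 using 1
  ext u
  exact and_congr_right fun hu => not_mem_singularSet_iff hι hu

/-- In charts the immersion has a smooth left inverse r near p. The coefficients of e₁ in an ambient
frame, functions on the surface, are composed with r to give functions near ι p; the resulting
horizontal field is nonzero at ι p and is normalized. -/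
theorem IsCharacteristicField.exists_frame_extension (he₁ : IsCharacteristicField I P ι e₁)
    (hι : ContMDiff I (𝓡 3) ∞ ι) {p : N} (hinj : Function.Injective (mfderiv I (𝓡 3) ι p))
    (hp : p ∉ singularSet I P ι) (hb : p ∉ I.boundary N) :
    ∃ U E₁, ι p ∈ U ∧ P.IsUnitaryFrameOn U E₁ ∧
      ∀ᶠ q in 𝓝 p, E₁ (ι q) = mfderiv I (𝓡 3) ι q (e₁ q) := by
  obtain ⟨U₀, E₀, hU₀, h₀⟩ := P.exists_unitaryFrame (ι p)
  set u₀ := extChartAt I p p with hu₀def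
  have hu₀ : u₀ ∈ chartDomain I p := mem_chartDomain (mem_extChartAt_source p) hb
  have hσ₀ : (extChartAt I p).symm u₀ = p := extChartAt_to_inv p
  set F : Plane → M := ι ∘ (extChartAt I p).symm with hF
  have hF₀ : F u₀ = ι p := by rw [hF, Function.comp_apply, hσ₀]
  have hFs : ∀ u ∈ chartDomain I p, ContMDiffAt 𝓘(ℝ, Plane) (𝓡 3) ∞ F u := fun u hu =>
    contMDiffAt_comp_symm hι hu
  have hFc : ContinuousOn F (chartDomain I p) := fun u hu =>
    (hFs u hu).continuousAt.continuousWithinAt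
  let O : Set Plane := {u | u ∈ chartDomain I p ∧ (extChartAt I p).symm u ∉ singularSet I P ι} ∩
    (chartDomain I p ∩ F ⁻¹' (U₀ ∩ (extChartAt (𝓡 3) (ι p)).source))
  have hO : IsOpen O := (isOpen_chartDomain_diff_singularSet hι p).inter
    (hFc.isOpen_inter_preimage (isOpen_chartDomain p)
      (h₀.isOpen.inter (isOpen_extChartAt_source (ι p))))
  have hu₀O : u₀ ∈ O := by
    refine ⟨⟨hu₀, ?_⟩, hu₀, ?_⟩
    · rw [hσ₀]; exact hp
    · rw [mem_preimage, hF₀]; exact ⟨hU₀, mem_extChartAt_source _⟩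
  let f' : Plane → EuclideanSpace ℝ (Fin 3) := fun u => extChartAt (𝓡 3) (ι p) (F u)
  have hf' : ∀ u ∈ O, ContDiffAt ℝ ∞ f' u := fun u hu =>
    extChartAt_comp_contDiffAt (hFs u hu.1.1) hu.2.2.2
  have hinj' : Function.Injective (fderiv ℝ f' u₀) := by
    rw [injective_iff_map_eq_zero]
    intro v hv
    have h1 := fderiv_chart_comp ((hFs u₀ hu₀).mdifferentiableAt (by simp)) hu₀O.2.2.2 v
    have h2 := h1.symm.trans hv
    have h3 : Function.Injective (mfderiv (𝓡 3) 𝓘(ℝ, EuclideanSpace ℝ (Fin 3))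
        (extChartAt (𝓡 3) (ι p)) (F u₀)) :=
      (isInvertible_mfderiv_extChartAt (I := 𝓡 3) hu₀O.2.2.2).injective
    have h4 : mfderiv 𝓘(ℝ, Plane) (𝓡 3) F u₀ v = 0 := h3 (h2.trans (map_zero _).symm)
    have h5 := (mfderiv_comp_symm (X := ι) hu₀ ((hι _).mdifferentiableAt (by simp)) v).symm.trans h4
    have hinj2 : ∀ q, q = p → Function.Injective (mfderiv I (𝓡 3) ι q) := by
      rintro q rfl; exact hinj
    have h6 := hinj2 _ hσ₀ (h5.trans (map_zero _).symm)
    have h7 := mfderiv_chart_mfderiv_symm hu₀ v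
    rw [← h7]
    exact (congrArg (mfderiv I 𝓘(ℝ, Plane) (extChartAt I p) ((extChartAt I p).symm u₀)) h6).trans
      (map_zero _)
  obtain ⟨V, r, hV, hV₀, hr, hleft⟩ := exists_smooth_leftInverse hO hf' hu₀O hinj'
  have cE : ∀ u ∈ O, ContDiffAt ℝ ∞ (fun y => tangentCoord I p y (e₁ ((extChartAt I p).symm y))) u := by
    intro u hu
    refine contDiffAt_tangentCoord hu.1.1 ((he₁.smooth _ hu.1.2).contMDiffAt ?_)
    have h1 : ∀ᶠ y in 𝓝 u, y ∈ O := hO.mem_nhds hu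
    have h2 := isOpen_source_inter_preimage (I := I) (p := p) hO
    have hs := (extChartAt I p).map_target (chartDomain_subset hu.1.1)
    refine mem_of_superset (h2.mem_nhds ⟨hs, ?_⟩) ?_
    · rw [mem_preimage, (extChartAt I p).right_inv (chartDomain_subset hu.1.1)]; exact hu
    · rintro q ⟨hq1, hq2⟩
      have := hq2.1.2
      rw [(extChartAt I p).left_inv hq1] at this
      exact this
  -- The value β(e₁) at the surface point with coordinates r(x). For β = e¹, e² of the ambient frame
  -- these are the extended coefficients.
  let cf : ((q : M) → TangentSpace (𝓡 3) q →L[ℝ] ℝ) → M → ℝ := fun β x =>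
    pullbackForm F β (r (extChartAt (𝓡 3) (ι p) x))
      (tangentCoord I p (r (extChartAt (𝓡 3) (ι p) x))
        (e₁ ((extChartAt I p).symm (r (extChartAt (𝓡 3) (ι p) x)))))
  let V' : Set M := ((extChartAt (𝓡 3) (ι p)).source ∩ extChartAt (𝓡 3) (ι p) ⁻¹' V) ∩ U₀
  have hV' : IsOpen V' := ((continuousOn_extChartAt (ι p)).isOpen_inter_preimage
    (isOpen_extChartAt_source _) hV).inter h₀.isOpen
  have hpV' : ι p ∈ V' := by
    refine ⟨⟨mem_extChartAt_source _, ?_⟩, hU₀⟩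
    have : f' u₀ = extChartAt (𝓡 3) (ι p) (ι p) := by simp only [f', hF₀]
    rw [mem_preimage, ← this]
    exact hV₀
  have hcf : ∀ β, (∀ q ∈ U₀, SmoothFormAt β q) → ∀ x ∈ V',
      ContMDiffAt (𝓡 3) 𝓘(ℝ, ℝ) ∞ (cf β) x := by
    intro β hβ x hx
    have hrx := hr _ hx.1.2
    have h1 : ContDiffAt ℝ ∞ (fun u => pullbackForm F β u
        (tangentCoord I p u (e₁ ((extChartAt I p).symm u)))) (r (extChartAt (𝓡 3) (ι p) x)) :=
      (contDiffAt_pullbackForm (hFs _ hrx.2.1.1) (hβ _ hrx.2.2.2.1)).clm_apply (cE _ hrx.2)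
    have h2 := ContDiffAt.comp (extChartAt (𝓡 3) (ι p) x) h1 hrx.1
    exact ContMDiffAt.comp x h2.contMDiffAt (contMDiffAt_extChartAt' (by simpa using hx.1.1))
  have key : ∀ᶠ u in 𝓝 u₀, u ∈ O ∧ cf (P.coframe₁ E₀) (F u) • E₀ (F u) +
      cf (P.coframe₂ E₀) (F u) • P.J (F u) (E₀ (F u)) =
      mfderiv I (𝓡 3) ι ((extChartAt I p).symm u) (e₁ ((extChartAt I p).symm u)) := by
    filter_upwards [hleft, hO.mem_nhds hu₀O] with u hu huO
    have hx := he₁.isUnit huO.1.2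
    have hd := (h₀.isUnit huO.2.2.1).decomposition
      (mfderiv I (𝓡 3) ι ((extChartAt I p).symm u) (e₁ ((extChartAt I p).symm u)))
    have hx0 : P.Θ (F u) (mfderiv I (𝓡 3) ι ((extChartAt I p).symm u)
      (e₁ ((extChartAt I p).symm u))) = 0 := hx.1
    rw [hx0, zero_smul, add_zero] at hd
    have hcfu : ∀ β, cf β (F u) = β (F u)
        (mfderiv I (𝓡 3) ι ((extChartAt I p).symm u) (e₁ ((extChartAt I p).symm u))) := by
      intro β
      have h1 : cf β (F u) = pullbackForm F β (r (f' u))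
        (tangentCoord I p (r (f' u)) (e₁ ((extChartAt I p).symm (r (f' u))))) := rfl
      rw [h1, hu]
      exact pullbackForm_tangentCoord hι huO.1.1 β _
    rw [hcfu, hcfu]
    exact ⟨huO, hd.symm⟩
  have hkp := key.self_of_nhds.2
  have hp' : ∀ q, q = p → q ∉ singularSet I P ι := by rintro q rfl; exact hp
  obtain ⟨U, hUV, hpU, h⟩ := exists_unitaryFrame_of_field (P := P) (p := ι p)
    (X := fun x => cf (P.coframe₁ E₀) x • E₀ x + cf (P.coframe₂ E₀) x • P.J x (E₀ x)) hV' hpV'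
    (fun x hx => (SmoothFieldAt.smul (hcf _ (fun q hq => h₀.smoothFormAt_coframe₁ hq) x hx)
      (h₀.smoothFieldAt hx.2)).add (SmoothFieldAt.smul
        (hcf _ (fun q hq => h₀.smoothFormAt_coframe₂ hq) x hx)
        (P.smoothFieldAt_J (h₀.smoothFieldAt hx.2))))
    (fun x hx => by simp [(h₀.isUnit hx.2).1, (h₀.isUnit hx.2).J.1])
    (by
      have h1 : ∀ x, x = ι p → cf (P.coframe₁ E₀) x • E₀ x +
          cf (P.coframe₂ E₀) x • P.J x (E₀ x) ≠ 0 →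
          cf (P.coframe₁ E₀) (ι p) • E₀ (ι p) +
            cf (P.coframe₂ E₀) (ι p) • P.J (ι p) (E₀ (ι p)) ≠ 0 := by
        rintro x rfl h; exact h
      refine h1 _ hF₀ ?_
      rw [hkp]
      intro h0
      have h2 := (he₁.isUnit (hp' _ hσ₀)).2
      rw [h0] at h2
      simp only [levi, map_zero, mul_zero] at h2
      norm_num at h2)
  refine ⟨U, _, hpU, h, ?_⟩
  have hφ : Tendsto (extChartAt I p) (𝓝 p) (𝓝 u₀) := continuousAt_extChartAt p
  filter_upwards [hφ.eventually key, (isOpen_extChartAt_source (I := I) p).mem_nhds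
    (mem_extChartAt_source p)] with q hq hqs
  obtain ⟨hqO, hqk⟩ := hq
  have hq' : ∀ q', q' = q → cf (P.coframe₁ E₀) (ι q') • E₀ (ι q') +
      cf (P.coframe₂ E₀) (ι q') • P.J (ι q') (E₀ (ι q')) = mfderiv I (𝓡 3) ι q' (e₁ q') →
      cf (P.coframe₁ E₀) (ι q) • E₀ (ι q) +
      cf (P.coframe₂ E₀) (ι q) • P.J (ι q) (E₀ (ι q)) = mfderiv I (𝓡 3) ι q (e₁ q) := by
    rintro q' rfl h; exact h
  have hq2 := hq' _ ((extChartAt I p).left_inv hqs) hqk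
  have hqS : q ∉ singularSet I P ι := by
    have := hqO.1.2
    rwa [(extChartAt I p).left_inv hqs] at this
  rw [hq2, he₁.unit q hqS]
  simp

/-- The coordinates of the characteristic field, for a coframe adapted to it. -/
theorem IsCharacteristicField.wedge_smul_tangentCoord (he₁ : IsCharacteristicField I P ι e₁)
    (hι : ContMDiff I (𝓡 3) ∞ ι) {p : N} {u : Plane} (hu : u ∈ chartDomain I p)
    (hS : (extChartAt I p).symm u ∉ singularSet I P ι)
    {E₁ : (q : M) → TangentSpace (𝓡 3) q} (hE : E₁ (ι ((extChartAt I p).symm u)) =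
      mfderiv I (𝓡 3) ι ((extChartAt I p).symm u) (e₁ ((extChartAt I p).symm u)))
    {θ η : Plane →L[ℝ] ℝ} (hθ : θ = pullbackForm (ι ∘ (extChartAt I p).symm) P.Θ u)
    (hη : η = pullbackForm (ι ∘ (extChartAt I p).symm) (P.coframe₁ E₁) u) :
    θ (planeBasis 0) * η (planeBasis 1) - θ (planeBasis 1) * η (planeBasis 0) ≠ 0 ∧
    (θ (planeBasis 0) * η (planeBasis 1) - θ (planeBasis 1) * η (planeBasis 0)) •
      tangentCoord I p u (e₁ ((extChartAt I p).symm u)) =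
      θ (planeBasis 0) • planeBasis 1 - θ (planeBasis 1) • planeBasis 0 := by
  have hx := he₁.isUnit hS
  have h1 : θ (tangentCoord I p u (e₁ ((extChartAt I p).symm u))) = 0 := by
    rw [hθ, pullbackForm_tangentCoord hι hu]; exact hx.1
  have h2 : η (tangentCoord I p u (e₁ ((extChartAt I p).symm u))) = 1 := by
    rw [hη, pullbackForm_tangentCoord hι hu, coframe₁, hE]; exact hx.dualForm_self
  refine ⟨plane_wedge_ne_zero h1 h2 ?_, plane_wedge_smul h1 h2⟩
  rw [hθ]
  exact (not_mem_singularSet_iff hι hu).1 hS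

end SurfaceGeometry

/-! ### Characteristic vectors and the flux of a variation -/

namespace PseudohermitianStructure

variable {M : Type*} [TopologicalSpace M] [ChartedSpace (EuclideanSpace ℝ (Fin 3)) M]
  [IsManifold (𝓡 3) ∞ M] {P : PseudohermitianStructure M} {r : M} {x : TangentSpace (𝓡 3) r}

variable (P) in
/-- The horizontal vector `Θ(w) v - Θ(v) w` in the plane spanned by `v` and `w`, normalized. -/
def charUnit (r : M) (v w : TangentSpace (𝓡 3) r) : TangentSpace (𝓡 3) r :=
  (√(P.levi r (P.Θ r w • v - P.Θ r v • w) (P.Θ r w • v - P.Θ r v • w)))⁻¹ •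
    (P.Θ r w • v - P.Θ r v • w)

/-- The vector Θ(w)v − Θ(v)w has frame coordinates (da, db), hence length |d|G = ςdG. After
normalization the determinant d drops out except for its sign, so the dual form is exactly the
rotated e¹ with coefficients ςa/G and ςb/G. -/
theorem IsUnit.charUnit_eq (hx : P.IsUnit r x) {v w : TangentSpace (𝓡 3) r} {a b d ς G : ℝ}
    (ha : P.Θ r w * P.dualForm r x v - P.Θ r v * P.dualForm r x w = d * a)
    (hb : P.Θ r w * P.dualForm r (P.J r x) v - P.Θ r v * P.dualForm r (P.J r x) w = d * b)
    (hς : ς ^ 2 = 1) (hd : 0 < ς * d) (hG : G = √(a ^ 2 + b ^ 2)) (hG0 : 0 < G) :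
    P.areaDensity r v w = ς * d * G ∧ ∀ z, P.dualForm r (P.charUnit r v w) z =
      ς * a / G * P.dualForm r x z + ς * b / G * P.dualForm r (P.J r x) z := by
  have hG2 : G ^ 2 = a ^ 2 + b ^ 2 := by rw [hG, Real.sq_sqrt (by positivity)]
  have hsq : √((d * a) ^ 2 + (d * b) ^ 2) = ς * d * G := by
    have : (d * a) ^ 2 + (d * b) ^ 2 = (ς * d * G) ^ 2 := by
      rw [mul_pow (ς * d), mul_pow ς, hς, hG2]; ring
    rw [this, Real.sqrt_sq (by positivity)]
  constructor
  · rw [hx.areaDensity_eq, ← hsq, ← ha, ← hb]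
    congr 1
    ring
  · intro z
    set y := P.Θ r w • v - P.Θ r v • w with hy
    have hy0 : P.Θ r y = 0 := by simp [hy]; ring
    have he : P.dualForm r x y = d * a := by rw [← ha]; simp [hy]
    have hf : P.dualForm r (P.J r x) y = d * b := by rw [← hb]; simp [hy]
    have hl : P.levi r y y = (d * a) ^ 2 + (d * b) ^ 2 := by
      rw [levi_eq_dualForm, hx.dualForm_eq hy0, he, hf]; ring
    have hc : P.charUnit r v w = (ς * d * G)⁻¹ • y := by
      rw [← hsq, ← hl]; rfl
    rw [hc, hx.dualForm_eq (by simp [hy0]), map_smul, map_smul, he, hf, smul_eq_mul, smul_eq_mul]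
    have hd0 : d ≠ 0 := by rintro rfl; simp at hd
    have hς0 : ς ≠ 0 := by rintro rfl; simp at hd
    have hς' : ς⁻¹ = ς := inv_eq_of_mul_eq_one_left (by rw [← pow_two]; exact hς)
    have h1 : (ς * d * G)⁻¹ * (d * a) = ς * a / G := by
      rw [mul_inv, mul_inv, hς']; field_simp
    have h2 : (ς * d * G)⁻¹ * (d * b) = ς * b / G := by
      rw [mul_inv, mul_inv, hς']; field_simp
    rw [h1, h2]

end PseudohermitianStructure

section Variations

open PseudohermitianStructure

variable {M : Type*} [TopologicalSpace M] [ChartedSpace (EuclideanSpace ℝ (Fin 3)) M]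
  {H : Type*} [TopologicalSpace H] {I : ModelWithCorners ℝ (EuclideanSpace ℝ (Fin 2)) H}
  {N : Type*} [TopologicalSpace N] [ChartedSpace H N]

variable (I) in
/-- A variation of a surface in the chart at `p`. -/
def chartVariation (Φ : ℝ → N → M) (p : N) (z : ℝ × Plane) : M :=
  Φ z.1 ((extChartAt I p).symm z.2)

/-- The velocity of a variation. -/
def velocity (Φ : ℝ → N → M) (t : ℝ) (q : N) : TangentSpace (𝓡 3) (Φ t q) :=
  (mfderiv 𝓘(ℝ, ℝ) (𝓡 3) (fun s => Φ s q) t : ℝ →L[ℝ] EuclideanSpace ℝ (Fin 3)) 1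

variable [IsManifold I ∞ N] {Φ : ℝ → N → M} {ε : ℝ}

theorem contMDiff_variation (hΦ : ContMDiffOn (𝓘(ℝ, ℝ).prod I) (𝓡 3) ∞
    (fun x : ℝ × N => Φ x.1 x.2) (Ioo (-ε) ε ×ˢ univ)) {t : ℝ} (ht : t ∈ Ioo (-ε) ε) :
    ContMDiff I (𝓡 3) ∞ (Φ t) := by
  intro q
  have h1 : ContMDiffAt (𝓘(ℝ, ℝ).prod I) (𝓡 3) ∞ (fun x : ℝ × N => Φ x.1 x.2) (t, q) :=
    hΦ.contMDiffAt ((isOpen_Ioo.prod isOpen_univ).mem_nhds ⟨ht, mem_univ _⟩)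
  have h2 : ContMDiffAt I (𝓘(ℝ, ℝ).prod I) ∞ (fun q : N => (t, q)) q :=
    contMDiffAt_const.prodMk contMDiffAt_id
  exact ContMDiffAt.comp q (f := fun q : N => (t, q)) h1 h2

theorem contMDiffAt_chartVariation (hΦ : ContMDiffOn (𝓘(ℝ, ℝ).prod I) (𝓡 3) ∞
    (fun x : ℝ × N => Φ x.1 x.2) (Ioo (-ε) ε ×ˢ univ)) {p : N} {t : ℝ} {u : Plane}
    (ht : t ∈ Ioo (-ε) ε) (hu : u ∈ chartDomain I p) :
    ContMDiffAt 𝓘(ℝ, ℝ × Plane) (𝓡 3) ∞ (chartVariation I Φ p) (t, u) := by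
  have h1 : ContMDiffAt (𝓘(ℝ, ℝ).prod I) (𝓡 3) ∞ (fun x : ℝ × N => Φ x.1 x.2)
      (t, (extChartAt I p).symm u) :=
    hΦ.contMDiffAt ((isOpen_Ioo.prod isOpen_univ).mem_nhds ⟨ht, mem_univ _⟩)
  have h2 : ContMDiffAt 𝓘(ℝ, ℝ × Plane) 𝓘(ℝ, ℝ) ∞ (fun z : ℝ × Plane => z.1) (t, u) :=
    contDiff_fst.contMDiff.contMDiffAt
  have h3 : ContMDiffAt 𝓘(ℝ, ℝ × Plane) 𝓘(ℝ, Plane) ∞ (fun z : ℝ × Plane => z.2) (t, u) :=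
    contDiff_snd.contMDiff.contMDiffAt
  exact ContMDiffAt.comp (t, u) h1 (h2.prodMk
    (ContMDiffAt.comp (t, u) (contMDiffAt_symm_of_mem hu) h3))

theorem pullbackForm_chartVariation (hΦ : ContMDiffOn (𝓘(ℝ, ℝ).prod I) (𝓡 3) ∞
    (fun x : ℝ × N => Φ x.1 x.2) (Ioo (-ε) ε ×ˢ univ)) {p : N} {t : ℝ} {u : Plane}
    (ht : t ∈ Ioo (-ε) ε) (hu : u ∈ chartDomain I p)
    (β : (q : M) → TangentSpace (𝓡 3) q →L[ℝ] ℝ) (y : Plane) :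
    pullbackForm (chartVariation I Φ p) β (t, u) (0, y) =
      pullbackForm (Φ t ∘ (extChartAt I p).symm) β u y := by
  have h1 := (contMDiffAt_chartVariation hΦ ht hu).mdifferentiableAt (by simp)
  have h2 : HasFDerivAt (fun v : Plane => (t, v)) (ContinuousLinearMap.inr ℝ ℝ Plane) u :=
    hasFDerivAt_prodMk_right t u
  have h3 := h1.hasMFDerivAt.comp u h2.hasMFDerivAt
  have h4 := h3.mfderiv
  exact (congrArg (fun L : Plane →L[ℝ] EuclideanSpace ℝ (Fin 3) =>
    β (Φ t ((extChartAt I p).symm u)) (L y)) h4).symm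

theorem pullbackForm_chartVariation_time (hΦ : ContMDiffOn (𝓘(ℝ, ℝ).prod I) (𝓡 3) ∞
    (fun x : ℝ × N => Φ x.1 x.2) (Ioo (-ε) ε ×ˢ univ)) {p : N} {t : ℝ} {u : Plane}
    (ht : t ∈ Ioo (-ε) ε) (hu : u ∈ chartDomain I p)
    (β : (q : M) → TangentSpace (𝓡 3) q →L[ℝ] ℝ) :
    pullbackForm (chartVariation I Φ p) β (t, u) (1, 0) =
      β (Φ t ((extChartAt I p).symm u)) (velocity Φ t ((extChartAt I p).symm u)) := by
  have h1 := (contMDiffAt_chartVariation hΦ ht hu).mdifferentiableAt (by simp)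
  have h2 : HasFDerivAt (fun s : ℝ => (s, u)) (ContinuousLinearMap.inl ℝ ℝ Plane) t :=
    hasFDerivAt_prodMk_left t u
  have h3 := h1.hasMFDerivAt.comp t h2.hasMFDerivAt
  have h4 := h3.mfderiv
  exact (congrArg (fun L : ℝ →L[ℝ] EuclideanSpace ℝ (Fin 3) =>
    β (Φ t ((extChartAt I p).symm u)) (L 1)) h4).symm

theorem mdifferentiableAt_of_comp_symm {φ : N → ℝ} {p : N} {u : Plane} (hu : u ∈ chartDomain I p)
    (h : DifferentiableAt ℝ (fun y => φ ((extChartAt I p).symm y)) u) :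
    MDifferentiableAt I 𝓘(ℝ, ℝ) φ ((extChartAt I p).symm u) := by
  have hs := (extChartAt I p).map_target (chartDomain_subset hu)
  have h0 : extChartAt I p ((extChartAt I p).symm u) = u :=
    (extChartAt I p).right_inv (chartDomain_subset hu)
  have h1 : MDifferentiableAt I 𝓘(ℝ, Plane) (extChartAt I p) ((extChartAt I p).symm u) :=
    mdifferentiableAt_extChartAt (by simpa using hs)
  have h2 : MDifferentiableAt 𝓘(ℝ, Plane) 𝓘(ℝ, ℝ) (fun y => φ ((extChartAt I p).symm y))
      (extChartAt I p ((extChartAt I p).symm u)) := by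
    rw [h0]; exact h.mdifferentiableAt
  refine (h2.comp _ h1).congr_of_eventuallyEq ?_
  filter_upwards [(isOpen_extChartAt_source p).mem_nhds hs] with q hq
  rw [Function.comp_apply, (extChartAt I p).left_inv hq]

theorem charDeriv_eq {φ : N → ℝ} {p : N} {u : Plane} (hu : u ∈ chartDomain I p)
    (h : DifferentiableAt ℝ (fun y => φ ((extChartAt I p).symm y)) u)
    (e₁ : (p : N) → TangentSpace I p) : charDeriv I e₁ φ ((extChartAt I p).symm u) =
      fderiv ℝ (fun y => φ ((extChartAt I p).symm y)) u
        (tangentCoord I p u (e₁ ((extChartAt I p).symm u))) := by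
  rw [fderiv_comp_symm hu (mdifferentiableAt_of_comp_symm hu h)]
  exact (congrArg (mfderiv I 𝓘(ℝ, ℝ) φ ((extChartAt I p).symm u))
    (mfderiv_symm_mfderiv_chart hu _)).symm

variable [IsManifold (𝓡 3) ∞ M] (P : PseudohermitianStructure M) (I) (ι : N → M) (e₁ : (p : N) → TangentSpace I p)

/-- The p-area density of `Φ t` relative to that of the unperturbed surface. -/
def relDensity (Φ : ℝ → N → M) (t : ℝ) (q : N) : ℝ :=
  P.areaDensity (Φ t q) (mfderiv I (𝓡 3) (Φ t) q (e₁ q))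
    (mfderiv I (𝓡 3) (Φ t) q (charLift P I ι e₁ q))

/-- The unit characteristic vector of the surface `Φ t`. -/
def charVariation (Φ : ℝ → N → M) (t : ℝ) (q : N) : TangentSpace (𝓡 3) (Φ t q) :=
  P.charUnit (Φ t q) (mfderiv I (𝓡 3) (Φ t) q (e₁ q))
    (mfderiv I (𝓡 3) (Φ t) q (charLift P I ι e₁ q))

/-- The contraction of the p-area form with the velocity of the variation. -/
def fluxFun (Φ : ℝ → N → M) (q : N) (v : TangentSpace I q) (t : ℝ) : ℝ :=
  P.Θ (Φ t q) (velocity Φ t q) *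
      P.dualForm (Φ t q) (charVariation I P ι e₁ Φ t q) (mfderiv I (𝓡 3) (Φ t) q v) -
    P.dualForm (Φ t q) (charVariation I P ι e₁ Φ t q) (velocity Φ t q) *
      P.Θ (Φ t q) (mfderiv I (𝓡 3) (Φ t) q v)

/-- The 1-form whose exterior derivative is the divergence term of the second variation. -/
def fluxForm (Φ : ℝ → N → M) (F : N → ℝ) (q : N) (v : TangentSpace I q) : ℝ :=
  deriv (fluxFun I P ι e₁ Φ q v) 0 +
    F q * charDeriv I e₁ F q * P.Θ (ι q) (mfderiv I (𝓡 3) ι q v)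

/-- The vector field whose divergence is the divergence term of the second variation. -/
def fluxField (Φ : ℝ → N → M) (F : N → ℝ) (q : N) : TangentSpace I q :=
  fluxForm I P ι e₁ Φ F q (e₁ q) • charLift P I ι e₁ q -
    fluxForm I P ι e₁ Φ F q (charLift P I ι e₁ q) • e₁ q

end Variations

/-! ### The second variation in one chart of the surface -/

section LocalVariation

open PseudohermitianStructure

variable {M : Type*} [TopologicalSpace M] [ChartedSpace (EuclideanSpace ℝ (Fin 3)) M]
  [IsManifold (𝓡 3) ∞ M] {P : PseudohermitianStructure M}
  {H : Type*} [TopologicalSpace H] {I : ModelWithCorners ℝ (EuclideanSpace ℝ (Fin 2)) H}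
  {N : Type*} [TopologicalSpace N] [ChartedSpace H N] [IsManifold I ∞ N] {ι : N → M}
  {e₁ : (p : N) → TangentSpace I p} {Φ : ℝ → N → M} {ε : ℝ}

/-- Links the coordinate-free density and flux with the coframe components in a chart. Here d is the
determinant relating the pair (`charLift`, e₁) to the coordinate basis. -/
theorem charVariation_eq {U : Set M} {E₁ : (q : M) → TangentSpace (𝓡 3) q}
    (h : P.IsUnitaryFrameOn U E₁) (hΦ : ContMDiffOn (𝓘(ℝ, ℝ).prod I) (𝓡 3) ∞
    (fun x : ℝ × N => Φ x.1 x.2) (Ioo (-ε) ε ×ˢ univ)) {p : N} {t : ℝ} {u : Plane}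
    (ht : t ∈ Ioo (-ε) ε) (hu : u ∈ chartDomain I p)
    (hU : Φ t ((extChartAt I p).symm u) ∈ U) {θ e f : ℝ × Plane →L[ℝ] ℝ} {y y' : Plane}
    (hθ : θ = pullbackForm (chartVariation I Φ p) P.Θ (t, u))
    (he : e = pullbackForm (chartVariation I Φ p) (P.coframe₁ E₁) (t, u))
    (hf : f = pullbackForm (chartVariation I Φ p) (P.coframe₂ E₁) (t, u))
    (hy : y = tangentCoord I p u (e₁ ((extChartAt I p).symm u)))
    (hy' : y' = tangentCoord I p u (charLift P I ι e₁ ((extChartAt I p).symm u)))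
    {a b d ς G : ℝ} (ha : a = θ (0, planeBasis 0) * e (0, planeBasis 1) -
      θ (0, planeBasis 1) * e (0, planeBasis 0)) (hb : b = θ (0, planeBasis 0) *
      f (0, planeBasis 1) - θ (0, planeBasis 1) * f (0, planeBasis 0))
    (hd : d = y' 0 * y 1 - y' 1 * y 0) (hς : ς ^ 2 = 1) (hςd : 0 < ς * d)
    (hG : G = √(a ^ 2 + b ^ 2)) (hG0 : 0 < G) :
    relDensity I P ι e₁ Φ t ((extChartAt I p).symm u) = ς * d * G ∧
    ∀ v, fluxFun I P ι e₁ Φ ((extChartAt I p).symm u) v t =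
      θ (1, 0) * (ς * a / G * e (0, tangentCoord I p u v) +
        ς * b / G * f (0, tangentCoord I p u v)) -
      (ς * a / G * e (1, 0) + ς * b / G * f (1, 0)) * θ (0, tangentCoord I p u v) := by
  have hx := h.isUnit hU
  have val : ∀ (β : (q : M) → TangentSpace (𝓡 3) q →L[ℝ] ℝ)
      (v : TangentSpace I ((extChartAt I p).symm u)),
      β (Φ t ((extChartAt I p).symm u)) (mfderiv I (𝓡 3) (Φ t) ((extChartAt I p).symm u) v) =
      pullbackForm (chartVariation I Φ p) β (t, u) (0, tangentCoord I p u v) := fun β v => by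
    rw [pullbackForm_chartVariation hΦ ht hu, pullbackForm_tangentCoord
      (contMDiff_variation hΦ ht) hu]
  have valT := pullbackForm_chartVariation_time hΦ ht hu
  have hpl : ∀ (β : ℝ × Plane →L[ℝ] ℝ) (y : Plane),
      β (0, y) = y 0 * β (0, planeBasis 0) + y 1 * β (0, planeBasis 1) := fun β y =>
    plane_apply (β.comp (ContinuousLinearMap.inr ℝ ℝ Plane)) y
  have key := hx.charUnit_eq (v := mfderiv I (𝓡 3) (Φ t) ((extChartAt I p).symm u)
      (e₁ ((extChartAt I p).symm u)))
    (w := mfderiv I (𝓡 3) (Φ t) ((extChartAt I p).symm u)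
      (charLift P I ι e₁ ((extChartAt I p).symm u))) (a := a) (b := b) (d := d) (ς := ς) (G := G)
    (by
      have h1 := val (P.coframe₁ E₁)
      unfold coframe₁ at h1
      rw [h1, h1, val P.Θ, val P.Θ, ← hy, ← hy', ← hθ]
      change θ (0, y') * (pullbackForm (chartVariation I Φ p) (P.coframe₁ E₁) (t, u)) (0, y) -
        θ (0, y) * (pullbackForm (chartVariation I Φ p) (P.coframe₁ E₁) (t, u)) (0, y') = _
      rw [← he, hpl θ y, hpl θ y', hpl e y, hpl e y', ha, hd]
      ring)
    (by
      have h1 := val (P.coframe₂ E₁)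
      unfold coframe₂ at h1
      rw [h1, h1, val P.Θ, val P.Θ, ← hy, ← hy', ← hθ]
      change θ (0, y') * (pullbackForm (chartVariation I Φ p) (P.coframe₂ E₁) (t, u)) (0, y) -
        θ (0, y) * (pullbackForm (chartVariation I Φ p) (P.coframe₂ E₁) (t, u)) (0, y') = _
      rw [← hf, hpl θ y, hpl θ y', hpl f y, hpl f y', hb, hd]
      ring) hς hςd hG hG0
  refine ⟨key.1, fun v => ?_⟩
  have k1 := key.2
  unfold fluxFun charVariation
  rw [k1, k1]
  have e1 := val (P.coframe₁ E₁)
  have e2 := valT (P.coframe₁ E₁)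
  have f1 := val (P.coframe₂ E₁)
  have f2 := valT (P.coframe₂ E₁)
  rw [hθ, he, hf, valT P.Θ, e2, f2, ← val P.Θ, ← e1, ← f1]
  rfl

/-- In the chart the second derivative of the density is the wanted integrand plus the divergence of
(Q₀, Q₁). The last clause identifies (Q₀, Q₁) as the density times the coordinates of `fluxField`,
which is defined without charts; that is what permits gluing the divergence terms. -/
theorem exists_local_variation (hι : ContMDiff I (𝓡 3) ∞ ι)
    (hι' : ∀ p, Function.Injective (mfderiv I (𝓡 3) ι p))
    (he₁ : IsCharacteristicField I P ι e₁) (hmin : IsPMinimal I P ι e₁)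
    {f g : N → ℝ} (hf : ContMDiff I 𝓘(ℝ, ℝ) ∞ f) (hg : ContMDiff I 𝓘(ℝ, ℝ) ∞ g)
    (hε : 0 < ε) (hΦ : ContMDiffOn (𝓘(ℝ, ℝ).prod I) (𝓡 3) ∞ (fun x : ℝ × N => Φ x.1 x.2)
      (Ioo (-ε) ε ×ˢ univ)) (hΦ0 : Φ 0 = ι)
    (hV : ∀ p ∉ singularSet I P ι, (velocity Φ 0 p : EuclideanSpace ℝ (Fin 3)) =
      (f p • legendrianNormal I P ι e₁ p + g p • P.reeb (ι p) : EuclideanSpace ℝ (Fin 3)))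
    {p : N} (hp : p ∉ singularSet I P ι) (hb : p ∉ I.boundary N) :
    ∃ (O : Set Plane) (δ : ℝ) (G : ℝ × Plane → ℝ) (Q₀ Q₁ : Plane → ℝ),
      IsOpen O ∧ extChartAt I p p ∈ O ∧ 0 < δ ∧ δ ≤ ε ∧
      (∀ u ∈ O, u ∈ chartDomain I p ∧ (extChartAt I p).symm u ∉ singularSet I P ι) ∧
      (∀ t ∈ Ioo (-δ) δ, ∀ u ∈ O, ContDiffAt ℝ ∞ G (t, u) ∧ 0 < G (t, u) ∧
        G (t, u) = relDensity I P ι e₁ Φ t ((extChartAt I p).symm u) * G (0, u)) ∧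
      (∀ u ∈ O, G (0, u) = P.areaDensity (ι ((extChartAt I p).symm u))
        (chartPartial I ι p u 0) (chartPartial I ι p u 1)) ∧
      ∀ u ∈ O, ContDiffAt ℝ ∞ Q₀ u ∧ ContDiffAt ℝ ∞ Q₁ u ∧
        fderiv ℝ (fun y => fderiv ℝ G y (1, 0)) (0, u) (1, 0) =
          G (0, u) * secondVariationIntegrand I P ι e₁ f g ((extChartAt I p).symm u) +
            (fderiv ℝ Q₀ u (planeBasis 0) + fderiv ℝ Q₁ u (planeBasis 1)) ∧
        ∀ l : Plane →L[ℝ] ℝ, l (planeBasis 0) * Q₀ u + l (planeBasis 1) * Q₁ u =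
          G (0, u) * l (tangentCoord I p u (fluxField I P ι e₁ Φ
            (fun q => f q - alphaFun I P ι e₁ q * g q) ((extChartAt I p).symm u))) := by
  obtain ⟨U, E₁, hpU, h, hE⟩ := he₁.exists_frame_extension hι (hι' p) hp hb
  set σ := (extChartAt I p).symm with hσ
  set u₀ := extChartAt I p p with hu₀def
  have hu₀ : u₀ ∈ chartDomain I p := mem_chartDomain (mem_extChartAt_source p) hb
  have hσ₀ : σ u₀ = p := extChartAt_to_inv p
  have h0ε : (0 : ℝ) ∈ Ioo (-ε) ε := ⟨by linarith, hε⟩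
  set Ψ := chartVariation I Φ p with hΨ
  have hΨs : ∀ z : ℝ × Plane, z.1 ∈ Ioo (-ε) ε → z.2 ∈ chartDomain I p →
      ContMDiffAt 𝓘(ℝ, ℝ × Plane) (𝓡 3) ∞ Ψ z := fun z h1 h2 => contMDiffAt_chartVariation hΦ h1 h2
  set Θ' := pullbackForm Ψ P.Θ with hΘ'
  set e' := pullbackForm Ψ (P.coframe₁ E₁) with he'
  set f' := pullbackForm Ψ (P.coframe₂ E₁) with hf'
  set w' := pullbackForm Ψ (P.connForm E₁) with hw'
  set b₀ : ℝ × Plane := (1, 0) with hb₀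
  set b₁ : ℝ × Plane := (0, planeBasis 0) with hb₁
  set b₂ : ℝ × Plane := (0, planeBasis 1) with hb₂
  set a : ℝ × Plane → ℝ := fun z => Θ' z b₁ * e' z b₂ - Θ' z b₂ * e' z b₁ with ha
  set b : ℝ × Plane → ℝ := fun z => Θ' z b₁ * f' z b₂ - Θ' z b₂ * f' z b₁ with hbdef
  set G : ℝ × Plane → ℝ := fun z => √(a z ^ 2 + b z ^ 2) with hG
  -- values at time zero
  have slice : ∀ (β : (q : M) → TangentSpace (𝓡 3) q →L[ℝ] ℝ) {u : Plane}, u ∈ chartDomain I p →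
      ∀ y : Plane, pullbackForm Ψ β (0, u) (0, y) = pullbackForm (ι ∘ σ) β u y := fun β u hu y => by
    rw [hΨ, pullbackForm_chartVariation hΦ h0ε hu, hΦ0]
  have slice_time : ∀ (β : (q : M) → TangentSpace (𝓡 3) q →L[ℝ] ℝ) {u : Plane},
      u ∈ chartDomain I p → σ u ∉ singularSet I P ι → pullbackForm Ψ β (0, u) b₀ =
      f (σ u) * β (ι (σ u)) (legendrianNormal I P ι e₁ (σ u)) +
        g (σ u) * β (ι (σ u)) (P.reeb (ι (σ u))) := fun β u hu hS => by
    have h1 := pullbackForm_chartVariation_time hΦ h0ε hu β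
    rw [hΨ, h1]
    have h2 : ∀ r, r = ι (σ u) → ∀ x : EuclideanSpace ℝ (Fin 3),
        (show EuclideanSpace ℝ (Fin 3) →L[ℝ] ℝ from β r) x =
        (show EuclideanSpace ℝ (Fin 3) →L[ℝ] ℝ from β (ι (σ u))) x := by rintro r rfl x; rfl
    refine (h2 _ (congrFun hΦ0 (σ u)) (velocity Φ 0 (σ u))).trans ?_
    refine (congrArg (show EuclideanSpace ℝ (Fin 3) →L[ℝ] ℝ from β (ι (σ u))) (hV _ hS)).trans ?_
    exact (map_add (β (ι (σ u))) _ _).trans (congrArg₂ (· + ·)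
      (map_smul (β (ι (σ u))) _ _) (map_smul (β (ι (σ u))) _ _))
  have hΨU₀ : Ψ (0, u₀) ∈ U := by
    have : Ψ (0, u₀) = ι p := by
      rw [hΨ, chartVariation]; simp only; rw [hΦ0, ← hσ, hσ₀]
    rw [this]; exact hpU
  have cβ : ∀ {β : (q : M) → TangentSpace (𝓡 3) q →L[ℝ] ℝ}, (∀ q ∈ U, SmoothFormAt β q) →
      ∀ z : ℝ × Plane, z.1 ∈ Ioo (-ε) ε → z.2 ∈ chartDomain I p → Ψ z ∈ U →
      ContDiffAt ℝ ∞ (pullbackForm Ψ β) z := fun hβ z h1 h2 h3 =>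
    contDiffAt_pullbackForm (hΨs z h1 h2) (hβ _ h3)
  have cΘ := cβ (β := P.Θ) fun q _ => P.smoothFormAt_Θ q
  have ce := cβ (β := P.coframe₁ E₁) fun q hq => h.smoothFormAt_coframe₁ hq
  have cf := cβ (β := P.coframe₂ E₁) fun q hq => h.smoothFormAt_coframe₂ hq
  have cw := cβ (β := P.connForm E₁) fun q hq => h.smoothFormAt_connForm hq
  have cap : ∀ {β : ℝ × Plane → ℝ × Plane →L[ℝ] ℝ} (v : ℝ × Plane) {y : ℝ × Plane},
      ContDiffAt ℝ ∞ β y → ContDiffAt ℝ ∞ (fun x => β x v) y :=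
    fun v _ h => h.clm_apply contDiffAt_const
  have ca : ∀ z : ℝ × Plane, z.1 ∈ Ioo (-ε) ε → z.2 ∈ chartDomain I p → Ψ z ∈ U →
      ContDiffAt ℝ ∞ a z := fun z h1 h2 h3 =>
    ((cap _ (cΘ z h1 h2 h3)).mul (cap _ (ce z h1 h2 h3))).sub
      ((cap _ (cΘ z h1 h2 h3)).mul (cap _ (ce z h1 h2 h3)))
  have cb : ∀ z : ℝ × Plane, z.1 ∈ Ioo (-ε) ε → z.2 ∈ chartDomain I p → Ψ z ∈ U →
      ContDiffAt ℝ ∞ b z := fun z h1 h2 h3 =>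
    ((cap _ (cΘ z h1 h2 h3)).mul (cap _ (cf z h1 h2 h3))).sub
      ((cap _ (cΘ z h1 h2 h3)).mul (cap _ (cf z h1 h2 h3)))
  -- the characteristic field in coordinates
  have wedge : ∀ {u : Plane}, u ∈ chartDomain I p → σ u ∉ singularSet I P ι →
      E₁ (ι (σ u)) = mfderiv I (𝓡 3) ι (σ u) (e₁ (σ u)) →
      a (0, u) ≠ 0 ∧ a (0, u) • tangentCoord I p u (e₁ (σ u)) =
        Θ' (0, u) b₁ • planeBasis 1 - Θ' (0, u) b₂ • planeBasis 0 := fun {u} hu hS hEu => by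
    have := he₁.wedge_smul_tangentCoord hι hu hS hEu rfl rfl
    simp only [ha, hΘ', he', hb₁, hb₂, slice _ hu]
    exact this
  have hES₀ : E₁ (ι (σ u₀)) = mfderiv I (𝓡 3) ι (σ u₀) (e₁ (σ u₀)) := by
    have h1 : ∀ q, q = p → E₁ (ι q) = mfderiv I (𝓡 3) ι q (e₁ q) := by
      rintro q rfl; exact hE.self_of_nhds
    exact h1 _ hσ₀
  have ha₀ : a (0, u₀) ≠ 0 := (wedge hu₀ (by rw [hσ₀]; exact hp) hES₀).1
  -- The sign of Θ∧e¹ on the coordinate basis: the chart need not be compatible with the orientation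
  -- of the surface.
  obtain ⟨ς, hς, hςa₀⟩ : ∃ ς : ℝ, ς ^ 2 = 1 ∧ 0 < ς * a (0, u₀) := by
    rcases lt_or_gt_of_ne ha₀ with h0 | h0
    · exact ⟨-1, by norm_num, by linarith⟩
    · exact ⟨1, by norm_num, by linarith⟩
  -- the domain
  have ev₁ : ∀ᶠ z : ℝ × Plane in 𝓝 (0, u₀), z.1 ∈ Ioo (-ε) ε ∧ z.2 ∈ chartDomain I p :=
    (isOpen_Ioo.prod (isOpen_chartDomain p)).mem_nhds ⟨h0ε, hu₀⟩
  have ev₂ : ∀ᶠ z : ℝ × Plane in 𝓝 (0, u₀), Ψ z ∈ U :=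
    (hΨs (0, u₀) h0ε hu₀).continuousAt.eventually (h.isOpen.mem_nhds hΨU₀)
  have ev₃ : ∀ᶠ z : ℝ × Plane in 𝓝 (0, u₀), 0 < ς * a z :=
    (continuousAt_const.mul (ca (0, u₀) h0ε hu₀ hΨU₀).continuousAt).eventually_const_lt hςa₀
  have ev₄ : ∀ᶠ u in 𝓝 u₀, (u ∈ chartDomain I p ∧ σ u ∉ singularSet I P ι) ∧
      E₁ (ι (σ u)) = mfderiv I (𝓡 3) ι (σ u) (e₁ (σ u)) := by
    have h1 := tendsto_symm hu₀
    rw [← hσ, hσ₀] at h1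
    have h2 : ∀ᶠ u in 𝓝 u₀, u ∈ chartDomain I p ∧ σ u ∉ singularSet I P ι :=
      (isOpen_chartDomain_diff_singularSet hι p).mem_nhds ⟨hu₀, by rw [← hσ, hσ₀]; exact hp⟩
    exact h2.and (h1.eventually hE)
  obtain ⟨S₁, hS₁, S₂, hS₂, hSS⟩ := mem_nhds_prod_iff.1 ((ev₁.and ev₂).and ev₃)
  obtain ⟨δ₀, hδ₀, hball⟩ := Metric.mem_nhds_iff.1 hS₁
  obtain ⟨O, hOsub, hO, hu₀O⟩ := mem_nhds_iff.1 (inter_mem hS₂ ev₄)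
  set δ := min δ₀ ε with hδ
  have hδpos : 0 < δ := lt_min hδ₀ hε
  have good : ∀ z : ℝ × Plane, z ∈ Ioo (-δ) δ ×ˢ O → ((z.1 ∈ Ioo (-ε) ε ∧ z.2 ∈ chartDomain I p) ∧
      Ψ z ∈ U) ∧ 0 < ς * a z := by
    rintro ⟨t, u⟩ ⟨ht, hu⟩
    refine hSS ⟨hball ?_, (hOsub hu).1⟩
    rw [Metric.mem_ball, Real.dist_eq, sub_zero, abs_lt]
    exact ⟨by have := ht.1; have := min_le_left δ₀ ε; simp only at *; linarith,
      ht.2.trans_le (min_le_left _ _)⟩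
  have hOO : IsOpen (Ioo (-δ) δ ×ˢ O) := isOpen_Ioo.prod hO
  have h0δ : (0 : ℝ) ∈ Ioo (-δ) δ := ⟨by linarith, hδpos⟩
  have mem0 : ∀ {u}, u ∈ O → ((0 : ℝ), u) ∈ Ioo (-δ) δ ×ˢ O := fun hu => ⟨h0δ, hu⟩
  have Odom : ∀ {u}, u ∈ O → u ∈ chartDomain I p := fun hu => (hOsub hu).2.1.1
  have OS : ∀ {u}, u ∈ O → σ u ∉ singularSet I P ι := fun hu => (hOsub hu).2.1.2
  have OE : ∀ {u}, u ∈ O → E₁ (ι (σ u)) = mfderiv I (𝓡 3) ι (σ u) (e₁ (σ u)) :=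
    fun hu => (hOsub hu).2.2
  have hG0 : ∀ z ∈ Ioo (-δ) δ ×ˢ O, 0 < G z := fun z hz => by
    have h1 := (good z hz).2
    have h2 : a z ≠ 0 := fun h0 => by rw [h0, mul_zero] at h1; exact h1.false
    exact Real.sqrt_pos.2 (by positivity)
  have cG : ∀ z ∈ Ioo (-δ) δ ×ˢ O, ContDiffAt ℝ ∞ G z := fun z hz => by
    obtain ⟨⟨⟨h1, h2⟩, h3⟩, -⟩ := good z hz
    refine (((ca z h1 h2 h3).pow 2).add ((cb z h1 h2 h3).pow 2)).sqrt ?_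
    exact (Real.sqrt_pos.1 (hG0 z hz)).ne'
  -- the function `α`
  set αs : Plane → ℝ := fun u => alphaFun I P ι e₁ (σ u) with hαs
  set Fs : Plane → ℝ := fun u => f (σ u) - αs u * g (σ u) with hFs
  have pl : ∀ (β : ℝ × Plane →L[ℝ] ℝ) (y : Plane), β (0, y) = y 0 * β b₁ + y 1 * β b₂ :=
    fun β y => plane_apply (β.comp (ContinuousLinearMap.inr ℝ ℝ Plane)) y
  have along : ∀ (β : (q : M) → TangentSpace (𝓡 3) q →L[ℝ] ℝ) {u : Plane}, u ∈ O →
      ∀ v : TangentSpace I (σ u), pullbackForm Ψ β (0, u) (0, tangentCoord I p u v) =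
      β (ι (σ u)) (mfderiv I (𝓡 3) ι (σ u) v) := fun β u hu v => by
    rw [slice β (Odom hu)]
    exact pullbackForm_tangentCoord hι (Odom hu) β v
  have tc_surj : ∀ {u : Plane}, u ∈ O → ∀ y : Plane, tangentCoord I p u
      (mfderiv 𝓘(ℝ, Plane) I σ u y) = y := fun hu y => mfderiv_chart_mfderiv_symm (Odom hu) y
  have hcf : ∀ {u : Plane}, u ∈ O → P.coframe₂ E₁ (ι (σ u)) =
      P.dualForm (ι (σ u)) (legendrianNormal I P ι e₁ (σ u)) := fun hu => by
    rw [coframe₂, OE hu]; rfl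
  have hce : ∀ {u : Plane}, u ∈ O → P.coframe₁ E₁ (ι (σ u)) =
      P.dualForm (ι (σ u)) (mfderiv I (𝓡 3) ι (σ u) (e₁ (σ u))) := fun hu => by
    rw [coframe₁, OE hu]
  have α_mul : ∀ {u : Plane}, u ∈ O → ∀ y : Plane, f' (0, u) (0, y) = αs u * Θ' (0, u) (0, y) := by
    intro u hu y
    have h1 := (he₁.alphaFun_spec (OS hu)).2 (mfderiv 𝓘(ℝ, Plane) I σ u y)
    rw [← tc_surj hu y, hf', hΘ', along _ hu, along _ hu, hcf hu]
    exact h1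
  have slice_b : ∀ {u : Plane}, u ∈ O → b (0, u) = 0 := fun hu => by
    simp only [hbdef, hb₁, hb₂, α_mul hu]; ring
  have comp0 : ∀ {R : ℝ × Plane → ℝ} {u : Plane}, ContDiffAt ℝ ∞ R (0, u) →
      ContDiffAt ℝ ∞ (fun v => R (0, v)) u := fun {R u} hR =>
    ContDiffAt.comp (g := R) (f := fun v : Plane => ((0 : ℝ), v)) u hR
      (contDiffAt_const.prodMk contDiffAt_id)
  have a_ne : ∀ z ∈ Ioo (-δ) δ ×ˢ O, a z ≠ 0 := fun z hz h0 => by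
    have h1 := (good z hz).2
    rw [h0, mul_zero] at h1
    exact h1.false
  have gΘ : ∀ z ∈ Ioo (-δ) δ ×ˢ O, ContDiffAt ℝ ∞ Θ' z := fun z hz =>
    cΘ z (good z hz).1.1.1 (good z hz).1.1.2 (good z hz).1.2
  have ge : ∀ z ∈ Ioo (-δ) δ ×ˢ O, ContDiffAt ℝ ∞ e' z := fun z hz =>
    ce z (good z hz).1.1.1 (good z hz).1.1.2 (good z hz).1.2
  have gf : ∀ z ∈ Ioo (-δ) δ ×ˢ O, ContDiffAt ℝ ∞ f' z := fun z hz =>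
    cf z (good z hz).1.1.1 (good z hz).1.1.2 (good z hz).1.2
  have gw : ∀ z ∈ Ioo (-δ) δ ×ˢ O, ContDiffAt ℝ ∞ w' z := fun z hz =>
    cw z (good z hz).1.1.1 (good z hz).1.1.2 (good z hz).1.2
  have ga : ∀ z ∈ Ioo (-δ) δ ×ˢ O, ContDiffAt ℝ ∞ a z := fun z hz =>
    ca z (good z hz).1.1.1 (good z hz).1.1.2 (good z hz).1.2
  have gb : ∀ z ∈ Ioo (-δ) δ ×ˢ O, ContDiffAt ℝ ∞ b z := fun z hz =>
    cb z (good z hz).1.1.1 (good z hz).1.1.2 (good z hz).1.2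
  -- The function α is defined by choice; its smoothness follows by solving e² = αΘ on the slice,
  -- where a ≠ 0.
  have cαs : ∀ u ∈ O, ContDiffAt ℝ ∞ αs u := by
    intro u hu
    have h1 : ContDiffAt ℝ ∞ (fun v : Plane => (f' (0, v) b₁ * e' (0, v) b₂ -
        f' (0, v) b₂ * e' (0, v) b₁) / a (0, v)) u := comp0 (R := fun z => (f' z b₁ * e' z b₂ -
        f' z b₂ * e' z b₁) / a z) ((((cap _ (gf _ (mem0 hu))).mul (cap _ (ge _ (mem0 hu)))).sub
        ((cap _ (gf _ (mem0 hu))).mul (cap _ (ge _ (mem0 hu))))).div (ga _ (mem0 hu))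
        (a_ne _ (mem0 hu)))
    refine h1.congr_of_eventuallyEq ?_
    filter_upwards [hO.mem_nhds hu] with v hv
    rw [eq_div_iff (a_ne _ (mem0 hv))]
    simp only [ha, hb₁, hb₂, α_mul hv]
    ring
  have cFs : ∀ u ∈ O, ContDiffAt ℝ ∞ Fs u := fun u hu =>
    (contDiffAt_comp_symm (Odom hu) (hf _)).sub
      ((cαs u hu).mul (contDiffAt_comp_symm (Odom hu) (hg _)))
  have comp2 : ∀ {R : Plane → ℝ}, (∀ u ∈ O, ContDiffAt ℝ ∞ R u) →
      ∀ z ∈ Ioo (-δ) δ ×ˢ O, ContDiffAt ℝ ∞ (fun z : ℝ × Plane => R z.2) z := fun {R} hR z hz =>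
    ContDiffAt.comp (g := R) (f := fun z : ℝ × Plane => z.2) z (hR _ hz.2) contDiffAt_snd
  have fder2 : ∀ {R : Plane → ℝ} {u : Plane}, DifferentiableAt ℝ R u → ∀ y : Plane,
      fderiv ℝ (fun z : ℝ × Plane => R z.2) (0, u) (0, y) = fderiv ℝ R u y := fun {R u} hR y => by
    have h1 : HasFDerivAt (fun z : ℝ × Plane => R z.2)
      ((fderiv ℝ R u).comp (ContinuousLinearMap.snd ℝ ℝ Plane)) (0, u) :=
      HasFDerivAt.comp (g := R) (f := fun z : ℝ × Plane => z.2) (0, u) hR.hasFDerivAt hasFDerivAt_snd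
    rw [h1.fderiv]; rfl
  have fder0 : ∀ {R : ℝ × Plane → ℝ} {u : Plane}, DifferentiableAt ℝ R (0, u) → ∀ y : Plane,
      fderiv ℝ (fun v : Plane => R (0, v)) u y = fderiv ℝ R (0, u) (0, y) := fun {R u} hR y => by
    have h1 : HasFDerivAt (fun v : Plane => R (0, v))
      ((fderiv ℝ R (0, u)).comp (ContinuousLinearMap.inr ℝ ℝ Plane)) u :=
      HasFDerivAt.comp (g := R) (f := fun v : Plane => ((0 : ℝ), v)) u hR.hasFDerivAt
        (hasFDerivAt_prodMk_right 0 u)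
    rw [h1.fderiv]; rfl
  have fderT : ∀ {R : ℝ × Plane → ℝ} {u : Plane}, DifferentiableAt ℝ R (0, u) →
      HasDerivAt (fun t : ℝ => R (t, u)) (fderiv ℝ R (0, u) b₀) 0 := fun {R u} hR => by
    have h1 := HasFDerivAt.comp (g := R) (f := fun t : ℝ => (t, u)) 0 hR.hasFDerivAt
        (hasFDerivAt_prodMk_left 0 u)
    exact h1.hasDerivAt
  have dd : ∀ {R : ℝ × Plane → ℝ} {y : ℝ × Plane}, ContDiffAt ℝ ∞ R y → DifferentiableAt ℝ R y :=
    fun h => h.differentiableAt (by simp)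
  have ddp : ∀ {R : Plane → ℝ} {y : Plane}, ContDiffAt ℝ ∞ R y → DifferentiableAt ℝ R y :=
    fun h => h.differentiableAt (by simp)
  -- the rotated coframe and the flux
  set F : ℝ × Plane → ℝ := fun z => Fs z.2 with hF
  set eF : ℝ × Plane → ℝ := fun z => (Θ' z b₁ * fderiv ℝ F z b₂ - Θ' z b₂ * fderiv ℝ F z b₁) / a z
    with heF
  set u' : ℝ × Plane → ℝ := fun z => -F z * eF z with hu'
  set c : ℝ × Plane → ℝ := fun z => ς * a z / G z with hc
  set s : ℝ × Plane → ℝ := fun z => ς * b z / G z with hs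
  set μ : ℝ × Plane → ℝ × Plane → ℝ := fun v x => Θ' x b₀ * (c x * e' x v + s x * f' x v) -
    (c x * e' x b₀ + s x * f' x b₀) * Θ' x v with hμ
  set R₀ : ℝ × Plane → ℝ := fun y => ς * (fderiv ℝ (μ b₂) y b₀ - u' y * Θ' y b₂) with hR₀
  set R₁ : ℝ × Plane → ℝ := fun y => ς * (-fderiv ℝ (μ b₁) y b₀ + u' y * Θ' y b₁) with hR₁
  have gF : ∀ z ∈ Ioo (-δ) δ ×ˢ O, ContDiffAt ℝ ∞ F z := comp2 cFs
  have gα : ∀ z ∈ Ioo (-δ) δ ×ˢ O, ContDiffAt ℝ ∞ (fun z : ℝ × Plane => αs z.2) z := comp2 cαs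
  have geF : ∀ z ∈ Ioo (-δ) δ ×ˢ O, ContDiffAt ℝ ∞ eF z := fun z hz =>
    (((cap _ (gΘ z hz)).mul ((gF z hz).fderiv_apply_const b₂)).sub
      ((cap _ (gΘ z hz)).mul ((gF z hz).fderiv_apply_const b₁))).div (ga z hz) (a_ne z hz)
  have gu : ∀ z ∈ Ioo (-δ) δ ×ˢ O, ContDiffAt ℝ ∞ u' z := fun z hz =>
    (gF z hz).neg.mul (geF z hz)
  have gc : ∀ z ∈ Ioo (-δ) δ ×ˢ O, ContDiffAt ℝ ∞ c z := fun z hz =>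
    (contDiffAt_const.mul (ga z hz)).div (cG z hz) (hG0 z hz).ne'
  have gs : ∀ z ∈ Ioo (-δ) δ ×ˢ O, ContDiffAt ℝ ∞ s z := fun z hz =>
    (contDiffAt_const.mul (gb z hz)).div (cG z hz) (hG0 z hz).ne'
  have gμ : ∀ v, ∀ z ∈ Ioo (-δ) δ ×ˢ O, ContDiffAt ℝ ∞ (μ v) z := fun v z hz =>
    ((cap _ (gΘ z hz)).mul (((gc z hz).mul (cap _ (ge z hz))).add
      ((gs z hz).mul (cap _ (gf z hz))))).sub
    ((((gc z hz).mul (cap _ (ge z hz))).add ((gs z hz).mul (cap _ (gf z hz)))).mul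
      (cap _ (gΘ z hz)))
  have gR₀ : ∀ z ∈ Ioo (-δ) δ ×ˢ O, ContDiffAt ℝ ∞ R₀ z := fun z hz =>
    contDiffAt_const.mul (((gμ _ z hz).fderiv_apply_const b₀).sub ((gu z hz).mul (cap _ (gΘ z hz))))
  have gR₁ : ∀ z ∈ Ioo (-δ) δ ×ˢ O, ContDiffAt ℝ ∞ R₁ z := fun z hz =>
    contDiffAt_const.mul (((gμ _ z hz).fderiv_apply_const b₀).neg.add
      ((gu z hz).mul (cap _ (gΘ z hz))))
  -- values on the slice
  have tcΘ : ∀ {u : Plane}, u ∈ O → Θ' (0, u) (0, tangentCoord I p u (e₁ (σ u))) = 0 := fun hu => by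
    rw [hΘ', along _ hu]; exact (he₁.isUnit (OS hu)).1
  have tce : ∀ {u : Plane}, u ∈ O → e' (0, u) (0, tangentCoord I p u (e₁ (σ u))) = 1 := fun hu => by
    rw [he', along _ hu, hce hu]; exact (he₁.isUnit (OS hu)).dualForm_self
  have tcΘ' : ∀ {u : Plane}, u ∈ O →
      Θ' (0, u) (0, tangentCoord I p u (charLift P I ι e₁ (σ u))) = 1 := fun {u} hu => by
    rw [hΘ', along _ hu, he₁.mfderiv_charLift (OS hu), map_add, map_smul, P.Θ_reeb]
    have : P.Θ (ι (σ u)) (legendrianNormal I P ι e₁ (σ u)) = 0 := (he₁.isUnit (OS hu)).J.1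
    rw [this]; simp
  -- This is (Θ∧e¹)(`charLift`, e₁) = 1 in coordinates. In particular d and a have the same sign, so
  -- ςd > 0.
  have hda : ∀ {u : Plane}, u ∈ O →
      (tangentCoord I p u (charLift P I ι e₁ (σ u)) 0 * tangentCoord I p u (e₁ (σ u)) 1 -
      tangentCoord I p u (charLift P I ι e₁ (σ u)) 1 * tangentCoord I p u (e₁ (σ u)) 0) *
        a (0, u) = 1 := fun {u} hu => by
    have h1 := tcΘ hu
    have h2 := tce hu
    have h3 := tcΘ' hu
    rw [pl] at h1 h2 h3
    simp only [ha]
    linear_combination (tangentCoord I p u (charLift P I ι e₁ (σ u)) 0 * Θ' (0, u) b₁ +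
      tangentCoord I p u (charLift P I ι e₁ (σ u)) 1 * Θ' (0, u) b₂) * h2 + h3 -
      (tangentCoord I p u (charLift P I ι e₁ (σ u)) 0 * e' (0, u) b₁ +
      tangentCoord I p u (charLift P I ι e₁ (σ u)) 1 * e' (0, u) b₂) * h1
  have slice_G : ∀ {u : Plane}, u ∈ O → G (0, u) = ς * a (0, u) := fun {u} hu => by
    have h1 : a (0, u) ^ 2 + b (0, u) ^ 2 = (ς * a (0, u)) ^ 2 := by
      rw [slice_b hu, mul_pow, hς]; ring
    simp only [hG]
    rw [h1, Real.sqrt_sq (good _ (mem0 hu)).2.le]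
  have ςς : ς * ς = 1 := by rw [← pow_two]; exact hς
  have charVar : ∀ t ∈ Ioo (-δ) δ, ∀ {u : Plane}, u ∈ O →
      relDensity I P ι e₁ Φ t (σ u) * G (0, u) = G (t, u) ∧
      ∀ v : TangentSpace I (σ u), fluxFun I P ι e₁ Φ (σ u) v t =
        tangentCoord I p u v 0 * μ b₁ (t, u) + tangentCoord I p u v 1 * μ b₂ (t, u) := by
    intro t ht u hu
    have hz : (t, u) ∈ Ioo (-δ) δ ×ˢ O := ⟨ht, hu⟩
    have h1 := hda hu
    have h2 := (good _ (mem0 hu)).2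
    obtain ⟨d, hd⟩ : ∃ d, d = tangentCoord I p u (charLift P I ι e₁ (σ u)) 0 *
        tangentCoord I p u (e₁ (σ u)) 1 - tangentCoord I p u (charLift P I ι e₁ (σ u)) 1 *
        tangentCoord I p u (e₁ (σ u)) 0 := ⟨_, rfl⟩
    rw [← hd] at h1
    have hςd : 0 < ς * d := by
      have h3 : (ς * d) * (ς * a (0, u)) = 1 := by linear_combination (d * a (0, u)) * ςς + h1
      by_contra h4
      have := mul_nonpos_of_nonpos_of_nonneg (not_lt.1 h4) h2.le
      linarith
    obtain ⟨k1, k2⟩ := charVariation_eq (ι := ι) (e₁ := e₁) h hΦ (good _ hz).1.1.1 (good _ hz).1.1.2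
      (good _ hz).1.2 (θ := Θ' (t, u)) (e := e' (t, u)) (f := f' (t, u)) rfl rfl rfl rfl rfl
      (a := a (t, u)) (b := b (t, u)) rfl rfl hd hς hςd (G := G (t, u)) rfl (hG0 _ hz)
    refine ⟨?_, fun v => ?_⟩
    · have k1' : relDensity I P ι e₁ Φ t (σ u) = ς * d * G (t, u) := k1
      rw [k1', slice_G hu]
      linear_combination (G (t, u) * d * a (0, u)) * ςς + G (t, u) * h1
    · have k3 : fluxFun I P ι e₁ Φ (σ u) v t = Θ' (t, u) b₀ *
          (ς * a (t, u) / G (t, u) * e' (t, u) (0, tangentCoord I p u v) +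
            ς * b (t, u) / G (t, u) * f' (t, u) (0, tangentCoord I p u v)) -
          (ς * a (t, u) / G (t, u) * e' (t, u) b₀ + ς * b (t, u) / G (t, u) * f' (t, u) b₀) *
            Θ' (t, u) (0, tangentCoord I p u v) := k2 v
      rw [k3, pl (Θ' (t, u)) (tangentCoord I p u v), pl (e' (t, u)) (tangentCoord I p u v),
        pl (f' (t, u)) (tangentCoord I p u v)]
      simp only [hμ, hc, hs]
      ring
  have hΨ0 : ∀ u, Ψ (0, u) = ι (σ u) := fun u => congrFun hΦ0 (σ u)
  have OU : ∀ {u : Plane}, u ∈ O → ι (σ u) ∈ U := fun {u} hu => by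
    rw [← hΨ0]; exact (good _ (mem0 hu)).1.2
  have area : ∀ u ∈ O, G (0, u) = P.areaDensity (ι (σ u)) (chartPartial I ι p u 0)
      (chartPartial I ι p u 1) := fun u hu => by
    rw [(h.isUnit (OU hu)).areaDensity_eq, chartPartial_eq ι (Odom hu), chartPartial_eq ι (Odom hu)]
    simp only [hG, ha, hbdef, hb₁, hb₂, hΘ', he', hf', slice _ (Odom hu)]
    rfl
  have cder : ∀ {φ : N → ℝ} {u : Plane}, u ∈ O → DifferentiableAt ℝ (fun y => φ (σ y)) u →
      charDeriv I e₁ φ (σ u) = (Θ' (0, u) b₁ * fderiv ℝ (fun z : ℝ × Plane => φ (σ z.2)) (0, u) b₂ -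
        Θ' (0, u) b₂ * fderiv ℝ (fun z : ℝ × Plane => φ (σ z.2)) (0, u) b₁) / a (0, u) := by
    intro φ u hu hd
    have e1 : fderiv ℝ (fun z : ℝ × Plane => φ (σ z.2)) (0, u) b₁ =
      fderiv ℝ (fun y => φ (σ y)) u (planeBasis 0) := fder2 hd _
    have e2 : fderiv ℝ (fun z : ℝ × Plane => φ (σ z.2)) (0, u) b₂ =
      fderiv ℝ (fun y => φ (σ y)) u (planeBasis 1) := fder2 hd _
    have h1 := congrArg (fderiv ℝ (fun y => φ (σ y)) u) (wedge (Odom hu) (OS hu) (OE hu)).2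
    rw [map_smul, map_sub, map_smul, map_smul] at h1
    simp only [smul_eq_mul] at h1
    rw [e1, e2, eq_div_iff (a_ne _ (mem0 hu)), ← h1, mul_comm]
    congr 1
    exact charDeriv_eq (Odom hu) hd e₁
  have cder_F : ∀ {u : Plane}, u ∈ O → charDeriv I e₁
      (fun q => f q - alphaFun I P ι e₁ q * g q) (σ u) = eF (0, u) := fun {u} hu =>
    cder (φ := fun q => f q - alphaFun I P ι e₁ q * g q) hu (ddp (cFs u hu))
  have hE' : ∀ {u : Plane}, u ∈ O → ∀ᶠ q in 𝓝 (σ u), E₁ (ι q) = mfderiv I (𝓡 3) ι q (e₁ q) := by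
    intro u hu
    have h1 : (extChartAt I p).source ∩ extChartAt I p ⁻¹' O ∈ 𝓝 (σ u) := by
      refine (isOpen_source_inter_preimage hO).mem_nhds
        ⟨(extChartAt I p).map_target (chartDomain_subset (Odom hu)), ?_⟩
      rw [mem_preimage, hσ, (extChartAt I p).right_inv (chartDomain_subset (Odom hu))]
      exact hu
    filter_upwards [h1] with q hq
    have h2 : ∀ r, r = q → E₁ (ι r) = mfderiv I (𝓡 3) ι r (e₁ r) →
      E₁ (ι q) = mfderiv I (𝓡 3) ι q (e₁ q) := by rintro r rfl h; exact h
    exact h2 _ ((extChartAt I p).left_inv hq.1) (OE hq.2)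
  have slice_e : ∀ {u : Plane}, u ∈ O → e' (0, u) b₀ = 0 := fun {u} hu => by
    have hx := he₁.isUnit (OS hu)
    rw [he', slice_time _ (Odom hu) (OS hu), hce hu, dualForm_reeb]
    have : P.dualForm (ι (σ u)) (mfderiv I (𝓡 3) ι (σ u) (e₁ (σ u)))
      (legendrianNormal I P ι e₁ (σ u)) = 0 := hx.dualForm_self_J
    rw [this]; ring
  have slice_F : ∀ {u : Plane}, u ∈ O → Fs u = f' (0, u) b₀ - αs u * Θ' (0, u) b₀ := fun {u} hu => by
    have hx := he₁.isUnit (OS hu)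
    have k1 : P.dualForm (ι (σ u)) (legendrianNormal I P ι e₁ (σ u))
      (legendrianNormal I P ι e₁ (σ u)) = 1 := hx.J.dualForm_self
    have k2 : P.Θ (ι (σ u)) (legendrianNormal I P ι e₁ (σ u)) = 0 := hx.J.1
    rw [hf', hΘ', slice_time _ (Odom hu) (OS hu), slice_time _ (Odom hu) (OS hu), hcf hu,
      dualForm_reeb, P.Θ_reeb, k1, k2]
    simp only [hFs]
    ring
  -- By `wedge` the left side is a·ω(e₁) = aH, and p-minimality applies because interior chart
  -- points are not boundary points.
  have slice_w : ∀ {u : Plane}, u ∈ O →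
      Θ' (0, u) b₁ * w' (0, u) b₂ - Θ' (0, u) b₂ * w' (0, u) b₁ = 0 := fun {u} hu => by
    have h1 := congrArg ((w' (0, u)).comp (ContinuousLinearMap.inr ℝ ℝ Plane))
      (wedge (Odom hu) (OS hu) (OE hu)).2
    rw [map_smul, map_sub, map_smul, map_smul] at h1
    simp only [smul_eq_mul] at h1
    have h2 : w' (0, u) (0, tangentCoord I p u (e₁ (σ u))) = 0 := by
      rw [hw', along _ hu, pMeanCurvature_eq ((hι _).mdifferentiableAt (by simp)) h (OU hu) (hE' hu)]
      exact hmin _ (OS hu) (not_mem_boundary (Odom hu))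
    have h3 : a (0, u) * w' (0, u) (0, tangentCoord I p u (e₁ (σ u))) =
      Θ' (0, u) b₁ * w' (0, u) b₂ - Θ' (0, u) b₂ * w' (0, u) b₁ := h1
    rw [← h3, h2, mul_zero]
  have main : ∀ {u : Plane}, u ∈ O → fderiv ℝ (fun y => fderiv ℝ G y b₀) (0, u) b₀ =
      G (0, u) * (eF (0, u) ^ 2 + F (0, u) ^ 2 * (-2 * P.websterCurvature (ι (σ u)) -
        2 * (P.torsionCoeff E₁ (ι (σ u))).im - 4 * ((Θ' (0, u) b₁ *
        fderiv ℝ (fun z : ℝ × Plane => αs z.2) (0, u) b₂ - Θ' (0, u) b₂ *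
        fderiv ℝ (fun z : ℝ × Plane => αs z.2) (0, u) b₁) / a (0, u)) - 4 * αs u ^ 2)) +
      (fderiv ℝ R₀ (0, u) b₁ + fderiv ℝ R₁ (0, u) b₂) := by
    intro u hu
    have hsl : ∀ {C : ℝ × Plane → Prop}, (∀ v ∈ O, C (0, v)) → ∀ z ∈ Ioo (-δ) δ ×ˢ O,
        ContinuousLinearMap.fst ℝ ℝ Plane z = 0 → C z := by
      rintro C hC ⟨t, v⟩ ⟨-, hv⟩ h0
      obtain rfl : t = 0 := h0
      exact hC v hv
    have hx := h.isUnit (good _ (mem0 hu)).1.2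
    have key := second_variation_forms (τ := ContinuousLinearMap.fst ℝ ℝ Plane) (b₀ := b₀)
      (b₁ := b₁) (b₂ := b₂) rfl rfl hOO
      gΘ ge gf gw (Ar := fun z => (P.torsionCoeff E₁ (Ψ z)).re)
      (Ai := fun z => (P.torsionCoeff E₁ (Ψ z)).im)
      (fun z hz => h.structureEqs (hΨs z (good z hz).1.1.1 (good z hz).1.1.2) (good z hz).1.2)
      hς (a := a) (b := b) (G := G) (c := c) (s := s) (fun _ => rfl) (fun _ => rfl) (fun _ => rfl)
      hG0 (fun _ => rfl) (fun _ => rfl) (hsl fun v hv => slice_b hv)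
      (hsl fun v hv => (good _ (mem0 hv)).2) (hsl fun v hv => slice_e hv)
      (hsl fun v hv => slice_w hv) gα gF (hsl fun v hv => α_mul hv _) (hsl fun v hv => α_mul hv _)
      (hsl fun v hv => slice_F hv) (eF := eF) (u := u') (fun _ => rfl) (fun _ => rfl) (mem0 hu) rfl
      -- Only the e¹∧e² coefficient of dω is known; `l` = dω(T, ·) is the part containing Θ, which
      -- the flat formula discards.
      (W := P.websterCurvature (Ψ (0, u)))
      (l := (extDerivOneForm (P.connForm E₁) (Ψ (0, u)) (P.reeb (Ψ (0, u)))).comp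
        (mfderiv 𝓘(ℝ, ℝ × Plane) (𝓡 3) Ψ (0, u)))
      (fun x y => by
        rw [hw', flatD_pullbackForm (hΨs _ h0ε (Odom hu))
          (h.smoothFormAt_connForm (good _ (mem0 hu)).1.2),
          hx.alternating_apply (extDerivOneForm_antisymm _ _),
          h.websterCurvature_eq (good _ (mem0 hu)).1.2]
        rfl)
    simp only [hΨ0 u] at key
    exact key
  -- A₁₁ is the complex conjugate of the coefficient in the structure equation, hence the sign
  -- change.
  have tor : ∀ {u : Plane}, u ∈ O → (P.torsion (ι (σ u)) (mfderiv I (𝓡 3) ι (σ u) (e₁ (σ u)))).im =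
      -(P.torsionCoeff E₁ (ι (σ u))).im := fun {u} hu => by
    rw [← OE hu, h.torsion_eq (OU hu)]; rfl
  have flux : ∀ {u : Plane}, u ∈ O → ∀ v : TangentSpace I (σ u),
      fluxForm I P ι e₁ Φ (fun q => f q - alphaFun I P ι e₁ q * g q) (σ u) v =
        tangentCoord I p u v 0 * (fderiv ℝ (μ b₁) (0, u) b₀ - u' (0, u) * Θ' (0, u) b₁) +
        tangentCoord I p u v 1 * (fderiv ℝ (μ b₂) (0, u) b₀ - u' (0, u) * Θ' (0, u) b₂) := by
    intro u hu v
    have h1 : fluxFun I P ι e₁ Φ (σ u) v =ᶠ[𝓝 0] fun t =>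
        tangentCoord I p u v 0 * μ b₁ (t, u) + tangentCoord I p u v 1 * μ b₂ (t, u) := by
      filter_upwards [isOpen_Ioo.mem_nhds h0δ] with t ht
      exact (charVar t ht hu).2 v
    have h2 := ((fderT (dd (gμ b₁ _ (mem0 hu)))).const_mul (tangentCoord I p u v 0)).add
      ((fderT (dd (gμ b₂ _ (mem0 hu)))).const_mul (tangentCoord I p u v 1))
    have h3 : P.Θ (ι (σ u)) (mfderiv I (𝓡 3) ι (σ u) v) = tangentCoord I p u v 0 * Θ' (0, u) b₁ +
        tangentCoord I p u v 1 * Θ' (0, u) b₂ := by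
      rw [← pl, hΘ', along _ hu]
    unfold fluxForm
    rw [h1.deriv_eq, cder_F hu, h3]
    refine (congrArg (· + _) h2.deriv).trans ?_
    simp only [hu', hF]
    ring
  refine ⟨O, δ, G, fun u => R₀ (0, u), fun u => R₁ (0, u), hO, hu₀O, hδpos, min_le_right _ _,
    fun u hu => ⟨Odom hu, OS hu⟩, fun t ht u hu => ⟨cG _ ⟨ht, hu⟩, hG0 _ ⟨ht, hu⟩,
    ((charVar t ht hu).1).symm⟩, area, fun u hu => ⟨comp0 (gR₀ _ (mem0 hu)),
    comp0 (gR₁ _ (mem0 hu)), ?_, fun l => ?_⟩⟩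
  · rw [main hu, fder0 (dd (gR₀ _ (mem0 hu))), fder0 (dd (gR₁ _ (mem0 hu)))]
    congr 2
    change _ = (charDeriv I e₁ (fun q => f q - alphaFun I P ι e₁ q * g q) (σ u)) ^ 2 +
      (f (σ u) - alphaFun I P ι e₁ (σ u) * g (σ u)) ^ 2 *
        (-2 * P.websterCurvature (ι (σ u)) +
          2 * (P.torsion (ι (σ u)) (mfderiv I (𝓡 3) ι (σ u) (e₁ (σ u)))).im -
          4 * charDeriv I e₁ (alphaFun I P ι e₁) (σ u) - 4 * alphaFun I P ι e₁ (σ u) ^ 2)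
    rw [cder_F hu, tor hu, cder (φ := alphaFun I P ι e₁) hu (ddp (cαs u hu))]
    simp only [hF, hFs, hαs]
    ring
  -- The contraction of Θ∧e¹ with `fluxField` is the flux form. In coordinates this amounts to
  -- cancelling a against d by `hda`.
  · have hlin : ∀ (r r' : ℝ) (v v' : TangentSpace I (σ u)),
        l (tangentCoord I p u (r • v - r' • v')) =
        r * l (tangentCoord I p u v) - r' * l (tangentCoord I p u v') := fun r r' v v' => by
      have h1 : tangentCoord I p u (r • v - r' • v') =
          r • tangentCoord I p u v - r' • tangentCoord I p u v' :=
        (map_sub (mfderiv I 𝓘(ℝ, Plane) (extChartAt I p) (σ u)) _ _).trans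
          (congrArg₂ (· - ·) (map_smul (mfderiv I 𝓘(ℝ, Plane) (extChartAt I p) (σ u)) _ _)
          (map_smul (mfderiv I 𝓘(ℝ, Plane) (extChartAt I p) (σ u)) _ _))
      rw [h1, map_sub, map_smul, map_smul, smul_eq_mul, smul_eq_mul]
    have h1 := hda hu
    rw [fluxField, hlin, flux hu, flux hu, slice_G hu, plane_apply l (tangentCoord I p u (e₁ (σ u))),
      plane_apply l (tangentCoord I p u (charLift P I ι e₁ (σ u)))]
    simp only [hR₀, hR₁, smul_eq_mul]
    obtain ⟨y, hy⟩ : ∃ y : Plane, y = tangentCoord I p u (e₁ (σ u)) := ⟨_, rfl⟩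
    obtain ⟨y', hy'⟩ : ∃ y : Plane, y = tangentCoord I p u (charLift P I ι e₁ (σ u)) := ⟨_, rfl⟩
    rw [← hy, ← hy'] at h1 ⊢
    linear_combination -(ς * (l (planeBasis 0) * (fderiv ℝ (μ b₂) (0, u) b₀ -
      u' (0, u) * Θ' (0, u) b₂) - l (planeBasis 1) * (fderiv ℝ (μ b₁) (0, u) b₀ -
      u' (0, u) * Θ' (0, u) b₁))) * h1

end LocalVariation

/-! ### The p-area measure: continuity of the density and local finiteness -/

section AreaMeasure

open PseudohermitianStructure

variable {M : Type*} [TopologicalSpace M] [ChartedSpace (EuclideanSpace ℝ (Fin 3)) M]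
  [IsManifold (𝓡 3) ∞ M] {P : PseudohermitianStructure M}
  {H : Type*} [TopologicalSpace H] {I : ModelWithCorners ℝ (EuclideanSpace ℝ (Fin 2)) H}
  {N : Type*} [TopologicalSpace N] [ChartedSpace H N] {X : N → M}

variable (P I) in
/-- The p-area density of a map in the chart at `x`. -/
def chartDensity (X : N → M) (x : N) (u : Plane) : ℝ :=
  P.areaDensity (X ((extChartAt I x).symm u)) (chartPartial I X x u 0) (chartPartial I X x u 1)

theorem areaDensity_nonneg (r : M) (v w : TangentSpace (𝓡 3) r) : 0 ≤ P.areaDensity r v w :=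
  abs_nonneg _

theorem chartDensity_nonneg (x : N) (u : Plane) : 0 ≤ chartDensity P I X x u :=
  areaDensity_nonneg _ _ _

theorem chartDensity_congr {Y : N → M} {x : N} {u : Plane} (hu : u ∈ (extChartAt I x).target)
    (h : X =ᶠ[𝓝 ((extChartAt I x).symm u)] Y) : chartDensity P I X x u = chartDensity P I Y x u := by
  have h1 : Tendsto (extChartAt I x).symm (𝓝[range I] u) (𝓝 ((extChartAt I x).symm u)) :=
    ((continuousOn_extChartAt_symm x u hu).mono_of_mem_nhdsWithin
      (extChartAt_target_mem_nhdsWithin_of_mem hu))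
  have h2 : X ∘ (extChartAt I x).symm =ᶠ[𝓝[range I] u] Y ∘ (extChartAt I x).symm := h1.eventually h
  have h3 : ∀ i, (chartPartial I X x u i : EuclideanSpace ℝ (Fin 3)) = chartPartial I Y x u i := by
    intro i
    have := h2.mfderivWithin_eq (I := 𝓘(ℝ, Plane)) (I' := 𝓡 3) (h.self_of_nhds)
    exact congrArg (fun L : Plane →L[ℝ] EuclideanSpace ℝ (Fin 3) =>
      L (EuclideanSpace.single i (1 : ℝ))) this
  have h4 : ∀ r r', r = r' → ∀ v w : EuclideanSpace ℝ (Fin 3),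
      P.areaDensity r v w = P.areaDensity r' v w := by rintro r r' rfl v w; rfl
  have h5 : ∀ v w v' w' : EuclideanSpace ℝ (Fin 3), v = v' → w = w' →
      P.areaDensity (Y ((extChartAt I x).symm u)) v w =
      P.areaDensity (Y ((extChartAt I x).symm u)) v' w' := by rintro v w v' w' rfl rfl; rfl
  exact (h4 _ _ h.self_of_nhds _ _).trans (h5 _ _ _ _ (h3 0) (h3 1))

variable [IsManifold I ∞ N]

/-- Read X in a fixed chart of M: the function is the coefficient form of β applied to a derivative
of a smooth map. Continuity is taken within the range of the model because boundary points are
included. -/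
theorem continuousWithinAt_form_chartPartial (hX : ContMDiff I (𝓡 3) ∞ X)
    {β : (q : M) → TangentSpace (𝓡 3) q →L[ℝ] ℝ} {x : N} {u : Plane}
    (hu : u ∈ (extChartAt I x).target) (hβ : SmoothFormAt β (X ((extChartAt I x).symm u)))
    (i : Fin 2) :
    ContinuousWithinAt (fun y => β (X ((extChartAt I x).symm y)) (chartPartial I X x y i))
      (range I) u := by
  set q₀ := X ((extChartAt I x).symm u) with hq₀
  have hXσ : ∀ y ∈ (extChartAt I x).target,
      ContMDiffWithinAt 𝓘(ℝ, Plane) (𝓡 3) ∞ (X ∘ (extChartAt I x).symm) (range I) y := fun y hy =>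
    (hX _).comp_contMDiffWithinAt y (contMDiffWithinAt_extChartAt_symm_range x hy)
  set F : Plane → EuclideanSpace ℝ (Fin 3) := extChartAt (𝓡 3) q₀ ∘ X ∘ (extChartAt I x).symm with hF
  have hF' : ContDiffWithinAt ℝ ∞ F (range I) u := by
    rw [← contMDiffWithinAt_iff_contDiffWithinAt]
    exact (contMDiffAt_extChartAt (x := q₀)).comp_contMDiffWithinAt u (hXσ u hu)
  have hru : u ∈ range I := extChartAt_target_subset_range x hu
  have hdF : ContinuousWithinAt (fderivWithin ℝ F (range I)) (range I) u :=
    (hF'.fderivWithin_right (m := ∞) I.uniqueDiffOn (by simp) hru).continuousWithinAt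
  have hco : ContinuousWithinAt (fun y => oneFormInChart β q₀ (F y)
      (fderivWithin ℝ F (range I) y (planeBasis i))) (range I) u := by
    have h1 : ContinuousWithinAt (fun y => oneFormInChart β q₀ (F y)) (range I) u :=
      ContinuousAt.comp_continuousWithinAt (g := oneFormInChart β q₀) (f := F) hβ.continuousAt
        hF'.continuousWithinAt
    exact h1.clm_apply (hdF.clm_apply continuousWithinAt_const)
  refine hco.congr_of_eventuallyEq_of_mem ?_ hru
  have h1 : ∀ᶠ y in 𝓝[range I] u, y ∈ (extChartAt I x).target :=
    extChartAt_target_mem_nhdsWithin_of_mem hu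
  have h2 : ∀ᶠ y in 𝓝[range I] u, (X ∘ (extChartAt I x).symm) y ∈ (extChartAt (𝓡 3) q₀).source :=
    (hXσ u hu).continuousWithinAt.eventually
      ((isOpen_extChartAt_source q₀).mem_nhds (mem_extChartAt_source q₀))
  filter_upwards [h1, h2] with y hy1 hy2
  have h3 : MDifferentiableAt (𝓡 3) 𝓘(ℝ, EuclideanSpace ℝ (Fin 3)) (extChartAt (𝓡 3) q₀)
      ((X ∘ (extChartAt I x).symm) y) := mdifferentiableAt_extChartAt (by simpa using hy2)
  have h4 := mfderiv_comp_mfderivWithin y h3 ((hXσ y hy1).mdifferentiableWithinAt (by simp))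
    (I.uniqueDiffOn.uniqueMDiffOn y (extChartAt_target_subset_range x hy1))
  rw [mfderivWithin_eq_fderivWithin] at h4
  refine (oneFormInChart_comp hy2 (chartPartial I X x y i)).symm.trans ?_
  exact congrArg (fun L : Plane →L[ℝ] EuclideanSpace ℝ (Fin 3) =>
    oneFormInChart β q₀ (F y) (L (planeBasis i))) h4.symm

theorem continuousWithinAt_chartDensity (hX : ContMDiff I (𝓡 3) ∞ X) {x : N} {u : Plane}
    (hu : u ∈ (extChartAt I x).target) :
    ContinuousWithinAt (chartDensity P I X x) (range I) u := by
  obtain ⟨U, E₁, hq, h⟩ := P.exists_unitaryFrame (X ((extChartAt I x).symm u))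
  have cβ : ∀ {β : (q : M) → TangentSpace (𝓡 3) q →L[ℝ] ℝ},
      SmoothFormAt β (X ((extChartAt I x).symm u)) → ∀ i, ContinuousWithinAt
      (fun y => β (X ((extChartAt I x).symm y)) (chartPartial I X x y i)) (range I) u :=
    fun hβ i => continuousWithinAt_form_chartPartial hX hu hβ i
  have hΘ := cβ (P.smoothFormAt_Θ _)
  have he := cβ (h.smoothFormAt_coframe₁ hq)
  have hf := cβ (h.smoothFormAt_coframe₂ hq)
  have hco := (((((hΘ 0).mul (he 1)).sub ((hΘ 1).mul (he 0))).pow 2).add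
    ((((hΘ 0).mul (hf 1)).sub ((hΘ 1).mul (hf 0))).pow 2)).sqrt
  have hru : u ∈ range I := extChartAt_target_subset_range x hu
  refine hco.congr_of_eventuallyEq_of_mem ?_ hru
  have h1 : Tendsto (extChartAt I x).symm (𝓝[range I] u) (𝓝 ((extChartAt I x).symm u)) :=
    ((continuousOn_extChartAt_symm x u hu).mono_of_mem_nhdsWithin
      (extChartAt_target_mem_nhdsWithin_of_mem hu))
  filter_upwards [h1.eventually (hX.continuous.continuousAt.eventually (h.isOpen.mem_nhds hq))]
    with y hy
  exact (h.isUnit hy).areaDensity_eq _ _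

theorem measurableSet_extChartAt_target (x : N) : MeasurableSet (extChartAt I x).target := by
  rw [extChartAt_target]
  exact ((((chartAt H x).open_target.preimage I.continuous_symm)).measurableSet).inter
    I.isClosed_range.measurableSet

variable [MeasurableSpace N] [BorelSpace N]

theorem measurableSet_inter_preimage_symm {O : Set Plane} (hO : MeasurableSet O) {x : N}
    (hOt : O ⊆ (extChartAt I x).target) {B : Set N} (hB : MeasurableSet B) :
    MeasurableSet (O ∩ (extChartAt I x).symm ⁻¹' B) := by
  have h1 : Continuous (O.restrict (extChartAt I x).symm) :=
    ((continuousOn_extChartAt_symm x).mono hOt).restrict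
  have h2 := (MeasurableSet.subtype_image hO (h1.measurable hB))
  convert h2 using 1
  ext u
  constructor
  · rintro ⟨h3, h4⟩; exact ⟨⟨u, h3⟩, h4, rfl⟩
  · rintro ⟨⟨v, hv⟩, h4, rfl⟩; exact ⟨hv, h4⟩

variable [T2Space N] [SigmaCompactSpace N]

theorem pAreaMeasure_apply {B : Set N} (hB : MeasurableSet B) :
    pAreaMeasure I P X B = ∑' x : N, ∫⁻ u in (extChartAt I x).symm ⁻¹' B ∩ (extChartAt I x).target,
      ENNReal.ofReal (chartPartition I N x ((extChartAt I x).symm u) * chartDensity P I X x u) := by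
  unfold pAreaMeasure
  rw [Measure.sum_apply _ hB]
  refine tsum_congr fun x => ?_
  have hσ : AEMeasurable (extChartAt I x).symm
      ((volume : Measure Plane).restrict (extChartAt I x).target) :=
    (continuousOn_extChartAt_symm x).aemeasurable (measurableSet_extChartAt_target x)
  rw [Measure.map_apply_of_aemeasurable (hσ.mono_ac (withDensity_absolutelyContinuous _ _)) hB,
    withDensity_apply', Measure.restrict_restrict' (measurableSet_extChartAt_target x)]
  rfl

theorem pAreaMeasure_congr {Y : N → M} {B : Set N} (hB : MeasurableSet B)
    (h : ∀ q ∈ B, X =ᶠ[𝓝 q] Y) : pAreaMeasure I P X B = pAreaMeasure I P Y B := by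
  rw [pAreaMeasure_apply hB, pAreaMeasure_apply hB]
  refine tsum_congr fun x => ?_
  refine setLIntegral_congr_fun (g := fun u => ENNReal.ofReal (chartPartition I N x
    ((extChartAt I x).symm u) * chartDensity P I Y x u)) ?_ fun u hu => ?_
  · rw [inter_comm]
    exact measurableSet_inter_preimage_symm (measurableSet_extChartAt_target x) subset_rfl hB
  · rw [chartDensity_congr hu.2 (h _ hu.1)]

theorem chartPartition_tsupport_subset (x : N) :
    tsupport (chartPartition I N x) ⊆ (extChartAt I x).source := by
  rw [extChartAt_source]
  exact Classical.choose_spec (SmoothPartitionOfUnity.exists_isSubordinate_chartAt_source I N) x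

/-- Near p only finitely many functions of the partition are nonzero. Each contributes a density
that is bounded near p if p lies in its chart, and zero near p otherwise, because its support is
closed and contained in the chart. -/
theorem isLocallyFiniteMeasure_pAreaMeasure (hX : ContMDiff I (𝓡 3) ∞ X) :
    IsLocallyFiniteMeasure (pAreaMeasure I P X) := by
  refine ⟨fun p => ?_⟩
  obtain ⟨W₀, hW₀, hfin⟩ := (chartPartition I N).locallyFinite p
  have preim : ∀ {x : N} {B : Set N}, MeasurableSet B →
      MeasurableSet ((extChartAt I x).symm ⁻¹' B ∩ (extChartAt I x).target) := fun {x B} hB => by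
    rw [inter_comm]
    exact measurableSet_inter_preimage_symm (measurableSet_extChartAt_target x) subset_rfl hB
  have key : ∀ x : N, ∃ W ∈ 𝓝 p, ∃ C < (⊤ : ENNReal), ∀ B ⊆ W, MeasurableSet B →
      ∫⁻ u in (extChartAt I x).symm ⁻¹' B ∩ (extChartAt I x).target,
        ENNReal.ofReal (chartPartition I N x ((extChartAt I x).symm u) * chartDensity P I X x u)
        ≤ C := by
    intro x
    by_cases hx : p ∈ (extChartAt I x).source
    · have hu := (extChartAt I x).map_source hx
      have hc := continuousWithinAt_chartDensity (P := P) hX hu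
      have h1 : ∀ᶠ y in 𝓝[range I] (extChartAt I x p),
          chartDensity P I X x y < chartDensity P I X x (extChartAt I x p) + 1 :=
        hc.eventually_lt_const (lt_add_one _)
      obtain ⟨r, hr, hr'⟩ := Metric.mem_nhdsWithin_iff.1 h1
      refine ⟨(extChartAt I x).source ∩ extChartAt I x ⁻¹' Metric.ball (extChartAt I x p) r,
        (isOpen_source_inter_preimage Metric.isOpen_ball).mem_nhds ⟨hx, Metric.mem_ball_self hr⟩,
        ENNReal.ofReal (chartDensity P I X x (extChartAt I x p) + 1) *
          volume (Metric.ball (extChartAt I x p) r),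
        ENNReal.mul_lt_top ENNReal.ofReal_lt_top measure_ball_lt_top, fun B hB _ => ?_⟩
      have hsub : (extChartAt I x).symm ⁻¹' B ∩ (extChartAt I x).target ⊆
          Metric.ball (extChartAt I x p) r ∩ range I := by
        rintro u ⟨hu1, hu2⟩
        have h2 := (hB hu1).2
        rw [mem_preimage, (extChartAt I x).right_inv hu2] at h2
        exact ⟨h2, extChartAt_target_subset_range x hu2⟩
      refine (lintegral_mono_set hsub).trans ?_
      refine (setLIntegral_mono' (measurableSet_ball.inter I.isClosed_range.measurableSet)
        (g := fun _ => ENNReal.ofReal (chartDensity P I X x (extChartAt I x p) + 1))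
        fun u hu => ?_).trans ?_
      · refine ENNReal.ofReal_le_ofReal ?_
        refine le_trans (mul_le_of_le_one_left (chartDensity_nonneg _ _)
          ((chartPartition I N).le_one x _)) (hr' hu).le
      · rw [setLIntegral_const]
        exact mul_le_mul_right (measure_mono inter_subset_left) _
    · refine ⟨(tsupport (chartPartition I N x))ᶜ, (isClosed_tsupport _).isOpen_compl.mem_nhds
        fun h => hx (chartPartition_tsupport_subset x h), 0, ENNReal.zero_lt_top, fun B hB hBm => ?_⟩
      refine (setLIntegral_eq_zero (preim hBm) ?_).le
      rintro u ⟨hu1, -⟩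
      simp only [image_eq_zero_of_notMem_tsupport (hB hu1), zero_mul, ENNReal.ofReal_zero,
        Pi.zero_apply]
  choose W hW C hC hWC using key
  set J := hfin.toFinset
  have hmem : W₀ ∩ ⋂ x ∈ J, W x ∈ 𝓝 p :=
    inter_mem hW₀ ((Filter.biInter_finset_mem J).2 fun x _ => hW x)
  obtain ⟨V, hV, hVo, hpV⟩ := mem_nhds_iff.1 hmem
  refine ⟨V, hVo.mem_nhds hpV, ?_⟩
  rw [pAreaMeasure_apply hVo.measurableSet, tsum_eq_sum (s := J)]
  · refine (ENNReal.sum_lt_top).2 fun x hx => ?_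
    refine (hWC x V (fun q hq => ?_) hVo.measurableSet).trans_lt (hC x)
    exact mem_iInter₂.1 (hV hq).2 x hx
  · intro x hx
    refine setLIntegral_eq_zero (preim hVo.measurableSet) ?_
    rintro u ⟨hu1, -⟩
    have : chartPartition I N x ((extChartAt I x).symm u) = 0 := by
      by_contra h0
      exact hx (hfin.mem_toFinset.2 ⟨_, h0, (hV hu1).1⟩)
    simp only [this, zero_mul, ENNReal.ofReal_zero, Pi.zero_apply]

end AreaMeasure

/-! ### The p-area measure in a single interior chart -/

section ChartFormula

open PseudohermitianStructure

variable {M : Type*} [TopologicalSpace M] [ChartedSpace (EuclideanSpace ℝ (Fin 3)) M]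
  [IsManifold (𝓡 3) ∞ M] {P : PseudohermitianStructure M}
  {H : Type*} [TopologicalSpace H] {I : ModelWithCorners ℝ (EuclideanSpace ℝ (Fin 2)) H}
  {N : Type*} [TopologicalSpace N] [ChartedSpace H N] {X : N → M}

theorem plane_det (A : Plane →L[ℝ] Plane) : A.det =
    A (planeBasis 0) 0 * A (planeBasis 1) 1 - A (planeBasis 1) 0 * A (planeBasis 0) 1 := by
  rw [ContinuousLinearMap.det,
    ← LinearMap.det_toMatrix (EuclideanSpace.basisFun (Fin 2) ℝ).toBasis, Matrix.det_fin_two]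
  simp [LinearMap.toMatrix_apply, planeBasis]

variable [IsManifold I ∞ N]

/-- By the chain rule the coordinate vectors transform with the Jacobian matrix, and the area
density is multiplied by the absolute value of its determinant. -/
theorem chartDensity_transition (hX : ContMDiff I (𝓡 3) ∞ X) {p x : N} {u : Plane}
    (hu : u ∈ chartDomain I p) (hx : (extChartAt I p).symm u ∈ (extChartAt I x).source) :
    DifferentiableAt ℝ (extChartAt I x ∘ (extChartAt I p).symm) u ∧
    chartDensity P I X p u =
      |(fderiv ℝ (extChartAt I x ∘ (extChartAt I p).symm) u).det| *
        chartDensity P I X x ((extChartAt I x ∘ (extChartAt I p).symm) u) := by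
  set τ : Plane → Plane := extChartAt I x ∘ (extChartAt I p).symm with hτ
  have hv : τ u ∈ chartDomain I x := mem_chartDomain hx (not_mem_boundary hu)
  have hτd : DifferentiableAt ℝ τ u := by
    rw [← mdifferentiableAt_iff_differentiableAt]
    exact MDifferentiableAt.comp u (mdifferentiableAt_extChartAt (by simpa using hx))
      ((contMDiffAt_symm_of_mem hu).mdifferentiableAt (by simp))
  refine ⟨hτd, ?_⟩
  have h1 := (((contMDiffAt_comp_symm hX hv).mdifferentiableAt (by simp)).hasMFDerivAt).comp u
    hτd.hasFDerivAt.hasMFDerivAt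
  have hev : X ∘ (extChartAt I p).symm =ᶠ[𝓝 u] (X ∘ (extChartAt I x).symm) ∘ τ := by
    filter_upwards [(tendsto_symm hu).eventually ((isOpen_extChartAt_source x).mem_nhds hx)] with y hy
    simp only [Function.comp_apply, hτ, (extChartAt I x).left_inv hy]
  have h2 := (h1.congr_of_eventuallyEq hev).mfderiv
  have h0 : ∀ i, (chartPartial I X p u i : EuclideanSpace ℝ (Fin 3)) =
      (fderiv ℝ τ u (planeBasis i)) 0 • (chartPartial I X x (τ u) 0 : EuclideanSpace ℝ (Fin 3)) +
      (fderiv ℝ τ u (planeBasis i)) 1 • (chartPartial I X x (τ u) 1 : EuclideanSpace ℝ (Fin 3)) := by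
    intro i
    have e1 : (chartPartial I X p u i : EuclideanSpace ℝ (Fin 3)) =
        (mfderiv 𝓘(ℝ, Plane) (𝓡 3) (X ∘ (extChartAt I x).symm) (τ u) :
          Plane →L[ℝ] EuclideanSpace ℝ (Fin 3)) (fderiv ℝ τ u (planeBasis i)) :=
      (chartPartial_eq X hu i).trans (congrArg (fun L : Plane →L[ℝ] EuclideanSpace ℝ (Fin 3) =>
        L (planeBasis i)) h2)
    rw [e1]
    refine (plane_apply (show Plane →L[ℝ] EuclideanSpace ℝ (Fin 3) from
      mfderiv 𝓘(ℝ, Plane) (𝓡 3) (X ∘ (extChartAt I x).symm) (τ u)) _).trans ?_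
    exact congrArg₂ (· + ·) (congrArg _ (chartPartial_eq X hv 0).symm)
      (congrArg _ (chartPartial_eq X hv 1).symm)
  have h4 : ∀ r r', r = r' → ∀ v w v' w' : EuclideanSpace ℝ (Fin 3), v = v' → w = w' →
      P.areaDensity r v w = P.areaDensity r' v' w' := by rintro r r' rfl v w v' w' rfl rfl; rfl
  refine (h4 _ _ (congrArg X ((extChartAt I x).left_inv hx).symm) _ _ _ _ (h0 0) (h0 1)).trans ?_
  refine (areaDensity_linear_comb P _ _ _ _ _ _).trans ?_
  rw [plane_det]
  congr 2
  ring

theorem continuousOn_chartDensity (hX : ContMDiff I (𝓡 3) ∞ X) (x : N) :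
    ContinuousOn (chartDensity P I X x) (chartDomain I x) := fun _ hu =>
  ((continuousWithinAt_chartDensity hX (chartDomain_subset hu)).continuousAt
    (range_mem_nhds hu)).continuousWithinAt

theorem continuousOn_symm_chartDomain (x : N) :
    ContinuousOn (extChartAt I x).symm (chartDomain I x) :=
  (continuousOn_extChartAt_symm x).mono fun _ hu => chartDomain_subset hu

variable [T2Space N] [SigmaCompactSpace N]

theorem tsum_chartPartition (q : N) :
    ∑' x : N, ENNReal.ofReal (chartPartition I N x q) = 1 := by
  have h1 := (chartPartition I N).sum_eq_one (mem_univ q)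
  have hfin : (Function.support fun x => chartPartition I N x q).Finite :=
    (chartPartition I N).locallyFinite.point_finite q
  rw [finsum_eq_sum_of_support_subset (s := hfin.toFinset) _ (by simp)] at h1
  rw [tsum_eq_sum (s := hfin.toFinset), ← ENNReal.ofReal_sum_of_nonneg
    fun x _ => (chartPartition I N).nonneg x q, h1, ENNReal.ofReal_one]
  intro x hx
  have : chartPartition I N x q = 0 := by
    by_contra h0
    exact hx (hfin.mem_toFinset.2 h0)
  rw [this, ENNReal.ofReal_zero]

variable [MeasurableSpace N] [BorelSpace N]

/-- Each summand is transported from the chart at x to the chart at p; the Jacobian of the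
substitution is that of the density. The partition functions then sum to one. -/
theorem pAreaMeasure_apply_chart (hX : ContMDiff I (𝓡 3) ∞ X) {p : N} {B : Set N}
    (hB : MeasurableSet B)
    (hBp : B ⊆ (extChartAt I p).source ∩ extChartAt I p ⁻¹' chartDomain I p) :
    pAreaMeasure I P X B = ∫⁻ u in chartDomain I p ∩ (extChartAt I p).symm ⁻¹' B,
      ENNReal.ofReal (chartDensity P I X p u) := by
  set D := chartDomain I p with hD
  have hDm : MeasurableSet D := (isOpen_chartDomain p).measurableSet
  have hDt : D ⊆ (extChartAt I p).target := fun u hu => chartDomain_subset hu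
  set σ := (extChartAt I p).symm with hσ
  have hAm : MeasurableSet (D ∩ σ ⁻¹' B) := measurableSet_inter_preimage_symm hDm hDt hB
  have step : ∀ x : N, ∫⁻ u in (extChartAt I x).symm ⁻¹' B ∩ (extChartAt I x).target,
      ENNReal.ofReal (chartPartition I N x ((extChartAt I x).symm u) * chartDensity P I X x u) =
      ∫⁻ u in D ∩ σ ⁻¹' B, ENNReal.ofReal (chartPartition I N x (σ u)) *
        ENNReal.ofReal (chartDensity P I X p u) := by
    intro x
    set A := D ∩ σ ⁻¹' (B ∩ (extChartAt I x).source) with hA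
    have hAxm : MeasurableSet A := measurableSet_inter_preimage_symm hDm hDt
      (hB.inter (isOpen_extChartAt_source x).measurableSet)
    set τ : Plane → Plane := extChartAt I x ∘ σ with hτ
    have himg : τ '' A = (extChartAt I x).symm ⁻¹' B ∩ (extChartAt I x).target := by
      ext v
      constructor
      · rintro ⟨u, ⟨hu, huB, hux⟩, rfl⟩
        refine ⟨?_, (extChartAt I x).map_source hux⟩
        rw [mem_preimage, hτ, Function.comp_apply, (extChartAt I x).left_inv hux]
        exact huB
      · rintro ⟨hvB, hvt⟩
        have h1 := hBp hvB
        have h2 : σ (extChartAt I p ((extChartAt I x).symm v)) = (extChartAt I x).symm v :=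
          (extChartAt I p).left_inv h1.1
        refine ⟨extChartAt I p ((extChartAt I x).symm v), ⟨h1.2, ?_, ?_⟩, ?_⟩
        · rw [h2]; exact hvB
        · rw [h2]; exact (extChartAt I x).map_target hvt
        · rw [hτ, Function.comp_apply, h2, (extChartAt I x).right_inv hvt]
    have hinj : InjOn τ A := by
      rintro u ⟨hu, -, hux⟩ v ⟨hv, -, hvx⟩ huv
      exact (extChartAt I p).symm.injOn (hDt hu) (hDt hv) ((extChartAt I x).injOn hux hvx huv)
    rw [← himg, lintegral_image_eq_lintegral_abs_det_fderiv_mul volume hAxm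
      (f' := fun u => fderiv ℝ τ u) (fun u hu =>
        (chartDensity_transition (P := P) hX hu.1 hu.2.2).1.hasFDerivAt.hasFDerivWithinAt) hinj]
    have h1 : ∫⁻ u in A, ENNReal.ofReal |(fderiv ℝ τ u).det| * ENNReal.ofReal
        (chartPartition I N x ((extChartAt I x).symm (τ u)) * chartDensity P I X x (τ u)) =
        ∫⁻ u in A, ENNReal.ofReal (chartPartition I N x (σ u)) *
          ENNReal.ofReal (chartDensity P I X p u) := by
      refine setLIntegral_congr_fun (g := fun u => ENNReal.ofReal (chartPartition I N x (σ u)) *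
          ENNReal.ofReal (chartDensity P I X p u)) hAxm fun u hu => ?_
      have h2 := (chartDensity_transition (P := P) hX hu.1 hu.2.2).2
      have h3 : (extChartAt I x).symm (τ u) = σ u := (extChartAt I x).left_inv hu.2.2
      change _ = ENNReal.ofReal (chartPartition I N x (σ u)) *
          ENNReal.ofReal (chartDensity P I X p u)
      rw [h3, h2, ← ENNReal.ofReal_mul (abs_nonneg _),
        ← ENNReal.ofReal_mul ((chartPartition I N).nonneg x _)]
      congr 1
      simp only [hτ]
      ring
    rw [h1, ← lintegral_inter_add_diff _ (D ∩ σ ⁻¹' B) hAxm]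
    have h4 : D ∩ σ ⁻¹' B ∩ A = A :=
      inter_eq_right.2 fun u hu => ⟨hu.1, hu.2.1⟩
    rw [h4, setLIntegral_eq_zero (hAm.diff hAxm), add_zero]
    rintro u ⟨⟨hu1, hu2⟩, hu3⟩
    have h5 : chartPartition I N x (σ u) = 0 := by
      refine image_eq_zero_of_notMem_tsupport fun h0 => hu3 ⟨hu1, hu2, ?_⟩
      exact chartPartition_tsupport_subset x h0
    simp only [h5, ENNReal.ofReal_zero, zero_mul, Pi.zero_apply]
  rw [pAreaMeasure_apply hB, tsum_congr step]
  -- The index set is all of N, whereas interchanging sum and integral needs a countable one. By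
  -- local finiteness on a σ-compact space only countably many functions are nonzero.
  set S : Set N := {x | (Function.support (chartPartition I N x)).Nonempty} with hS
  have hSc : S.Countable := by
    have hl : LocallyFinite fun x : S => Function.support (chartPartition I N x) :=
      (chartPartition I N).locallyFinite.comp_injective Subtype.val_injective
    have := hl.countable_univ fun x => x.2
    exact countable_univ_iff.1 this
  have hS0 : ∀ x ∉ S, ∀ q, chartPartition I N x q = 0 := fun x hx q => by
    by_contra h0
    exact hx ⟨q, h0⟩
  have : Countable S := hSc
  rw [← tsum_subtype_eq_of_support_subset (s := S), ← lintegral_tsum]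
  · refine lintegral_congr fun u => ?_
    rw [ENNReal.tsum_mul_right,
      tsum_subtype_eq_of_support_subset (f := fun x => ENNReal.ofReal (chartPartition I N x (σ u)))
      (s := S), tsum_chartPartition, one_mul]
    intro x hx
    by_contra h0
    exact hx (by simp only [hS0 x h0, ENNReal.ofReal_zero])
  · intro x
    refine AEMeasurable.mul (f := fun u => ENNReal.ofReal (chartPartition I N x (σ u)))
      (g := fun u => ENNReal.ofReal (chartDensity P I X p u)) ?_ ?_
    · refine ContinuousOn.aemeasurable ?_ hAm
      exact ENNReal.continuous_ofReal.comp_continuousOn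
        ((chartPartition I N x).contMDiff.continuous.comp_continuousOn
          ((continuousOn_symm_chartDomain p).mono inter_subset_left))
    · refine ContinuousOn.aemeasurable ?_ hAm
      exact ENNReal.continuous_ofReal.comp_continuousOn
        ((continuousOn_chartDensity hX p).mono inter_subset_left)
  · intro x hx
    by_contra h0
    exact hx (by simp only [hS0 x h0, ENNReal.ofReal_zero, zero_mul, lintegral_zero])

theorem restrict_pAreaMeasure (hX : ContMDiff I (𝓡 3) ∞ X) {p : N} {B : Set N}
    (hB : MeasurableSet B)
    (hBp : B ⊆ (extChartAt I p).source ∩ extChartAt I p ⁻¹' chartDomain I p) :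
    (pAreaMeasure I P X).restrict B = Measure.map (extChartAt I p).symm
      ((volume.restrict (chartDomain I p ∩ (extChartAt I p).symm ⁻¹' B)).withDensity
        fun u => ENNReal.ofReal (chartDensity P I X p u)) := by
  have hDm : MeasurableSet (chartDomain I p) := (isOpen_chartDomain p).measurableSet
  have hAm := measurableSet_inter_preimage_symm hDm (fun u hu => chartDomain_subset hu) hB
  have hσ : AEMeasurable (extChartAt I p).symm
      ((volume : Measure Plane).restrict (chartDomain I p ∩ (extChartAt I p).symm ⁻¹' B)) :=
    ((continuousOn_symm_chartDomain p).mono inter_subset_left).aemeasurable hAm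
  refine Measure.ext fun C hC => ?_
  rw [Measure.restrict_apply hC, pAreaMeasure_apply_chart hX (hC.inter hB)
    (inter_subset_right.trans hBp), Measure.map_apply_of_aemeasurable
    (hσ.mono_ac (withDensity_absolutelyContinuous _ _)) hC, withDensity_apply',
    Measure.restrict_restrict' hAm]
  congr 2
  ext u
  simp only [mem_inter_iff, mem_preimage]
  tauto

theorem setIntegral_pAreaMeasure (hX : ContMDiff I (𝓡 3) ∞ X) {p : N} {B : Set N}
    (hB : MeasurableSet B)
    (hBp : B ⊆ (extChartAt I p).source ∩ extChartAt I p ⁻¹' chartDomain I p) {F : N → ℝ}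
    (hF : AEStronglyMeasurable F ((pAreaMeasure I P X).restrict B)) :
    ∫ q in B, F q ∂(pAreaMeasure I P X) =
      ∫ u in chartDomain I p ∩ (extChartAt I p).symm ⁻¹' B,
        chartDensity P I X p u * F ((extChartAt I p).symm u) := by
  have hDm : MeasurableSet (chartDomain I p) := (isOpen_chartDomain p).measurableSet
  have hAm := measurableSet_inter_preimage_symm hDm (fun u hu => chartDomain_subset hu) hB
  have hσ : AEMeasurable (extChartAt I p).symm
      ((volume : Measure Plane).restrict (chartDomain I p ∩ (extChartAt I p).symm ⁻¹' B)) :=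
    ((continuousOn_symm_chartDomain p).mono inter_subset_left).aemeasurable hAm
  rw [restrict_pAreaMeasure hX hB hBp] at hF ⊢
  rw [integral_map (hσ.mono_ac (withDensity_absolutelyContinuous _ _)) hF,
    integral_withDensity_eq_integral_toReal_smul₀]
  · refine integral_congr_ae (Eventually.of_forall fun u => ?_)
    simp only [ENNReal.toReal_ofReal (chartDensity_nonneg _ _), smul_eq_mul]
  · refine ContinuousOn.aemeasurable ?_ hAm
    exact ENNReal.continuous_ofReal.comp_continuousOn
      ((continuousOn_chartDensity hX p).mono inter_subset_left)
  · exact Eventually.of_forall fun u => ENNReal.ofReal_lt_top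

end ChartFormula

/-! ### Divergence and differentiation under the integral in the plane -/

section PlaneIntegrals

/-- Integration by parts against the constant function 1. -/
theorem integral_fderiv_eq_zero {F : Plane → ℝ} (hF : ContDiff ℝ 1 F) (hc : HasCompactSupport F)
    (v : Plane) : ∫ u, fderiv ℝ F u v = 0 := by
  have h1 : Continuous fun u => fderiv ℝ F u v :=
    (hF.continuous_fderiv (by simp)).clm_apply continuous_const
  have h2 : HasCompactSupport fun u => fderiv ℝ F u v := hc.fderiv_apply (𝕜 := ℝ) v
  have h3 := integral_mul_fderiv_eq_neg_fderiv_mul_of_integrable (μ := (volume : Measure Plane))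
    (f := F) (g := fun _ => (1 : ℝ)) (v := v)
    (by simpa using h1.integrable_of_hasCompactSupport h2) (by simp)
    (by simpa using hF.continuous.integrable_of_hasCompactSupport hc)
    (fun x _ => hF.differentiable (by simp) x) (fun x _ => differentiableAt_const _)
  simp only [fderiv_fun_const, Pi.zero_apply, zero_apply, mul_zero, integral_zero, mul_one] at h3
  linarith

/-- A form of the divergence theorem for a component of a vector field with compact support in an
open set. -/
theorem setIntegral_fderiv_eq_zero {F : Plane → ℝ} {O C : Set Plane} (hO : IsOpen O)
    (hF : ∀ u ∈ O, ContDiffAt ℝ ∞ F u) (hC : IsCompact C) (hCO : C ⊆ O)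
    (h0 : ∀ u ∈ O, u ∉ C → F u = 0) (v : Plane) :
    IntegrableOn (fun u => fderiv ℝ F u v) O ∧ ∫ u in O, fderiv ℝ F u v = 0 := by
  have hin : ∀ u ∈ O, O.indicator F =ᶠ[𝓝 u] F := fun u hu => by
    filter_upwards [hO.mem_nhds hu] with y hy
    exact indicator_of_mem hy F
  have hout : ∀ u ∉ C, O.indicator F =ᶠ[𝓝 u] fun _ => 0 := fun u hu => by
    filter_upwards [hC.isClosed.isOpen_compl.mem_nhds hu] with y hy
    by_cases hyO : y ∈ O
    · rw [indicator_of_mem hyO, h0 y hyO hy]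
    · exact indicator_of_notMem hyO F
  have hs : ContDiff ℝ 1 (O.indicator F) := contDiff_iff_contDiffAt.2 fun u => by
    by_cases hu : u ∈ O
    · exact ((hF u hu).of_le (by norm_cast)).congr_of_eventuallyEq (hin u hu)
    · exact contDiffAt_const.congr_of_eventuallyEq (hout u fun h => hu (hCO h))
  have hc : HasCompactSupport (O.indicator F) := HasCompactSupport.intro hC fun u hu =>
    (hout u hu).self_of_nhds
  have heq : O.indicator (fun u => fderiv ℝ F u v) = fun u => fderiv ℝ (O.indicator F) u v := by
    funext u
    by_cases hu : u ∈ O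
    · simp only [indicator_of_mem hu, (hin u hu).fderiv_eq]
    · simp only [indicator_of_notMem hu]
      rw [(hout u fun h => hu (hCO h)).fderiv_eq]
      simp
  constructor
  · rw [← integrable_indicator_iff hO.measurableSet, heq]
    exact ((hs.continuous_fderiv (by simp)).clm_apply
      continuous_const).integrable_of_hasCompactSupport (hc.fderiv_apply (𝕜 := ℝ) v)
  · rw [← integral_fderiv_eq_zero hs hc v, ← integral_indicator hO.measurableSet, heq]

/-- The time derivative of the integrand is continuous, hence bounded, on the compact product of a
closed time interval around t with C. The constant bound is integrable over C. -/
theorem hasDerivAt_setIntegral {G : ℝ × Plane → ℝ} {χ : Plane → ℝ} {δ : ℝ} {C : Set Plane}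
    (hC : IsCompact C) (hχ : ContinuousOn χ C)
    (hG : ∀ t ∈ Ioo (-δ) δ, ∀ u ∈ C, ContDiffAt ℝ ∞ G (t, u)) {t : ℝ} (ht : t ∈ Ioo (-δ) δ) :
    HasDerivAt (fun s => ∫ u in C, χ u * G (s, u)) (∫ u in C, χ u * fderiv ℝ G (t, u) (1, 0)) t := by
  obtain ⟨r, hr, hrs⟩ := Metric.nhds_basis_closedBall.mem_iff.1 (isOpen_Ioo.mem_nhds ht)
  have hcont : ∀ z ∈ Metric.closedBall t r ×ˢ C, ContinuousAt (fun z => fderiv ℝ G z (1, 0)) z := by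
    rintro ⟨s, u⟩ ⟨hs, hu⟩
    exact ((hG s (hrs hs) u hu).fderiv_apply_const (1, 0)).continuousAt
  obtain ⟨B, hB⟩ := ((isCompact_closedBall t r).prod hC).exists_bound_of_continuousOn
    (f := fun z => χ z.2 * fderiv ℝ G z (1, 0)) ((hχ.comp continuousOn_snd fun z hz => hz.2).mul
      fun z hz => (hcont z hz).continuousWithinAt)
  have hslice : ∀ {R : ℝ × Plane → ℝ} {s : ℝ}, (∀ u ∈ C, ContinuousAt R (s, u)) →
      ContinuousOn (fun u => χ u * R (s, u)) C := fun {R s} h => hχ.mul fun u hu =>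
    (ContinuousAt.comp (g := R) (f := fun u : Plane => (s, u)) (h u hu)
      (by fun_prop)).continuousWithinAt
  have htr : t ∈ Metric.closedBall t r := Metric.mem_closedBall_self hr.le
  refine (hasDerivAt_integral_of_dominated_loc_of_deriv_le (s := Metric.closedBall t r)
    (bound := fun _ => B) (F' := fun s u => χ u * fderiv ℝ G (s, u) (1, 0))
    (Metric.closedBall_mem_nhds t hr) ?_ ?_ ?_ ?_ ?_ ?_).2
  · filter_upwards [isOpen_Ioo.mem_nhds ht] with s hs
    exact (hslice fun u hu => (hG s hs u hu).continuousAt).aestronglyMeasurable hC.measurableSet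
  · exact (hslice fun u hu => (hG t ht u hu).continuousAt).integrableOn_compact hC
  · exact (hslice (R := fun z => fderiv ℝ G z (1, 0))
      fun u hu => hcont _ ⟨htr, hu⟩).aestronglyMeasurable hC.measurableSet
  · exact (ae_restrict_mem hC.measurableSet).mono fun u hu s hs => hB (s, u) ⟨hs, hu⟩
  · exact integrableOn_const hC.measure_lt_top.ne
  · refine (ae_restrict_mem hC.measurableSet).mono fun u hu s hs => ?_
    have h1 := ((hG s (hrs hs) u hu).differentiableAt (by simp)).hasFDerivAt
    exact ((HasFDerivAt.comp (g := G) (f := fun s : ℝ => (s, u)) s h1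
      (hasFDerivAt_prodMk_left s u)).hasDerivAt).const_mul (χ u)

end PlaneIntegrals

/-! ### The density relative to the unperturbed surface -/

section RelativeDensity

open PseudohermitianStructure

variable {M : Type*} [TopologicalSpace M] [ChartedSpace (EuclideanSpace ℝ (Fin 3)) M]
  [IsManifold (𝓡 3) ∞ M] {P : PseudohermitianStructure M}
  {H : Type*} [TopologicalSpace H] {I : ModelWithCorners ℝ (EuclideanSpace ℝ (Fin 2)) H}
  {N : Type*} [TopologicalSpace N] [ChartedSpace H N] [IsManifold I ∞ N] {ι : N → M}
  {e₁ : (p : N) → TangentSpace I p} {Φ : ℝ → N → M}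

theorem IsCharacteristicField.eq_add (he₁ : IsCharacteristicField I P ι e₁) {q : N}
    (hinj : Function.Injective (mfderiv I (𝓡 3) ι q)) (hq : q ∉ singularSet I P ι)
    (v : TangentSpace I q) :
    v = P.dualForm (ι q) (mfderiv I (𝓡 3) ι q (e₁ q)) (mfderiv I (𝓡 3) ι q v) • e₁ q +
      P.Θ (ι q) (mfderiv I (𝓡 3) ι q v) • charLift P I ι e₁ q := by
  apply hinj
  rw [map_add, map_smul, map_smul, he₁.mfderiv_charLift hq]
  have h1 := (he₁.isUnit hq).decomposition (mfderiv I (𝓡 3) ι q v)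
  have h2 : P.dualForm (ι q) (P.J (ι q) (mfderiv I (𝓡 3) ι q (e₁ q))) (mfderiv I (𝓡 3) ι q v) =
    alphaFun I P ι e₁ q * P.Θ (ι q) (mfderiv I (𝓡 3) ι q v) := (he₁.alphaFun_spec hq).2 v
  rw [h2] at h1
  refine h1.trans ?_
  rw [legendrianNormal, smul_add, smul_smul, mul_comm (alphaFun I P ι e₁ q), add_assoc]

theorem relDensity_eq_one (he₁ : IsCharacteristicField I P ι e₁) {q : N}
    (hq : q ∉ singularSet I P ι) : P.areaDensity (ι q) (mfderiv I (𝓡 3) ι q (e₁ q))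
      (mfderiv I (𝓡 3) ι q (charLift P I ι e₁ q)) = 1 := by
  have hx := he₁.isUnit hq
  have h1 : P.Θ (ι q) (mfderiv I (𝓡 3) ι q (charLift P I ι e₁ q)) = 1 := by
    have h2 : P.Θ (ι q) (legendrianNormal I P ι e₁ q) = 0 := hx.J.1
    rw [he₁.mfderiv_charLift hq, map_add, map_smul, P.Θ_reeb, h2, smul_zero, zero_add]
  rw [hx.areaDensity_eq, hx.1, h1, hx.dualForm_self, hx.dualForm_J_self]
  norm_num

/-- The coordinate vectors are combinations of e₁ and `charLift` with coefficients independent of t.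
The same determinant therefore occurs at time t and at time zero, where the relative density is 1.
-/
theorem chartDensity_variation (hι : ContMDiff I (𝓡 3) ∞ ι)
    (hι' : ∀ p, Function.Injective (mfderiv I (𝓡 3) ι p))
    (he₁ : IsCharacteristicField I P ι e₁) {p : N} {u : Plane} (hu : u ∈ chartDomain I p)
    (hS : (extChartAt I p).symm u ∉ singularSet I P ι) {t : ℝ} (hΦ : ContMDiff I (𝓡 3) ∞ (Φ t)) :
    chartDensity P I (Φ t) p u =
      relDensity I P ι e₁ Φ t ((extChartAt I p).symm u) * chartDensity P I ι p u := by
  set q := (extChartAt I p).symm u with hq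
  obtain ⟨v, hv⟩ : ∃ v : Fin 2 → TangentSpace I q,
    v = fun i => mfderiv 𝓘(ℝ, Plane) I (extChartAt I p).symm u (planeBasis i) := ⟨_, rfl⟩
  set r : Fin 2 → ℝ := fun i => P.dualForm (ι q) (mfderiv I (𝓡 3) ι q (e₁ q))
    (mfderiv I (𝓡 3) ι q (v i)) with hr
  set s : Fin 2 → ℝ := fun i => P.Θ (ι q) (mfderiv I (𝓡 3) ι q (v i)) with hs
  have key : ∀ {X : N → M}, ContMDiff I (𝓡 3) ∞ X → chartDensity P I X p u =
      |r 0 * s 1 - s 0 * r 1| * P.areaDensity (X q) (mfderiv I (𝓡 3) X q (e₁ q))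
        (mfderiv I (𝓡 3) X q (charLift P I ι e₁ q)) := by
    intro X hX
    have h1 : ∀ i, (chartPartial I X p u i : EuclideanSpace ℝ (Fin 3)) =
        (r i • mfderiv I (𝓡 3) X q (e₁ q) +
          s i • mfderiv I (𝓡 3) X q (charLift P I ι e₁ q) : TangentSpace (𝓡 3) (X q)) := by
      intro i
      refine (chartPartial_eq X hu i).trans ?_
      refine (mfderiv_comp_symm hu ((hX _).mdifferentiableAt (by simp)) (planeBasis i)).trans ?_
      have h2 : mfderiv 𝓘(ℝ, Plane) I (extChartAt I p).symm u (planeBasis i) = v i := by rw [hv]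
      refine (congrArg (mfderiv I (𝓡 3) X q)
        (h2.trans (he₁.eq_add (hι' q) hS (v i)))).trans ?_
      rw [map_add, map_smul, map_smul]
    have h4 : ∀ v w v' w' : EuclideanSpace ℝ (Fin 3), v = v' → w = w' →
      P.areaDensity (X q) v w = P.areaDensity (X q) v' w' := by rintro v w v' w' rfl rfl; rfl
    exact (h4 _ _ _ _ (h1 0) (h1 1)).trans (areaDensity_linear_comb P _ _ _ _ _ _)
  rw [key hΦ, key hι, relDensity_eq_one he₁ hS, relDensity]
  ring

end RelativeDensity

/-! ### Globalization by partitions of unity -/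

section Gluing

open PseudohermitianStructure

variable {M : Type*} [TopologicalSpace M] [ChartedSpace (EuclideanSpace ℝ (Fin 3)) M]
  [IsManifold (𝓡 3) ∞ M] {P : PseudohermitianStructure M}
  {H : Type*} [TopologicalSpace H] {I : ModelWithCorners ℝ (EuclideanSpace ℝ (Fin 2)) H}
  {N : Type*} [TopologicalSpace N] [ChartedSpace H N] [IsManifold I ∞ N] {ι : N → M}
  {Φ : ℝ → N → M} {ε : ℝ} {K : Set N} {O : N → Set Plane}

theorem charDeriv_eq_zero {Z : (q : N) → TangentSpace I q} {φ : N → ℝ} {q : N}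
    (h : φ =ᶠ[𝓝 q] fun _ => 0) : charDeriv I Z φ q = 0 := by
  rw [charDeriv, h.mfderiv_eq, mfderiv_const]
  rfl

theorem preimage_symm_chart {p : N} {W : Set Plane} (hW : W ⊆ chartDomain I p) :
    chartDomain I p ∩ (extChartAt I p).symm ⁻¹' ((extChartAt I p).source ∩ extChartAt I p ⁻¹' W) =
      W := by
  ext u
  constructor
  · rintro ⟨h1, -, h2⟩
    rwa [mem_preimage, (extChartAt I p).right_inv (chartDomain_subset h1)] at h2
  · intro hu
    have h1 := chartDomain_subset (hW hu)
    exact ⟨hW hu, (extChartAt I p).map_target h1, by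
      rwa [mem_preimage, (extChartAt I p).right_inv h1]⟩

theorem preimage_symm_image {p : N} {C : Set N}
    (hC : C ⊆ (extChartAt I p).source ∩ extChartAt I p ⁻¹' chartDomain I p) :
    chartDomain I p ∩ (extChartAt I p).symm ⁻¹' C = extChartAt I p '' C := by
  ext u
  constructor
  · rintro ⟨h1, h2⟩
    exact ⟨_, h2, (extChartAt I p).right_inv (chartDomain_subset h1)⟩
  · rintro ⟨q, hq, rfl⟩
    refine ⟨(hC hq).2, ?_⟩
    rwa [mem_preimage, (extChartAt I p).left_inv (hC hq).1]

theorem continuous_of_continuousOn_charts (hK : IsClosed K)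
    (hO : ∀ p ∈ K, IsOpen (O p) ∧ extChartAt I p p ∈ O p) {R : N → ℝ}
    (hR : ∀ q ∉ K, R q = 0)
    (hc : ∀ p ∈ K, ContinuousOn (fun u => R ((extChartAt I p).symm u)) (O p)) : Continuous R := by
  refine continuous_iff_continuousAt.2 fun q => ?_
  by_cases hq : q ∈ K
  · have h1 : ContinuousAt (fun u => R ((extChartAt I q).symm u)) (extChartAt I q q) :=
      (hc q hq).continuousAt ((hO q hq).1.mem_nhds (hO q hq).2)
    have h2 : ContinuousAt (fun r => R ((extChartAt I q).symm (extChartAt I q r))) q :=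
      ContinuousAt.comp (g := fun u => R ((extChartAt I q).symm u)) (f := extChartAt I q) h1
        (continuousAt_extChartAt q)
    refine h2.congr ?_
    filter_upwards [extChartAt_source_mem_nhds (I := I) q] with r hr
    rw [(extChartAt I q).left_inv hr]
  · refine continuousAt_const.congr (f := fun _ => (0 : ℝ)) ?_
    filter_upwards [hK.isOpen_compl.mem_nhds hq] with r hr
    exact (hR r hr).symm

variable [T2Space N] [SigmaCompactSpace N]

/-- Cover N by the given neighbourhoods of points of K and by the complement of K, and keep the
finitely many functions whose supports meet K. Their sum is 1 on a neighbourhood of each point of K,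
so its derivatives vanish there. -/
theorem exists_partition (I : ModelWithCorners ℝ (EuclideanSpace ℝ (Fin 2)) H)
    [IsManifold I ∞ N] (hK : IsCompact K) {V : N → Set N}
    (hV : ∀ p ∈ K, IsOpen (V p) ∧ p ∈ V p) : ∃ (J : Finset N) (ρ : N → N → ℝ),
      (∀ i ∈ J, i ∈ K ∧ ContMDiff I 𝓘(ℝ, ℝ) ∞ (ρ i) ∧ tsupport (ρ i) ⊆ V i) ∧
      ∀ q ∈ K, ∀ᶠ r in 𝓝 q, ∑ i ∈ J, ρ i r = 1 := by
  classical
  obtain ⟨ρ, hρ⟩ := SmoothPartitionOfUnity.exists_isSubordinate I (isClosed_univ (X := N))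
    (fun i => if i ∈ K then V i else Kᶜ) (fun i => by
      by_cases hi : i ∈ K
      · simp only [if_pos hi]; exact (hV i hi).1
      · simp only [if_neg hi]; exact hK.isClosed.isOpen_compl) (fun q _ => by
      refine mem_iUnion.2 ⟨q, ?_⟩
      by_cases hq : q ∈ K
      · simp only [if_pos hq]; exact (hV q hq).2
      · simp only [if_neg hq]; exact hq)
  have hl : LocallyFinite fun i => tsupport (ρ i) := ρ.locallyFinite.closure
  have hfin : {i | (tsupport (ρ i) ∩ K).Nonempty}.Finite := hl.finite_nonempty_inter_compact hK
  refine ⟨hfin.toFinset, fun i => ρ i, fun i hi => ?_, fun q hq => ?_⟩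
  · have hi' : (tsupport (ρ i) ∩ K).Nonempty := hfin.mem_toFinset.1 hi
    have hs := hρ i
    have hiK : i ∈ K := by
      by_contra h0
      obtain ⟨r, hr1, hr2⟩ := hi'
      simp only [if_neg h0] at hs
      exact hs hr1 hr2
    simp only [if_pos hiK] at hs
    exact ⟨hiK, (ρ i).contMDiff, hs⟩
  · have hl' : LocallyFinite fun i : {i : N // i ∉ hfin.toFinset} => tsupport (ρ i) :=
      hl.comp_injective Subtype.val_injective
    have hcl := hl'.isClosed_iUnion fun i => isClosed_tsupport _
    have hq' : q ∉ ⋃ i : {i : N // i ∉ hfin.toFinset}, tsupport (ρ i) := by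
      intro h0
      obtain ⟨i, hi⟩ := mem_iUnion.1 h0
      exact i.2 (hfin.mem_toFinset.2 ⟨q, hi, hq⟩)
    filter_upwards [hcl.isOpen_compl.mem_nhds hq'] with r hr
    rw [← ρ.sum_eq_one (mem_univ r)]
    refine (finsum_eq_sum_of_support_subset _ fun i hi => ?_).symm
    by_contra h0
    exact hr (mem_iUnion.2 ⟨⟨i, h0⟩, subset_tsupport _ hi⟩)

variable [MeasurableSpace N] [BorelSpace N]

theorem integrable_pAreaMeasure (hι : ContMDiff I (𝓡 3) ∞ ι) (hK : IsCompact K) {R : N → ℝ}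
    (hR : Continuous R) (h0 : ∀ q ∉ K, R q = 0) : Integrable R (pAreaMeasure I P ι) := by
  have := isLocallyFiniteMeasure_pAreaMeasure (P := P) hι
  exact hR.integrable_of_hasCompactSupport (HasCompactSupport.intro hK h0)

/-- The divergence theorem for the field Z with respect to the p-area. The function E is its
divergence, expressed through the local vector densities (Q₀, Q₁), and cutting Z off with a
partition of unity reduces the claim to the plane. -/
theorem integral_eq_zero_of_local_divergence (hι : ContMDiff I (𝓡 3) ∞ ι) (hK : IsCompact K)
    (hO : ∀ p ∈ K, IsOpen (O p) ∧ extChartAt I p p ∈ O p) (hOd : ∀ p ∈ K, O p ⊆ chartDomain I p)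
    (hpos : ∀ p ∈ K, ∀ u ∈ O p, 0 < chartDensity P I ι p u) {Q₀ Q₁ : N → Plane → ℝ} {E : N → ℝ}
    {Z : (q : N) → TangentSpace I q} (hE : ∀ q ∉ K, E q = 0) (hZ : ∀ q ∉ K, Z q = 0)
    (hQ : ∀ p ∈ K, ∀ u ∈ O p, ContDiffAt ℝ ∞ (Q₀ p) u ∧ ContDiffAt ℝ ∞ (Q₁ p) u ∧
      chartDensity P I ι p u * E ((extChartAt I p).symm u) =
        fderiv ℝ (Q₀ p) u (planeBasis 0) + fderiv ℝ (Q₁ p) u (planeBasis 1) ∧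
      ∀ l : Plane →L[ℝ] ℝ, l (planeBasis 0) * Q₀ p u + l (planeBasis 1) * Q₁ p u =
        chartDensity P I ι p u * l (tangentCoord I p u (Z ((extChartAt I p).symm u)))) :
    Continuous E ∧ ∫ q, E q ∂(pAreaMeasure I P ι) = 0 := by
  have hdens : ∀ p ∈ K, ContinuousOn (chartDensity P I ι p) (O p) := fun p hp =>
    (continuousOn_chartDensity hι p).mono (hOd p hp)
  have hcont : ∀ {R : N → ℝ}, (∀ q ∉ K, R q = 0) → (∀ p ∈ K, ∃ D : Plane → ℝ,
      (∀ u ∈ O p, ContinuousAt D u) ∧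
      ∀ u ∈ O p, chartDensity P I ι p u * R ((extChartAt I p).symm u) = D u) → Continuous R := by
    intro R hR h
    refine continuous_of_continuousOn_charts hK.isClosed hO hR fun p hp => ?_
    obtain ⟨D, hD, hD'⟩ := h p hp
    refine (ContinuousOn.div (fun u hu => (hD u hu).continuousWithinAt) (hdens p hp)
      fun u hu => (hpos p hp u hu).ne').congr fun u hu => ?_
    rw [Pi.div_apply, eq_div_iff (hpos p hp u hu).ne', ← hD' u hu, mul_comm]
  have hEc : Continuous E := hcont hE fun p hp => ⟨_, fun u hu =>
    (((hQ p hp u hu).1.fderiv_apply_const (planeBasis 0)).add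
      ((hQ p hp u hu).2.1.fderiv_apply_const (planeBasis 1))).continuousAt,
    fun u hu => (hQ p hp u hu).2.2.1⟩
  refine ⟨hEc, ?_⟩
  obtain ⟨J, ρ, hJ, hsum⟩ := exists_partition I hK
    (V := fun p => (extChartAt I p).source ∩ extChartAt I p ⁻¹' O p)
    fun p hp => ⟨isOpen_source_inter_preimage (hO p hp).1, mem_extChartAt_source p, (hO p hp).2⟩
  have hρ : ∀ i ∈ J, ∀ p ∈ K, ∀ u ∈ O p,
      ContDiffAt ℝ ∞ (fun y => ρ i ((extChartAt I p).symm y)) u := fun i hi p hp u hu =>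
    contDiffAt_comp_symm (hOd p hp hu) ((hJ i hi).2.1 _)
  -- By the product rule `h i` is the divergence of ρᵢZ.
  set h : N → N → ℝ := fun i q => ρ i q * E q + charDeriv I Z (ρ i) q with hh
  have hcd0 : ∀ φ : N → ℝ, ∀ q ∉ K, charDeriv I Z φ q = 0 := fun φ q hq => by
    rw [charDeriv, hZ q hq]
    exact map_zero (mfderiv I 𝓘(ℝ, ℝ) φ q)
  have hh0 : ∀ i, ∀ q ∉ K, h i q = 0 := fun i q hq => by
    simp only [hh, hE q hq, mul_zero, hcd0 _ q hq, add_zero]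
  have key : ∀ i ∈ J, ∀ p ∈ K, ∀ u ∈ O p,
      chartDensity P I ι p u * h i ((extChartAt I p).symm u) =
        fderiv ℝ (fun y => ρ i ((extChartAt I p).symm y) * Q₀ p y) u (planeBasis 0) +
        fderiv ℝ (fun y => ρ i ((extChartAt I p).symm y) * Q₁ p y) u (planeBasis 1) := by
    intro i hi p hp u hu
    obtain ⟨h1, h2, h3, h4⟩ := hQ p hp u hu
    have h5 := (hρ i hi p hp u hu).differentiableAt (by simp)
    have h6 := h4 (fderiv ℝ (fun y => ρ i ((extChartAt I p).symm y)) u)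
    rw [← charDeriv_eq (hOd p hp hu) h5 Z] at h6
    rw [fderiv_fun_mul h5 (h1.differentiableAt (by simp)),
      fderiv_fun_mul h5 (h2.differentiableAt (by simp))]
    simp only [hh, add_apply, smul_apply, smul_eq_mul]
    linear_combination ρ i ((extChartAt I p).symm u) * h3 - h6
  have hhc : ∀ i ∈ J, Continuous (h i) := fun i hi => hcont (hh0 i) fun p hp => ⟨_, fun u hu =>
    ((((hρ i hi p hp u hu).mul (hQ p hp u hu).1).fderiv_apply_const (planeBasis 0)).add
      (((hρ i hi p hp u hu).mul (hQ p hp u hu).2.1).fderiv_apply_const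
        (planeBasis 1))).continuousAt, fun u hu => key i hi p hp u hu⟩
  -- Near points of K the functions ρᵢ sum to 1, so the terms Z(ρᵢ) cancel; off K both E and Z
  -- vanish.
  have hEsum : E = fun q => ∑ i ∈ J, h i q := by
    funext q
    by_cases hq : q ∈ K
    · have h1 : ∑ i ∈ J, charDeriv I Z (ρ i) q = 0 := by
        have hu := (hO q hq).2
        have hd : ∀ i ∈ J, DifferentiableAt ℝ (fun y => ρ i ((extChartAt I q).symm y))
          (extChartAt I q q) := fun i hi => (hρ i hi q hq _ hu).differentiableAt (by simp)
        have h2 : ∀ i ∈ J, charDeriv I Z (ρ i) q =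
            fderiv ℝ (fun y => ρ i ((extChartAt I q).symm y)) (extChartAt I q q)
            (tangentCoord I q (extChartAt I q q) (Z ((extChartAt I q).symm (extChartAt I q q)))) :=
          fun i hi => by
            rw [← charDeriv_eq (hOd q hq hu) (hd i hi) Z, extChartAt_to_inv]
        rw [Finset.sum_congr rfl h2, ← ContinuousLinearMap.sum_apply, ← fderiv_fun_sum hd]
        have h3 : (fun y => ∑ i ∈ J, ρ i ((extChartAt I q).symm y)) =ᶠ[𝓝 (extChartAt I q q)]
            fun _ => 1 := by
          have h4 := tendsto_symm (hOd q hq hu)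
          rw [extChartAt_to_inv] at h4
          exact h4.eventually (hsum q hq)
        rw [h3.fderiv_eq]
        simp
      simp only [hh, Finset.sum_add_distrib, h1, ← Finset.sum_mul,
        (hsum q hq).self_of_nhds, one_mul, add_zero]
    · rw [hE q hq, Finset.sum_eq_zero fun i _ => hh0 i q hq]
  rw [hEsum, integral_finset_sum _ fun i hi => integrable_pAreaMeasure hι hK (hhc i hi) (hh0 i)]
  refine Finset.sum_eq_zero fun i hi => ?_
  obtain ⟨hiK, -, hts⟩ := hJ i hi
  have hOi := hO i hiK
  have hVd : (extChartAt I i).source ∩ extChartAt I i ⁻¹' O i ⊆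
      (extChartAt I i).source ∩ extChartAt I i ⁻¹' chartDomain I i :=
    inter_subset_inter_right _ (preimage_mono (hOd i hiK))
  rw [← setIntegral_eq_integral_of_forall_compl_eq_zero
    (s := (extChartAt I i).source ∩ extChartAt I i ⁻¹' O i),
    setIntegral_pAreaMeasure hι (isOpen_source_inter_preimage hOi.1).measurableSet hVd
      (hhc i hi).aestronglyMeasurable, preimage_symm_chart (hOd i hiK),
    setIntegral_congr_fun hOi.1.measurableSet (key i hi i hiK)]
  · set C := extChartAt I i '' (tsupport (ρ i) ∩ K) with hC
    have hCc : IsCompact C := (hK.inter_left (isClosed_tsupport _)).image_of_continuousOn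
      ((continuousOn_extChartAt i).mono fun q hq => (hts hq.1).1)
    have hCO : C ⊆ O i := by
      rintro _ ⟨q, hq, rfl⟩
      exact (hts hq.1).2
    -- Off C either ρᵢ vanishes or the point lies outside K. In the latter case Z = 0, and testing
    -- the last clause of `hQ` on the coordinate functionals gives Q₀ = Q₁ = 0.
    have hoff : ∀ u ∈ O i, u ∉ C → ρ i ((extChartAt I i).symm u) = 0 ∨
        (Q₀ i u = 0 ∧ Q₁ i u = 0) := by
      intro u hu huC
      by_cases h1 : (extChartAt I i).symm u ∈ tsupport (ρ i)
      · right
        have h2 : (extChartAt I i).symm u ∉ K := fun h2 => huC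
          ⟨_, ⟨h1, h2⟩, (extChartAt I i).right_inv (chartDomain_subset (hOd i hiK hu))⟩
        have h3 : ∀ l : Plane →L[ℝ] ℝ,
            l (planeBasis 0) * Q₀ i u + l (planeBasis 1) * Q₁ i u = 0 := fun l => by
          rw [(hQ i hiK u hu).2.2.2 l, hZ _ h2]
          have h4 : tangentCoord I i u 0 = 0 :=
            map_zero (mfderiv I 𝓘(ℝ, Plane) (extChartAt I i) ((extChartAt I i).symm u))
          rw [h4, map_zero, mul_zero]
        have h5 := h3 (EuclideanSpace.proj 0)
        have h6 := h3 (EuclideanSpace.proj 1)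
        simp [planeBasis] at h5 h6
        exact ⟨h5, h6⟩
      · left
        exact image_eq_zero_of_notMem_tsupport h1
    have d0 := setIntegral_fderiv_eq_zero hOi.1
      (fun u hu => (hρ i hi i hiK u hu).mul (hQ i hiK u hu).1) hCc hCO
      (fun u hu huC => by
        rcases hoff u hu huC with h | h
        · rw [h, zero_mul]
        · rw [h.1, mul_zero]) (planeBasis 0)
    have d1 := setIntegral_fderiv_eq_zero hOi.1
      (fun u hu => (hρ i hi i hiK u hu).mul (hQ i hiK u hu).2.1) hCc hCO
      (fun u hu huC => by
        rcases hoff u hu huC with h | h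
        · rw [h, zero_mul]
        · rw [h.2, mul_zero]) (planeBasis 1)
    rw [integral_add d0.1 d1.1, d0.2, d1.2, add_zero]
  · intro q hq
    have h1 : q ∉ tsupport (ρ i) := fun h1 => hq (hts h1)
    have h2 : ρ i =ᶠ[𝓝 q] fun _ => 0 := notMem_tsupport_iff_eventuallyEq.1 h1
    simp only [hh, charDeriv_eq_zero h2, h2.self_of_nhds, zero_mul, add_zero]

/-- The area of L \ K does not move. On K the area is a finite sum of chart integrals of ρᵢGᵢ over
fixed compact sets, and it is differentiated twice under the integral sign. -/
theorem hasDerivAt_area {L : Set N} (hΦ : ContMDiffOn (𝓘(ℝ, ℝ).prod I) (𝓡 3) ∞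
    (fun x : ℝ × N => Φ x.1 x.2) (Ioo (-ε) ε ×ˢ univ)) (hε : 0 < ε) (hK : IsCompact K)
    (hL : IsCompact L) (hKL : K ⊆ L) (hΦK : ∀ t ∈ Ioo (-ε) ε, ∀ q ∉ K, Φ t q = Φ 0 q)
    (hO : ∀ p ∈ K, IsOpen (O p) ∧ extChartAt I p p ∈ O p) (hOd : ∀ p ∈ K, O p ⊆ chartDomain I p)
    {δ : N → ℝ} {G : N → ℝ × Plane → ℝ} (hδ : ∀ p ∈ K, 0 < δ p)
    (hG : ∀ p ∈ K, ∀ t ∈ Ioo (-δ p) (δ p), ∀ u ∈ O p, ContDiffAt ℝ ∞ (G p) (t, u) ∧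
      (t ∈ Ioo (-ε) ε → chartDensity P I (Φ t) p u = G p (t, u))) {R : N → ℝ} (hR : Continuous R)
    (hRK : ∀ q ∉ K, R q = 0) (hGR : ∀ p ∈ K, ∀ u ∈ O p,
      fderiv ℝ (fun y => fderiv ℝ (G p) y (1, 0)) (0, u) (1, 0) =
        chartDensity P I (Φ 0) p u * R ((extChartAt I p).symm u)) :
    ∃ A' : ℝ → ℝ,
      (∀ᶠ t in 𝓝 (0 : ℝ), HasDerivAt (fun s => (pAreaMeasure I P (Φ s) L).toReal) (A' t) t) ∧
      HasDerivAt A' (∫ q, R q ∂(pAreaMeasure I P (Φ 0))) 0 := by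
  obtain ⟨J, ρ, hJ, hsum⟩ := exists_partition I hK
    (V := fun p => (extChartAt I p).source ∩ extChartAt I p ⁻¹' O p)
    fun p hp => ⟨isOpen_source_inter_preimage (hO p hp).1, mem_extChartAt_source p, (hO p hp).2⟩
  have hΦs : ∀ {t}, t ∈ Ioo (-ε) ε → ContMDiff I (𝓡 3) ∞ (Φ t) := fun ht => contMDiff_variation hΦ ht
  have h0ε : (0 : ℝ) ∈ Ioo (-ε) ε := ⟨by linarith, hε⟩
  have hKm : MeasurableSet K := hK.isClosed.measurableSet
  set S : N → Set N := fun i => tsupport (ρ i) ∩ K with hS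
  have hSc : ∀ i, IsCompact (S i) := fun i => hK.inter_left (isClosed_tsupport _)
  set C : N → Set Plane := fun i => extChartAt I i '' S i with hC
  have hSV : ∀ i ∈ J, S i ⊆ (extChartAt I i).source ∩ extChartAt I i ⁻¹' O i := fun i hi q hq =>
    (hJ i hi).2.2 hq.1
  have hSd : ∀ i ∈ J, S i ⊆ (extChartAt I i).source ∩ extChartAt I i ⁻¹' chartDomain I i :=
    fun i hi => (hSV i hi).trans
      (inter_subset_inter_right _ (preimage_mono (hOd i (hJ i hi).1)))
  have hCc : ∀ i ∈ J, IsCompact (C i) := fun i hi => (hSc i).image_of_continuousOn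
    ((continuousOn_extChartAt i).mono fun q hq => (hSV i hi hq).1)
  have hCO : ∀ i ∈ J, C i ⊆ O i := by
    rintro i hi _ ⟨q, hq, rfl⟩
    exact (hSV i hi hq).2
  have hρc : ∀ i ∈ J, Continuous (ρ i) := fun i hi => (hJ i hi).2.1.continuous
  have hχ : ∀ i ∈ J, ContinuousOn (fun u => ρ i ((extChartAt I i).symm u)) (C i) := fun i hi =>
    (hρc i hi).comp_continuousOn ((continuousOn_symm_chartDomain i).mono
      ((hCO i hi).trans (hOd i (hJ i hi).1)))
  -- One time interval that serves for all the finitely many charts in use.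
  obtain ⟨δ₀, hδ₀, hδε, hδJ⟩ : ∃ δ₀ : ℝ, 0 < δ₀ ∧ δ₀ ≤ ε ∧ ∀ i ∈ J, δ₀ ≤ δ i := by
    have h1 : ∀ {r : ℝ}, 0 < r → ∀ᶠ t in 𝓝[>] (0 : ℝ), t ≤ r := fun hr =>
      mem_of_superset (Ioc_mem_nhdsGT hr) fun t ht => ht.2
    obtain ⟨t, h2, h3, h4⟩ := ((eventually_mem_nhdsWithin (a := (0 : ℝ)) (s := Ioi 0)).and
      ((h1 hε).and ((Filter.eventually_all_finset J).2 fun i hi => h1 (hδ i (hJ i hi).1)))).exists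
    exact ⟨t, h2, h3, h4⟩
  have hsub : ∀ i ∈ J, Ioo (-δ₀) δ₀ ⊆ Ioo (-δ i) (δ i) := fun i hi =>
    Ioo_subset_Ioo (neg_le_neg (hδJ i hi)) (hδJ i hi)
  have hsubε : Ioo (-δ₀) δ₀ ⊆ Ioo (-ε) ε := Ioo_subset_Ioo (neg_le_neg hδε) hδε
  have h0δ : (0 : ℝ) ∈ Ioo (-δ₀) δ₀ := ⟨by linarith, hδ₀⟩
  -- integrals against the partition of unity in charts
  have hint : ∀ {t}, t ∈ Ioo (-δ₀) δ₀ → ∀ i ∈ J, ∀ {F : N → ℝ}, Continuous F →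
      ∫ q in S i, F q ∂(pAreaMeasure I P (Φ t)) =
        ∫ u in C i, G i (t, u) * F ((extChartAt I i).symm u) := by
    intro t ht i hi F hF
    rw [setIntegral_pAreaMeasure (hΦs (hsubε ht)) (hSc i).isClosed.measurableSet (hSd i hi)
      hF.aestronglyMeasurable, preimage_symm_image (hSd i hi)]
    refine setIntegral_congr_fun (hCc i hi).measurableSet fun u hu => ?_
    simp only [(hG i (hJ i hi).1 t (hsub i hi ht) u (hCO i hi hu)).2 (hsubε ht)]
  have harea : ∀ t ∈ Ioo (-δ₀) δ₀, (pAreaMeasure I P (Φ t) L).toReal =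
      (pAreaMeasure I P (Φ 0) (L \ K)).toReal +
        ∑ i ∈ J, ∫ u in C i, ρ i ((extChartAt I i).symm u) * G i (t, u) := by
    intro t ht
    have hfinite := isLocallyFiniteMeasure_pAreaMeasure (P := P) (hΦs (hsubε ht))
    -- Since K is closed, each point outside it has a neighbourhood on which the variation is
    -- constant, so the first derivatives that enter the density agree as well.
    have h1 : pAreaMeasure I P (Φ t) (L \ K) = pAreaMeasure I P (Φ 0) (L \ K) := by
      refine pAreaMeasure_congr (hL.isClosed.measurableSet.diff hKm) fun q hq => ?_
      filter_upwards [hK.isClosed.isOpen_compl.mem_nhds hq.2] with r hr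
      exact hΦK t (hsubε ht) r hr
    have h2 := measure_inter_add_diff (μ := pAreaMeasure I P (Φ t)) L hKm
    rw [inter_eq_right.2 hKL, h1] at h2
    have hKt : pAreaMeasure I P (Φ t) K ≠ ⊤ := hK.measure_lt_top.ne
    have hLt : pAreaMeasure I P (Φ 0) (L \ K) ≠ ⊤ := by
      rw [← h1]; exact ((measure_mono diff_subset).trans_lt hL.measure_lt_top).ne
    rw [← h2, ENNReal.toReal_add hKt hLt, add_comm]
    congr 1
    have h3 : (pAreaMeasure I P (Φ t) K).toReal =
        ∫ q in K, ∑ i ∈ J, ρ i q ∂(pAreaMeasure I P (Φ t)) := by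
      rw [setIntegral_congr_fun hKm fun q hq => (hsum q hq).self_of_nhds]
      simp [Measure.real]
    rw [h3, integral_finset_sum _ fun i hi => (hρc i hi).continuousOn.integrableOn_compact hK]
    refine Finset.sum_congr rfl fun i hi => ?_
    have h4 : ∫ q in K, ρ i q ∂(pAreaMeasure I P (Φ t)) =
        ∫ q in S i, ρ i q ∂(pAreaMeasure I P (Φ t)) := by
      refine setIntegral_eq_of_subset_of_forall_diff_eq_zero hKm inter_subset_right
        fun q hq => image_eq_zero_of_notMem_tsupport fun h0 => hq.2 ⟨h0, hq.1⟩
    rw [h4, hint ht i hi (hρc i hi)]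
    simp only [mul_comm]
  refine ⟨fun t => ∑ i ∈ J, ∫ u in C i, ρ i ((extChartAt I i).symm u) * fderiv ℝ (G i) (t, u) (1, 0),
    ?_, ?_⟩
  · filter_upwards [isOpen_Ioo.mem_nhds h0δ] with t ht
    have h1 : (fun s => (pAreaMeasure I P (Φ s) L).toReal) =ᶠ[𝓝 t] fun s =>
        (pAreaMeasure I P (Φ 0) (L \ K)).toReal +
        ∑ i ∈ J, ∫ u in C i, ρ i ((extChartAt I i).symm u) * G i (s, u) := by
      filter_upwards [isOpen_Ioo.mem_nhds ht] with s hs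
      exact harea s hs
    refine HasDerivAt.congr_of_eventuallyEq ?_ h1
    refine (HasDerivAt.fun_sum fun i hi => ?_).const_add _
    exact hasDerivAt_setIntegral (hCc i hi) (hχ i hi) (fun s hs u hu =>
      (hG i (hJ i hi).1 s (hsub i hi hs) u (hCO i hi hu)).1) ht
  · have h2 : ∫ q, R q ∂(pAreaMeasure I P (Φ 0)) = ∑ i ∈ J, ∫ u in C i,
        ρ i ((extChartAt I i).symm u) *
          fderiv ℝ (fun y => fderiv ℝ (G i) y (1, 0)) (0, u) (1, 0) := by
      have h3 : R = fun q => ∑ i ∈ J, ρ i q * R q := by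
        funext q
        by_cases hq : q ∈ K
        · rw [← Finset.sum_mul, (hsum q hq).self_of_nhds, one_mul]
        · rw [hRK q hq]; simp
      have h4 : ∀ i ∈ J, Continuous fun q => ρ i q * R q := fun i hi => (hρc i hi).mul hR
      rw [h3, integral_finset_sum _ fun i hi => integrable_pAreaMeasure (hΦs h0ε) hK (h4 i hi)
        fun q hq => by rw [hRK q hq, mul_zero]]
      refine Finset.sum_congr rfl fun i hi => ?_
      rw [← setIntegral_eq_integral_of_forall_compl_eq_zero (s := S i), hint h0δ i hi (h4 i hi)]
      · refine setIntegral_congr_fun (hCc i hi).measurableSet fun u hu => ?_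
        have h5 := hCO i hi hu
        have h6 := (hG i (hJ i hi).1 0 (hsub i hi h0δ) u h5).2 h0ε
        change G i (0, u) * (ρ i ((extChartAt I i).symm u) * R ((extChartAt I i).symm u)) = _
        rw [hGR i (hJ i hi).1 u h5, h6]
        ring
      · intro q hq
        by_cases hqK : q ∈ K
        · rw [image_eq_zero_of_notMem_tsupport fun h0 => hq ⟨h0, hqK⟩, zero_mul]
        · rw [hRK q hqK, mul_zero]
    rw [h2]
    refine HasDerivAt.fun_sum fun i hi => ?_
    exact hasDerivAt_setIntegral (G := fun y => fderiv ℝ (G i) y (1, 0)) (hCc i hi) (hχ i hi)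
      (fun s hs u hu => (hG i (hJ i hi).1 s (hsub i hi hs) u (hCO i hi hu)).1.fderiv_apply_const
        (1, 0)) h0δ

end Gluing

/-! ### Vanishing off the support of the variation, and the conclusion -/

section SupportOfVariation

open PseudohermitianStructure

variable {M : Type*} [TopologicalSpace M] [ChartedSpace (EuclideanSpace ℝ (Fin 3)) M]
  [IsManifold (𝓡 3) ∞ M] {P : PseudohermitianStructure M}
  {H : Type*} [TopologicalSpace H] {I : ModelWithCorners ℝ (EuclideanSpace ℝ (Fin 2)) H}
  {N : Type*} [TopologicalSpace N] [ChartedSpace H N] [IsManifold I ∞ N] {ι : N → M}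
  {e₁ : (p : N) → TangentSpace I p} {f g : N → ℝ} {Φ : ℝ → N → M} {ε : ℝ} {K : Set N}

theorem velocity_eq_zero (hΦK : ∀ t ∈ Ioo (-ε) ε, ∀ p ∉ K, Φ t p = ι p) {q : N} (hq : q ∉ K)
    {t : ℝ} (ht : t ∈ Ioo (-ε) ε) : velocity Φ t q = 0 := by
  have h : (fun s => Φ s q) =ᶠ[𝓝 t] fun _ => ι q := by
    filter_upwards [isOpen_Ioo.mem_nhds ht] with s hs
    exact hΦK s hs q hq
  have h1 : (mfderiv 𝓘(ℝ, ℝ) (𝓡 3) (fun s => Φ s q) t : ℝ →L[ℝ] EuclideanSpace ℝ (Fin 3)) = 0 :=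
    h.mfderiv_eq.trans mfderiv_const
  change (mfderiv 𝓘(ℝ, ℝ) (𝓡 3) (fun s => Φ s q) t : ℝ →L[ℝ] EuclideanSpace ℝ (Fin 3)) 1 = 0
  rw [h1]
  rfl

/-- The vectors e₂ and T are independent: apply e² and Θ. Hence f and g vanish at nonsingular points
off K. -/
theorem variation_components_eq_zero (he₁ : IsCharacteristicField I P ι e₁)
    (hV : ∀ p ∉ singularSet I P ι, (velocity Φ 0 p : EuclideanSpace ℝ (Fin 3)) =
      (f p • legendrianNormal I P ι e₁ p + g p • P.reeb (ι p) : EuclideanSpace ℝ (Fin 3)))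
    {q : N} (hq : q ∉ singularSet I P ι) (h0 : velocity Φ 0 q = 0) : f q = 0 ∧ g q = 0 := by
  have hx := he₁.isUnit hq
  have h1 : (f q • legendrianNormal I P ι e₁ q + g q • P.reeb (ι q) : TangentSpace (𝓡 3) (ι q)) =
      0 := (hV q hq).symm.trans h0
  have hn : P.Θ (ι q) (legendrianNormal I P ι e₁ q) = 0 := hx.J.1
  have hn' : P.dualForm (ι q) (legendrianNormal I P ι e₁ q) (legendrianNormal I P ι e₁ q) = 1 :=
    hx.J.dualForm_self
  have h2 := congrArg (P.Θ (ι q)) h1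
  have h3 := congrArg (P.dualForm (ι q) (legendrianNormal I P ι e₁ q)) h1
  rw [map_add, map_smul, map_smul, P.Θ_reeb, hn, map_zero] at h2
  rw [map_add, map_smul, map_smul, P.dualForm_reeb, hn', map_zero] at h3
  simpa using And.intro h3 h2

theorem relDensity_eq_of_notMem (hK : IsClosed K) (hΦK : ∀ t ∈ Ioo (-ε) ε, ∀ p ∉ K, Φ t p = ι p)
    {q : N} (hq : q ∉ K) {t : ℝ} (ht : t ∈ Ioo (-ε) ε) :
    relDensity I P ι e₁ Φ t q = P.areaDensity (ι q) (mfderiv I (𝓡 3) ι q (e₁ q))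
      (mfderiv I (𝓡 3) ι q (charLift P I ι e₁ q)) := by
  have h : Φ t =ᶠ[𝓝 q] ι := by
    filter_upwards [hK.isOpen_compl.mem_nhds hq] with r hr
    exact hΦK t ht r hr
  have h1 : (mfderiv I (𝓡 3) (Φ t) q : EuclideanSpace ℝ (Fin 2) →L[ℝ] EuclideanSpace ℝ (Fin 3)) =
      mfderiv I (𝓡 3) ι q := h.mfderiv_eq
  have h2 : ∀ r r' : M, r = r' → ∀ v v' w w' : EuclideanSpace ℝ (Fin 3), v = v' → w = w' →
      P.areaDensity r v w = P.areaDensity r' v' w' := by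
    rintro r _ rfl v _ w _ rfl rfl
    rfl
  exact h2 _ _ h.eq_of_nhds _ _ _ _ (DFunLike.congr_fun h1 _) (DFunLike.congr_fun h1 _)

theorem fluxField_eq_zero (hε : 0 < ε) (hΦK : ∀ t ∈ Ioo (-ε) ε, ∀ p ∉ K, Φ t p = ι p) {F : N → ℝ}
    {q : N} (hq : q ∉ K) (hF : F q = 0) : fluxField I P ι e₁ Φ F q = 0 := by
  have h : ∀ v : TangentSpace I q, fluxForm I P ι e₁ Φ F q v = 0 := fun v => by
    have h1 : fluxFun I P ι e₁ Φ q v =ᶠ[𝓝 0] fun _ => 0 := by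
      filter_upwards [isOpen_Ioo.mem_nhds (show (0 : ℝ) ∈ Ioo (-ε) ε from ⟨by linarith, hε⟩)]
        with t ht
      rw [fluxFun, velocity_eq_zero hΦK hq ht, map_zero, map_zero]
      ring
    rw [fluxForm, h1.deriv_eq, hF]
    simp
  rw [fluxField, h, h, zero_smul, zero_smul, sub_zero]

end SupportOfVariation

theorem deriv_deriv_slice {E : Type*} [NormedAddCommGroup E] [NormedSpace ℝ E] {G : ℝ × E → ℝ}
    {u : E} {δ : ℝ} (hδ : 0 < δ) (hG : ∀ t ∈ Ioo (-δ) δ, ContDiffAt ℝ ∞ G (t, u)) :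
    deriv (fun t => deriv (fun s => G (s, u)) t) 0 =
      fderiv ℝ (fun y => fderiv ℝ G y (1, 0)) (0, u) (1, 0) := by
  have h : ∀ {R : ℝ × E → ℝ} {t : ℝ}, ContDiffAt ℝ ∞ R (t, u) →
      HasDerivAt (fun s => R (s, u)) (fderiv ℝ R (t, u) (1, 0)) t := fun {R t} hR =>
    (HasFDerivAt.comp (g := R) (f := fun s : ℝ => (s, u)) t
      (hR.differentiableAt (by simp)).hasFDerivAt (hasFDerivAt_prodMk_left t u)).hasDerivAt
  have h0 : (0 : ℝ) ∈ Ioo (-δ) δ := ⟨by linarith, hδ⟩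
  have h1 : (fun t => deriv (fun s => G (s, u)) t) =ᶠ[𝓝 0] fun t => fderiv ℝ G (t, u) (1, 0) := by
    filter_upwards [isOpen_Ioo.mem_nhds h0] with t ht
    exact (h (hG t ht)).deriv
  rw [h1.deriv_eq]
  exact (h (R := fun y => fderiv ℝ G y (1, 0)) ((hG 0 h0).fderiv_apply_const (1, 0))).deriv

theorem proposition6p1
    -- the ambient pseudohermitian 3-manifold
    {M : Type*} [TopologicalSpace M] [ChartedSpace (EuclideanSpace ℝ (Fin 3)) M]
    [IsManifold (𝓡 3) ∞ M] [T2Space M] (P : PseudohermitianStructure M)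
    -- the surface, possibly with boundary, and its immersion in `M`
    {H : Type*} [TopologicalSpace H] (I : ModelWithCorners ℝ (EuclideanSpace ℝ (Fin 2)) H)
    {N : Type*} [TopologicalSpace N] [ChartedSpace H N] [IsManifold I ∞ N] [T2Space N]
    [SigmaCompactSpace N] [MeasurableSpace N] [BorelSpace N]
    (ι : N → M) (hι : ContMDiff I (𝓡 3) ∞ ι)
    (hι' : ∀ p, Function.Injective (mfderiv I (𝓡 3) ι p))
    -- a characteristic field on the nonsingular part, and p-minimality
    (e₁ : (p : N) → TangentSpace I p) (he₁ : IsCharacteristicField I P ι e₁)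
    (hmin : IsPMinimal I P ι e₁)
    -- the functions `f, g`
    (f g : N → ℝ) (hf : ContMDiff I 𝓘(ℝ, ℝ) ∞ f) (hg : ContMDiff I 𝓘(ℝ, ℝ) ∞ g)
    (hfc : HasCompactSupport f) (hgc : HasCompactSupport g)
    (hfd : Disjoint (tsupport f) (singularSet I P ι ∪ I.boundary N))
    (hgd : Disjoint (tsupport g) (singularSet I P ι ∪ I.boundary N))
    -- a variation `Φ t` of the surface, supported in the compact set `K`, in the direction
    -- `f e₂ + g T`
    (ε : ℝ) (hε : 0 < ε) (Φ : ℝ → N → M)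
    (hΦ : ContMDiffOn (𝓘(ℝ, ℝ).prod I) (𝓡 3) ∞ (fun x : ℝ × N => Φ x.1 x.2)
      (Ioo (-ε) ε ×ˢ univ))
    (hΦ0 : Φ 0 = ι)
    (K : Set N) (hK : IsCompact K) (hKd : Disjoint K (singularSet I P ι ∪ I.boundary N))
    (hΦK : ∀ t ∈ Ioo (-ε) ε, ∀ p ∉ K, Φ t p = ι p)
    (hV : ∀ p ∉ singularSet I P ι,
      HasMFDerivAt 𝓘(ℝ, ℝ) (𝓡 3) (fun t => Φ t p) 0
        (ContinuousLinearMap.toSpanSingleton ℝ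
          (f p • legendrianNormal I P ι e₁ p + g p • P.reeb (ι p) : EuclideanSpace ℝ (Fin 3))))
    -- a compact piece of the surface which contains the support of the variation
    (L : Set N) (hL : IsCompact L) (hKL : K ⊆ L) :
    (∀ t ∈ Ioo (-ε) ε, pAreaMeasure I P (Φ t) L < ⊤) ∧
    Integrable (secondVariationIntegrand I P ι e₁ f g) (pAreaMeasure I P ι) ∧
    ∃ A' : ℝ → ℝ,
      (∀ᶠ t in 𝓝 (0 : ℝ), HasDerivAt (fun s => (pAreaMeasure I P (Φ s) L).toReal) (A' t) t) ∧
      HasDerivAt A' (∫ p, secondVariationIntegrand I P ι e₁ f g p ∂(pAreaMeasure I P ι)) 0 := by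
  have h0ε : (0 : ℝ) ∈ Ioo (-ε) ε := ⟨by linarith, hε⟩
  have hΦs : ∀ {t}, t ∈ Ioo (-ε) ε → ContMDiff I (𝓡 3) ∞ (Φ t) := fun ht => contMDiff_variation hΦ ht
  have hKc := hK.isClosed
  have hV' : ∀ p ∉ singularSet I P ι, (velocity Φ 0 p : EuclideanSpace ℝ (Fin 3)) =
      (f p • legendrianNormal I P ι e₁ p + g p • P.reeb (ι p) : EuclideanSpace ℝ (Fin 3)) :=
    fun p hp => by
      have h := DFunLike.congr_fun (hV p hp).mfderiv (1 : ℝ)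
      exact h.trans (one_smul ℝ _)
  have hKS : ∀ p ∈ K, p ∉ singularSet I P ι ∧ p ∉ I.boundary N := fun p hp =>
    ⟨fun h => hKd.le_bot ⟨hp, Or.inl h⟩, fun h => hKd.le_bot ⟨hp, Or.inr h⟩⟩
  have hfg : ∀ q ∉ K, f q = 0 ∧ g q = 0 := fun q hq => by
    by_cases hS : q ∈ singularSet I P ι
    · exact ⟨image_eq_zero_of_notMem_tsupport fun h => hfd.le_bot ⟨h, Or.inl hS⟩,
        image_eq_zero_of_notMem_tsupport fun h => hgd.le_bot ⟨h, Or.inl hS⟩⟩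
    · exact variation_components_eq_zero he₁ hV' hS (velocity_eq_zero hΦK hq h0ε)
  set F : N → ℝ := fun q => f q - alphaFun I P ι e₁ q * g q with hF
  have hF0 : ∀ q ∉ K, F q = 0 := fun q hq => by simp [hF, hfg q hq]
  -- The second derivative of the area form relative to the p-area at time zero. Being defined
  -- without charts, it can be compared globally with the integrand B.
  set D : N → ℝ := fun q => deriv (fun t => deriv (fun s => relDensity I P ι e₁ Φ s q) t) 0 with hD
  have hD0 : ∀ q ∉ K, D q = 0 := fun q hq => by
    have h1 : (fun t => deriv (fun s => relDensity I P ι e₁ Φ s q) t) =ᶠ[𝓝 0] fun _ => 0 := by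
      filter_upwards [isOpen_Ioo.mem_nhds h0ε] with t ht
      have h2 : (fun s => relDensity I P ι e₁ Φ s q) =ᶠ[𝓝 t] fun _ => P.areaDensity (ι q)
          (mfderiv I (𝓡 3) ι q (e₁ q)) (mfderiv I (𝓡 3) ι q (charLift P I ι e₁ q)) := by
        filter_upwards [isOpen_Ioo.mem_nhds ht] with s hs
        exact relDensity_eq_of_notMem hKc hΦK hq hs
      rw [h2.deriv_eq, deriv_const]
    exact h1.deriv_eq.trans (deriv_const _ _)
  set B := secondVariationIntegrand I P ι e₁ f g with hB
  have hB0 : ∀ q ∉ K, B q = 0 := fun q hq => by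
    have h1 : F =ᶠ[𝓝 q] fun _ => 0 := by
      filter_upwards [hKc.isOpen_compl.mem_nhds hq] with r hr
      exact hF0 r hr
    have h2 : charDeriv I e₁ F q = 0 := charDeriv_eq_zero h1
    have h3 : f q - alphaFun I P ι e₁ q * g q = 0 := hF0 q hq
    rw [hB, secondVariationIntegrand, h3]
    change charDeriv I e₁ F q ^ 2 + _ = 0
    rw [h2]
    ring
  choose! O δ G Q₀ Q₁ hO hpO hδ hδε hOS hG hG0 hQ using fun p (hp : p ∈ K) =>
    exists_local_variation hι hι' he₁ hmin hf hg hε hΦ hΦ0 hV' (hKS p hp).1 (hKS p hp).2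
  have hO' : ∀ p ∈ K, IsOpen (O p) ∧ extChartAt I p p ∈ O p := fun p hp => ⟨hO p hp, hpO p hp⟩
  have hOd : ∀ p ∈ K, O p ⊆ chartDomain I p := fun p hp u hu => (hOS p hp u hu).1
  have h0δ : ∀ p ∈ K, (0 : ℝ) ∈ Ioo (-δ p) (δ p) := fun p hp =>
    ⟨by linarith [hδ p hp], hδ p hp⟩
  have hdens : ∀ p ∈ K, ∀ u ∈ O p, chartDensity P I ι p u = G p (0, u) := fun p hp u hu =>
    (hG0 p hp u hu).symm
  have hDG : ∀ p ∈ K, ∀ u ∈ O p, fderiv ℝ (fun y => fderiv ℝ (G p) y (1, 0)) (0, u) (1, 0) =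
      G p (0, u) * D ((extChartAt I p).symm u) := by
    intro p hp u hu
    rw [← deriv_deriv_slice (hδ p hp) fun t ht => (hG p hp t ht u hu).1]
    have h1 : (fun t => deriv (fun s => G p (s, u)) t) =ᶠ[𝓝 0] fun t => G p (0, u) *
        deriv (fun s => relDensity I P ι e₁ Φ s ((extChartAt I p).symm u)) t := by
      filter_upwards [isOpen_Ioo.mem_nhds (h0δ p hp)] with t ht
      have h2 : (fun s => G p (s, u)) =ᶠ[𝓝 t] fun s => G p (0, u) *
          relDensity I P ι e₁ Φ s ((extChartAt I p).symm u) := by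
        filter_upwards [isOpen_Ioo.mem_nhds ht] with s hs
        rw [(hG p hp s hs u hu).2.2, mul_comm]
      rw [h2.deriv_eq, deriv_const_mul_field]
    rw [h1.deriv_eq, deriv_const_mul_field]
  have hGpos : ∀ p ∈ K, ∀ u ∈ O p, 0 < G p (0, u) := fun p hp u hu =>
    (hG p hp 0 (h0δ p hp) u hu).2.1
  -- D − B is the divergence of `fluxField`, which vanishes off K, so D and B have the same integral
  -- once both are known to be integrable.
  obtain ⟨hEc, hE⟩ := integral_eq_zero_of_local_divergence (P := P) (E := fun q => D q - B q)
    (Z := fluxField I P ι e₁ Φ F) (Q₀ := Q₀) (Q₁ := Q₁) hι hK hO' hOd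
    (fun p hp u hu => (hdens p hp u hu).symm ▸ hGpos p hp u hu)
    (fun q hq => by rw [hD0 q hq, hB0 q hq, sub_zero])
    (fun q hq => fluxField_eq_zero hε hΦK hq (hF0 q hq))
    (fun p hp u hu => by
      obtain ⟨h1, h2, h3, h4⟩ := hQ p hp u hu
      refine ⟨h1, h2, ?_, ?_⟩
      · rw [hdens p hp u hu, mul_sub, ← hDG p hp u hu, h3]
        ring
      · rw [hdens p hp u hu]
        exact h4)
  have hDc : Continuous D := continuous_of_continuousOn_charts hKc hO' hD0 fun p hp => by
    have h1 : ∀ u ∈ O p, D ((extChartAt I p).symm u) =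
        fderiv ℝ (fun y => fderiv ℝ (G p) y (1, 0)) (0, u) (1, 0) / G p (0, u) := fun u hu => by
      rw [hDG p hp u hu, mul_div_cancel_left₀ _ (hGpos p hp u hu).ne']
    refine ContinuousOn.congr (fun u hu => ContinuousAt.continuousWithinAt ?_) h1
    have h2 := (hG p hp 0 (h0δ p hp) u hu).1
    have h3 : ContinuousAt (fun u : Plane => ((0 : ℝ), u)) u := by fun_prop
    exact (ContinuousAt.comp (f := fun u : Plane => ((0 : ℝ), u))
      ((h2.fderiv_apply_const (1, 0)).fderiv_apply_const (1, 0)).continuousAt h3).div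
      (ContinuousAt.comp (f := fun u : Plane => ((0 : ℝ), u)) h2.continuousAt h3)
      (hGpos p hp u hu).ne'
  -- B contains quantities defined by choice. Its continuity follows from that of D and of the
  -- divergence D − B, both of which have smooth expressions in charts.
  have hBc : Continuous B := (hDc.sub hEc).congr fun q => sub_sub_cancel _ _
  have hBi := integrable_pAreaMeasure (P := P) hι hK hBc hB0
  have hDi := integrable_pAreaMeasure (P := P) hι hK hDc hD0
  have hDB : ∫ q, D q ∂(pAreaMeasure I P ι) = ∫ q, B q ∂(pAreaMeasure I P ι) := by
    rw [integral_sub hDi hBi] at hE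
    linarith
  refine ⟨fun t ht => ?_, hBi, ?_⟩
  · have := isLocallyFiniteMeasure_pAreaMeasure (P := P) (hΦs ht)
    exact hL.measure_lt_top
  · have h := hasDerivAt_area (P := P) hΦ hε hK hL hKL
      (fun t ht q hq => (hΦK t ht q hq).trans (congrFun hΦ0 q).symm) hO' hOd hδ
      (fun p hp t ht u hu => ⟨(hG p hp t ht u hu).1, fun ht' => by
        rw [chartDensity_variation hι hι' he₁ (hOd p hp hu) (hOS p hp u hu).2 (hΦs ht'),
          hdens p hp u hu, (hG p hp t ht u hu).2.2]⟩) hDc hD0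
      (fun p hp u hu => by rw [hΦ0, hdens p hp u hu]; exact hDG p hp u hu)
    rw [hΦ0, hDB] at h
    exact h

end
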